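/- Let $S$ be a connected smooth surface (not necessarily compact) with universal covering $\pi:\widetilde S\to S$, on which $\pi_1(S)$ acts by deck transformations, and let $c_1,\overline{c_2}$ be oppositely oriented complex structures on $S$, with local holomorphic coordinates $z$ and $\overline w$. Every complex-valued $1$-form splits uniquely into a multiple of $dz$ and a multiple of $d\overline w$. Write $\Omega^1=\Omega^{1,0}_{c_1}\oplus\Omega^{0,1}_{c_2}$ for this splitting (also for bundle-valued forms), with projections $\Pi_1,\Pi_2$. Let $G$ be a semisimple Lie group with Lie algebra $\mathfrak g$, contained in a complexification $G^{\mathbb C}$ (a complex Lie group with Lie algebra $\mathfrak g\otimes\mathbb C$), and let $\nu$ be a symmetric $\mathrm{Ad}(G)$-invariant bilinear form on $\mathfrak g$. Below, maximal compact subgroups $K\subset G$ are those that come with a Cartan involution $\theta$, i.e. an involutive automorphism of $\mathfrak g$ such that $\nu(\cdot,-\theta\,\cdot)$ is symmetric and positive definite and $K=\{g\in G:\mathrm{Ad}_g\theta=\theta\mathrm{Ad}_g\}$ (if $G$ has finite centre and finitely many components and such a $\theta$ exists, these are all the maximal compact subgroups). Let $\mathfrak g=\mathfrak k\oplus\mathfrak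 p$ be the eigenspace decomposition of $\theta$ and $K^{\mathbb C}=K\exp(i\mathfrak k)\subset G^{\mathbb C}$. The complex manifold $G^{\mathbb C}/K^{\mathbb C}$ carries the invariant holomorphic Riemannian metric induced by the complex bilinear extension of $\nu$ to $\mathfrak p^{\mathbb C}\cong T(G^{\mathbb C}/K^{\mathbb C})$. A smooth map $f:\widetilde S\to G^{\mathbb C}/K^{\mathbb C}$ is complex harmonic if $\mathrm{tr}_g\nabla df=0$ for all (local) complex metrics $g=\lambda\,dz\,d\overline w$, $\lambda\neq0$, where $\nabla$ is induced by the Levi-Civita connections of $g$ and of $G^{\mathbb C}/K^{\mathbb C}$. A complex harmonic $G$-bundle over $(S,c_1,\overline{c_2})$ consists of a maximal compact subgroup $K\subset G$, a smooth principal $K^{\mathbb C}$-bundle $P_{K^{\mathbb C}}\to S$, a principal connection $A$ on it, and $\phi_1\in\Omega^{1,0}_{c_1}(\mathrm{ad}\,\mathfrak p^{\mathbb C})$, $\overline{\phi_2}\in\Omega^{0,1}_{c_2}(\mathrm{ad}\,\mathfrak p^{\mathbb C})$, where $\mathrm{ad}\,\mathfrak p^{\mathbb C}=P_{K^{\mathbb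 C}}\times_{\mathrm{Ad}}\mathfrak p^{\mathbb C}$, such that $$\partial_1\overline{\phi_2}=0,\qquad \overline\partial_2\phi_1=0,$$ and such that the connection $A+\phi_1+\overline{\phi_2}$ on $P_{K^{\mathbb C}}\times_{K^{\mathbb C}}G^{\mathbb C}$ is flat. Here $\partial_1=d_A\circ\Pi_2$ and $\overline\partial_2=d_A\circ\Pi_1$ on $\mathrm{ad}\,\mathfrak p^{\mathbb C}$-valued $1$-forms. An isomorphism is an isomorphism of principal bundles over $S$ that identifies the connections and the forms $\phi_1,\overline{\phi_2}$; it may change $K$ to $hKh^{-1}$ with $h\in G$, and is then equivariant with respect to conjugation by $h$. Fix one maximal compact subgroup $K$. The group $G^{\mathbb C}$ acts on the pairs $(\rho,f)$, where $\rho:\pi_1(S)\to G^{\mathbb C}$ is a representation and $f:\widetilde S\to G^{\mathbb C}/K^{\mathbb C}$ is a $\rho$-equivariant complex harmonic map, by $g\cdot(\rho,f)=(g\rho g^{-1},g\cdot f)$. **Theorem.** There is a bijection between the $G^{\mathbb C}$-orbits of pairs $(\rho,f)$ and the isomorphism classes of complex harmonic $G$-bundles over $(S,c_1,\overline{c_2})$.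 It takes the class of $(\rho,f)$ to the class of $(P_f,A_f,\phi_1^f,\overline{\phi_2}^f)$, where $P_f\subset\widetilde S\times_\rho G^{\mathbb C}$ is the reduction to $K^{\mathbb C}$ defined by $f$, and $A_f$ and $\phi_1^f+\overline{\phi_2}^f$ are the $\mathfrak k^{\mathbb C}$- and $\mathfrak p^{\mathbb C}$-parts of the restriction to $P_f$ of the flat connection of $\widetilde S\times_\rho G^{\mathbb C}$ (i.e. the pull-back by $f$ of the canonical connection of $G^{\mathbb C}\to G^{\mathbb C}/K^{\mathbb C}$, and $df$). -/

import Mathlib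

open scoped Manifold ContDiff Topology

universe u v w

noncomputable section

namespace ComplexHarmonic

/-! ### Surfaces with two complex structures -/

section Surface

variable {S : Type*} [TopologicalSpace S] [ChartedSpace ℂ S]

variable (S) in
/-- A complex structure on a smooth surface `S` (charted on `ℂ = ℝ²`): an atlas of smooth complex
valued charts with holomorphic transition functions. -/
structure ComplexStructure where
  charts : Set (OpenPartialHomeomorph S ℂ)
  smooth : ∀ z ∈ charts, z ∈ IsManifold.maximalAtlas 𝓘(ℝ, ℂ) ∞ S
  cover : ∀ x : S, ∃ z ∈ charts, x ∈ z.source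
  holomorphic : ∀ z ∈ charts, ∀ w ∈ charts,
    DifferentiableOn ℂ (w ∘ z.symm) (z.target ∩ z.symm ⁻¹' w.source)

/-- Two complex structures induce opposite orientations. -/
def OppositelyOriented (c₁ c₂ : ComplexStructure S) : Prop :=
  ∀ z ∈ c₁.charts, ∀ w ∈ c₂.charts, ∀ x ∈ z.source ∩ w.source,
    (fderiv ℝ (w ∘ z.symm) (z x)).det < 0

variable (S) in
/-- Vector valued `1`-forms on a surface. -/
abbrev OneForm (W : Type*) [NormedAddCommGroup W] [NormedSpace ℝ W] :=
  ∀ x : S, TangentSpace 𝓘(ℝ, ℂ) x →L[ℝ] W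

/-- The differential `dF` at `x` of a complex valued function `F` on a surface. -/
def dFun (F : S → ℂ) (x : S) : TangentSpace 𝓘(ℝ, ℂ) x →L[ℝ] ℂ :=
  mfderiv 𝓘(ℝ, ℂ) 𝓘(ℝ, ℂ) F x

section Forms

variable {W : Type*} [NormedAddCommGroup W] [NormedSpace ℂ W]

/-- A complex vector valued covector at `x` is of type `(1,0)` for the complex structure `c`:
it is a multiple of `dz`, for holomorphic coordinates `z` of `c` around `x`. -/
def IsTypeOneZero (c : ComplexStructure S) (x : S)
    (η : TangentSpace 𝓘(ℝ, ℂ) x →L[ℝ] W) : Prop :=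
  ∀ z ∈ c.charts, x ∈ z.source → ∃ a : W, ∀ v, η v = dFun z x v • a

/-- The projection of a form to its `c`-part in the splitting of complex valued covectors into
those of type `(1,0)` for `c` and those of type `(1,0)` for the oppositely oriented complex
structure `c'`: the component `β'` of type `(1,0)` for `c` such that `β - β'` is of type `(1,0)`
for `c'`. With `c` and `c'` having coordinates `z` and `w̄`, these are the components along
`dz` and `dw̄`. -/
def typeProj (c c' : ComplexStructure S) (β : OneForm S W) : OneForm S W := fun x ↦
  Classical.epsilon fun η : TangentSpace 𝓘(ℝ, ℂ) x →L[ℝ] W ↦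
    IsTypeOneZero c x η ∧ IsTypeOneZero c' x (β x - η)

/-- The form `β` written in the preferred chart around `x`. -/
def formInChart (β : OneForm S W) (x : S) : ℂ → ℂ →L[ℝ] W := fun y ↦
  (β ((chartAt ℂ x).symm y)).comp (mfderiv 𝓘(ℝ, ℂ) 𝓘(ℝ, ℂ) (chartAt ℂ x).symm y)

/-- Smoothness of a form on an (open) set. -/
def SmoothFormOn (β : OneForm S W) (U : Set S) : Prop :=
  ∀ x ∈ U, ContDiffAt ℝ ∞ (formInChart β x) (chartAt ℂ x x)

/-- The exterior derivative of a `1`-form, computed at `x` in the preferred chart around `x`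
(in which the tangent space at `x` is `ℂ`):
`dβ(u,v) = ∂_u (β(v)) - ∂_v (β(u))` for constant `u`, `v`. -/
def extDerivForm (β : OneForm S W) (x : S) (u v : TangentSpace 𝓘(ℝ, ℂ) x) : W :=
  (fderiv ℝ (formInChart β x) (chartAt ℂ x x) u) v -
    (fderiv ℝ (formInChart β x) (chartAt ℂ x x) v) u

end Forms

/-- The coordinate frame `∂₁, ∂₂` of a chart with values in `ℂ = ℝ²`. -/
def frame : Fin 2 → ℂ := ![1, Complex.I]

/-- The coefficient matrix, in the preferred chart around `x`, of a complex valued bilinear form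
`g` on the tangent spaces of the surface. -/
def metricMatrix (g : ∀ x : S, TangentSpace 𝓘(ℝ, ℂ) x →L[ℝ] TangentSpace 𝓘(ℝ, ℂ) x →L[ℝ] ℂ)
    (x : S) (y : ℂ) : Matrix (Fin 2) (Fin 2) ℂ :=
  Matrix.of fun i j ↦ g ((chartAt ℂ x).symm y)
    (mfderiv 𝓘(ℝ, ℂ) 𝓘(ℝ, ℂ) (chartAt ℂ x).symm y (frame i))
    (mfderiv 𝓘(ℝ, ℂ) 𝓘(ℝ, ℂ) (chartAt ℂ x).symm y (frame j))

/-- The Christoffel symbols `Γᵏᵢⱼ` at `x` of the Levi-Civita connection of a complex metric `g`,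
in the preferred chart around `x`. -/
def metricChristoffel
    (g : ∀ x : S, TangentSpace 𝓘(ℝ, ℂ) x →L[ℝ] TangentSpace 𝓘(ℝ, ℂ) x →L[ℝ] ℂ)
    (x : S) (k i j : Fin 2) : ℂ :=
  (1 / 2) * ∑ l, (metricMatrix g x (chartAt ℂ x x))⁻¹ k l *
    (fderiv ℝ (fun y ↦ metricMatrix g x y j l) (chartAt ℂ x x) (frame i) +
      fderiv ℝ (fun y ↦ metricMatrix g x y i l) (chartAt ℂ x x) (frame j) -
      fderiv ℝ (fun y ↦ metricMatrix g x y i j) (chartAt ℂ x x) (frame l))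

/-- `g` is on the set `U` a smooth positive complex metric belonging to the pair of complex
structures obtained from `c₁`, `c₂` by pulling back with the local diffeomorphism `π`: if `z` and
`w̄` are coordinates of `c₁` and `c₂`, then `g = lam (dz ⊗ dw̄ + dw̄ ⊗ dz)` with `lam ≠ 0`, where `z`
and `w̄` stand for `z ∘ π` and `w̄ ∘ π`. -/
def IsComplexMetricOn {St : Type*} [TopologicalSpace St] [ChartedSpace ℂ St] (π : St → S)
    (c₁ c₂ : ComplexStructure S) (U : Set St)
    (g : ∀ x : St, TangentSpace 𝓘(ℝ, ℂ) x →L[ℝ] TangentSpace 𝓘(ℝ, ℂ) x →L[ℝ] ℂ) : Prop :=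
  (∀ x ∈ U, ∀ i j, ContDiffAt ℝ ∞ (fun y ↦ metricMatrix g x y i j) (chartAt ℂ x x)) ∧
  ∀ x ∈ U, ∀ z ∈ c₁.charts, ∀ w ∈ c₂.charts, π x ∈ z.source → π x ∈ w.source →
    ∃ lam : ℂ, lam ≠ 0 ∧ ∀ u v, g x u v =
      lam * (dFun (z ∘ π) x u * dFun (w ∘ π) x v + dFun (w ∘ π) x u * dFun (z ∘ π) x v)

end Surface

/-! ### Complex harmonic maps to holomorphic Riemannian manifolds -/

section Harmonic

variable {V : Type*} [NormedAddCommGroup V] [NormedSpace ℂ V]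

/-- The Christoffel symbol `Γ(u,v)` at `y` of a field `B` of (holomorphic, nondegenerate, symmetric)
complex bilinear forms on an open set of `V`: the vector with
`2 B(Γ(u,v),w) = ∂_u B(v,w) + ∂_v B(u,w) - ∂_w B(u,v)` for all `w`. -/
def holChristoffel (B : V → V → V → ℂ) (y u v : V) : V :=
  Classical.epsilon fun c : V ↦ ∀ w : V, 2 * B y c w =
    fderiv ℂ (fun y' ↦ B y' v w) y u + fderiv ℂ (fun y' ↦ B y' u w) y v -
      fderiv ℂ (fun y' ↦ B y' u v) y w

variable {X : Type*} [TopologicalSpace X] [ChartedSpace V X]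

/-- The holomorphic metric `h` of `X` in the preferred chart around `x`. -/
def holMetricInChart
    (h : ∀ x : X, TangentSpace 𝓘(ℂ, V) x → TangentSpace 𝓘(ℂ, V) x → ℂ) (x : X) :
    V → V → V → ℂ := fun y u v ↦
  h ((chartAt V x).symm y) (mfderiv 𝓘(ℂ, V) 𝓘(ℂ, V) (chartAt V x).symm y u)
    (mfderiv 𝓘(ℂ, V) 𝓘(ℂ, V) (chartAt V x).symm y v)

variable {St : Type*} [TopologicalSpace St] [ChartedSpace ℂ St]

/-- The map `f` in the preferred charts around `x` and `f x`. -/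
def mapInCharts (V : Type*) [NormedAddCommGroup V] [NormedSpace ℂ V]
    {X : Type*} [TopologicalSpace X] [ChartedSpace V X] (f : St → X) (x : St) : ℂ → V :=
  fun y ↦ chartAt V (f x) (f ((chartAt ℂ x).symm y))

/-- `tr_g ∇ df` at `x` (in the preferred charts around `x` and `f x`), where `∇` is built from the
Levi-Civita connection of the complex metric `g` on the surface and the Levi-Civita connection of
the holomorphic Riemannian metric `h` on the complex manifold `X`:
`∑ gⁱʲ (∂ᵢ∂ⱼf - ∑ Γᵏᵢⱼ ∂ₖf + Γ(∂ᵢf, ∂ⱼf))`. -/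
def tension (h : ∀ x : X, TangentSpace 𝓘(ℂ, V) x → TangentSpace 𝓘(ℂ, V) x → ℂ)
    (g : ∀ x : St, TangentSpace 𝓘(ℝ, ℂ) x →L[ℝ] TangentSpace 𝓘(ℝ, ℂ) x →L[ℝ] ℂ)
    (f : St → X) (x : St) : V :=
  let D : Fin 2 → (ℂ → V) → ℂ → V := fun i F y ↦ fderiv ℝ F y (frame i)
  let F : ℂ → V := mapInCharts V f x
  let y₀ : ℂ := chartAt ℂ x x
  ∑ i, ∑ j, (metricMatrix g x y₀)⁻¹ i j •
    (D i (D j F) y₀ - ∑ k, metricChristoffel g x k i j • D k F y₀ +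
      holChristoffel (holMetricInChart h (f x)) (F y₀) (D i F y₀) (D j F y₀))

/-- The smooth map `f` from a covering `π : St → S` of the surface `S` to the holomorphic
Riemannian manifold `(X, h)` is complex harmonic for the oppositely oriented complex structures
`c₁`, `c₂` of `S`: one has `tr_g ∇ df = 0` for the complex metrics `g` (defined locally) that belong
to `c₁`, `c₂`. -/
def IsComplexHarmonic {S : Type*} [TopologicalSpace S] [ChartedSpace ℂ S] (π : St → S)
    (c₁ c₂ : ComplexStructure S)
    (h : ∀ x : X, TangentSpace 𝓘(ℂ, V) x → TangentSpace 𝓘(ℂ, V) x → ℂ) (f : St → X) : Prop :=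
  ∀ U : Set St, IsOpen U →
    ∀ g : (∀ x : St, TangentSpace 𝓘(ℝ, ℂ) x →L[ℝ] TangentSpace 𝓘(ℝ, ℂ) x →L[ℝ] ℂ),
      IsComplexMetricOn π c₁ c₂ U g → ∀ x ∈ U, tension h g f x = 0

end Harmonic

/-! ### Lie groups, complexifications, symmetric spaces -/

section Lie

instance instLieGroupMinSmoothness {EG : Type*} [NormedAddCommGroup EG] [NormedSpace ℝ EG]
    {G : Type*} [TopologicalSpace G] [ChartedSpace EG G] [Group G]
    [h : LieGroup 𝓘(ℝ, EG) ∞ G] : LieGroup 𝓘(ℝ, EG) (minSmoothness ℝ 3) G :=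
  LieGroup.of_le (n := ∞) (by simpa using ENat.LEInfty.out)

/-- The adjoint action of `g` on the Lie algebra: the derivative at `1` of conjugation by `g`. -/
def Ad {𝕜 : Type*} [NontriviallyNormedField 𝕜] (E : Type*) [NormedAddCommGroup E]
    [NormedSpace 𝕜 E] {G : Type*} [TopologicalSpace G] [ChartedSpace E G] [Group G] (g : G) :
    GroupLieAlgebra 𝓘(𝕜, E) G →L[𝕜] GroupLieAlgebra 𝓘(𝕜, E) G :=
  mfderiv 𝓘(𝕜, E) 𝓘(𝕜, E) (fun x : G ↦ g * x * g⁻¹) 1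

variable {EG : Type*} [NormedAddCommGroup EG] [NormedSpace ℝ EG]
  {G : Type*} [TopologicalSpace G] [ChartedSpace EG G] [Group G]
  {E : Type*} [NormedAddCommGroup E] [NormedSpace ℂ E]
  {GC : Type*} [TopologicalSpace GC] [ChartedSpace E GC] [Group GC]

/-- The Lie bracket of the complex Lie group `GC`. The Lie algebra of `GC` is the tangent space at
`1`, which is the model vector space `E`. -/
def bracketC (GC : Type*) [TopologicalSpace GC] [ChartedSpace E GC] [Group GC] (a b : E) : E :=
  Bracket.bracket (L := GroupLieAlgebra 𝓘(ℂ, E) GC) (M := GroupLieAlgebra 𝓘(ℂ, E) GC) a b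

/-- The adjoint action of the complex Lie group `GC` on its Lie algebra `E`. -/
def AdC (g : GC) : E →L[ℂ] E := Ad (𝕜 := ℂ) E g

/-- The map induced on Lie algebras by a homomorphism `j : G → GC`. -/
def dHom (EG : Type*) [NormedAddCommGroup EG] [NormedSpace ℝ EG] {G : Type*} [TopologicalSpace G]
    [ChartedSpace EG G] [Group G] (E : Type*) [NormedAddCommGroup E] [NormedSpace ℂ E]
    {GC : Type*} [TopologicalSpace GC] [ChartedSpace E GC] [Group GC] (j : G →* GC) :
    GroupLieAlgebra 𝓘(ℝ, EG) G →L[ℝ] E :=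
  mfderiv 𝓘(ℝ, EG) 𝓘(ℝ, E) j 1

/-- `j : G → GC` exhibits the complex Lie group `GC` as a complexification of the real Lie group
`G`: it is an injective homomorphism of Lie groups, and the Lie algebra of `GC` is the
complexification `𝔤 ⊕ i𝔤` of the Lie algebra `𝔤` of `G`. -/
structure IsComplexification (EG E : Type*) [NormedAddCommGroup EG] [NormedSpace ℝ EG]
    [NormedAddCommGroup E] [NormedSpace ℂ E] {G GC : Type*} [TopologicalSpace G]
    [ChartedSpace EG G] [Group G] [TopologicalSpace GC] [ChartedSpace E GC] [Group GC]
    (j : G →* GC) : Prop where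
  injective : Function.Injective j
  smooth : ContMDiff 𝓘(ℝ, EG) 𝓘(ℝ, E) ∞ j
  realForm : Function.Bijective
    fun p : GroupLieAlgebra 𝓘(ℝ, EG) G × GroupLieAlgebra 𝓘(ℝ, EG) G ↦
      dHom EG E j p.1 + Complex.I • dHom EG E j p.2

/-- The complex bilinear extension to the Lie algebra of `GC` of a bilinear form `ν` on the Lie
algebra of `G`. -/
def complexForm (j : G →* GC) (ν : LinearMap.BilinForm ℝ (GroupLieAlgebra 𝓘(ℝ, EG) G))
    (Z W : E) : ℂ :=
  let coords : E → GroupLieAlgebra 𝓘(ℝ, EG) G × GroupLieAlgebra 𝓘(ℝ, EG) G :=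
    Function.invFun fun p ↦ dHom EG E j p.1 + Complex.I • dHom EG E j p.2
  ((ν (coords Z).1 (coords W).1 - ν (coords Z).2 (coords W).2 : ℝ) : ℂ) +
    ((ν (coords Z).1 (coords W).2 + ν (coords Z).2 (coords W).1 : ℝ) : ℂ) * Complex.I

/-- A maximal compact subgroup `K` of `G` together with its Cartan involution `θ` for the invariant
form `ν` on the Lie algebra `𝔤` of `G`: `θ` is an involutive automorphism of `𝔤` for which the
bilinear form `ν(·, -θ ·)` is symmetric and positive definite, and `K` is the maximal compact
subgroup belonging to `θ`, that is, the subgroup of those `g` for which `Ad g` commutes with `θ`.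
The eigenspaces of `θ` for `1` and `-1` are the summands of the Cartan decomposition
`𝔤 = 𝔨 ⊕ 𝔭`, and `𝔨` is the Lie algebra of `K`. -/
structure MaximalCompact [CompleteSpace EG] [LieGroup 𝓘(ℝ, EG) ∞ G]
    (ν : LinearMap.BilinForm ℝ (GroupLieAlgebra 𝓘(ℝ, EG) G)) where
  θ : GroupLieAlgebra 𝓘(ℝ, EG) G ≃ₗ⁅ℝ⁆ GroupLieAlgebra 𝓘(ℝ, EG) G
  involutive : ∀ a, θ (θ a) = a
  invariant : ∀ a b, ν (θ a) (θ b) = ν a b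
  posDef : ∀ a, a ≠ 0 → 0 < ν a (-θ a)
  K : Subgroup G
  mem_iff : ∀ g, g ∈ K ↔ ∀ a, Ad (𝕜 := ℝ) EG g (θ a) = θ (Ad (𝕜 := ℝ) EG g a)
  compact : IsCompact (K : Set G)
  maximal : ∀ L : Subgroup G, IsCompact (L : Set G) → K ≤ L → L = K

namespace MaximalCompact

variable [CompleteSpace EG] [LieGroup 𝓘(ℝ, EG) ∞ G] {ν : LinearMap.BilinForm ℝ (GroupLieAlgebra 𝓘(ℝ, EG) G)}

/-- The complexification `𝔨 ⊗ ℂ`, inside the Lie algebra of `GC`. -/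
def kC (M : MaximalCompact ν) (E : Type*) [NormedAddCommGroup E] [NormedSpace ℂ E]
    {GC : Type*} [TopologicalSpace GC] [ChartedSpace E GC] [Group GC] (j : G →* GC) :
    Submodule ℂ E :=
  Submodule.span ℂ (dHom EG E j '' {a | M.θ a = a})

/-- The complexification `𝔭 ⊗ ℂ`, inside the Lie algebra of `GC`. -/
def pC (M : MaximalCompact ν) (E : Type*) [NormedAddCommGroup E] [NormedSpace ℂ E]
    {GC : Type*} [TopologicalSpace GC] [ChartedSpace E GC] [Group GC] (j : G →* GC) :
    Submodule ℂ E :=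
  Submodule.span ℂ (dHom EG E j '' {a | M.θ a = -a})

/-- The complexification `KC = K exp(i𝔨)` of `K` inside `GC`: the subgroup generated by `K` and by
the one-parameter subgroups with directions in `i𝔨`. -/
def KC (M : MaximalCompact ν) (E : Type*) [NormedAddCommGroup E] [NormedSpace ℂ E]
    {GC : Type*} [TopologicalSpace GC] [ChartedSpace E GC] [Group GC] (j : G →* GC) :
    Subgroup GC :=
  Subgroup.closure (j '' (M.K : Set G) ∪
    {g | ∃ γ : ℝ → GC, ContMDiff 𝓘(ℝ, ℝ) 𝓘(ℝ, E) ∞ γ ∧ (∀ s t, γ (s + t) = γ s * γ t) ∧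
      (∃ a, M.θ a = a ∧
        (mfderiv 𝓘(ℝ, ℝ) 𝓘(ℝ, E) γ 0 (1 : ℝ) : E) = Complex.I • dHom EG E j a) ∧ γ 1 = g})

/-- Conjugation by `h ∈ G` takes the maximal compact subgroup `M` to `M'`; in terms of the Cartan
involutions, `θ' = Ad h ∘ θ ∘ (Ad h)⁻¹`. -/
def ConjTo (M M' : MaximalCompact ν) (h : G) : Prop :=
  (∀ k, k ∈ M.K ↔ h * k * h⁻¹ ∈ M'.K) ∧
    ∀ a, M'.θ (Ad (𝕜 := ℝ) EG h a) = Ad (𝕜 := ℝ) EG h (M.θ a)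

variable {V : Type*} [NormedAddCommGroup V] [NormedSpace ℂ V]

/-- The identification of the tangent space of `GC ⧸ KC` at `x = g KC` with `𝔭 ⊗ ℂ` by left
translation: the vector `Z ∈ 𝔭 ⊗ ℂ` that the derivative at `1` of `a ↦ g a KC` sends to `u`. Here
`g` is some representative of `x`; other choices change `Z` by the adjoint action of `KC`. -/
def tangentToPC (M : MaximalCompact ν) (j : G →* GC) [ChartedSpace V (GC ⧸ M.KC E j)]
    (x : GC ⧸ M.KC E j) (u : TangentSpace 𝓘(ℂ, V) x) : E :=
  Classical.epsilon fun Z : E ↦ Z ∈ M.pC E j ∧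
    (mfderiv 𝓘(ℂ, E) 𝓘(ℂ, V) (fun a : GC ↦ (QuotientGroup.mk (x.out * a) : GC ⧸ M.KC E j)) 1
      (Z : TangentSpace 𝓘(ℂ, E) (1 : GC)) : V) = u

/-- The invariant holomorphic Riemannian metric on `GC ⧸ KC` induced by `ν`. -/
def symmetricMetric (M : MaximalCompact ν) (j : G →* GC) [ChartedSpace V (GC ⧸ M.KC E j)]
    (x : GC ⧸ M.KC E j) (u v : TangentSpace 𝓘(ℂ, V) x) : ℂ :=
  complexForm j ν (M.tangentToPC j x u) (M.tangentToPC j x v)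

end MaximalCompact

end Lie

/-! ### Equivariant complex harmonic maps -/

/-- The fundamental group of `S`, as the group of deck transformations of its universal covering
`π : St → S`. -/
def Deck {S St : Type*} [TopologicalSpace St] (π : St → S) : Subgroup (St ≃ₜ St) where
  carrier := {γ | ∀ x, π (γ x) = π x}
  mul_mem' := fun {a b} ha hb x ↦ (ha (b x)).trans (hb x)
  one_mem' := fun _ ↦ rfl
  inv_mem' := fun {a} ha x ↦ by
    have := ha (a⁻¹ x)
    rw [show a (a⁻¹ x) = x from a.apply_symm_apply x] at this
    exact this.symm

section Pairs

variable {S St : Type*} [TopologicalSpace S] [ChartedSpace ℂ S] [TopologicalSpace St]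
  [ChartedSpace ℂ St]
  {EG : Type*} [NormedAddCommGroup EG] [NormedSpace ℝ EG]
  {G : Type*} [TopologicalSpace G] [ChartedSpace EG G] [Group G] [LieGroup 𝓘(ℝ, EG) ∞ G]
  [CompleteSpace EG]
  {E : Type*} [NormedAddCommGroup E] [NormedSpace ℂ E]
  {GC : Type*} [TopologicalSpace GC] [ChartedSpace E GC] [Group GC]
  {V : Type*} [NormedAddCommGroup V] [NormedSpace ℂ V]
  {ν : LinearMap.BilinForm ℝ (GroupLieAlgebra 𝓘(ℝ, EG) G)}

/-- A representation `ρ` of the fundamental group in `GC` with a smooth `ρ`-equivariant complex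
harmonic map `f` from the universal covering to `GC ⧸ KC`. -/
structure HarmonicPair (π : St → S) (c₁ c₂ : ComplexStructure S) (j : G →* GC)
    (M : MaximalCompact ν) [ChartedSpace V (GC ⧸ M.KC E j)] where
  ρ : Deck π →* GC
  f : St → GC ⧸ M.KC E j
  smooth : ContMDiff 𝓘(ℝ, ℂ) 𝓘(ℝ, V) ∞ f
  equivariant : ∀ (γ : Deck π) (x : St), f ((γ : St ≃ₜ St) x) = ρ γ • f x
  harmonic : IsComplexHarmonic π c₁ c₂ (M.symmetricMetric (V := V) j) f

/-- Two pairs are in the same orbit of `GC`, acting by `g · (ρ, f) = (g ρ g⁻¹, g f)`. -/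
def HarmonicPair.Rel {π : St → S} {c₁ c₂ : ComplexStructure S} {j : G →* GC}
    {M : MaximalCompact ν} [ChartedSpace V (GC ⧸ M.KC E j)]
    (p p' : HarmonicPair (E := E) (V := V) π c₁ c₂ j M) : Prop :=
  ∃ g : GC, (∀ γ, p'.ρ γ = g * p.ρ γ * g⁻¹) ∧ ∀ x, p'.f x = g • p.f x

end Pairs

/-! ### Principal bundles, connections, complex harmonic bundles -/

section Bundles

variable {S : Type u} [TopologicalSpace S] [ChartedSpace ℂ S]
  {E : Type*} [NormedAddCommGroup E] [NormedSpace ℂ E]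
  {GC : Type v} [TopologicalSpace GC] [ChartedSpace E GC] [Group GC]

/-- A set over `S` with a right action of `H` that is simply transitive on the fibres. -/
structure PrincipalSet (S : Type u) (H : Subgroup GC) where
  P : Type (max u v)
  [action : MulAction Hᵐᵒᵖ P]
  proj : P → S
  transitive : ∀ p q, proj p = proj q ↔ ∃ k : H, MulOpposite.op k • p = q
  free : ∀ (p : P) (k : H), MulOpposite.op k • p = p → k = 1

attribute [instance] PrincipalSet.action

/-- For `p`, `q` in the same fibre, the element `k` with `q = p k`. -/
def PrincipalSet.div {H : Subgroup GC} (B : PrincipalSet S H) (p q : B.P) : H :=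
  Classical.epsilon fun k : H ↦ MulOpposite.op k • p = q

/-- A smooth principal `H`-bundle over the surface `S`, where `H` is a closed (Lie) subgroup of
`GC`. The smooth structure of the total space is given by a bundle atlas: local sections `sec i` over
open sets `U i` that cover `S` (that is, local trivialisations `(x, k) ↦ sec i x · k`), with smooth
transition functions `U i ∩ U j → H ⊆ GC`. The values of `sec i` outside `U i` are irrelevant. -/
structure PrincipalBundle (E : Type*) [NormedAddCommGroup E] [NormedSpace ℂ E]
    {GC : Type v} [TopologicalSpace GC] [ChartedSpace E GC] [Group GC]
    (S : Type u) [TopologicalSpace S] [ChartedSpace ℂ S] (H : Subgroup GC) extends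
    PrincipalSet S H where
  ι : Type (max u v)
  U : ι → Set S
  isOpen_U : ∀ i, IsOpen (U i)
  cover : ∀ x, ∃ i, x ∈ U i
  sec : ι → S → P
  proj_sec : ∀ i, ∀ x ∈ U i, proj (sec i x) = x
  smooth_trans : ∀ i i', ContMDiffOn 𝓘(ℝ, ℂ) 𝓘(ℝ, E) ∞
    (fun x ↦ (toPrincipalSet.div (sec i x) (sec i' x) : GC)) (U i ∩ U i')

/-- The pull-back `g⁻¹ dg` of the Maurer-Cartan form by `g : S → GC`, at `x`. -/
def maurerCartan (E : Type*) [NormedAddCommGroup E] [NormedSpace ℂ E]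
    {GC : Type*} [TopologicalSpace GC] [ChartedSpace E GC] [Group GC]
    {S : Type*} [TopologicalSpace S] [ChartedSpace ℂ S] (g : S → GC) (x : S) :
    TangentSpace 𝓘(ℝ, ℂ) x →L[ℝ] E :=
  mfderiv 𝓘(ℝ, ℂ) 𝓘(ℝ, E) (fun y ↦ (g x)⁻¹ * g y) x

/-- The transition function `t` with `sec i' = sec i · t`. -/
def PrincipalBundle.trans {H : Subgroup GC} (B : PrincipalBundle E S H) (i i' : B.ι) (x : S) : GC :=
  (B.div (B.sec i x) (B.sec i' x) : GC)

/-- A smooth principal connection on `B`, where `𝔥` is the Lie algebra of `H`, given by its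
connection forms: the `𝔥`-valued pull-backs `form i` along the local sections `sec i`. That they come
from an equivariant form on the total space that is the Maurer-Cartan form on the fibres is the rule
`form i' = Ad(t⁻¹) form i + t⁻¹ dt` for `sec i' = sec i · t`. -/
structure Connection {H : Subgroup GC} (B : PrincipalBundle E S H) (𝔥 : Submodule ℂ E) where
  form : B.ι → OneForm S E
  mem : ∀ i, ∀ x ∈ B.U i, ∀ v, form i x v ∈ 𝔥
  smooth : ∀ i, SmoothFormOn (form i) (B.U i)
  gauge : ∀ i i', ∀ x ∈ B.U i ∩ B.U i', ∀ v,
    form i' x v = AdC (E := E) (B.trans i i' x)⁻¹ (form i x v) + maurerCartan E (B.trans i i') x v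

/-- A smooth `1`-form on `S` with values in the associated bundle `B ×_H 𝔪`, where `H` acts on
`𝔪` by the adjoint action, given by its expressions in the local frames defined by the
sections `sec i`. -/
structure AdForm {H : Subgroup GC} (B : PrincipalBundle E S H) (𝔪 : Submodule ℂ E) where
  form : B.ι → OneForm S E
  mem : ∀ i, ∀ x ∈ B.U i, ∀ v, form i x v ∈ 𝔪
  smooth : ∀ i, SmoothFormOn (form i) (B.U i)
  gauge : ∀ i i', ∀ x ∈ B.U i ∩ B.U i', ∀ v,
    form i' x v = AdC (E := E) (B.trans i i' x)⁻¹ (form i x v)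

/-- The exterior covariant derivative `d_A β = dβ + [A ∧ β]` of an `ad`-valued `1`-form, in a
local frame. -/
def covExtDeriv (GC : Type*) [TopologicalSpace GC] [ChartedSpace E GC] [Group GC]
    (A β : OneForm S E) (x : S) (a b : TangentSpace 𝓘(ℝ, ℂ) x) : E :=
  extDerivForm β x a b + bracketC GC (A x a) (β x b) - bracketC GC (A x b) (β x a)

/-- The curvature `dA + ½[A ∧ A]` of a connection form. -/
def curvature (GC : Type*) [TopologicalSpace GC] [ChartedSpace E GC] [Group GC]
    (A : OneForm S E) (x : S) (a b : TangentSpace 𝓘(ℝ, ℂ) x) : E :=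
  extDerivForm A x a b + bracketC GC (A x a) (A x b)

/-- The operator `∂₁` on `ad`-valued `1`-forms defined by a connection and by the complex structures
`c₁`, `c₂` (coordinates `z`, `w̄`): it kills the `dz`-part, and on the `dw̄`-part it is
`s ⊗ dw̄ ↦ ∂₁ s ∧ dw̄ = d_A (s ⊗ dw̄)`. -/
def del₁ (GC : Type*) [TopologicalSpace GC] [ChartedSpace E GC] [Group GC]
    (c₁ c₂ : ComplexStructure S) (A β : OneForm S E) (x : S)
    (a b : TangentSpace 𝓘(ℝ, ℂ) x) : E :=
  covExtDeriv GC A (typeProj c₂ c₁ β) x a b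

/-- The operator `∂̄₂` on `ad`-valued `1`-forms: it kills the `dw̄`-part, and on the `dz`-part it is
`s ⊗ dz ↦ ∂̄₂ s ∧ dz = d_A (s ⊗ dz)`. -/
def delBar₂ (GC : Type*) [TopologicalSpace GC] [ChartedSpace E GC] [Group GC]
    (c₁ c₂ : ComplexStructure S) (A β : OneForm S E) (x : S)
    (a b : TangentSpace 𝓘(ℝ, ℂ) x) : E :=
  covExtDeriv GC A (typeProj c₁ c₂ β) x a b

variable {EG : Type*} [NormedAddCommGroup EG] [NormedSpace ℝ EG]
  {G : Type w} [TopologicalSpace G] [ChartedSpace EG G] [Group G] [LieGroup 𝓘(ℝ, EG) ∞ G]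
  [CompleteSpace EG]
  {ν : LinearMap.BilinForm ℝ (GroupLieAlgebra 𝓘(ℝ, EG) G)}

/-- A complex harmonic `G`-bundle over `S` with the oppositely oriented complex structures `c₁`, `c₂`
(coordinates `z`, `w̄`): a maximal compact subgroup `K` of `G`, a principal `KC`-bundle with a
connection `A`, and `𝔭 ⊗ ℂ`-valued forms `φ₁` (a multiple of `dz`) and `φ₂` (a multiple of `dw̄`)
such that `∂₁ φ₂ = 0`, `∂̄₂ φ₁ = 0` and the connection `A + φ₁ + φ₂` on the associated
`GC`-bundle is flat. -/
structure HarmonicBundle (c₁ c₂ : ComplexStructure S) (j : G →* GC)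
    (ν : LinearMap.BilinForm ℝ (GroupLieAlgebra 𝓘(ℝ, EG) G)) where
  M : MaximalCompact ν
  B : PrincipalBundle E S (M.KC E j)
  A : Connection B (M.kC E j)
  φ₁ : AdForm B (M.pC E j)
  φ₂ : AdForm B (M.pC E j)
  type₁ : ∀ i, ∀ x ∈ B.U i, IsTypeOneZero c₁ x (φ₁.form i x)
  type₂ : ∀ i, ∀ x ∈ B.U i, IsTypeOneZero c₂ x (φ₂.form i x)
  del_φ₂ : ∀ i, ∀ x ∈ B.U i, ∀ a b, del₁ GC c₁ c₂ (A.form i) (φ₂.form i) x a b = 0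
  delBar_φ₁ : ∀ i, ∀ x ∈ B.U i, ∀ a b, delBar₂ GC c₁ c₂ (A.form i) (φ₁.form i) x a b = 0
  flat : ∀ i, ∀ x ∈ B.U i, ∀ a b,
    curvature GC (fun y ↦ A.form i y + φ₁.form i y + φ₂.form i y) x a b = 0

/-- Isomorphism of complex harmonic `G`-bundles: an isomorphism `F` of principal bundles over the
identity of `S` that identifies the connections and the Higgs fields. The maximal compact subgroups
may be different: `F` is equivariant for the isomorphism from `KC` to `K'C` given by conjugation by
some `h ∈ G` that takes `K` to `K'`. The pulled back forms are compared in the local sections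
`F (sec i) = sec' i' · t`. -/
def HarmonicBundle.Iso {c₁ c₂ : ComplexStructure S} {j : G →* GC}
    (b b' : HarmonicBundle (E := E) c₁ c₂ j ν) : Prop :=
  ∃ (h : G) (F : b.B.P → b'.B.P), b.M.ConjTo b'.M h ∧
    (∀ p, b'.B.proj (F p) = b.B.proj p) ∧
    (∀ p (k : b.M.KC E j) (k' : b'.M.KC E j), (k' : GC) = j h * k * (j h)⁻¹ →
      F (MulOpposite.op k • p) = MulOpposite.op k' • F p) ∧
    ∀ i i', ∃ t : S → GC, (∀ x, t x = (b'.B.div (b'.B.sec i' x) (F (b.B.sec i x)) : GC)) ∧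
      ContMDiffOn 𝓘(ℝ, ℂ) 𝓘(ℝ, E) ∞ t (b.B.U i ∩ b'.B.U i') ∧
      ∀ x ∈ b.B.U i ∩ b'.B.U i', ∀ v,
        AdC (E := E) (j h) (b.A.form i x v) =
          AdC (E := E) (t x)⁻¹ (b'.A.form i' x v) + maurerCartan E t x v ∧
        AdC (E := E) (j h) (b.φ₁.form i x v) = AdC (E := E) (t x)⁻¹ (b'.φ₁.form i' x v) ∧
        AdC (E := E) (j h) (b.φ₂.form i x v) = AdC (E := E) (t x)⁻¹ (b'.φ₂.form i' x v)

variable {St : Type u} [TopologicalSpace St] [ChartedSpace ℂ St]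
  {V : Type*} [NormedAddCommGroup V] [NormedSpace ℂ V]

/-- The bundle `b` is (isomorphic to) the complex harmonic `G`-bundle of the pair `p = (ρ, f)`.

The flat bundle `P_ρ` of `ρ` is the quotient of `St × GC` by `γ (x, g) = (γ x, ρ(γ) g)`, its flat
connection is the Maurer-Cartan form of `GC`, and `f` defines its reduction
`P_f = {[x, g] : g KC = f x}` to `KC`. Isomorphisms from the bundle of `b` to `P_f` have the form
`q ↦ [x, F(x, q)]`, where `F(x, q) ∈ GC` is defined for `π x = proj q`, is `KC`-equivariant in
`q`, satisfies `F(γ x, q) = ρ(γ) F(x, q)`, and has `F(x, q) KC = f x`. The connection `A` and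
the forms `φ₁ + φ₂` have to be the `𝔨 ⊗ ℂ`-part and the `𝔭 ⊗ ℂ`-part of the restriction to `P_f` of
the flat connection, that is, the pull-back by `f` of the canonical connection of `GC → GC ⧸ KC`,
and `df`. If the maximal compact subgroup `K'` of `b` is not that of `p`, then it is `h K h⁻¹` for
some `h ∈ G`, and `GC ⧸ K'C` is identified with `GC ⧸ KC` by `g K'C ↦ g h KC`. -/
def Corresponds {π : St → S} {c₁ c₂ : ComplexStructure S} {j : G →* GC}
    {M : MaximalCompact ν} [ChartedSpace V (GC ⧸ M.KC E j)]
    (p : HarmonicPair (E := E) (V := V) π c₁ c₂ j M) (b : HarmonicBundle (E := E) c₁ c₂ j ν) : Prop :=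
  ∃ (h : G) (F : St → b.B.P → GC), M.ConjTo b.M h ∧
    (∀ x q, π x = b.B.proj q → ∀ k : b.M.KC E j, F x (MulOpposite.op k • q) = F x q * k) ∧
    (∀ (γ : Deck π) x q, π x = b.B.proj q → F ((γ : St ≃ₜ St) x) q = p.ρ γ * F x q) ∧
    (∀ x q, π x = b.B.proj q → p.f x = QuotientGroup.mk (F x q * j h)) ∧
    ∀ i, ContMDiffOn 𝓘(ℝ, ℂ) 𝓘(ℝ, E) ∞ (fun x ↦ F x (b.B.sec i (π x))) (π ⁻¹' b.B.U i) ∧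
      ∀ x ∈ π ⁻¹' b.B.U i, ∀ v,
        maurerCartan E (fun x' ↦ F x' (b.B.sec i (π x'))) x v =
          (b.A.form i (π x) + b.φ₁.form i (π x) + b.φ₂.form i (π x))
            (mfderiv 𝓘(ℝ, ℂ) 𝓘(ℝ, ℂ) π x v)

end Bundles

end ComplexHarmonic

end

/-! Let `s` be a local lift of `f` to `G^ℂ` and split `s⁻¹ds = A + φ` along `𝔤^ℂ = 𝔨^ℂ ⊕ 𝔭^ℂ`.
Multiplying the lift on the right by a `K^ℂ`-valued map `k` changes `A` by a gauge transformation
and `φ` by `Ad(k⁻¹)`. So `A` is a connection on the reduction `P_f`, and `φ` is an `ad 𝔭^ℂ`-valued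
form that represents `df`. The connection `A` induces the Levi-Civita connection of `G^ℂ/K^ℂ`: it is
torsion free because `[𝔭,𝔭] ⊂ 𝔨`, and metric because `ν` is invariant. Hence `∇df` is the covariant
derivative of `φ` (`exists_parallel_frame`, `exists_frame_second_derivative`).

Write `φ = a dz + b dw̄` for the splitting into types. For a metric `λ dz dw̄` the coordinates are
isotropic and harmonic, so only mixed covariant derivatives of `a` and `b` survive in the trace. The
`𝔭`-part `d_A φ = 0` of the Maurer-Cartan equation identifies the two mixed terms, and the tension
becomes a nonvanishing multiple of `d_A φ₂ = -d_A φ₁` (`trace_second_derivative`,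
`exists_frame_tension`). Thus harmonicity is equivalent to each of the two equations for the Higgs
fields (`tension_eq_zero_iff`, `covExtDeriv_iff_covExtDeriv`), and flatness of `A + φ₁ + φ₂` is the
full Maurer-Cartan equation. This produces a bundle from a pair.

Conversely, the flat connection of a bundle can be integrated on the simply connected covering:
locally by the Frobenius theorem (`exists_mc_eq`), globally because a locally constant cocycle is a
coboundary there (`exists_development`). The resulting development `F` is unique up to a left factor
in `G^ℂ`. Its behaviour under deck transformations is `ρ`, and its class modulo `K^ℂ` is `f`. Two
bundles of the same pair have developments that can be matched pointwise. This defines an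
isomorphism of bundles that identifies the flat connections, hence also their `𝔨^ℂ`- and `𝔭^ℂ`-parts
and the components of the two types.

Semisimplicity enters twice. The kernel of the differential of `G^ℂ → G^ℂ/K^ℂ` at `1` is exactly
`𝔨^ℂ`, because the centre of `𝔤^ℂ` is zero (`mem_kC_of_pr_one_eq_zero`). And Cartan involutions are
conjugate, because derivations of `𝔤` are inner (`MaximalCompact.exists_conjTo`); so a bundle whose
maximal compact subgroup differs from the fixed one still gives a map to the fixed quotient. -/

noncomputable section

namespace ComplexHarmonic

set_option linter.unusedSectionVars false

open Filter

/-! ### Lie groups in the chart at the identity: left invariant frame and bracket -/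

section LieChart


variable {𝕜 : Type*} [RCLike 𝕜] {E : Type*} [NormedAddCommGroup E] [NormedSpace 𝕜 E]
  {G : Type*} [TopologicalSpace G] [ChartedSpace E G] [Group G]

section TangentDerivative

variable {N N' N'' M M' M'' : Type*} [NormedAddCommGroup N] [NormedSpace 𝕜 N]
  [NormedAddCommGroup N'] [NormedSpace 𝕜 N'] [NormedAddCommGroup N''] [NormedSpace 𝕜 N'']
  [TopologicalSpace M] [ChartedSpace N M] [TopologicalSpace M'] [ChartedSpace N' M']
  [TopologicalSpace M''] [ChartedSpace N'' M'']

variable (𝕜 N N') in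
/-- The derivative of a map between manifolds, as a map between the model spaces. -/
def tder (f : M → M') (x : M) : N →L[𝕜] N' := mfderiv 𝓘(𝕜, N) 𝓘(𝕜, N') f x

theorem tder_eq_fderiv_charts {f : M → M'} {x : M}
    (hf : MDifferentiableAt 𝓘(𝕜, N) 𝓘(𝕜, N') f x) :
    tder 𝕜 N N' f x =
      fderiv 𝕜 (fun y ↦ chartAt N' (f x) (f ((chartAt N x).symm y))) (chartAt N x x) := by
  have h : tder 𝕜 N N' f x = fderivWithin 𝕜 (writtenInExtChartAt 𝓘(𝕜, N) 𝓘(𝕜, N') x f)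
    (Set.range 𝓘(𝕜, N)) ((extChartAt 𝓘(𝕜, N) x) x) := if_pos hf
  rw [h]
  simp only [modelWithCornersSelf_coe, Set.range_id, fderivWithin_univ]
  rfl

theorem tder_eq_fderiv_chart {f : M → N'} {x : M}
    (hf : MDifferentiableAt 𝓘(𝕜, N) 𝓘(𝕜, N') f x) :
    tder 𝕜 N N' f x = fderiv 𝕜 (fun y ↦ f ((chartAt N x).symm y)) (chartAt N x x) :=
  tder_eq_fderiv_charts hf

theorem tder_eq_fderiv (f : N → N') (x : N) : tder 𝕜 N N' f x = fderiv 𝕜 f x :=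
  mfderiv_eq_fderiv

theorem tder_comp {g : M' → M''} {f : M → M'} (x : M)
    (hg : MDifferentiableAt 𝓘(𝕜, N') 𝓘(𝕜, N'') g (f x))
    (hf : MDifferentiableAt 𝓘(𝕜, N) 𝓘(𝕜, N') f x) :
    tder 𝕜 N N'' (fun y ↦ g (f y)) x = (tder 𝕜 N' N'' g (f x)).comp (tder 𝕜 N N' f x) :=
  mfderiv_comp x hg hf

theorem tder_comp_of_eq {g : M' → M''} {f : M → M'} (x : M) {y : M'} (hy : f x = y)
    (hg : MDifferentiableAt 𝓘(𝕜, N') 𝓘(𝕜, N'') g y)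
    (hf : MDifferentiableAt 𝓘(𝕜, N) 𝓘(𝕜, N') f x) :
    tder 𝕜 N N'' (fun y ↦ g (f y)) x = (tder 𝕜 N' N'' g y).comp (tder 𝕜 N N' f x) := by
  subst hy; exact tder_comp x hg hf

theorem tder_congr {f g : M → M'} {x : M} (h : f =ᶠ[𝓝 x] g) :
    tder 𝕜 N N' f x = tder 𝕜 N N' g x := by
  have h1 : f x = g x := h.self_of_nhds
  have h2 := Filter.EventuallyEq.mfderiv_eq (I := 𝓘(𝕜, N)) (I' := 𝓘(𝕜, N')) h
  exact h2

theorem tder_id (x : M) : tder 𝕜 N N (fun y : M ↦ y) x = ContinuousLinearMap.id 𝕜 N :=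
  mfderiv_id

theorem tder_const (c : M') (x : M) : tder 𝕜 N N' (fun _ : M ↦ c) x = 0 :=
  mfderiv_const

theorem contMDiffAt_chart_symm [IsManifold 𝓘(𝕜, N) ∞ M] {x : M} {a : N}
    (ha : a ∈ (chartAt N x).target) :
    ContMDiffAt 𝓘(𝕜, N) 𝓘(𝕜, N) ∞ (chartAt N x).symm a :=
  (contMDiffOn_chart_symm (I := 𝓘(𝕜, N)) (n := ∞) (x := x)).contMDiffAt
    ((chartAt N x).open_target.mem_nhds ha)

theorem contMDiffAt_chart [IsManifold 𝓘(𝕜, N) ∞ M] {x : M} {a : M}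
    (ha : a ∈ (chartAt N x).source) :
    ContMDiffAt 𝓘(𝕜, N) 𝓘(𝕜, N) ∞ (chartAt N x) a :=
  (contMDiffOn_chart (I := 𝓘(𝕜, N)) (n := ∞) (x := x)).contMDiffAt
    ((chartAt N x).open_source.mem_nhds ha)

theorem _root_.ContMDiffAt.mdiff {f : M → M'} {x : M}
    (hf : ContMDiffAt 𝓘(𝕜, N) 𝓘(𝕜, N') ∞ f x) : MDifferentiableAt 𝓘(𝕜, N) 𝓘(𝕜, N') f x :=
  hf.mdifferentiableAt (by simp)

theorem tder_chart_comp_tder_symm [IsManifold 𝓘(𝕜, N) ∞ M] {x : M} {a : N}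
    (ha : a ∈ (chartAt N x).target) :
    (tder 𝕜 N N (chartAt N x) ((chartAt N x).symm a)).comp (tder 𝕜 N N (chartAt N x).symm a) =
      ContinuousLinearMap.id 𝕜 N := by
  rw [← tder_comp a (contMDiffAt_chart ((chartAt N x).map_target ha)).mdiff
    (contMDiffAt_chart_symm ha).mdiff, ← tder_id (M := N)]
  refine tder_congr ?_
  filter_upwards [(chartAt N x).open_target.mem_nhds ha] with b hb
  exact (chartAt N x).right_inv hb

theorem tder_symm_comp_tder_chart [IsManifold 𝓘(𝕜, N) ∞ M] {x : M} {a : M}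
    (ha : a ∈ (chartAt N x).source) :
    (tder 𝕜 N N (chartAt N x).symm (chartAt N x a)).comp (tder 𝕜 N N (chartAt N x) a) =
      ContinuousLinearMap.id 𝕜 N := by
  rw [← tder_comp a (contMDiffAt_chart_symm ((chartAt N x).map_source ha)).mdiff
    (contMDiffAt_chart ha).mdiff, ← tder_id (M := M)]
  refine tder_congr ?_
  filter_upwards [(chartAt N x).open_source.mem_nhds ha] with b hb
  exact (chartAt N x).left_inv hb

theorem tder_chart_self [IsManifold 𝓘(𝕜, N) ∞ M] (x : M) :
    tder 𝕜 N N (chartAt N x) x = ContinuousLinearMap.id 𝕜 N := by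
  rw [tder_eq_fderiv_chart (contMDiffAt_chart (mem_chart_source N x)).mdiff,
    Filter.EventuallyEq.fderiv_eq (f₁ := _) (f := id), fderiv_id]
  filter_upwards [(chartAt N x).open_target.mem_nhds (mem_chart_target N x)] with a ha
  exact (chartAt N x).right_inv ha

theorem tder_chart_symm_self [IsManifold 𝓘(𝕜, N) ∞ M] (x : M) :
    tder 𝕜 N N (chartAt N x).symm (chartAt N x x) = ContinuousLinearMap.id 𝕜 N := by
  have := tder_symm_comp_tder_chart (𝕜 := 𝕜) (mem_chart_source N x)
  rwa [tder_chart_self, ContinuousLinearMap.comp_id] at this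

end TangentDerivative

variable (E G) in
/-- The group multiplication in the preferred chart around `1`. -/
def mulChart (p : E × E) : E :=
  chartAt E (1 : G) ((chartAt E (1 : G)).symm p.1 * (chartAt E (1 : G)).symm p.2)

variable (E G) in
/-- The coordinates of `1` in the preferred chart around `1`. -/
def oneChart : E := chartAt E (1 : G) 1

variable (𝕜 E G) in
/-- The left invariant frame, in the preferred chart around `1`. -/
def leftFrame (a : E) : E →L[𝕜] E := fderiv 𝕜 (fun b ↦ mulChart E G (a, b)) (oneChart E G)

theorem oneChart_mem_target : oneChart E G ∈ (chartAt E (1 : G)).target :=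
  mem_chart_target E (1 : G)

@[simp] theorem symm_oneChart : (chartAt E (1 : G)).symm (oneChart E G) = 1 :=
  (chartAt E (1 : G)).left_inv (mem_chart_source E 1)

theorem eventually_mem_target : ∀ᶠ a in 𝓝 (oneChart E G), a ∈ (chartAt E (1 : G)).target :=
  (chartAt E (1 : G)).open_target.mem_nhds oneChart_mem_target

theorem mulChart_oneChart_right {a : E} (ha : a ∈ (chartAt E (1 : G)).target) :
    mulChart E G (a, oneChart E G) = a := by
  simp [mulChart, (chartAt E (1 : G)).right_inv ha]

theorem mulChart_oneChart_left {a : E} (ha : a ∈ (chartAt E (1 : G)).target) :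
    mulChart E G (oneChart E G, a) = a := by
  simp [mulChart, (chartAt E (1 : G)).right_inv ha]

theorem leftFrame_oneChart : leftFrame 𝕜 E G (oneChart E G) = ContinuousLinearMap.id 𝕜 E := by
  rw [leftFrame, Filter.EventuallyEq.fderiv_eq (f₁ := _) (f := id), fderiv_id]
  filter_upwards [eventually_mem_target] with a ha
  exact mulChart_oneChart_left ha

section LieGroup

variable [LieGroup 𝓘(𝕜, E) ∞ G]

theorem contDiffAt_mulChart {a b : E} (ha : a ∈ (chartAt E (1 : G)).target)
    (hb : b ∈ (chartAt E (1 : G)).target)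
    (hab : (chartAt E (1 : G)).symm a * (chartAt E (1 : G)).symm b ∈ (chartAt E (1 : G)).source) :
    ContDiffAt 𝕜 ∞ (mulChart E G) (a, b) := by
  rw [← contMDiffAt_iff_contDiffAt]
  have h1 : ContMDiffAt 𝓘(𝕜, E × E) 𝓘(𝕜, E) ∞
      (fun p : E × E ↦ (chartAt E (1 : G)).symm p.1) (a, b) :=
    ContMDiffAt.comp (a, b) (contMDiffAt_chart_symm ha) (contDiff_fst.contMDiff.contMDiffAt)
  have h2 : ContMDiffAt 𝓘(𝕜, E × E) 𝓘(𝕜, E) ∞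
      (fun p : E × E ↦ (chartAt E (1 : G)).symm p.2) (a, b) :=
    ContMDiffAt.comp (a, b) (contMDiffAt_chart_symm hb) (contDiff_snd.contMDiff.contMDiffAt)
  exact ContMDiffAt.comp (a, b) (contMDiffAt_chart hab) (h1.mul h2)

theorem contDiffAt_mulChart_one {a : E} (ha : a ∈ (chartAt E (1 : G)).target) :
    ContDiffAt 𝕜 ∞ (mulChart E G) (a, oneChart E G) :=
  contDiffAt_mulChart ha oneChart_mem_target
    (by simpa using (chartAt E (1 : G)).map_target ha)

theorem contDiffAt_leftFrame {a : E} (ha : a ∈ (chartAt E (1 : G)).target) :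
    ContDiffAt 𝕜 ∞ (leftFrame 𝕜 E G) a :=
  ContDiffAt.fderiv (f := fun a b ↦ mulChart E G (a, b)) (g := fun _ ↦ oneChart E G) (n := ∞)
    (contDiffAt_mulChart_one ha) contDiffAt_const (by simp)

theorem leftFrame_eq_tder {a : E} (ha : a ∈ (chartAt E (1 : G)).target) :
    leftFrame 𝕜 E G a = tder 𝕜 E E
      (fun x : G ↦ chartAt E (1 : G) ((chartAt E (1 : G)).symm a * x)) 1 := by
  rw [tder_eq_fderiv_chart]
  · rfl
  · refine ContMDiffAt.mdiff (𝕜 := 𝕜) ?_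
    refine ContMDiffAt.comp 1 (contMDiffAt_chart ?_) contMDiffAt_mul_left
    simpa using (chartAt E (1 : G)).map_target ha

/-- The pull-back inverts the derivative of the inverse chart, which gives the derivative of the
chart. Composed with the derivative of a left translation this is the derivative of multiplication
in the chart. -/
theorem mpullback_mulInvariantVectorField_chart (w : GroupLieAlgebra 𝓘(𝕜, E) G) {a : E}
    (ha : a ∈ (chartAt E (1 : G)).target) :
    VectorField.mpullback 𝓘(𝕜, E) 𝓘(𝕜, E) (chartAt E (1 : G)).symm
        (mulInvariantVectorField w) a = leftFrame 𝕜 E G a w := by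
  have hs : (chartAt E (1 : G)).symm a ∈ (chartAt E (1 : G)).source :=
    (chartAt E (1 : G)).map_target ha
  have e1 := tder_symm_comp_tder_chart (𝕜 := 𝕜) hs
  rw [(chartAt E (1 : G)).right_inv ha] at e1
  have e2 : (tder 𝕜 E E (chartAt E (1 : G)).symm a).inverse =
    tder 𝕜 E E (chartAt E (1 : G)) ((chartAt E (1 : G)).symm a) :=
    ContinuousLinearMap.inverse_eq e1 (tder_chart_comp_tder_symm ha)
  have e3 : VectorField.mpullback 𝓘(𝕜, E) 𝓘(𝕜, E) (chartAt E (1 : G)).symm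
      (mulInvariantVectorField w) a = (tder 𝕜 E E (chartAt E (1 : G)).symm a).inverse
        (tder 𝕜 E E (fun x : G ↦ (chartAt E (1 : G)).symm a * x) 1 w) := rfl
  rw [e3, e2, leftFrame_eq_tder ha, tder_comp_of_eq (y := (chartAt E (1 : G)).symm a) 1 (by simp)
    (contMDiffAt_chart hs).mdiff (contMDiffAt_mul_left).mdiff]
  rfl

/-- Both the frame and the derivative of the chart are the identity at `1`, so the bracket of left
invariant fields is the bracket of vector fields on the model space, computed with the frame. -/
theorem groupLieAlgebra_bracket_eq (v w : GroupLieAlgebra 𝓘(𝕜, E) G) :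
    (⁅v, w⁆ : GroupLieAlgebra 𝓘(𝕜, E) G) =
      fderiv 𝕜 (fun a ↦ leftFrame 𝕜 E G a w) (oneChart E G) v -
        fderiv 𝕜 (fun a ↦ leftFrame 𝕜 E G a v) (oneChart E G) w := by
  -- `X` and `s` stand for the pulled back fields and for the domain of the within-derivatives,
  -- which is the whole space since there is no boundary.
  have key : ∀ (X : E → E → E) (s : Set E), s = Set.univ →
      (∀ w, X w =ᶠ[𝓝 (oneChart E G)] fun a ↦ leftFrame 𝕜 E G a w) → ∀ v w : E,
      (tder 𝕜 E E (chartAt E (1 : G)) 1).inverse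
        (VectorField.lieBracketWithin 𝕜 (X v) (X w) s (oneChart E G)) =
      fderiv 𝕜 (fun a ↦ leftFrame 𝕜 E G a w) (oneChart E G) v -
        fderiv 𝕜 (fun a ↦ leftFrame 𝕜 E G a v) (oneChart E G) w := by
    intro X s hs hX v w
    rw [hs, VectorField.lieBracketWithin_univ, VectorField.lieBracket, (hX v).fderiv_eq,
      (hX w).fderiv_eq, (hX v).self_of_nhds, (hX w).self_of_nhds]
    beta_reduce
    rw [leftFrame_oneChart,
      tder_chart_self, ContinuousLinearMap.inverse_id]
    rfl
  refine key (fun w a ↦ VectorField.mpullbackWithin 𝓘(𝕜, E) 𝓘(𝕜, E) (chartAt E (1 : G)).symm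
    (mulInvariantVectorField (w : GroupLieAlgebra 𝓘(𝕜, E) G)) (Set.range 𝓘(𝕜, E)) a)
    ((extChartAt 𝓘(𝕜, E) (1 : G)).symm ⁻¹' Set.univ ∩ Set.range 𝓘(𝕜, E)) (by simp) ?_ v w
  intro w
  filter_upwards [eventually_mem_target] with a ha
  rw [modelWithCornersSelf_coe, Set.range_id, VectorField.mpullbackWithin_univ]
  exact mpullback_mulInvariantVectorField_chart w ha

end LieGroup

end LieChart

/-! ### The pull-back of the Maurer-Cartan form and its product rule -/

section MaurerCartan


variable {𝕜 : Type*} [RCLike 𝕜] {E : Type*} [NormedAddCommGroup E] [NormedSpace 𝕜 E]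
  {G : Type*} [TopologicalSpace G] [ChartedSpace E G] [Group G]
  {N : Type*} [NormedAddCommGroup N] [NormedSpace 𝕜 N]
  {M : Type*} [TopologicalSpace M] [ChartedSpace N M]

variable (𝕜 N E) in
/-- The pull-back of the Maurer-Cartan form of a Lie group by a map `s`. -/
def mc (s : M → G) (x : M) : N →L[𝕜] E := tder 𝕜 N E (fun y ↦ (s x)⁻¹ * s y) x

variable (𝕜 E) in
/-- The adjoint action, as an endomorphism of the model space. -/
def adj (g : G) : E →L[𝕜] E := tder 𝕜 E E (fun x : G ↦ g * x * g⁻¹) 1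

theorem mc_congr {s t : M → G} {x : M} (h : s =ᶠ[𝓝 x] t) : mc 𝕜 E N s x = mc 𝕜 E N t x := by
  refine tder_congr ?_
  filter_upwards [h] with y hy
  rw [hy, h.self_of_nhds]

theorem mc_const (g : G) (x : M) : mc 𝕜 E N (fun _ ↦ g) x = 0 := by
  simp only [mc]
  exact tder_const _ _

theorem mc_const_mul (g : G) (s : M → G) (x : M) :
    mc 𝕜 E N (fun y ↦ g * s y) x = mc 𝕜 E N s x := by
  simp only [mc]
  congr 1
  funext y
  group

variable [LieGroup 𝓘(𝕜, E) ∞ G]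

theorem mdiff_div {s : M → G} {x : M} (hs : MDifferentiableAt 𝓘(𝕜, N) 𝓘(𝕜, E) s x) (g : G) :
    MDifferentiableAt 𝓘(𝕜, N) 𝓘(𝕜, E) (fun y ↦ g * s y) x :=
  MDifferentiableAt.comp (g := fun z : G ↦ g * z) x
    (ContMDiffAt.mdiff contMDiffAt_mul_left) hs

theorem mdiff_conj (g x : G) :
    MDifferentiableAt 𝓘(𝕜, E) 𝓘(𝕜, E) (fun y ↦ g * y * g⁻¹) x :=
  ContMDiffAt.mdiff (𝕜 := 𝕜) ((contMDiffAt_const.mul contMDiffAt_id).mul contMDiffAt_const)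

theorem mc_comp {N' M' : Type*} [NormedAddCommGroup N'] [NormedSpace 𝕜 N']
    [TopologicalSpace M'] [ChartedSpace N' M'] {s : M → G} {κ : M' → M} {x : M'}
    (hs : MDifferentiableAt 𝓘(𝕜, N) 𝓘(𝕜, E) s (κ x))
    (hκ : MDifferentiableAt 𝓘(𝕜, N') 𝓘(𝕜, N) κ x) :
    mc 𝕜 E N' (fun y ↦ s (κ y)) x = (mc 𝕜 E N s (κ x)).comp (tder 𝕜 N' N κ x) :=
  tder_comp (g := fun y ↦ (s (κ x))⁻¹ * s y) x (mdiff_div hs _) hκ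

theorem mc_hom_comp {E' G' : Type*} [NormedAddCommGroup E'] [NormedSpace 𝕜 E']
    [TopologicalSpace G'] [ChartedSpace E' G'] [Group G'] {j : G → G'}
    (hj : ∀ a b, j (a * b) = j a * j b) (hj' : MDifferentiableAt 𝓘(𝕜, E) 𝓘(𝕜, E') j 1)
    {s : M → G} {x : M} (hs : MDifferentiableAt 𝓘(𝕜, N) 𝓘(𝕜, E) s x) :
    mc 𝕜 E' N (fun y ↦ j (s y)) x = (tder 𝕜 E E' j 1).comp (mc 𝕜 E N s x) := by
  have h1 : ∀ y, (j (s x))⁻¹ * j (s y) = j ((s x)⁻¹ * s y) := fun y ↦ by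
    rw [inv_mul_eq_iff_eq_mul, ← hj, mul_inv_cancel_left]
  simp only [mc, h1]
  exact tder_comp_of_eq x (by simp) hj' (mdiff_div hs _)

theorem mc_conj {s : M → G} {x : M} (hs : MDifferentiableAt 𝓘(𝕜, N) 𝓘(𝕜, E) s x) (g : G) :
    mc 𝕜 E N (fun y ↦ g * s y * g⁻¹) x = (adj 𝕜 E g).comp (mc 𝕜 E N s x) :=
  mc_hom_comp (j := fun y ↦ g * y * g⁻¹) (fun a b ↦ by group) (mdiff_conj g 1) hs

theorem mc_mul_const {s : M → G} {x : M} (hs : MDifferentiableAt 𝓘(𝕜, N) 𝓘(𝕜, E) s x) (g : G) :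
    mc 𝕜 E N (fun y ↦ s y * g) x = (adj 𝕜 E g⁻¹).comp (mc 𝕜 E N s x) := by
  rw [← mc_conj hs, ← mc_const_mul g⁻¹]
  simp only [inv_inv, mul_assoc]

/-- On each of the two axes through `(1, 1)` multiplication is the identity. -/
theorem fderiv_mulChart_one (p : E × E) :
    fderiv 𝕜 (mulChart E G) (oneChart E G, oneChart E G) p = p.1 + p.2 := by
  have hd : DifferentiableAt 𝕜 (mulChart E G) (oneChart E G, oneChart E G) :=
    (contDiffAt_mulChart_one (𝕜 := 𝕜) oneChart_mem_target).differentiableAt (by simp)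
  have h1 : fderiv 𝕜 (fun a ↦ mulChart E G (a, oneChart E G)) (oneChart E G) =
      ContinuousLinearMap.id 𝕜 E := by
    rw [Filter.EventuallyEq.fderiv_eq (f₁ := _) (f := id), fderiv_id]
    filter_upwards [eventually_mem_target] with a ha
    exact mulChart_oneChart_right ha
  have h2 : fderiv 𝕜 (fun a ↦ mulChart E G (oneChart E G, a)) (oneChart E G) =
      ContinuousLinearMap.id 𝕜 E := leftFrame_oneChart
  have e1 := (HasFDerivAt.comp (f := fun a : E ↦ (a, oneChart E G)) (oneChart E G) hd.hasFDerivAt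
    ((hasFDerivAt_id (𝕜 := 𝕜) (oneChart E G)).prodMk
      (hasFDerivAt_const (oneChart E G) (oneChart E G)))).fderiv
  have e2 := (HasFDerivAt.comp (f := fun a : E ↦ (oneChart E G, a)) (oneChart E G) hd.hasFDerivAt
    ((hasFDerivAt_const (𝕜 := 𝕜) (oneChart E G) (oneChart E G)).prodMk
      (hasFDerivAt_id (oneChart E G)))).fderiv
  have e1' := (DFunLike.congr_fun e1 p.1).symm.trans (DFunLike.congr_fun h1 p.1)
  have e2' := (DFunLike.congr_fun e2 p.2).symm.trans (DFunLike.congr_fun h2 p.2)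
  simp at e1' e2'
  conv_lhs => rw [show p = (p.1, 0) + (0, p.2) by simp]
  rw [map_add, e1', e2']

theorem tder_chart_one_comp {u : M → G} {x : M} (hx : u x = 1)
    (hu : MDifferentiableAt 𝓘(𝕜, N) 𝓘(𝕜, E) u x) :
    tder 𝕜 N E (fun y ↦ chartAt E (1 : G) (u y)) x = tder 𝕜 N E u x := by
  rw [tder_comp_of_eq x hx (contMDiffAt_chart (mem_chart_source E (1 : G))).mdiff hu,
    tder_chart_self, ContinuousLinearMap.id_comp]

theorem mdiff_mul {u v : M → G} {x : M} (hu : MDifferentiableAt 𝓘(𝕜, N) 𝓘(𝕜, E) u x)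
    (hv : MDifferentiableAt 𝓘(𝕜, N) 𝓘(𝕜, E) v x) :
    MDifferentiableAt 𝓘(𝕜, N) 𝓘(𝕜, E) (fun y ↦ u y * v y) x :=
  MDifferentiableAt.comp (I' := 𝓘(𝕜, E).prod 𝓘(𝕜, E)) (g := fun p : G × G ↦ p.1 * p.2) x
    ((contMDiff_mul 𝓘(𝕜, E) ∞).mdifferentiableAt (by simp)) (hu.prodMk hv)

theorem mdiff_inv {u : M → G} {x : M} (hu : MDifferentiableAt 𝓘(𝕜, N) 𝓘(𝕜, E) u x) :
    MDifferentiableAt 𝓘(𝕜, N) 𝓘(𝕜, E) (fun y ↦ (u y)⁻¹) x :=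
  MDifferentiableAt.comp (g := fun p : G ↦ p⁻¹) x
    ((contMDiff_inv 𝓘(𝕜, E) ∞).mdifferentiableAt (by simp)) hu

theorem tder_mul_of_eq_one {u v : M → G} {x : M} (hx : u x = 1) (hx' : v x = 1)
    (hu : MDifferentiableAt 𝓘(𝕜, N) 𝓘(𝕜, E) u x) (hv : MDifferentiableAt 𝓘(𝕜, N) 𝓘(𝕜, E) v x) :
    tder 𝕜 N E (fun y ↦ u y * v y) x = tder 𝕜 N E u x + tder 𝕜 N E v x := by
  have hc : MDifferentiableAt 𝓘(𝕜, E) 𝓘(𝕜, E) (chartAt E (1 : G)) 1 :=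
    (contMDiffAt_chart (mem_chart_source E (1 : G))).mdiff
  have hcu : MDifferentiableAt 𝓘(𝕜, N) 𝓘(𝕜, E) (fun y ↦ chartAt E (1 : G) (u y)) x :=
    MDifferentiableAt.comp x (by rwa [hx]) hu
  have hcv : MDifferentiableAt 𝓘(𝕜, N) 𝓘(𝕜, E) (fun y ↦ chartAt E (1 : G) (v y)) x :=
    MDifferentiableAt.comp x (by rwa [hx']) hv
  rw [← tder_chart_one_comp (by simp [hx, hx']) (mdiff_mul hu hv)]
  have hn : ∀ {w : M → G}, w x = 1 → MDifferentiableAt 𝓘(𝕜, N) 𝓘(𝕜, E) w x →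
      ∀ᶠ y in 𝓝 x, w y ∈ (chartAt E (1 : G)).source := fun {w} hw1 hw ↦
    hw.continuousAt.eventually_mem
      ((chartAt E (1 : G)).open_source.mem_nhds (by rw [hw1]; exact mem_chart_source E 1))
  have e : (fun y ↦ chartAt E (1 : G) (u y * v y)) =ᶠ[𝓝 x]
      fun y ↦ mulChart E G (chartAt E (1 : G) (u y), chartAt E (1 : G) (v y)) := by
    filter_upwards [hn hx hu, hn hx' hv] with y h1 h2
    simp [mulChart, (chartAt E (1 : G)).left_inv h1, (chartAt E (1 : G)).left_inv h2]
  have hd : DifferentiableAt 𝕜 (mulChart E G) (oneChart E G, oneChart E G) :=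
    (contDiffAt_mulChart_one (𝕜 := 𝕜) oneChart_mem_target).differentiableAt (by simp)
  have hp : MDifferentiableAt 𝓘(𝕜, N) 𝓘(𝕜, E × E)
      (fun y ↦ (chartAt E (1 : G) (u y), chartAt E (1 : G) (v y))) x := hcu.prodMk_space hcv
  rw [tder_congr e, tder_comp_of_eq (y := (oneChart E G, oneChart E G)) x
    (by simp [hx, hx', oneChart]) hd.mdifferentiableAt hp, tder_eq_fderiv,
    ← tder_chart_one_comp hx hu, ← tder_chart_one_comp hx' hv]
  ext w
  rw [ContinuousLinearMap.comp_apply, fderiv_mulChart_one]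
  have : tder 𝕜 N (E × E) (fun y ↦ (chartAt E (1 : G) (u y), chartAt E (1 : G) (v y))) x =
      (tder 𝕜 N E (fun y ↦ chartAt E (1 : G) (u y)) x).prod
        (tder 𝕜 N E (fun y ↦ chartAt E (1 : G) (v y)) x) := by
    have h1 := tder_comp (g := fun p : E × E ↦ p.1) x differentiableAt_fst.mdifferentiableAt hp
    have h2 := tder_comp (g := fun p : E × E ↦ p.2) x differentiableAt_snd.mdifferentiableAt hp
    rw [tder_eq_fderiv, fderiv_fst] at h1
    rw [tder_eq_fderiv, fderiv_snd] at h2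
    ext w
    · rw [h1]; rfl
    · rw [h2]; rfl
  rw [this]
  rfl

/-- After left translation by the inverse of the value at `x`, the product is `(t(x)⁻¹ s(x)⁻¹ s(y)
t(x)) · (t(x)⁻¹ t(y))`. Both factors are `1` at `y = x`, where derivatives of products add up. -/
theorem mc_mul {s t : M → G} {x : M} (hs : MDifferentiableAt 𝓘(𝕜, N) 𝓘(𝕜, E) s x)
    (ht : MDifferentiableAt 𝓘(𝕜, N) 𝓘(𝕜, E) t x) :
    mc 𝕜 E N (fun y ↦ s y * t y) x = (adj 𝕜 E (t x)⁻¹).comp (mc 𝕜 E N s x) + mc 𝕜 E N t x := by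
  rw [← mc_mul_const hs]
  simp only [mc]
  rw [← tder_mul_of_eq_one (by group) (by simp) _ (mdiff_div ht _)]
  · congr 1
    funext y
    group
  · exact mdiff_div (mdiff_mul hs mdifferentiableAt_const) _

theorem adj_mul (g h : G) : adj 𝕜 E (g * h) = (adj 𝕜 E g).comp (adj 𝕜 E h) := by
  rw [adj, adj, adj, ← tder_comp_of_eq (f := fun x : G ↦ h * x * h⁻¹) 1 (by simp)
    (mdiff_conj g 1) (mdiff_conj h 1)]
  congr 1
  funext y
  group

theorem adj_one : adj 𝕜 E (1 : G) = ContinuousLinearMap.id 𝕜 E := by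
  simp only [adj, one_mul, inv_one, mul_one]
  exact tder_id _

@[simp] theorem adj_inv_adj (g : G) (v : E) : adj 𝕜 E g⁻¹ (adj 𝕜 E g v) = v := by
  rw [← ContinuousLinearMap.comp_apply, ← adj_mul, inv_mul_cancel, adj_one]; rfl

@[simp] theorem adj_adj_inv (g : G) (v : E) : adj 𝕜 E g (adj 𝕜 E g⁻¹ v) = v := by
  rw [← ContinuousLinearMap.comp_apply, ← adj_mul, mul_inv_cancel, adj_one]; rfl

/-- The product rule for the constant map `s · s⁻¹`. -/
theorem mc_inv {s : M → G} {x : M} (hs : MDifferentiableAt 𝓘(𝕜, N) 𝓘(𝕜, E) s x) :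
    mc 𝕜 E N (fun y ↦ (s y)⁻¹) x = -(adj 𝕜 E (s x)).comp (mc 𝕜 E N s x) := by
  have h := mc_mul hs (mdiff_inv hs)
  simp only [mul_inv_cancel, mc_const, inv_inv] at h
  rw [eq_neg_iff_add_eq_zero, add_comm]
  exact h.symm

theorem tder_eq_comp_mc {s : M → G} {x : M} (hs : MDifferentiableAt 𝓘(𝕜, N) 𝓘(𝕜, E) s x) :
    tder 𝕜 N E s x = (tder 𝕜 E E (fun y : G ↦ s x * y) 1).comp (mc 𝕜 E N s x) := by
  rw [mc, ← tder_comp_of_eq x (by simp) (contMDiffAt_mul_left).mdiff (mdiff_div hs _)]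
  simp

/-- The map in the preferred chart around `1`, after translating the value at `x` to `1`. -/
def localLog (E : Type*) [NormedAddCommGroup E] {G : Type*} [TopologicalSpace G]
    [ChartedSpace E G] [Group G] {M : Type*} (s : M → G) (x y : M) : E :=
  chartAt E (1 : G) ((s x)⁻¹ * s y)

theorem contMDiffAt_div {s : M → G} {y : M} (hs : ContMDiffAt 𝓘(𝕜, N) 𝓘(𝕜, E) ∞ s y) (g : G) :
    ContMDiffAt 𝓘(𝕜, N) 𝓘(𝕜, E) ∞ (fun y ↦ g * s y) y :=
  contMDiffAt_const.mul hs

theorem localLog_self (s : M → G) (x : M) : localLog E s x x = oneChart E G := by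
  simp [localLog, oneChart]

theorem contMDiffAt_localLog {s : M → G} {x y : M} (hs : ContMDiffAt 𝓘(𝕜, N) 𝓘(𝕜, E) ∞ s y)
    (hy : (s x)⁻¹ * s y ∈ (chartAt E (1 : G)).source) :
    ContMDiffAt 𝓘(𝕜, N) 𝓘(𝕜, E) ∞ (localLog E s x) y :=
  ContMDiffAt.comp y (contMDiffAt_chart hy) (contMDiffAt_div hs _)

theorem eventually_div_mem_source {s : M → G} {x : M}
    (hs : MDifferentiableAt 𝓘(𝕜, N) 𝓘(𝕜, E) s x) :
    ∀ᶠ y in 𝓝 x, (s x)⁻¹ * s y ∈ (chartAt E (1 : G)).source :=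
  (mdiff_div hs (s x)⁻¹).continuousAt.eventually_mem
    ((chartAt E (1 : G)).open_source.mem_nhds (by simp [mem_chart_source]))

/-- Away from the base point the Maurer-Cartan form is not the derivative of the chart expression;
the left invariant frame is the correction. This turns `s⁻¹ds = α` into a differential equation in a
vector space. -/
theorem leftFrame_comp_mc {s : M → G} {x y : M} (hs : MDifferentiableAt 𝓘(𝕜, N) 𝓘(𝕜, E) s y)
    (hy : (s x)⁻¹ * s y ∈ (chartAt E (1 : G)).source) :
    (leftFrame 𝕜 E G (localLog E s x y)).comp (mc 𝕜 E N s y) =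
      tder 𝕜 N E (localLog E s x) y := by
  have ht : localLog E s x y ∈ (chartAt E (1 : G)).target := (chartAt E (1 : G)).map_source hy
  rw [leftFrame_eq_tder ht, mc, ← tder_comp_of_eq y (by simp) _ (mdiff_div hs _)]
  · congr 1
    funext y'
    simp only [localLog, (chartAt E (1 : G)).left_inv hy]
    congr 1
    group
  · refine ContMDiffAt.mdiff (𝕜 := 𝕜) ?_
    refine ContMDiffAt.comp 1 (contMDiffAt_chart ?_) contMDiffAt_mul_left
    simpa using (chartAt E (1 : G)).map_target ht

end MaurerCartan

/-! ### The Maurer-Cartan equation; homomorphisms and brackets -/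

section MaurerCartanEquation


variable {𝕜 : Type*} [RCLike 𝕜] {E : Type*} [NormedAddCommGroup E] [NormedSpace 𝕜 E]
  {G : Type*} [TopologicalSpace G] [ChartedSpace E G] [Group G] [LieGroup 𝓘(𝕜, E) ∞ G]
  {N : Type*} [NormedAddCommGroup N] [NormedSpace 𝕜 N]
  {M : Type*} [TopologicalSpace M] [ChartedSpace N M]

theorem mc_self_eq (s : M → G) (x : M) (hs : MDifferentiableAt 𝓘(𝕜, N) 𝓘(𝕜, E) s x) :
    mc 𝕜 E N s x = tder 𝕜 N E (localLog E s x) x := by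
  have := leftFrame_comp_mc (x := x) (y := x) hs (by simp [mem_chart_source])
  rwa [localLog_self, leftFrame_oneChart, ContinuousLinearMap.id_comp] at this

theorem contDiffAt_localLog {s : N → G} {x : N} (hs : ContMDiffAt 𝓘(𝕜, N) 𝓘(𝕜, E) ∞ s x) :
    ContDiffAt 𝕜 ∞ (localLog E s x) x :=
  (contMDiffAt_localLog hs (by simp [mem_chart_source])).contDiffAt

theorem isInvertible_leftFrame_one [CompleteSpace E] :
    ∀ᶠ a in 𝓝 (oneChart E G), (leftFrame 𝕜 E G a).IsInvertible := by
  have h : ContinuousAt (leftFrame 𝕜 E G) (oneChart E G) :=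
    (contDiffAt_leftFrame (𝕜 := 𝕜) oneChart_mem_target).continuousAt
  have h' := ContinuousLinearEquiv.nhds (ContinuousLinearEquiv.refl 𝕜 E)
  refine h.eventually ?_
  rw [leftFrame_oneChart]
  exact h'

/-- Near `x` the frame is invertible, so the form is the inverse frame applied to the derivative of
`localLog`; inversion of operators on a Banach space is smooth. -/
theorem contDiffAt_mc [CompleteSpace E] {s : N → G} {x : N}
    (hs : ∀ᶠ y in 𝓝 x, ContMDiffAt 𝓘(𝕜, N) 𝓘(𝕜, E) ∞ s y) :
    ContDiffAt 𝕜 ∞ (fun y ↦ mc 𝕜 E N s y) x := by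
  have hsx := hs.self_of_nhds
  have hl := contDiffAt_localLog hsx
  have hc : Tendsto (localLog E s x) (𝓝 x) (𝓝 (oneChart E G)) := by
    have := hl.continuousAt.tendsto
    rwa [localLog_self] at this
  have e : (fun y ↦ mc 𝕜 E N s y) =ᶠ[𝓝 x]
      fun y ↦ ((leftFrame 𝕜 E G (localLog E s x y)).inverse).comp (fderiv 𝕜 (localLog E s x) y) := by
    filter_upwards [hs, eventually_div_mem_source hsx.mdiff,
      hc.eventually (isInvertible_leftFrame_one (𝕜 := 𝕜))] with y h1 h2 h3
    have := leftFrame_comp_mc h1.mdiff h2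
    rw [tder_eq_fderiv] at this
    rw [← this, ← ContinuousLinearMap.comp_assoc]
    rw [h3.inverse_comp_self]
    rfl
  refine ContDiffAt.congr_of_eventuallyEq ?_ e
  refine ContDiffAt.clm_comp ?_ (hl.fderiv_right (m := ∞) (by simp))
  have h1 : ContDiffAt 𝕜 ∞ (leftFrame 𝕜 E G) (localLog E s x x) := by
    rw [localLog_self]; exact contDiffAt_leftFrame (𝕜 := 𝕜) oneChart_mem_target
  have h2 : ContDiffAt 𝕜 ∞ ContinuousLinearMap.inverse (leftFrame 𝕜 E G (localLog E s x x)) := by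
    rw [localLog_self, leftFrame_oneChart]
    exact contDiffAt_map_inverse (ContinuousLinearEquiv.refl 𝕜 E)
  exact h2.comp x (h1.comp x hl)

theorem eventually_leftFrame_mc {s : N → G} {x : N}
    (hs : ∀ᶠ y in 𝓝 x, ContMDiffAt 𝓘(𝕜, N) 𝓘(𝕜, E) ∞ s y) (v : N) :
    (fun y ↦ leftFrame 𝕜 E G (localLog E s x y) (mc 𝕜 E N s y v)) =ᶠ[𝓝 x]
      fun y ↦ fderiv 𝕜 (localLog E s x) y v := by
  filter_upwards [hs, eventually_div_mem_source hs.self_of_nhds.mdiff] with y h1 h2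
  rw [← tder_eq_fderiv, ← leftFrame_comp_mc h1.mdiff h2]
  rfl

/-- The derivative of `a ↦ leftFrame a w` at `1`, in the direction `v`. -/
def frameDeriv (𝕜 E G : Type*) [RCLike 𝕜] [NormedAddCommGroup E] [NormedSpace 𝕜 E]
    [TopologicalSpace G] [ChartedSpace E G] [Group G] (v w : E) : E :=
  fderiv 𝕜 (leftFrame 𝕜 E G) (oneChart E G) v w

theorem differentiableAt_leftFrame :
    DifferentiableAt 𝕜 (leftFrame 𝕜 E G) (oneChart E G) :=
  (contDiffAt_leftFrame oneChart_mem_target).differentiableAt (by simp)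

/-- The Lie bracket of a Lie group, on the model space. -/
def lieB (𝕜 : Type*) [RCLike 𝕜] {E : Type*} [NormedAddCommGroup E] [NormedSpace 𝕜 E]
    (G : Type*) [TopologicalSpace G] [ChartedSpace E G] [Group G] (v w : E) : E :=
  Bracket.bracket (L := GroupLieAlgebra 𝓘(𝕜, E) G) (M := GroupLieAlgebra 𝓘(𝕜, E) G) v w

theorem lieB_eq_frameDeriv (v w : E) :
    lieB 𝕜 G v w = frameDeriv 𝕜 E G v w - frameDeriv 𝕜 E G w v := by
  have h : ∀ w v : E, fderiv 𝕜 (fun a ↦ leftFrame 𝕜 E G a w) (oneChart E G) v =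
      frameDeriv 𝕜 E G v w := by
    intro w v
    rw [fderiv_clm_apply differentiableAt_leftFrame (differentiableAt_const w)]
    simp [frameDeriv]
  exact (groupLieAlgebra_bracket_eq (𝕜 := 𝕜) (G := G) v w).trans <| congrArg₂ (· - ·) (h w v) (h v w)

/-- This is the derivative at `x` of the identity `leftFrame ∘ mc = D localLog`, by the product
rule; the frame is the identity at `1`. -/
theorem fderiv_fderiv_localLog [CompleteSpace E] {s : N → G} {x : N}
    (hs : ∀ᶠ y in 𝓝 x, ContMDiffAt 𝓘(𝕜, N) 𝓘(𝕜, E) ∞ s y) (u v : N) :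
    fderiv 𝕜 (fderiv 𝕜 (localLog E s x)) x u v =
      frameDeriv 𝕜 E G (mc 𝕜 E N s x u) (mc 𝕜 E N s x v) +
        fderiv 𝕜 (fun y ↦ mc 𝕜 E N s y) x u v := by
  have hsx := hs.self_of_nhds
  have hl := contDiffAt_localLog hsx
  have hα : DifferentiableAt 𝕜 (fun y ↦ mc 𝕜 E N s y) x :=
    (contDiffAt_mc hs).differentiableAt (by simp)
  have hf : DifferentiableAt 𝕜 (fderiv 𝕜 (localLog E s x)) x :=
    (hl.fderiv_right (m := ∞) (by simp)).differentiableAt (by simp)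
  have hL : DifferentiableAt 𝕜 (leftFrame 𝕜 E G) (localLog E s x x) := by
    rw [localLog_self]; exact differentiableAt_leftFrame (𝕜 := 𝕜)
  have hL' : DifferentiableAt 𝕜 (fun y ↦ leftFrame 𝕜 E G (localLog E s x y)) x :=
    hL.comp x (hl.differentiableAt (by simp))
  have e := (eventually_leftFrame_mc hs v).fderiv_eq (𝕜 := 𝕜)
  have e1 : fderiv 𝕜 (fun y ↦ fderiv 𝕜 (localLog E s x) y v) x u =
      fderiv 𝕜 (fderiv 𝕜 (localLog E s x)) x u v := by
    rw [fderiv_clm_apply hf (differentiableAt_const v)]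
    simp
  have e2 : fderiv 𝕜 (fun y ↦ mc 𝕜 E N s y v) x u =
      fderiv 𝕜 (fun y ↦ mc 𝕜 E N s y) x u v := by
    rw [fderiv_clm_apply hα (differentiableAt_const v)]
    simp
  have hαv : DifferentiableAt 𝕜 (fun y ↦ mc 𝕜 E N s y v) x :=
    hα.clm_apply (differentiableAt_const v)
  have e3 : fderiv 𝕜 (fun y ↦ leftFrame 𝕜 E G (localLog E s x y)) x =
      (fderiv 𝕜 (leftFrame 𝕜 E G) (oneChart E G)).comp (fderiv 𝕜 (localLog E s x) x) := by
    have := fderiv_comp (𝕜 := 𝕜) x hL (hl.differentiableAt (by simp))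
    rw [localLog_self] at this
    exact this
  rw [← e1, ← e, fderiv_clm_apply hL' hαv, e3, ← e2, localLog_self, leftFrame_oneChart,
    mc_self_eq s x hsx.mdiff, tder_eq_fderiv]
  simp [frameDeriv, add_comm]

/-- The Maurer-Cartan equation. -/
theorem fderiv_mc_sub [CompleteSpace E] {s : N → G} {x : N}
    (hs : ∀ᶠ y in 𝓝 x, ContMDiffAt 𝓘(𝕜, N) 𝓘(𝕜, E) ∞ s y) (u v : N) :
    fderiv 𝕜 (fun y ↦ mc 𝕜 E N s y) x u v - fderiv 𝕜 (fun y ↦ mc 𝕜 E N s y) x v u +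
      lieB 𝕜 G (mc 𝕜 E N s x u) (mc 𝕜 E N s x v) = 0 := by
  have h1 := fderiv_fderiv_localLog hs u v
  have h2 := fderiv_fderiv_localLog hs v u
  -- The left side of `fderiv_fderiv_localLog` is symmetric, so antisymmetrising the right side
  -- leaves the exterior derivative of the form plus the bracket.
  have h3 : fderiv 𝕜 (fderiv 𝕜 (localLog E s x)) x u v =
      fderiv 𝕜 (fderiv 𝕜 (localLog E s x)) x v u :=
    ((contDiffAt_localLog hs.self_of_nhds).isSymmSndFDerivAt (by simp; exact WithTop.coe_le_coe.mpr le_top)) u v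
  have h4 := lieB_eq_frameDeriv (𝕜 := 𝕜) (G := G) (mc 𝕜 E N s x u) (mc 𝕜 E N s x v)
  rw [h3, h2] at h1
  rw [h4, ← sub_eq_zero.mpr h1.symm]
  abel

variable {E' G' : Type*} [NormedAddCommGroup E'] [NormedSpace 𝕜 E']
  [TopologicalSpace G'] [ChartedSpace E' G'] [Group G'] [LieGroup 𝓘(𝕜, E') ∞ G']

/-- The differential of a homomorphism of Lie groups is a homomorphism of Lie algebras. -/
theorem tder_one_bracket [CompleteSpace E] [CompleteSpace E'] {j : G → G'}
    (hj : ∀ a b, j (a * b) = j a * j b)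
    (hj' : ∀ᶠ a in 𝓝 1, ContMDiffAt 𝓘(𝕜, E) 𝓘(𝕜, E') ∞ j a) (v w : E) :
    tder 𝕜 E E' j 1 (lieB 𝕜 G v w) = lieB 𝕜 G' (tder 𝕜 E E' j 1 v) (tder 𝕜 E E' j 1 w) := by
  -- apply the Maurer-Cartan equation to the inverse of the chart and to its image under `j`
  let s : E → G := (chartAt E (1 : G)).symm
  have hs : ∀ᶠ a in 𝓝 (oneChart E G), ContMDiffAt 𝓘(𝕜, E) 𝓘(𝕜, E) ∞ s a := by
    filter_upwards [eventually_mem_target] with a ha using contMDiffAt_chart_symm ha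
  have hjs : ∀ᶠ a in 𝓝 (oneChart E G), ContMDiffAt 𝓘(𝕜, E) 𝓘(𝕜, E') ∞ (fun a ↦ j (s a)) a := by
    have hc : Tendsto s (𝓝 (oneChart E G)) (𝓝 1) := by
      have := hs.self_of_nhds.continuousAt.tendsto
      rwa [show s (oneChart E G) = 1 from symm_oneChart] at this
    filter_upwards [hs, hc.eventually hj'] with a h1 h2 using h2.comp a h1
  have hm : mc 𝕜 E E s (oneChart E G) = ContinuousLinearMap.id 𝕜 E := by
    rw [mc_self_eq _ _ hs.self_of_nhds.mdiff, ← tder_id (M := E)]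
    refine tder_congr ?_
    filter_upwards [eventually_mem_target] with a ha
    simp [localLog, s, (chartAt E (1 : G)).right_inv ha]
  have e : (fun a ↦ mc 𝕜 E' E (fun a ↦ j (s a)) a) =ᶠ[𝓝 (oneChart E G)]
      fun a ↦ (tder 𝕜 E E' j 1).comp (mc 𝕜 E E s a) := by
    filter_upwards [hs] with a ha
    exact mc_hom_comp hj hj'.self_of_nhds.mdiff ha.mdiff
  have h1 := fderiv_mc_sub hs v w
  have h2 := fderiv_mc_sub hjs v w
  have hα : DifferentiableAt 𝕜 (fun y ↦ mc 𝕜 E E s y) (oneChart E G) :=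
    (contDiffAt_mc hs).differentiableAt (by simp)
  have e3 : ∀ u w, fderiv 𝕜 (fun a ↦ mc 𝕜 E' E (fun a ↦ j (s a)) a) (oneChart E G) u w =
      tder 𝕜 E E' j 1 (fderiv 𝕜 (fun a ↦ mc 𝕜 E E s a) (oneChart E G) u w) := by
    intro u w
    rw [e.fderiv_eq, fderiv_clm_comp (differentiableAt_const _) hα]
    simp
  have e4 : mc 𝕜 E' E (fun a ↦ j (s a)) (oneChart E G) = tder 𝕜 E E' j 1 := by
    have := e.self_of_nhds; beta_reduce at this; rw [this, hm]; rfl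
  rw [e3, e3, e4, ← map_sub] at h2
  rw [hm] at h1
  have h1' := congrArg (tder 𝕜 E E' j 1) h1
  rw [map_zero] at h1'
  rw [map_add] at h1'
  exact add_left_cancel (h1'.trans h2.symm)

theorem adj_bracket [CompleteSpace E] (g : G) (v w : E) :
    adj 𝕜 E g (lieB 𝕜 G v w) = lieB 𝕜 G (adj 𝕜 E g v) (adj 𝕜 E g w) :=
  tder_one_bracket (j := fun x : G ↦ g * x * g⁻¹) (fun a b ↦ by group)
    (Eventually.of_forall fun a ↦
      (contMDiffAt_const.mul contMDiffAt_id).mul contMDiffAt_const) v w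

end MaurerCartanEquation

/-! ### Maps into a Lie group with equal Maurer-Cartan forms -/

section LocallyConstant


variable {E : Type*} [NormedAddCommGroup E] [NormedSpace ℝ E]
  {G : Type*} [TopologicalSpace G] [ChartedSpace E G] [Group G] [LieGroup 𝓘(ℝ, E) ∞ G]
  {N : Type*} [NormedAddCommGroup N] [NormedSpace ℝ N]
  {M : Type*} [TopologicalSpace M] [ChartedSpace N M] [IsManifold 𝓘(ℝ, N) ∞ M]

theorem eventually_eq_of_fderiv_eq_zero {f : N → E} {x : N}
    (hf : ∀ᶠ y in 𝓝 x, DifferentiableAt ℝ f y) (hf' : ∀ᶠ y in 𝓝 x, fderiv ℝ f y = 0) :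
    ∀ᶠ y in 𝓝 x, f y = f x := by
  obtain ⟨ε, hε, h⟩ := Metric.eventually_nhds_iff_ball.mp (hf.and hf')
  filter_upwards [Metric.ball_mem_nhds x hε] with y hy
  refine (convex_ball x ε).is_const_of_fderivWithin_eq_zero (𝕜 := ℝ)
    (fun z hz ↦ (h z hz).1.differentiableWithinAt) (fun z hz ↦ ?_) hy (Metric.mem_ball_self hε)
  rw [(h z hz).1.fderivWithin (Metric.isOpen_ball.uniqueDiffWithinAt hz), (h z hz).2]

theorem eventually_eq_of_mc_eq_zero {s : M → G} {x : M}
    (hs : ∀ᶠ y in 𝓝 x, ContMDiffAt 𝓘(ℝ, N) 𝓘(ℝ, E) ∞ s y)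
    (h0 : ∀ᶠ y in 𝓝 x, mc ℝ E N s y = 0) : ∀ᶠ y in 𝓝 x, s y = s x := by
  let c := chartAt N x
  have hcx : c.symm (c x) = x := c.left_inv (mem_chart_source N x)
  have hc : Tendsto c.symm (𝓝 (c x)) (𝓝 x) := by
    have := (c.continuousAt_symm (mem_chart_target N x)).tendsto
    rwa [hcx] at this
  let f : N → E := fun y ↦ localLog E s x (c.symm y)
  have hd : ∀ᶠ y in 𝓝 (c x), DifferentiableAt ℝ f y ∧ fderiv ℝ f y = 0 := by
    filter_upwards [hc.eventually hs, hc.eventually h0,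
      hc.eventually (eventually_div_mem_source (𝕜 := ℝ) (N := N) (s := s) (x := x) (hs.self_of_nhds).mdiff),
      c.open_target.mem_nhds (mem_chart_target N x)] with y h1 h2 h3 h4
    have hl := contMDiffAt_localLog h1 h3
    have hcs : ContMDiffAt 𝓘(ℝ, N) 𝓘(ℝ, N) ∞ c.symm y := contMDiffAt_chart_symm h4
    refine ⟨(hl.comp y hcs).contDiffAt.differentiableAt (by simp), ?_⟩
    have h5 := leftFrame_comp_mc h1.mdiff h3
    rw [← tder_eq_fderiv, tder_comp y hl.mdiff hcs.mdiff, ← h5, h2]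
    simp
  have := eventually_eq_of_fderiv_eq_zero (hd.mono fun _ h ↦ h.1) (hd.mono fun _ h ↦ h.2)
  have hcc : Tendsto c (𝓝 x) (𝓝 (c x)) := (c.continuousAt (mem_chart_source N x)).tendsto
  filter_upwards [hcc.eventually this, c.open_source.mem_nhds (mem_chart_source N x),
    eventually_div_mem_source hs.self_of_nhds.mdiff] with y h1 h2 h3
  simp only [f, c.left_inv h2, hcx, localLog_self] at h1
  have h4 := congrArg (chartAt E (1 : G)).symm h1
  rw [localLog, (chartAt E (1 : G)).left_inv h3, symm_oneChart] at h4
  exact (inv_mul_eq_one.mp h4).symm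

/-- The form of `s t⁻¹` is `Ad(t)` applied to the difference of the forms of `s` and `t`, so it
vanishes. -/
theorem eventually_eq_of_mc_eq {s t : M → G} {x : M}
    (hs : ∀ᶠ y in 𝓝 x, ContMDiffAt 𝓘(ℝ, N) 𝓘(ℝ, E) ∞ s y)
    (ht : ∀ᶠ y in 𝓝 x, ContMDiffAt 𝓘(ℝ, N) 𝓘(ℝ, E) ∞ t y)
    (h : ∀ᶠ y in 𝓝 x, mc ℝ E N s y = mc ℝ E N t y) :
    ∀ᶠ y in 𝓝 x, s y * (t y)⁻¹ = s x * (t x)⁻¹ := by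
  refine eventually_eq_of_mc_eq_zero (N := N) (E := E) (s := fun y ↦ s y * (t y)⁻¹) ?_ ?_
  · filter_upwards [hs, ht] with y h1 h2
    exact ContMDiffAt.mul h1 (ContMDiffAt.inv h2)
  · filter_upwards [hs, ht, h] with y h1 h2 h3
    rw [mc_mul h1.mdiff (mdiff_inv h2.mdiff), mc_inv h2.mdiff, inv_inv, h3]
    simp

end LocallyConstant

/-! ### Total differential equations: the local theorem of Frobenius -/

section Frobenius

open Filter Metric Set

variable {E : Type*} [NormedAddCommGroup E] [NormedSpace ℝ E] [CompleteSpace E]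
  {N : Type*} [NormedAddCommGroup N] [NormedSpace ℝ N]

/-- The fixed point of the Picard iteration, together with the fact that it stays in the ball, since
all later estimates hold only there. The time interval has length one, so `L ≤ a` suffices. -/
theorem exists_ode_solution_mem_closedBall {f : ℝ → E → E} {x₀ : E} {a L K : ℝ} (ha : 0 ≤ a)
    (hL : 0 ≤ L) (hK : 0 ≤ K) (hLa : L ≤ a)
    (hf : ∀ t ∈ Icc (0 : ℝ) 1, ∀ x ∈ closedBall x₀ a, ∀ y ∈ closedBall x₀ a,
      ‖f t x - f t y‖ ≤ K * ‖x - y‖)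
    (hc : ∀ x ∈ closedBall x₀ a, ContinuousOn (f · x) (Icc (0 : ℝ) 1))
    (hb : ∀ t ∈ Icc (0 : ℝ) 1, ∀ x ∈ closedBall x₀ a, ‖f t x‖ ≤ L) :
    ∃ α : ℝ → E, α 0 = x₀ ∧ ∀ t ∈ Icc (0 : ℝ) 1, α t ∈ closedBall x₀ a ∧
      HasDerivWithinAt α (f t (α t)) (Icc 0 1) t := by
  lift a to NNReal using ha
  lift L to NNReal using hL
  lift K to NNReal using hK
  have hP : IsPicardLindelof f (tmin := 0) (tmax := 1) ⟨0, by simp⟩ x₀ a 0 L K :=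
    { lipschitzOnWith := fun t ht ↦ LipschitzOnWith.of_dist_le_mul fun x hx y hy ↦ by
        simpa only [dist_eq_norm] using hf t ht x hx y hy
      continuousOn := hc
      norm_le := hb
      mul_max_le := by simpa using hLa }
  obtain ⟨α, hα⟩ := ODE.FunSpace.exists_isFixedPt_next hP (mem_closedBall_self le_rfl)
  refine ⟨α.compProj, ?_, fun t ht ↦ ⟨α.compProj_mem_closedBall hP.mul_max_le, ?_⟩⟩
  · have := ODE.FunSpace.compProj_val (α := α) (t := ⟨0, by simp⟩)
    rw [this, ← hα, ODE.FunSpace.next_apply₀]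
  · apply ODE.hasDerivWithinAt_picard_Icc (t₀ := 0) (by simp) hP.continuousOn_uncurry
      α.continuous_compProj.continuousOn (fun _ ht' ↦ α.compProj_mem_closedBall hP.mul_max_le)
      x₀ ht |>.congr_of_mem _ ht
    intro t' ht'
    nth_rw 1 [← hα]
    rw [ODE.FunSpace.compProj_of_mem ht', ODE.FunSpace.next_apply]

/-- A first order estimate for the dependence on `w` of the solutions of the total differential
equation `dσ = F(y, σ)` along the rays `t ↦ y₀ + t w`. -/
theorem ray_solution_estimate {F : N × E → N →L[ℝ] E} {F' : N × E → N × E →L[ℝ] N →L[ℝ] E}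
    {y₀ : N} {x₀ : E} {R K M r : ℝ} (hK0 : 0 < K) (hM0 : 0 < M) (hr : 0 < r) (hr1 : r ≤ 1)
    (hrR : r ≤ R) (hMr : 4 * M * r ≤ R)
    (hd : ∀ p ∈ closedBall (y₀, x₀) R, HasFDerivAt F (F' p) p)
    (hL : ∀ p ∈ closedBall (y₀, x₀) R, ∀ q ∈ closedBall (y₀, x₀) R, ‖F' p - F' q‖ ≤ K * ‖p - q‖)
    (hK : ∀ p ∈ closedBall (y₀, x₀) R, ‖F' p‖ ≤ K)
    (hM : ∀ p ∈ closedBall (y₀, x₀) R, ‖F p‖ ≤ M)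
    (hI : ∀ p ∈ closedBall (y₀, x₀) R, ∀ u v, F' p (u, F p u) v = F' p (v, F p v) u)
    {w w' : N} (hw : ‖w‖ ≤ r) (hw' : ‖w'‖ ≤ r) {α α' : ℝ → E} (hα0 : α 0 = x₀) (hα'0 : α' 0 = x₀)
    (hα : ∀ t ∈ Icc (0 : ℝ) 1, α t ∈ closedBall x₀ (R / 4) ∧
      HasDerivWithinAt α (F (y₀ + t • w, α t) w) (Icc 0 1) t)
    (hα' : ∀ t ∈ Icc (0 : ℝ) 1, α' t ∈ closedBall x₀ (R / 4) ∧
      HasDerivWithinAt α' (F (y₀ + t • w', α' t) w') (Icc 0 1) t) :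
    ‖α' 1 - α 1 - F (y₀ + w, α 1) (w' - w)‖ ≤
      (K * (1 + M) ^ 2 + K * (1 + M)) * ((Real.exp K - 1) / K) * ‖w' - w‖ ^ 2 := by
  have hR : 0 < R := hr.trans_le hrR
  set v := w' - w with hv
  have hv2 : ‖v‖ ≤ 2 * r := (norm_sub_le _ _).trans (by linarith)
  have mem : ∀ {t : ℝ} {w : N} {x : E}, t ∈ Icc (0 : ℝ) 1 → ‖w‖ ≤ r → x ∈ closedBall x₀ R →
      (y₀ + t • w, x) ∈ closedBall (y₀, x₀) R := by
    intro t w x ht hw hx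
    rw [← closedBall_prod_same]
    refine ⟨?_, hx⟩
    rw [mem_closedBall, dist_eq_norm]
    simp only [add_sub_cancel_left, norm_smul, Real.norm_eq_abs, abs_of_nonneg ht.1]
    calc t * ‖w‖ ≤ 1 * r := by gcongr; exact ht.2
      _ ≤ R := by linarith
  have hsub : closedBall x₀ (R / 4) ⊆ closedBall x₀ R := closedBall_subset_closedBall (by linarith)
  have hlip : ∀ p ∈ closedBall (y₀, x₀) R, ∀ q ∈ closedBall (y₀, x₀) R,
      ‖F q - F p‖ ≤ K * ‖q - p‖ := fun p hp q hq ↦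
    (convex_closedBall _ _).norm_image_sub_le_of_norm_hasFDerivWithin_le
      (fun z hz ↦ (hd z hz).hasFDerivWithinAt) hK hp hq
  -- the approximate solution
  let g : ℝ → E := fun t ↦ α t + t • F (y₀ + t • w, α t) v
  let g' : ℝ → E := fun t ↦ F (y₀ + t • w, α t) w +
    (t • (F' (y₀ + t • w, α t) (w, F (y₀ + t • w, α t) w) v) + (1 : ℝ) • F (y₀ + t • w, α t) v)
  have hg : ∀ t ∈ Icc (0 : ℝ) 1, HasDerivWithinAt g (g' t) (Icc 0 1) t := by
    intro t ht
    have hp : HasDerivWithinAt (fun t ↦ (y₀ + t • w, α t)) (w, F (y₀ + t • w, α t) w)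
        (Icc 0 1) t := by
      refine HasDerivWithinAt.prodMk ?_ (hα t ht).2
      have := ((hasDerivWithinAt_id t (Icc (0 : ℝ) 1)).smul_const w).const_add y₀
      simpa using this
    have h1 := (hd _ (mem ht hw (hsub (hα t ht).1))).comp_hasDerivWithinAt t hp
    have h2 := h1.clm_apply (hasDerivWithinAt_const t (Icc 0 1) v)
    have h3 := (hasDerivWithinAt_id t (Icc (0 : ℝ) 1)).smul h2
    have h4 := (hα t ht).2.add h3
    refine h4.congr_deriv ?_
    simp [g']
  have hgmem : ∀ t ∈ Icc (0 : ℝ) 1, g t ∈ closedBall x₀ R := by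
    intro t ht
    have h1 := (hα t ht).1
    rw [mem_closedBall, dist_eq_norm] at h1 ⊢
    have h2 : ‖t • F (y₀ + t • w, α t) v‖ ≤ M * (2 * r) := by
      rw [norm_smul, Real.norm_eq_abs, abs_of_nonneg ht.1]
      calc t * ‖F (y₀ + t • w, α t) v‖ ≤ 1 * (‖F (y₀ + t • w, α t)‖ * ‖v‖) := by
            gcongr
            · exact ht.2
            · exact ContinuousLinearMap.le_opNorm _ _
        _ ≤ 1 * (M * (2 * r)) := by
            gcongr
            exact hM _ (mem ht hw (hsub (hα t ht).1))
        _ = _ := one_mul _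
    calc ‖g t - x₀‖ = ‖(α t - x₀) + t • F (y₀ + t • w, α t) v‖ := by
          simp only [g]; congr 1; abel
      _ ≤ R / 4 + M * (2 * r) := (norm_add_le _ _).trans (add_le_add h1 h2)
      _ ≤ R := by linarith
  -- The first summand bounds the Taylor remainder of `F`, the second one the term of second order
  -- in `v` that is left over in `key`.
  set C := K * (1 + M) ^ 2 + K * (1 + M) with hC
  have hbound : ∀ t ∈ Icc (0 : ℝ) 1, ‖g' t - F (y₀ + t • w', g t) w'‖ ≤ C * ‖v‖ ^ 2 := by
    intro t ht
    set p : N × E := (y₀ + t • w, α t) with hp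
    have hpm : p ∈ closedBall (y₀, x₀) R := mem ht hw (hsub (hα t ht).1)
    set q : N × E := (y₀ + t • w', g t) with hq
    have hqm : q ∈ closedBall (y₀, x₀) R := mem ht hw' (hgmem t ht)
    have hqp : q - p = t • (v, F p v) := by
      rw [hq, hp, Prod.mk_sub_mk, Prod.smul_mk]
      congr 1
      · rw [hv, smul_sub]; abel
      · simp only [g]; rw [add_sub_cancel_left]
    have hnv : ‖(v, F p v)‖ ≤ (1 + M) * ‖v‖ := by
      rw [Prod.norm_def]
      have := (F p).le_opNorm v
      have h2 := mul_le_mul_of_nonneg_right (hM p hpm) (norm_nonneg v)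
      have := norm_nonneg v
      apply max_le <;> nlinarith
    have hnqp : ‖q - p‖ ≤ (1 + M) * ‖v‖ := by
      rw [hqp, norm_smul, Real.norm_eq_abs, abs_of_nonneg ht.1]
      calc t * ‖(v, F p v)‖ ≤ 1 * ‖(v, F p v)‖ := by gcongr; exact ht.2
        _ ≤ _ := by rw [one_mul]; exact hnv
    have hrem : ‖F q - F p - F' p (q - p)‖ ≤ K * ‖q - p‖ * ‖q - p‖ := by
      refine Convex.norm_image_sub_le_of_norm_hasFDerivWithin_le' (f' := F') (s := segment ℝ p q)
        (fun z hz ↦ (hd z ((convex_closedBall _ _).segment_subset hpm hqm hz)).hasFDerivWithinAt)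
        (fun z hz ↦ ?_) (convex_segment _ _) (left_mem_segment _ _ _) (right_mem_segment _ _ _)
      refine (hL z ((convex_closedBall _ _).segment_subset hpm hqm hz) p hpm).trans ?_
      gcongr
      exact norm_sub_le_of_mem_segment hz
    have hw'v : w' = w + v := by rw [hv]; abel
    -- Integrability exchanges `w` and `v` in the derivative of `F`. The terms of first order in `v`
    -- then cancel, and the defect of the approximate solution is quadratic in `v`.
    have key : g' t - F q w' = -(F q - F p - F' p (q - p)) w' - t • F' p (v, F p v) v := by
      have h1 : F' p (q - p) = t • F' p (v, F p v) := by rw [hqp, map_smul]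
      simp only [g', h1, sub_apply, smul_apply]
      rw [hI p hpm w v, hw'v]
      simp only [map_add, one_smul, smul_add]
      abel
    rw [key]
    refine (norm_sub_le _ _).trans ?_
    have h1 : ‖-(F q - F p - F' p (q - p)) w'‖ ≤ K * (1 + M) ^ 2 * ‖v‖ ^ 2 := by
      rw [norm_neg]
      refine (ContinuousLinearMap.le_opNorm _ _).trans ?_
      calc ‖F q - F p - F' p (q - p)‖ * ‖w'‖ ≤ (K * ‖q - p‖ * ‖q - p‖) * 1 := by
            gcongr
            linarith
        _ ≤ (K * ((1 + M) * ‖v‖) * ((1 + M) * ‖v‖)) * 1 := by gcongr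
        _ = _ := by ring
    have h2 : ‖t • F' p (v, F p v) v‖ ≤ K * (1 + M) * ‖v‖ ^ 2 := by
      rw [norm_smul, Real.norm_eq_abs, abs_of_nonneg ht.1]
      calc t * ‖F' p (v, F p v) v‖ ≤ 1 * (‖F' p‖ * ‖(v, F p v)‖ * ‖v‖) := by
            gcongr
            · exact ht.2
            · exact ContinuousLinearMap.le_opNorm₂ _ _ _
        _ ≤ 1 * (K * ((1 + M) * ‖v‖) * ‖v‖) := by
            gcongr
            exact hK p hpm
        _ = _ := by ring
    calc _ ≤ _ := add_le_add h1 h2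
      _ = _ := by rw [hC]; ring
  have hmono : ∀ t ∈ Ico (0 : ℝ) 1, ∀ {f : ℝ → E} {f' : E}, HasDerivWithinAt f f' (Icc 0 1) t →
      HasDerivWithinAt f f' (Ici t) t := by
    intro t ht f f' h
    have h2 : HasDerivWithinAt f f' (Icc t 1) t := h.mono (Icc_subset_Icc_left ht.1)
    exact h2.mono_of_mem_nhdsWithin (Icc_mem_nhdsGE ht.2)
  have hK' : (K.toNNReal : ℝ) = K := Real.coe_toNNReal K hK0.le
  -- Grönwall compares the exact solution `α'` with `g`, which has the same initial value and defect
  -- at most `C ‖v‖²`. At time one this is the claim.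
  have hgron := dist_le_of_approx_trajectories_ODE_of_mem (a := 0) (b := 1) (δ := 0)
    (v := fun t x ↦ F (y₀ + t • w', x) w') (K := K.toNNReal) (s := fun _ ↦ closedBall x₀ R)
    (f := g) (g := α') (f' := g') (g' := fun t ↦ F (y₀ + t • w', α' t) w')
    (εf := C * ‖v‖ ^ 2) (εg := 0)
    (fun t ht ↦ LipschitzOnWith.of_dist_le_mul fun x hx y hy ↦ by
      have hxm := mem (Ico_subset_Icc_self ht) hw' hx
      have hym := mem (Ico_subset_Icc_self ht) hw' hy
      rw [dist_eq_norm, dist_eq_norm, ← sub_apply]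
      refine (ContinuousLinearMap.le_opNorm _ _).trans ?_
      calc _ ≤ (K * ‖((y₀ + t • w', x) : N × E) - (y₀ + t • w', y)‖) * 1 := by
            gcongr
            · exact hlip _ hym _ hxm
            · linarith
        _ = _ := by simp [Prod.norm_def, hK'])
    (fun t ht ↦ (hg t ht).continuousWithinAt)
    (fun t ht ↦ hmono t ht (hg t (Ico_subset_Icc_self ht)))
    (fun t ht ↦ by rw [dist_eq_norm]; exact hbound t (Ico_subset_Icc_self ht))
    (fun t ht ↦ hgmem t (Ico_subset_Icc_self ht))
    (fun t ht ↦ (hα' t ht).2.continuousWithinAt)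
    (fun t ht ↦ hmono t ht (hα' t (Ico_subset_Icc_self ht)).2)
    (fun t ht ↦ by rw [dist_self])
    (fun t ht ↦ hsub (hα' t (Ico_subset_Icc_self ht)).1)
    (by simp [g, hα0, hα'0]) 1 (by simp)
  rw [hK', gronwallBound_of_K_ne_0 hK0.ne', dist_comm, dist_eq_norm] at hgron
  simp only [g, one_smul, sub_zero, mul_one, zero_mul, zero_add, add_zero] at hgron
  rw [← sub_sub] at hgron
  refine hgron.trans (le_of_eq ?_)
  ring

/-- The local theorem of Frobenius for total differential equations. -/
theorem exists_total_differential_solution {F : N × E → N →L[ℝ] E} {y₀ : N} {x₀ : E}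
    (hF : ∀ᶠ p in 𝓝 (y₀, x₀), ContDiffAt ℝ ∞ F p)
    (hI : ∀ᶠ p in 𝓝 (y₀, x₀), ∀ u v,
      fderiv ℝ F p (u, F p u) v = fderiv ℝ F p (v, F p v) u) :
    ∃ σ : N → E, σ y₀ = x₀ ∧
      ∀ᶠ y in 𝓝 y₀, ContDiffAt ℝ ∞ σ y ∧ fderiv ℝ σ y = F (y, σ y) := by
  have hF0 := hF.self_of_nhds
  have hF' : ContDiffAt ℝ 1 (fderiv ℝ F) (y₀, x₀) :=
    (hF0.fderiv_right (m := ∞) (by simp)).of_le (by exact_mod_cast le_top)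
  obtain ⟨K₁, s, hs, hlip⟩ := hF'.exists_lipschitzOnWith
  have hFc : ∀ᶠ p in 𝓝 (y₀, x₀), ‖F p‖ < ‖F (y₀, x₀)‖ + 1 :=
    hF0.continuousAt.norm.eventually_lt_const (by linarith)
  have hFc' : ∀ᶠ p in 𝓝 (y₀, x₀), ‖fderiv ℝ F p‖ < ‖fderiv ℝ F (y₀, x₀)‖ + 1 :=
    (Metric.tendsto_nhds.mp hF'.continuousAt 1 one_pos).mono fun p hp ↦ by
      rw [dist_eq_norm] at hp
      have := norm_sub_norm_le (fderiv ℝ F p) (fderiv ℝ F (y₀, x₀))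
      linarith
  obtain ⟨R, hR, hball⟩ := Metric.nhds_basis_closedBall.eventually_iff.mp
    ((hF.and hI).and ((hFc.and hFc').and hs))
  set M := ‖F (y₀, x₀)‖ + 1
  set K := max (K₁ : ℝ) (‖fderiv ℝ F (y₀, x₀)‖ + 1)
  have hM0 : 0 < M := by positivity
  have hK0 : 0 < K := lt_of_lt_of_le (by positivity) (le_max_right _ _)
  -- The bound `1` lets factors `‖w‖` be dropped in the estimates, `R` keeps the rays inside the
  -- ball, and `R / (4M)` keeps the solutions within `R / 4` of `x₀`, leaving room for the
  -- approximate solutions.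
  set r := min 1 (min R (R / (4 * M)))
  have hr : 0 < r := by positivity
  have hr1 : r ≤ 1 := min_le_left _ _
  have hrR : r ≤ R := (min_le_right _ _).trans (min_le_left _ _)
  have hMr : 4 * M * r ≤ R := by
    have : r ≤ R / (4 * M) := (min_le_right _ _).trans (min_le_right _ _)
    rwa [le_div_iff₀ (by positivity), mul_comm] at this
  have hdiff : ∀ p ∈ closedBall (y₀, x₀) R, HasFDerivAt F (fderiv ℝ F p) p := fun p hp ↦
    ((hball hp).1.1.differentiableAt (by simp)).hasFDerivAt
  have hKb : ∀ p ∈ closedBall (y₀, x₀) R, ‖fderiv ℝ F p‖ ≤ K := fun p hp ↦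
    (hball hp).2.1.2.le.trans (le_max_right _ _)
  have hMb : ∀ p ∈ closedBall (y₀, x₀) R, ‖F p‖ ≤ M := fun p hp ↦ (hball hp).2.1.1.le
  have hLb : ∀ p ∈ closedBall (y₀, x₀) R, ∀ q ∈ closedBall (y₀, x₀) R,
      ‖fderiv ℝ F p - fderiv ℝ F q‖ ≤ K * ‖p - q‖ := by
    intro p hp q hq
    have h := hlip.dist_le_mul p (hball hp).2.2 q (hball hq).2.2
    rw [dist_eq_norm, dist_eq_norm] at h
    refine h.trans ?_
    gcongr
    exact le_max_left _ _
  have hFlip : ∀ p ∈ closedBall (y₀, x₀) R, ∀ q ∈ closedBall (y₀, x₀) R,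
      ‖F q - F p‖ ≤ K * ‖q - p‖ := fun p hp q hq ↦
    (convex_closedBall _ _).norm_image_sub_le_of_norm_hasFDerivWithin_le
      (fun z hz ↦ (hdiff z hz).hasFDerivWithinAt) hKb hp hq
  have mem : ∀ {t : ℝ} {w : N} {x : E}, t ∈ Icc (0 : ℝ) 1 → ‖w‖ ≤ r → x ∈ closedBall x₀ R →
      (y₀ + t • w, x) ∈ closedBall (y₀, x₀) R := by
    intro t w x ht hw hx
    rw [← closedBall_prod_same]
    refine ⟨?_, hx⟩
    rw [mem_closedBall, dist_eq_norm]
    simp only [add_sub_cancel_left, norm_smul, Real.norm_eq_abs, abs_of_nonneg ht.1]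
    calc t * ‖w‖ ≤ 1 * r := by gcongr; exact ht.2
      _ ≤ R := by linarith
  have hsub : closedBall x₀ (R / 4) ⊆ closedBall x₀ R := closedBall_subset_closedBall (by linarith)
  have hsol : ∀ w : N, ∃ α : ℝ → E, ‖w‖ ≤ r → (α 0 = x₀ ∧
      ∀ t ∈ Icc (0 : ℝ) 1, α t ∈ closedBall x₀ (R / 4) ∧
        HasDerivWithinAt α (F (y₀ + t • w, α t) w) (Icc 0 1) t) := by
    intro w
    by_cases hw : ‖w‖ ≤ r
    swap
    · exact ⟨fun _ ↦ x₀, fun h ↦ absurd h hw⟩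
    obtain ⟨α, h⟩ := exists_ode_solution_mem_closedBall (f := fun t x ↦ F (y₀ + t • w, x) w)
      (x₀ := x₀) (a := R / 4) (L := M * r) (K := K) (by positivity) (by positivity) hK0.le
      (by linarith)
      (fun t ht x hx y hy ↦ by
        rw [← sub_apply]
        refine (ContinuousLinearMap.le_opNorm _ _).trans ?_
        calc _ ≤ (K * ‖((y₀ + t • w, x) : N × E) - (y₀ + t • w, y)‖) * 1 := by
              gcongr
              · exact hFlip _ (mem ht hw (hsub hy)) _ (mem ht hw (hsub hx))
              · linarith
          _ = _ := by simp [Prod.norm_def])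
      (fun x hx t ht ↦ by
        have h1 : ContinuousAt F (y₀ + t • w, x) :=
          (hdiff _ (mem ht hw (hsub hx))).continuousAt
        have h2 : ContinuousAt (fun t : ℝ ↦ (y₀ + t • w, x)) t := by fun_prop
        exact ((h1.comp (f := fun t : ℝ ↦ (y₀ + t • w, x)) h2).clm_apply
          continuousAt_const).continuousWithinAt)
      (fun t ht x hx ↦ (ContinuousLinearMap.le_opNorm _ _).trans (by
        gcongr
        exact hMb _ (mem ht hw (hsub hx))))
    exact ⟨α, fun _ ↦ h⟩
  choose α hα using hsol
  -- The value at time one of the solution along the ray from `y₀` to `y`. Its dependence on `y` is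
  -- controlled up to second order by `ray_solution_estimate`, hence it is differentiable with the
  -- required derivative.
  let σ : N → E := fun y ↦ α (y - y₀) 1
  have hderiv : ∀ y ∈ ball y₀ r, HasFDerivAt σ (F (y, σ y)) y := by
    intro y hy
    have hyr : ‖y - y₀‖ < r := by rwa [mem_ball, dist_eq_norm] at hy
    have hO : (fun z ↦ σ z - σ y - F (y, σ y) (z - y)) =O[𝓝 y] fun z ↦ ‖z - y‖ ^ 2 := by
      refine Asymptotics.IsBigO.of_bound
        ((K * (1 + M) ^ 2 + K * (1 + M)) * ((Real.exp K - 1) / K)) ?_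
      filter_upwards [isOpen_ball.mem_nhds hy] with z hz
      have hzr : ‖z - y₀‖ < r := by rwa [mem_ball, dist_eq_norm] at hz
      have := ray_solution_estimate hK0 hM0 hr hr1 hrR hMr hdiff hLb hKb hMb
        (fun p hp ↦ (hball hp).1.2) hyr.le hzr.le (hα _ hyr.le).1 (hα _ hzr.le).1
        (hα _ hyr.le).2 (hα _ hzr.le).2
      simpa [σ] using this
    have h0 := hO.hasFDerivAt (𝕜 := ℝ) one_lt_two
    have h1 := h0.add (((F (y, σ y)).hasFDerivAt (x := y)).add_const (σ y - F (y, σ y) y))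
    rw [zero_add] at h1
    refine h1.congr_of_eventuallyEq (Eventually.of_forall fun z ↦ ?_)
    simp only [Pi.add_apply, map_sub]
    abel
  have hσmem : ∀ y ∈ ball y₀ r, (y, σ y) ∈ closedBall (y₀, x₀) R := by
    intro y hy
    have hyr : ‖y - y₀‖ < r := by rwa [mem_ball, dist_eq_norm] at hy
    have := mem (t := 1) (by simp) hyr.le (hsub ((hα _ hyr.le).2 1 (by simp)).1)
    simpa [σ] using this
  -- Bootstrapping: if `σ` is of class `Cⁿ`, then so is its derivative `F(y, σ y)`.
  have hsmooth : ∀ n : ℕ, ContDiffOn ℝ n σ (ball y₀ r) := by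
    intro n
    induction n with
    | zero =>
      exact contDiffOn_zero.mpr fun y hy ↦ (hderiv y hy).continuousAt.continuousWithinAt
    | succ n ih =>
      refine (contDiffOn_succ_iff_fderiv_of_isOpen isOpen_ball).mpr
        ⟨fun y hy ↦ (hderiv y hy).differentiableAt.differentiableWithinAt,
          fun h ↦ absurd h (WithTop.natCast_ne_top n), ?_⟩
      refine ContDiffOn.congr (f := fun y ↦ F (y, σ y)) ?_ fun y hy ↦ (hderiv y hy).fderiv
      intro y hy
      have h1 : ContDiffAt ℝ n F (y, σ y) :=
        ((hball (hσmem y hy)).1.1).of_le (by exact_mod_cast le_top)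
      exact h1.comp_contDiffWithinAt y (contDiffWithinAt_id.prodMk (ih y hy))
  refine ⟨σ, ?_, ?_⟩
  · -- along the constant ray the solution does not move
    have h0 : ‖(0 : N)‖ ≤ r := by simpa using hr.le
    have h1 := hα 0 h0
    have h2 := constant_of_derivWithin_zero (f := α 0) (a := 0) (b := 1)
      (fun t ht ↦ (h1.2 t ht).2.differentiableWithinAt) (fun t ht ↦ by
        have h3 := (h1.2 t (Ico_subset_Icc_self ht)).2
        rw [map_zero] at h3
        exact h3.derivWithin (uniqueDiffOn_Icc zero_lt_one t (Ico_subset_Icc_self ht)))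
      1 (by simp)
    simp only [σ, sub_self]
    rw [h2, h1.1]
  · filter_upwards [isOpen_ball.mem_nhds (mem_ball_self hr)] with y hy
    refine ⟨contDiffAt_infty.mpr fun n ↦ (hsmooth n).contDiffAt (isOpen_ball.mem_nhds hy),
      (hderiv y hy).fderiv⟩

end Frobenius

/-! ### Integration of flat forms with values in a Lie algebra; one-parameter subgroups -/

section Integration


variable {E : Type*} [NormedAddCommGroup E] [NormedSpace ℝ E] [CompleteSpace E]
  {G : Type*} [TopologicalSpace G] [ChartedSpace E G] [Group G] [LieGroup 𝓘(ℝ, E) ∞ G]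
  {N : Type*} [NormedAddCommGroup N] [NormedSpace ℝ N]

/-- The structure equation of the frame at all points near `1`, which is needed for integrability.
The Maurer-Cartan form of the inverse chart is inverse to the frame; differentiating this relation
carries the Maurer-Cartan equation over to the frame. -/
theorem fderiv_leftFrame_bracket :
    ∀ᶠ a in 𝓝 (oneChart E G), ∀ p q,
      fderiv ℝ (leftFrame ℝ E G) a (leftFrame ℝ E G a p) q -
        fderiv ℝ (leftFrame ℝ E G) a (leftFrame ℝ E G a q) p =
      leftFrame ℝ E G a (lieB ℝ G p q) := by
  let s : E → G := (chartAt E (1 : G)).symm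
  have hs : ∀ᶠ a in 𝓝 (oneChart E G), ContMDiffAt 𝓘(ℝ, E) 𝓘(ℝ, E) ∞ s a := by
    filter_upwards [eventually_mem_target] with a ha using contMDiffAt_chart_symm ha
  have hlog : ∀ a ∈ (chartAt E (1 : G)).target, localLog E s (oneChart E G) a = a := by
    intro a ha
    simp [localLog, s, (chartAt E (1 : G)).right_inv ha]
  have h1 : ∀ᶠ a in 𝓝 (oneChart E G),
      (leftFrame ℝ E G a).comp (mc ℝ E E s a) = ContinuousLinearMap.id ℝ E := by
    filter_upwards [hs, eventually_mem_target (G := G),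
      eventually_mem_nhds_iff.mpr (eventually_mem_target (G := G))] with a h1 h2 h3
    have := leftFrame_comp_mc (x := oneChart E G) h1.mdiff
      (by simpa [s] using (chartAt E (1 : G)).map_target h2)
    rw [hlog a h2] at this
    rw [this, ← tder_id (M := E)]
    refine tder_congr ?_
    filter_upwards [h3] with b hb using hlog b hb
  filter_upwards [h1.eventually_nhds, hs.eventually_nhds, isInvertible_leftFrame_one (𝕜 := ℝ),
    eventually_mem_target (G := G)] with a h1 h2 h3 h4 p q
  have hinv : ∀ p, mc ℝ E E s a (leftFrame ℝ E G a p) = p := by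
    intro p
    obtain ⟨L, hL⟩ := h3
    have h5 : ∀ v, leftFrame ℝ E G a (mc ℝ E E s a v) = v := fun v ↦
      DFunLike.congr_fun h1.self_of_nhds v
    have h6 := h5 (leftFrame ℝ E G a p)
    rw [← hL] at h6 ⊢
    exact L.injective h6
  have hθ : DifferentiableAt ℝ (leftFrame ℝ E G) a :=
    (contDiffAt_leftFrame h4).differentiableAt (by simp)
  have hω : DifferentiableAt ℝ (fun y ↦ mc ℝ E E s y) a :=
    (contDiffAt_mc h2).differentiableAt (by simp)
  have hprod : ∀ u v, fderiv ℝ (leftFrame ℝ E G) a u (mc ℝ E E s a v) =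
      -leftFrame ℝ E G a (fderiv ℝ (fun y ↦ mc ℝ E E s y) a u v) := by
    intro u v
    have e := Filter.EventuallyEq.fderiv_eq (𝕜 := ℝ) h1
    rw [fderiv_clm_comp hθ hω, fderiv_const_apply] at e
    have := DFunLike.congr_fun (DFunLike.congr_fun e u) v
    simp at this
    rw [eq_neg_iff_add_eq_zero, add_comm]
    exact this
  have hp := hprod (leftFrame ℝ E G a p) (leftFrame ℝ E G a q)
  have hq := hprod (leftFrame ℝ E G a q) (leftFrame ℝ E G a p)
  have hmc := fderiv_mc_sub h2 (leftFrame ℝ E G a p) (leftFrame ℝ E G a q)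
  rw [hinv] at hp hq
  rw [hinv, hinv] at hmc
  rw [hp, hq, ← sub_eq_zero, ← neg_eq_zero, ← map_zero (leftFrame ℝ E G a), ← hmc]
  simp only [map_add, map_sub]
  abel

/-- Local solutions of `s⁻¹ ds = α` for a form `α` that satisfies the Maurer-Cartan equation. -/
theorem exists_mc_eq {α : N → N →L[ℝ] E} {y₀ : N}
    (hα : ∀ᶠ y in 𝓝 y₀, ContDiffAt ℝ ∞ α y)
    (hflat : ∀ᶠ y in 𝓝 y₀, ∀ u v,
      fderiv ℝ α y u v - fderiv ℝ α y v u + lieB ℝ G (α y u) (α y v) = 0) :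
    ∃ s : N → G, s y₀ = 1 ∧ ∀ᶠ y in 𝓝 y₀, ContMDiffAt 𝓘(ℝ, N) 𝓘(ℝ, E) ∞ s y ∧
      mc ℝ E N s y = α y := by
  -- In the chart the equation `s⁻¹ds = α` reads `dσ = leftFrame(σ) ∘ α`.
  let F : N × E → N →L[ℝ] E := fun p ↦ (leftFrame ℝ E G p.2).comp (α p.1)
  have hF : ∀ y x, ContDiffAt ℝ ∞ α y → x ∈ (chartAt E (1 : G)).target →
      ContDiffAt ℝ ∞ F (y, x) := by
    intro y x h1 h2
    exact ((contDiffAt_leftFrame h2).comp (y, x) contDiffAt_snd).clm_comp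
      (h1.comp (y, x) contDiffAt_fst)
  have ev1 : ∀ᶠ p in 𝓝 (y₀, oneChart E G), ContDiffAt ℝ ∞ α p.1 :=
    continuousAt_fst.eventually hα
  have ev2 : ∀ᶠ p in 𝓝 (y₀, oneChart E G), p.2 ∈ (chartAt E (1 : G)).target :=
    continuousAt_snd.eventually (eventually_mem_target (G := G))
  obtain ⟨σ, hσ0, hσ⟩ := exists_total_differential_solution (F := F) (y₀ := y₀)
    (x₀ := oneChart E G)
    (by filter_upwards [ev1, ev2] with p h1 h2 using hF _ _ h1 h2)
    (by
      have ev3 : ∀ᶠ p in 𝓝 (y₀, oneChart E G), ∀ u v : N,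
          fderiv ℝ α p.1 u v - fderiv ℝ α p.1 v u + lieB ℝ G (α p.1 u) (α p.1 v) = 0 :=
        (continuousAt_fst (p := (y₀, oneChart E G))).eventually (p := fun y ↦ ∀ u v : N,
          fderiv ℝ α y u v - fderiv ℝ α y v u + lieB ℝ G (α y u) (α y v) = 0) hflat
      have ev4 : ∀ᶠ p in 𝓝 (y₀, oneChart E G), ∀ u v : E,
          fderiv ℝ (leftFrame ℝ E G) p.2 (leftFrame ℝ E G p.2 u) v -
            fderiv ℝ (leftFrame ℝ E G) p.2 (leftFrame ℝ E G p.2 v) u =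
          leftFrame ℝ E G p.2 (lieB ℝ G u v) :=
        (continuousAt_snd (p := (y₀, oneChart E G))).eventually
          (fderiv_leftFrame_bracket (E := E) (G := G))
      filter_upwards [ev1, ev2, ev3, ev4] with p h1 h2 h3 h4 u v
      have hα' : HasFDerivAt α (fderiv ℝ α p.1) p.1 := (h1.differentiableAt (by simp)).hasFDerivAt
      have hθ' : HasFDerivAt (leftFrame ℝ E G) (fderiv ℝ (leftFrame ℝ E G) p.2) p.2 :=
        ((contDiffAt_leftFrame h2).differentiableAt (by simp)).hasFDerivAt
      have hF' := (hθ'.comp p hasFDerivAt_snd).clm_comp (hα'.comp p hasFDerivAt_fst)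
      have hF'' : ∀ (w : N × E) v, fderiv ℝ F p w v =
          leftFrame ℝ E G p.2 (fderiv ℝ α p.1 w.1 v) +
            fderiv ℝ (leftFrame ℝ E G) p.2 w.2 (α p.1 v) := by
        intro w v
        have := DFunLike.congr_fun (DFunLike.congr_fun hF'.fderiv w) v
        refine this.trans ?_
        simp
      rw [hF'', hF'']
      -- Flatness of `α` antisymmetrises the derivative of `α` into a bracket, and the structure
      -- equation does the same for the derivative of the frame. The two brackets cancel, which is
      -- the integrability condition.
      have h5 := congrArg (leftFrame ℝ E G p.2) (h3 u v)
      have h6 := h4 (α p.1 u) (α p.1 v)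
      simp only [map_add, map_sub, map_zero, ← h6] at h5
      simp only [F, ContinuousLinearMap.comp_apply]
      rw [← sub_eq_zero, ← h5]
      abel)
  have hσc : Tendsto σ (𝓝 y₀) (𝓝 (oneChart E G)) := by
    have := hσ.self_of_nhds.1.continuousAt.tendsto
    rwa [hσ0] at this
  let s : N → G := fun y ↦ (chartAt E (1 : G)).symm (σ y)
  have hs : ∀ᶠ y in 𝓝 y₀, ContMDiffAt 𝓘(ℝ, N) 𝓘(ℝ, E) ∞ s y := by
    filter_upwards [hσ, hσc.eventually (eventually_mem_target (G := G))] with y h1 h2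
    exact ContMDiffAt.comp y (contMDiffAt_chart_symm h2) h1.1.contMDiffAt
  have hs0 : s y₀ = 1 := by simp [s, hσ0]
  refine ⟨s, hs0, ?_⟩
  have hlog : ∀ᶠ y in 𝓝 y₀, localLog E s y₀ y = σ y := by
    filter_upwards [hσc.eventually (eventually_mem_target (G := G))] with y h
    simp only [localLog, hs0, inv_one, one_mul, s]
    exact (chartAt E (1 : G)).right_inv h
  filter_upwards [hs, hσ, hlog.eventually_nhds,
    hσc.eventually (isInvertible_leftFrame_one (𝕜 := ℝ) (G := G)),
    eventually_div_mem_source hs.self_of_nhds.mdiff] with y h1 h2 h3 h4 h5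
  refine ⟨h1, ?_⟩
  have h6 := leftFrame_comp_mc h1.mdiff h5
  rw [tder_eq_fderiv, Filter.EventuallyEq.fderiv_eq h3, h2.2, h3.self_of_nhds] at h6
  ext v
  obtain ⟨L, hL⟩ := h4
  have h7 := DFunLike.congr_fun h6 v
  simp only [F, ContinuousLinearMap.comp_apply, ← hL] at h7
  exact L.injective h7

theorem lieB_smul_smul (a b : ℝ) (Z : E) : lieB ℝ G (a • Z) (b • Z) = 0 := by
  rw [lieB_eq_frameDeriv]
  simp only [frameDeriv, map_smul, smul_apply]
  rw [smul_comm, sub_self]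

/-- It makes the theory of integral curves of the left invariant field of `Z` applicable to
solutions of `s⁻¹ds = Z dt`. -/
theorem hasMFDerivAt_of_mc_eq {s : ℝ → G} {t : ℝ} {Z : E}
    (hs : MDifferentiableAt 𝓘(ℝ, ℝ) 𝓘(ℝ, E) s t) (hmc : mc ℝ E ℝ s t 1 = Z) :
    HasMFDerivAt 𝓘(ℝ, ℝ) 𝓘(ℝ, E) s t ((1 : ℝ →L[ℝ] ℝ).smulRight
      (mulInvariantVectorField (I := 𝓘(ℝ, E)) (G := G) Z (s t))) := by
  have h1 := hs.hasMFDerivAt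
  have h2 : tder ℝ ℝ E s t = (1 : ℝ →L[ℝ] ℝ).smulRight
      (tder ℝ E E (fun y : G ↦ s t * y) 1 Z) := by
    ext
    rw [tder_eq_comp_mc hs, ← hmc]
    simp
  have h3 : mfderiv 𝓘(ℝ, ℝ) 𝓘(ℝ, E) s t = (1 : ℝ →L[ℝ] ℝ).smulRight
      (mulInvariantVectorField (I := 𝓘(ℝ, E)) (G := G) Z (s t)) := h2
  rwa [h3] at h1

variable [T2Space G]

/-- One-parameter subgroups with given velocity exist. -/
theorem exists_oneParameterSubgroup (Z : E) :
    ∃ γ : ℝ → G, ContMDiff 𝓘(ℝ, ℝ) 𝓘(ℝ, E) ∞ γ ∧ (∀ s t, γ (s + t) = γ s * γ t) ∧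
      tder ℝ ℝ E γ 0 1 = Z := by
  -- The constant form `Z dt` is flat, as the bracket of two multiples of `Z` vanishes.
  obtain ⟨s, hs0, hs⟩ := exists_mc_eq (G := G) (y₀ := (0 : ℝ))
    (α := fun _ ↦ (1 : ℝ →L[ℝ] ℝ).smulRight Z) (Eventually.of_forall fun _ ↦ contDiffAt_const)
    (Eventually.of_forall fun y u v ↦ by
      rw [fderiv_const_apply]
      simp [lieB_smul_smul])
  obtain ⟨ε, hε, hsε⟩ := Metric.eventually_nhds_iff_ball.mp hs
  have hball : ∀ {t}, t ∈ Set.Ioo (-ε) ε ↔ t ∈ Metric.ball (0 : ℝ) ε := by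
    intro t
    rw [Real.ball_eq_Ioo]
    simp
  let V : ∀ x : G, TangentSpace 𝓘(ℝ, E) x := mulInvariantVectorField (I := 𝓘(ℝ, E)) (G := G) Z
  have hV : ContMDiff 𝓘(ℝ, E) 𝓘(ℝ, E).tangent 1
      (fun x ↦ (⟨x, V x⟩ : TangentBundle 𝓘(ℝ, E) G)) :=
    (contMDiff_mulInvariantVectorField (I := 𝓘(ℝ, E)) (G := G) Z).of_le
      (by simp [minSmoothness_of_isRCLikeNormedField])
  -- Left translates of one local solution are integral curves through every point with a common
  -- lifetime `ε`, so integral curves extend to all times.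
  have hloc : ∀ g : G, IsMIntegralCurveOn (I := 𝓘(ℝ, E)) (fun t ↦ g * s t) V
      (Set.Ioo (-ε) ε) := by
    intro g t ht
    have h1 := hsε t (hball.mp ht)
    refine (hasMFDerivAt_of_mc_eq (mdiff_div h1.1.mdiff g) ?_).hasMFDerivWithinAt
    rw [mc_const_mul, h1.2]
    simp
  have : IsManifold 𝓘(ℝ, E) 1 G := IsManifold.of_le (n := ∞) (by norm_cast)
  obtain ⟨γ, hγ0, hγ⟩ := exists_isMIntegralCurve_of_isMIntegralCurveOn (I := 𝓘(ℝ, E)) (M := G)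
    hV hε (fun g ↦ ⟨fun t ↦ g * s t, by simp [hs0], hloc g⟩) 1
  have hγmd : ∀ t, MDifferentiableAt 𝓘(ℝ, ℝ) 𝓘(ℝ, E) γ t := fun t ↦ (hγ t).mdifferentiableAt
  have htr : ∀ g, IsMIntegralCurve (I := 𝓘(ℝ, E)) (fun t ↦ g * γ t) V := by
    intro g t
    refine hasMFDerivAt_of_mc_eq (mdiff_div (hγmd t) g) ?_
    rw [mc_const_mul]
    have h1 : tder ℝ ℝ E γ t = (1 : ℝ →L[ℝ] ℝ).smulRight
      (tder ℝ E E (fun y : G ↦ γ t * y) 1 Z) := (hγ t).mfderiv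
    have h2 : mc ℝ E ℝ γ t =
        (tder ℝ E E (fun y : G ↦ (γ t)⁻¹ * y) (γ t)).comp (tder ℝ ℝ E γ t) :=
      tder_comp (g := fun y : G ↦ (γ t)⁻¹ * y) t
        (contMDiff_mul_left (I := 𝓘(ℝ, E)) (n := ∞) (a := (γ t)⁻¹)).contMDiffAt.mdiff (hγmd t)
    have h3 := tder_comp_of_eq (𝕜 := ℝ) (g := fun y : G ↦ (γ t)⁻¹ * y) (f := fun y : G ↦ γ t * y)
      (1 : G) (y := γ t) (by simp)
      (contMDiff_mul_left (I := 𝓘(ℝ, E)) (n := ∞) (a := (γ t)⁻¹)).contMDiffAt.mdiff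
      (contMDiff_mul_left (I := 𝓘(ℝ, E)) (n := ∞) (a := γ t)).contMDiffAt.mdiff
    simp only [inv_mul_cancel_left] at h3
    rw [tder_id] at h3
    rw [h2, h1]
    simpa using (DFunLike.congr_fun h3 Z).symm
  -- As functions of `t`, both sides are integral curves with value `γ a` at `0`.
  have hadd : ∀ s t, γ (s + t) = γ s * γ t := by
    intro a t
    have h1 : IsMIntegralCurve (I := 𝓘(ℝ, E)) (γ ∘ (· + a)) V := hγ.comp_add a
    have h2 := isMIntegralCurve_Ioo_eq_of_contMDiff_boundaryless (t₀ := 0) hV h1 (htr (γ a))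
      (by simp [hγ0])
    have := congrFun h2 t
    simpa [add_comm] using this
  have hγs : ∀ t ∈ Set.Ioo (-ε) ε, γ t = s t := by
    have h1 := hloc 1
    simp only [one_mul] at h1
    exact isMIntegralCurveOn_Ioo_eqOn_of_contMDiff_boundaryless (t₀ := 0) (by simp [hε]) hV
      (hγ.isMIntegralCurveOn _) h1 (by simp [hγ0, hs0])
  refine ⟨γ, fun t₀ ↦ ?_, hadd, ?_⟩
  · have e : γ = fun t ↦ γ t₀ * γ (t - t₀) := by
      funext t; rw [← hadd]; congr 1; ring
    have h0 : ContMDiffAt 𝓘(ℝ, ℝ) 𝓘(ℝ, E) ∞ γ 0 := by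
      refine (hsε 0 (Metric.mem_ball_self hε)).1.congr_of_eventuallyEq ?_
      filter_upwards [Ioo_mem_nhds (neg_lt_zero.mpr hε) hε] with t ht using hγs t ht
    rw [e]
    refine contMDiffAt_const.mul (ContMDiffAt.comp (f := fun t : ℝ ↦ t - t₀) t₀
      (by rwa [sub_self]) ?_)
    exact (contDiff_id.sub contDiff_const).contMDiff.contMDiffAt
  · have h1 : tder ℝ ℝ E γ 0 = mc ℝ E ℝ γ 0 := by simp [mc, hγ0]
    have h2 : mc ℝ E ℝ γ 0 = mc ℝ E ℝ s 0 := by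
      refine mc_congr ?_
      filter_upwards [Ioo_mem_nhds (neg_lt_zero.mpr hε) hε] with t ht using hγs t ht
    rw [h1, h2, (hsε 0 (Metric.mem_ball_self hε)).2]
    simp

end Integration

/-! ### The adjoint action along maps and one-parameter subgroups -/

section OneParameter


variable {E : Type*} [NormedAddCommGroup E] [NormedSpace ℝ E] [CompleteSpace E]
  {G : Type*} [TopologicalSpace G] [ChartedSpace E G] [Group G] [LieGroup 𝓘(ℝ, E) ∞ G]
  [T2Space G] {γ : ℝ → G}

theorem oneParam_zero (hadd : ∀ s t, γ (s + t) = γ s * γ t) : γ 0 = 1 := by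
  have := hadd 0 0
  rw [add_zero] at this
  exact left_eq_mul.mp this

theorem oneParam_neg (hadd : ∀ s t, γ (s + t) = γ s * γ t) (t : ℝ) : γ (-t) = (γ t)⁻¹ := by
  rw [eq_inv_iff_mul_eq_one, ← hadd, neg_add_cancel, oneParam_zero hadd]

theorem mc_oneParam (hγ : ContMDiff 𝓘(ℝ, ℝ) 𝓘(ℝ, E) ∞ γ) (hadd : ∀ s t, γ (s + t) = γ s * γ t)
    (t : ℝ) : mc ℝ E ℝ γ t = tder ℝ ℝ E γ 0 := by
  have : (fun y ↦ (γ t)⁻¹ * γ y) = fun y ↦ γ (y - t) := by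
    funext y
    rw [sub_eq_add_neg, add_comm, hadd, oneParam_neg hadd]
  rw [mc, this, tder_comp_of_eq (f := fun y : ℝ ↦ y - t) (y := (0 : ℝ)) t (by simp)
    (hγ 0).mdiff (differentiableAt_id.sub_const t).mdifferentiableAt, tder_eq_fderiv]
  simp only [fderiv_sub_const, fderiv_fun_id]
  rfl

/-- The derivative of the inverse adjoint action along a map into the group. -/
theorem fderiv_adj_inv {N : Type*} [NormedAddCommGroup N] [NormedSpace ℝ N] {k : N → G} {x : N}
    (hk : ∀ᶠ y in 𝓝 x, ContMDiffAt 𝓘(ℝ, N) 𝓘(ℝ, E) ∞ k y) (W : E) :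
    DifferentiableAt ℝ (fun y ↦ adj ℝ E (k y)⁻¹ W) x ∧
      ∀ u, fderiv ℝ (fun y ↦ adj ℝ E (k y)⁻¹ W) x u =
        -lieB ℝ G (mc ℝ E N k x u) (adj ℝ E (k x)⁻¹ W) := by
  obtain ⟨η, hη, hηadd, hη1⟩ := exists_oneParameterSubgroup (G := G) W
  -- For `s(y, τ) = η(τ) k(y)`, the `τ`-component of the Maurer-Cartan form is `Ad(k⁻¹) W`, and its
  -- `N`-component is that of `k` and does not depend on `τ`. The mixed component of the
  -- Maurer-Cartan equation is therefore a formula for the derivative of `Ad(k⁻¹) W`.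
  let s : N × ℝ → G := fun p ↦ η p.2 * k p.1
  have hk' : ∀ᶠ p in 𝓝 (x, (0 : ℝ)), ContMDiffAt 𝓘(ℝ, N) 𝓘(ℝ, E) ∞ k p.1 :=
    (continuousAt_fst (p := (x, (0 : ℝ)))).eventually hk
  have h1 : ∀ p : N × ℝ, ContMDiffAt 𝓘(ℝ, N) 𝓘(ℝ, E) ∞ k p.1 →
      ContMDiffAt 𝓘(ℝ, N × ℝ) 𝓘(ℝ, E) ∞ (fun p : N × ℝ ↦ k p.1) p := fun p hp ↦
    ContMDiffAt.comp (f := Prod.fst) p hp contDiff_fst.contMDiff.contMDiffAt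
  have h2 : ContMDiff 𝓘(ℝ, N × ℝ) 𝓘(ℝ, E) ∞ fun p : N × ℝ ↦ η p.2 :=
    hη.comp contDiff_snd.contMDiff
  have hs : ∀ᶠ p in 𝓝 (x, (0 : ℝ)), ContMDiffAt 𝓘(ℝ, N × ℝ) 𝓘(ℝ, E) ∞ s p :=
    hk'.mono fun p hp ↦ (h2 p).mul (h1 p hp)
  have hmc : ∀ p : N × ℝ, ContMDiffAt 𝓘(ℝ, N) 𝓘(ℝ, E) ∞ k p.1 → ∀ u, mc ℝ E (N × ℝ) s p u =
      u.2 • adj ℝ E (k p.1)⁻¹ W + mc ℝ E N k p.1 u.1 := by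
    intro p hp u
    have e1 := mc_comp (𝕜 := ℝ) (s := k) (κ := fun p : N × ℝ ↦ p.1) (x := p) hp.mdiff
      differentiableAt_fst.mdifferentiableAt
    have e2 := mc_comp (𝕜 := ℝ) (s := η) (κ := fun p : N × ℝ ↦ p.2) (x := p) (hη _).mdiff
      differentiableAt_snd.mdifferentiableAt
    rw [tder_eq_fderiv, fderiv_fst] at e1
    rw [mc_oneParam hη hηadd, tder_eq_fderiv, fderiv_snd] at e2
    rw [mc_mul (h2 p).mdiff (h1 p hp).mdiff, e1, e2]
    simp only [add_apply, ContinuousLinearMap.comp_apply, ContinuousLinearMap.coe_fst',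
      ContinuousLinearMap.coe_snd']
    congr 1
    rw [show u.2 = u.2 • (1 : ℝ) by simp, map_smul, hη1]; simp
  have hd : DifferentiableAt ℝ (fun p ↦ mc ℝ E (N × ℝ) s p) (x, 0) :=
    (contDiffAt_mc hs).differentiableAt (by simp)
  have e (u w : N × ℝ) : fderiv ℝ (fun p ↦ mc ℝ E (N × ℝ) s p) (x, 0) u w =
      fderiv ℝ (fun p ↦ mc ℝ E (N × ℝ) s p w) (x, 0) u := by
    rw [fderiv_clm_apply hd (differentiableAt_const _)]
    simp
  have e1 : (fun p ↦ mc ℝ E (N × ℝ) s p (0, 1)) =ᶠ[𝓝 (x, (0 : ℝ))]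
      fun p ↦ adj ℝ E (k p.1)⁻¹ W := by
    filter_upwards [hk'] with p hp
    rw [hmc p hp]; simp
  have e2 (u : N) : (fun p ↦ mc ℝ E (N × ℝ) s p (u, 0)) =ᶠ[𝓝 (x, (0 : ℝ))]
      fun p ↦ mc ℝ E N k p.1 u := by
    filter_upwards [hk'] with p hp
    rw [hmc p hp]; simp
  have hdw : DifferentiableAt ℝ (fun p : N × ℝ ↦ adj ℝ E (k p.1)⁻¹ W) (x, 0) :=
    (hd.clm_apply (differentiableAt_const ((0, 1) : N × ℝ))).congr_of_eventuallyEq e1.symm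
  have hline : HasFDerivAt (fun y : N ↦ (y, (0 : ℝ))) (ContinuousLinearMap.inl ℝ N ℝ) x :=
    hasFDerivAt_prodMk_left x 0
  have hcomp := HasFDerivAt.comp (g := fun p : N × ℝ ↦ adj ℝ E (k p.1)⁻¹ W) x
    hdw.hasFDerivAt hline
  refine ⟨hcomp.differentiableAt, fun u ↦ ?_⟩
  have hflat := fderiv_mc_sub hs (x := (x, (0 : ℝ))) (u, 0) (0, 1)
  have h0 : fderiv ℝ (fun p : N × ℝ ↦ mc ℝ E N k p.1 u) (x, 0) (0, 1) = 0 := by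
    have hdm : DifferentiableAt ℝ (fun y ↦ mc ℝ E N k y u) x :=
      ((contDiffAt_mc hk).differentiableAt (by simp)).clm_apply (differentiableAt_const u)
    have := HasFDerivAt.comp (g := fun y ↦ mc ℝ E N k y u) (f := Prod.fst) (x, (0 : ℝ))
      hdm.hasFDerivAt hasFDerivAt_fst
    rw [show (fun p : N × ℝ ↦ mc ℝ E N k p.1 u) = (fun y ↦ mc ℝ E N k y u) ∘ Prod.fst from rfl,
      this.fderiv]
    simp
  have hx := hk.self_of_nhds
  rw [e, e, e1.fderiv_eq, (e2 u).fderiv_eq, h0, hmc _ hx, hmc _ hx] at hflat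
  simp only [zero_smul, one_smul, zero_add, sub_zero, map_zero, add_zero] at hflat
  rw [show (fun y ↦ adj ℝ E (k y)⁻¹ W) = (fun p : N × ℝ ↦ adj ℝ E (k p.1)⁻¹ W) ∘
    fun y ↦ (y, (0 : ℝ)) from rfl, hcomp.fderiv, ← eq_neg_iff_add_eq_zero.mpr hflat]
  rfl

/-- The derivative of the adjoint action along a one-parameter subgroup. -/
theorem hasDerivAt_adj (hγ : ContMDiff 𝓘(ℝ, ℝ) 𝓘(ℝ, E) ∞ γ)
    (hadd : ∀ s t, γ (s + t) = γ s * γ t) (W : E) (t : ℝ) :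
    HasDerivAt (fun t ↦ adj ℝ E (γ t) W) (lieB ℝ G (tder ℝ ℝ E γ 0 1) (adj ℝ E (γ t) W)) t := by
  obtain ⟨h1, h2⟩ := fderiv_adj_inv (k := γ) (x := -t) (Eventually.of_forall fun y ↦ hγ y) W
  have h3 := h1.hasFDerivAt.hasDerivAt.scomp t (hasDerivAt_neg t)
  have h4 : ((fun t ↦ adj ℝ E (γ t)⁻¹ W) ∘ Neg.neg) = fun t ↦ adj ℝ E (γ t) W := by
    funext t
    simp [oneParam_neg hadd]
  rw [h4] at h3
  refine h3.congr_deriv ?_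
  rw [h2, mc_oneParam hγ hadd]
  simp [oneParam_neg hadd]

variable (𝕜 : Type*) [RCLike 𝕜] {F : Type*} [NormedAddCommGroup F] [NormedSpace 𝕜 F]
  {H : Type*} [TopologicalSpace H] [ChartedSpace F H] [Group H] [LieGroup 𝓘(𝕜, F) ∞ H]

variable (H) in
/-- The adjoint representation of the Lie algebra. -/
def adL (Z : F) : F →L[𝕜] F :=
  fderiv 𝕜 (leftFrame 𝕜 F H) (oneChart F H) Z -
    (fderiv 𝕜 (leftFrame 𝕜 F H) (oneChart F H)).flip Z

theorem adL_apply (Z W : F) : adL 𝕜 H Z W = lieB 𝕜 H Z W := by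
  rw [lieB_eq_frameDeriv]; rfl

theorem lieB_add_left (a b c : F) : lieB 𝕜 H (a + b) c = lieB 𝕜 H a c + lieB 𝕜 H b c := by
  simp only [lieB_eq_frameDeriv, frameDeriv, map_add, add_apply]
  abel

theorem lieB_add_right (a b c : F) : lieB 𝕜 H a (b + c) = lieB 𝕜 H a b + lieB 𝕜 H a c := by
  simp only [← adL_apply, map_add]

theorem lieB_smul_left (r : 𝕜) (a b : F) : lieB 𝕜 H (r • a) b = r • lieB 𝕜 H a b := by
  simp only [lieB_eq_frameDeriv, frameDeriv, map_smul, smul_apply, smul_sub]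

theorem lieB_smul_right (r : 𝕜) (a b : F) : lieB 𝕜 H a (r • b) = r • lieB 𝕜 H a b := by
  simp only [← adL_apply, map_smul]

theorem lieB_skew (a b : F) : lieB 𝕜 H a b = -lieB 𝕜 H b a := by
  simp only [lieB_eq_frameDeriv, neg_sub]

variable {𝕜}

theorem eq_zero_of_linear_ode {f : ℝ → E} {L : E →L[ℝ] E} (hf : ∀ t, HasDerivAt f (L (f t)) t)
    (h0 : f 0 = 0) (t : ℝ) : f t = 0 := by
  have := ODE_solution_unique_univ (v := fun _ x ↦ L x) (s := fun _ ↦ Set.univ) (K := ‖L‖₊)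
    (t₀ := 0) (f := f) (g := fun _ ↦ 0) (fun _ ↦ L.lipschitz.lipschitzOnWith)
    (fun t ↦ ⟨hf t, trivial⟩) (fun t ↦ ⟨by simpa using hasDerivAt_const t (0 : E), trivial⟩) h0
  exact congrFun this t

/-- If `ad Z` commutes with `T`, so does the adjoint action of the one-parameter subgroup
of `Z`. -/
theorem adj_comm_of_lieB_comm (hγ : ContMDiff 𝓘(ℝ, ℝ) 𝓘(ℝ, E) ∞ γ)
    (hadd : ∀ s t, γ (s + t) = γ s * γ t) {T : E →L[ℝ] E}
    (hT : ∀ W, lieB ℝ G (tder ℝ ℝ E γ 0 1) (T W) = T (lieB ℝ G (tder ℝ ℝ E γ 0 1) W))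
    (W : E) (t : ℝ) : adj ℝ E (γ t) (T W) = T (adj ℝ E (γ t) W) := by
  have hd : ∀ t, HasDerivAt (fun t ↦ adj ℝ E (γ t) (T W) - T (adj ℝ E (γ t) W))
      (adL ℝ G (tder ℝ ℝ E γ 0 1) (adj ℝ E (γ t) (T W) - T (adj ℝ E (γ t) W))) t := by
    intro t
    refine ((hasDerivAt_adj hγ hadd (T W) t).sub
      (T.hasFDerivAt.comp_hasDerivAt t (hasDerivAt_adj hγ hadd W t))).congr_deriv ?_
    rw [map_sub, adL_apply, adL_apply, hT]
  have := eq_zero_of_linear_ode hd (by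
    rw [oneParam_zero hadd, adj_one]; simp) t
  exact sub_eq_zero.mp this

/-- On eigenvectors of `ad Z`, the adjoint action of the one-parameter subgroup of `Z` is the
exponential of the eigenvalue. -/
theorem adj_eigenvector (hγ : ContMDiff 𝓘(ℝ, ℝ) 𝓘(ℝ, E) ∞ γ)
    (hadd : ∀ s t, γ (s + t) = γ s * γ t) {W : E} {μ : ℝ}
    (hW : lieB ℝ G (tder ℝ ℝ E γ 0 1) W = μ • W) (t : ℝ) :
    adj ℝ E (γ t) W = Real.exp (t * μ) • W := by
  have hd : ∀ t, HasDerivAt (fun t ↦ adj ℝ E (γ t) W - Real.exp (t * μ) • W)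
      (adL ℝ G (tder ℝ ℝ E γ 0 1) (adj ℝ E (γ t) W - Real.exp (t * μ) • W)) t := by
    intro t
    have h1 : HasDerivAt (fun t : ℝ ↦ Real.exp (t * μ)) (Real.exp (t * μ) * μ) t := by
      simpa using ((hasDerivAt_id t).mul_const μ).exp
    refine ((hasDerivAt_adj hγ hadd W t).sub (h1.smul_const W)).congr_deriv ?_
    rw [map_sub, adL_apply, map_smul, adL_apply, hW, smul_smul]
  have := eq_zero_of_linear_ode hd (by rw [oneParam_zero hadd, adj_one]; simp) t
  exact sub_eq_zero.mp this

end OneParameter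

/-! ### Complex Lie groups as real Lie groups -/

section RealComplex

variable {N N' : Type*} [NormedAddCommGroup N] [NormedSpace ℂ N] [NormedAddCommGroup N']
  [NormedSpace ℂ N'] {M M' : Type*} [TopologicalSpace M] [ChartedSpace N M] [TopologicalSpace M']
  [ChartedSpace N' M']

theorem _root_.ContMDiffAt.restrictReal {n : WithTop ℕ∞} {f : M → M'} {x : M}
    (hf : ContMDiffAt 𝓘(ℂ, N) 𝓘(ℂ, N') n f x) : ContMDiffAt 𝓘(ℝ, N) 𝓘(ℝ, N') n f x := by
  rw [contMDiffAt_iff] at hf ⊢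
  exact ⟨hf.1, hf.2.restrict_scalars ℝ⟩

theorem _root_.MDifferentiableAt.restrictReal {f : M → M'} {x : M}
    (hf : MDifferentiableAt 𝓘(ℂ, N) 𝓘(ℂ, N') f x) : MDifferentiableAt 𝓘(ℝ, N) 𝓘(ℝ, N') f x := by
  rw [mdifferentiableAt_iff] at hf ⊢
  exact ⟨hf.1, hf.2.restrictScalars ℝ⟩

theorem tder_real_apply {f : M → M'} {x : M} (hf : MDifferentiableAt 𝓘(ℂ, N) 𝓘(ℂ, N') f x)
    (v : N) : tder ℝ N N' f x v = tder ℂ N N' f x v := by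
  have h : DifferentiableAt ℂ (fun y ↦ chartAt N' (f x) (f ((chartAt N x).symm y)))
      (chartAt N x x) := by
    have := hf.differentiableWithinAt_writtenInExtChartAt
    simpa [writtenInExtChartAt, extChartAt, Function.comp_def, differentiableWithinAt_univ] using this
  rw [tder_eq_fderiv_charts hf, tder_eq_fderiv_charts hf.restrictReal,
    h.fderiv_restrictScalars ℝ]
  rfl

theorem isManifold_real [IsManifold 𝓘(ℂ, N) ω M] : IsManifold 𝓘(ℝ, N) ∞ M := by
  refine isManifold_of_contDiffOn _ _ _ fun e e' he he' ↦ ?_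
  have := (mem_groupoid_of_pregroupoid.mp
    (HasGroupoid.compatible (G := contDiffGroupoid ω 𝓘(ℂ, N)) he he')).1
  exact (ContDiffOn.restrict_scalars ℝ this).of_le (by simp)

instance instLieGroupSmooth {GC : Type*} [TopologicalSpace GC] [ChartedSpace N GC] [Group GC]
    [LieGroup 𝓘(ℂ, N) ω GC] : LieGroup 𝓘(ℂ, N) ∞ GC := LieGroup.of_le (n := ω) (by simp)

instance instLieGroupReal {GC : Type*} [TopologicalSpace GC] [ChartedSpace N GC] [Group GC]
    [LieGroup 𝓘(ℂ, N) ω GC] : LieGroup 𝓘(ℝ, N) ∞ GC :=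
  { isManifold_real with
    contMDiff_mul := fun p ↦ by
      have := (contMDiff_mul 𝓘(ℂ, N) ω (G := GC)).contMDiffAt (x := p)
      rw [contMDiffAt_iff] at this ⊢
      exact ⟨this.1, (this.2.restrict_scalars ℝ).of_le (by simp)⟩
    contMDiff_inv := fun p ↦ ((contMDiff_inv 𝓘(ℂ, N) ω (G := GC)).contMDiffAt
      (x := p)).restrictReal.of_le (by simp) }

variable {GC : Type*} [TopologicalSpace GC] [ChartedSpace N GC] [Group GC]
    [LieGroup 𝓘(ℂ, N) ω GC]

theorem adj_real_apply (g : GC) (v : N) : adj ℝ N g v = adj ℂ N g v :=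
  tder_real_apply (mdiff_conj g 1) v

theorem leftFrame_real_apply {a : N} (ha : a ∈ (chartAt N (1 : GC)).target) (v : N) :
    leftFrame ℝ N GC a v = leftFrame ℂ N GC a v := by
  have h : DifferentiableAt ℂ (fun b ↦ mulChart N GC (a, b)) (oneChart N GC) :=
    ((contDiffAt_mulChart_one (𝕜 := ℂ) ha).differentiableAt (by simp)).comp _
      ((differentiableAt_const _).prodMk differentiableAt_id)
  rw [leftFrame, leftFrame, h.fderiv_restrictScalars ℝ]
  rfl

/-- Multiplication is holomorphic, so real and complex differentiation give the same frame and the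
same derivative of the frame. -/
theorem lieB_real (v w : N) : lieB ℝ GC v w = lieB ℂ GC v w := by
  have h (w v : N) : fderiv ℝ (fun a ↦ leftFrame ℝ N GC a w) (oneChart N GC) v =
      fderiv ℂ (fun a ↦ leftFrame ℂ N GC a w) (oneChart N GC) v := by
    have h1 : (fun a ↦ leftFrame ℝ N GC a w) =ᶠ[𝓝 (oneChart N GC)]
        fun a ↦ leftFrame ℂ N GC a w := by
      filter_upwards [eventually_mem_target (E := N) (G := GC)] with a ha using
        leftFrame_real_apply ha w
    have h2 : DifferentiableAt ℂ (fun a ↦ leftFrame ℂ N GC a w) (oneChart N GC) :=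
      (differentiableAt_leftFrame (𝕜 := ℂ)).clm_apply (differentiableAt_const w)
    rw [h1.fderiv_eq, h2.fderiv_restrictScalars ℝ]
    rfl
  exact (groupLieAlgebra_bracket_eq (𝕜 := ℝ) (E := N) (G := GC) v w).trans
    ((congrArg₂ (· - ·) (h w v) (h v w)).trans
      (groupLieAlgebra_bracket_eq (𝕜 := ℂ) (E := N) (G := GC) v w).symm)

theorem mc_real_apply {s : M' → GC} {x : M'}
    (hs : MDifferentiableAt 𝓘(ℂ, N') 𝓘(ℂ, N) s x) (v : N') :
    mc ℝ N N' s x v = mc ℂ N N' s x v :=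
  tder_real_apply (mdiff_div hs _) v

end RealComplex

theorem _root_.ContMDiffAt.mdiff' {𝕜 N N' M M' : Type*} [RCLike 𝕜] [NormedAddCommGroup N]
    [NormedSpace 𝕜 N] [NormedAddCommGroup N'] [NormedSpace 𝕜 N'] [TopologicalSpace M]
    [ChartedSpace N M] [TopologicalSpace M'] [ChartedSpace N' M'] {f : M → M'} {x : M}
    (hf : ContMDiffAt 𝓘(𝕜, N) 𝓘(𝕜, N') ω f x) : MDifferentiableAt 𝓘(𝕜, N) 𝓘(𝕜, N') f x :=
  hf.mdifferentiableAt (by simp)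

/-! ### Holomorphic local sections of submersions -/

section LocalSection

variable {N V : Type*} [NormedAddCommGroup N] [NormedSpace ℂ N] [NormedAddCommGroup V]
  [NormedSpace ℂ V] [CompleteSpace N] [CompleteSpace V] {M X : Type*} [TopologicalSpace M] [ChartedSpace N M]
  [TopologicalSpace X] [ChartedSpace V X] [IsManifold 𝓘(ℂ, N) ω M] [IsManifold 𝓘(ℂ, V) ω X]

/-- A submersion has local sections with prescribed derivative. -/
theorem exists_local_section {q : M → X} (hq : ContMDiff 𝓘(ℂ, N) 𝓘(ℂ, V) ω q) (g : M)
    {R : V →L[ℂ] N} (hR : (tder ℂ N V q g).comp R = ContinuousLinearMap.id ℂ V) :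
    ∃ σ : X → M, σ (q g) = g ∧ tder ℂ V N σ (q g) = R ∧
      ∀ᶠ x in 𝓝 (q g), q (σ x) = x ∧ ContMDiffAt 𝓘(ℂ, V) 𝓘(ℂ, N) ω σ x := by
  set c := chartAt N g
  set d := chartAt V (q g)
  have hcs : ∀ {a}, a ∈ c.target → ContMDiffAt 𝓘(ℂ, N) 𝓘(ℂ, N) ω c.symm a := fun ha ↦
    (contMDiffOn_chart_symm (I := 𝓘(ℂ, N)) (n := ω) (x := g)).contMDiffAt
      (c.open_target.mem_nhds ha)
  have hds : ∀ {a}, a ∈ d.source → ContMDiffAt 𝓘(ℂ, V) 𝓘(ℂ, V) ω d a := fun ha ↦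
    (contMDiffOn_chart (I := 𝓘(ℂ, V)) (n := ω) (x := q g)).contMDiffAt
      (d.open_source.mem_nhds ha)
  -- The map `q` in charts, restricted to the slice through `g` in the directions of `R`. Its
  -- derivative is the identity by the choice of `R`, so the inverse function theorem applies.
  let ψ : V → V := fun y ↦ d (q (c.symm (c g + R y)))
  have hc0 : c g + R 0 = c g := by simp
  have hmem : ∀ᶠ y in 𝓝 (0 : V), c g + R y ∈ c.target := by
    have : Tendsto (fun y ↦ c g + R y) (𝓝 0) (𝓝 (c g)) := by
      have : Continuous fun y ↦ c g + R y := by fun_prop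
      simpa using this.tendsto 0
    exact this.eventually (c.open_target.mem_nhds (mem_chart_target N g))
  have hsl : ∀ y, c g + R y ∈ c.target →
      ContMDiffAt 𝓘(ℂ, V) 𝓘(ℂ, N) ω (fun y ↦ c.symm (c g + R y)) y := by
    intro y hy
    refine ContMDiffAt.comp (f := fun y ↦ c g + R y) y (hcs hy) ?_
    exact (contDiff_const.add R.contDiff).contMDiff.contMDiffAt
  have hmem0 : c g + R 0 ∈ c.target := by rw [hc0]; exact mem_chart_target N g
  have hval : c.symm (c g + R 0) = g := by rw [hc0]; exact c.left_inv (mem_chart_source N g)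
  have hψM : ContMDiffAt 𝓘(ℂ, V) 𝓘(ℂ, V) ω (fun y ↦ q (c.symm (c g + R y))) 0 :=
    (hq _).comp 0 (hsl 0 hmem0)
  have hψ : ContDiffAt ℂ ω ψ 0 := by
    refine contMDiffAt_iff_contDiffAt.mp ?_
    refine ContMDiffAt.comp (f := fun y ↦ q (c.symm (c g + R y))) (0 : V)
      (hds ?_) hψM
    rw [hval]; exact mem_chart_source V (q g)
  have hslD : tder ℂ V N (fun y ↦ c.symm (c g + R y)) 0 = R := by
    rw [tder_comp_of_eq (f := fun y ↦ c g + R y) (0 : V) hc0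
      (hcs (mem_chart_target N g)).mdiff'
      ((contDiff_const.add R.contDiff).contMDiff.contMDiffAt (n := ω)).mdiff',
      tder_chart_symm_self, tder_eq_fderiv, fderiv_const_add, R.fderiv]
    rfl
  have hder : fderiv ℂ ψ 0 = ContinuousLinearMap.id ℂ V := by
    have h2 : tder ℂ V V (fun y ↦ q (c.symm (c g + R y))) 0 = ContinuousLinearMap.id ℂ V := by
      rw [tder_comp_of_eq (f := fun y ↦ c.symm (c g + R y)) (0 : V) hval (hq g).mdiff'
        (hsl 0 hmem0).mdiff', hslD, hR]
    rw [← tder_eq_fderiv]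
    refine (tder_comp_of_eq (f := fun y ↦ q (c.symm (c g + R y))) (g := d) (0 : V)
      (y := q g) (congrArg q hval) (hds (mem_chart_source V (q g))).mdiff'
      hψM.mdiff').trans ?_
    rw [h2, tder_chart_self]
    rfl
  have hψ' : HasFDerivAt ψ ((ContinuousLinearEquiv.refl ℂ V : V ≃L[ℂ] V) : V →L[ℂ] V) 0 := by
    have := (hψ.differentiableAt (by simp)).hasFDerivAt
    rwa [hder] at this
  set P := hψ.toOpenPartialHomeomorph ψ hψ' (by simp) with hP
  have hPψ : ∀ y, P y = ψ y := fun y ↦ rfl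
  have hψ0 : ψ 0 = d (q g) := by simp only [ψ]; rw [hval]
  have h0P : (0 : V) ∈ P.source := hψ.mem_toOpenPartialHomeomorph_source hψ' (by simp)
  have hinv : P.symm (d (q g)) = 0 := by
    rw [← hψ0, ← hPψ]; exact P.left_inv h0P
  have hinvS : ContDiffAt ℂ ω P.symm (d (q g)) := by
    have := hψ.to_localInverse hψ' (by simp)
    rwa [hψ0] at this
  have hmemT : d (q g) ∈ P.target := by rw [← hψ0, ← hPψ]; exact P.map_source h0P
  let σ : X → M := fun x ↦ c.symm (c g + R (P.symm (d x)))
  have hσ0 : σ (q g) = g := by simp only [σ]; rw [hinv, hval]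
  have hdx : ContMDiffAt 𝓘(ℂ, V) 𝓘(ℂ, V) ω d (q g) := hds (mem_chart_source V (q g))
  have hPd : ContMDiffAt 𝓘(ℂ, V) 𝓘(ℂ, V) ω (fun x ↦ P.symm (d x)) (q g) :=
    ContMDiffAt.comp (q g) hinvS.contMDiffAt hdx
  have hσS : ContMDiffAt 𝓘(ℂ, V) 𝓘(ℂ, N) ω σ (q g) := by
    refine ContMDiffAt.comp (f := fun x ↦ P.symm (d x)) (g := fun y ↦ c.symm (c g + R y))
      (q g) (hsl _ ?_) hPd
    rw [hinv]; exact hmem0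
  have hσe : ∀ᶠ x in 𝓝 (q g), ContMDiffAt 𝓘(ℂ, V) 𝓘(ℂ, N) ω σ x := by
    exact (contMDiffAt_iff_contMDiffAt_nhds (by simp)).mp hσS
  refine ⟨σ, hσ0, ?_, ?_⟩
  · have e1 : tder ℂ V N (fun y ↦ c.symm (c g + R y)) 0 = R := hslD
    have e2 : tder ℂ V V (fun x ↦ P.symm (d x)) (q g) = ContinuousLinearMap.id ℂ V := by
      have h1 : fderiv ℂ P.symm (d (q g)) = ContinuousLinearMap.id ℂ V := by
        have h2 : HasFDerivAt P ((ContinuousLinearEquiv.refl ℂ V : V ≃L[ℂ] V) : V →L[ℂ] V)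
            (P.symm (d (q g))) := by rw [hinv]; exact hψ'
        exact (P.hasFDerivAt_symm hmemT h2).fderiv
      rw [tder_comp (g := P.symm) (f := d) (q g)
        ((hinvS.differentiableAt (by simp)).mdifferentiableAt) hdx.mdiff', tder_eq_fderiv, h1,
        tder_chart_self]
      rfl
    refine (tder_comp_of_eq (f := fun x ↦ P.symm (d x)) (g := fun y ↦ c.symm (c g + R y))
      (q g) (y := 0) hinv (hsl 0 hmem0).mdiff' hPd.mdiff').trans ?_
    rw [e1, e2]
    rfl
  · have hd : ContinuousAt d (q g) := hdx.continuousAt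
    have e1 : ∀ᶠ x in 𝓝 (q g), x ∈ d.source := d.open_source.mem_nhds (mem_chart_source V (q g))
    have e2 : ∀ᶠ x in 𝓝 (q g), d x ∈ P.target := hd.eventually (P.open_target.mem_nhds hmemT)
    have e3 : ∀ᶠ x in 𝓝 (q g), q (σ x) ∈ d.source := by
      have : ContinuousAt (fun x ↦ q (σ x)) (q g) :=
        (hq.continuous.continuousAt).comp hσS.continuousAt
      refine this.eventually (d.open_source.mem_nhds ?_)
      simp only [hσ0]; exact mem_chart_source V (q g)
    filter_upwards [e1, e2, e3, hσe] with x h1 h2 h3 h4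
    exact ⟨d.injOn h3 h1 (P.right_inv h2), h4⟩

end LocalSection

/-! ### The complexified Lie algebra and complex linear extensions -/

section Complexification

variable {EG : Type*} [NormedAddCommGroup EG] [NormedSpace ℝ EG]
  {G : Type*} [TopologicalSpace G] [ChartedSpace EG G] [Group G]
  {E : Type*} [NormedAddCommGroup E] [NormedSpace ℂ E]
  {GC : Type*} [TopologicalSpace GC] [ChartedSpace E GC] [Group GC]
  {j : G →* GC}

variable (EG E) in
/-- The differential of `j` at `1`, as a map between model spaces. -/
def dH (j : G →* GC) : EG →L[ℝ] E := tder ℝ EG E j 1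

/-- The decomposition of the Lie algebra of the complexification into real and imaginary parts. -/
def realFormEquiv (hj : IsComplexification EG E j) : (EG × EG) ≃ₗ[ℝ] E :=
  LinearEquiv.ofBijective
    ((dH EG E j : EG →ₗ[ℝ] E).coprod (((LinearMap.lsmul ℂ E Complex.I).restrictScalars ℝ) ∘ₗ
      (dH EG E j : EG →ₗ[ℝ] E))) hj.realForm

theorem realFormEquiv_apply (hj : IsComplexification EG E j) (p : EG × EG) :
    realFormEquiv hj p = dH EG E j p.1 + Complex.I • dH EG E j p.2 := rfl

theorem exists_re_im (hj : IsComplexification EG E j) (Z : E) :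
    ∃ a b, Z = dH EG E j a + Complex.I • dH EG E j b :=
  ⟨((realFormEquiv hj).symm Z).1, ((realFormEquiv hj).symm Z).2,
    ((realFormEquiv hj).apply_symm_apply Z).symm⟩

theorem re_im_injective (hj : IsComplexification EG E j) {a b a' b' : EG}
    (h : dH EG E j a + Complex.I • dH EG E j b = dH EG E j a' + Complex.I • dH EG E j b') :
    a = a' ∧ b = b' :=
  Prod.ext_iff.mp ((realFormEquiv hj).injective (a₁ := (a, b)) (a₂ := (a', b')) h)

section Extension

variable {F : Type*} [AddCommGroup F] [Module ℂ F] [Module ℝ F] [IsScalarTower ℝ ℂ F]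

/-- The complex linear extension of a real linear map on the real form. -/
def cext (hj : IsComplexification EG E j) (f : EG →ₗ[ℝ] F) : E →ₗ[ℂ] F where
  toFun Z := f ((realFormEquiv hj).symm Z).1 + Complex.I • f ((realFormEquiv hj).symm Z).2
  map_add' Z W := by simp only [map_add, Prod.fst_add, Prod.snd_add, smul_add]; abel
  map_smul' c Z := by
    obtain ⟨a, b, rfl⟩ := exists_re_im hj Z
    have h1 : c • (dH EG E j a + Complex.I • dH EG E j b) =
        realFormEquiv hj (c.re • a - c.im • b, c.im • a + c.re • b) := by
      rw [realFormEquiv_apply]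
      simp only [map_sub, map_add, map_smul]
      conv_lhs => rw [← Complex.re_add_im c]
      simp only [← Complex.coe_smul]
      match_scalars <;> (ring_nf; try simp) <;> ring
    have h2 : dH EG E j a + Complex.I • dH EG E j b = realFormEquiv hj (a, b) := rfl
    rw [h1, h2, LinearEquiv.symm_apply_apply, LinearEquiv.symm_apply_apply]
    simp only [map_sub, map_add, map_smul, RingHom.id_apply]
    conv_rhs => rw [← Complex.re_add_im c]
    simp only [← algebraMap_smul ℂ (_ : ℝ) (_ : F), Complex.coe_algebraMap]
    match_scalars
    all_goals (ring_nf; try simp)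

theorem cext_re_im (hj : IsComplexification EG E j) (f : EG →ₗ[ℝ] F) (a b : EG) :
    cext hj f (dH EG E j a + Complex.I • dH EG E j b) = f a + Complex.I • f b := by
  have h2 : dH EG E j a + Complex.I • dH EG E j b = realFormEquiv hj (a, b) := rfl
  simp only [cext, LinearMap.coe_mk, AddHom.coe_mk]
  rw [h2, LinearEquiv.symm_apply_apply]

theorem cext_dH (hj : IsComplexification EG E j) (f : EG →ₗ[ℝ] F) (a : EG) :
    cext hj f (dH EG E j a) = f a := by
  simpa using cext_re_im hj f a 0

/-- The real form spans over `ℂ`. Identities for the involution, the form, the bracket and the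
adjoint action of `K` are inherited from `𝔤` in this way. -/
theorem linearMap_ext_dH (hj : IsComplexification EG E j) {L L' : E →ₗ[ℂ] F}
    (h : ∀ a, L (dH EG E j a) = L' (dH EG E j a)) : L = L' := by
  ext Z
  obtain ⟨a, b, rfl⟩ := exists_re_im hj Z
  simp [h]

end Extension

theorem bilin_ext_dH {F : Type*} [AddCommGroup F] [Module ℂ F]
    (hj : IsComplexification EG E j) {L L' : E →ₗ[ℂ] E →ₗ[ℂ] F}
    (h : ∀ a b, L (dH EG E j a) (dH EG E j b) = L' (dH EG E j a) (dH EG E j b)) : L = L' := by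
  refine LinearMap.ext fun Z ↦ LinearMap.ext fun W ↦ ?_
  obtain ⟨a, b, rfl⟩ := exists_re_im hj Z
  obtain ⟨c, d, rfl⟩ := exists_re_im hj W
  simp [h]

/-- The complex bilinear extension of a real bilinear form. -/
def formC (hj : IsComplexification EG E j) (ν : EG →ₗ[ℝ] EG →ₗ[ℝ] ℝ) : E →ₗ[ℂ] E →ₗ[ℂ] ℂ :=
  cext hj
    { toFun := fun a ↦ cext hj ((Complex.ofRealCLM : ℝ →ₗ[ℝ] ℂ) ∘ₗ ν a)
      map_add' := fun a b ↦ linearMap_ext_dH hj fun c ↦ by simp [cext_dH]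
      map_smul' := fun r a ↦ linearMap_ext_dH hj fun c ↦ by simp [cext_dH] }

theorem formC_dH (hj : IsComplexification EG E j) (ν : EG →ₗ[ℝ] EG →ₗ[ℝ] ℝ) (a b : EG) :
    formC hj ν (dH EG E j a) (dH EG E j b) = ν a b := by
  rw [formC, cext_dH]
  simp [cext_dH]

variable [LieGroup 𝓘(ℝ, EG) ∞ G]

/-- A bilinear form on the Lie algebra as a bilinear form on the model space. -/
def modelForm (ν : LinearMap.BilinForm ℝ (GroupLieAlgebra 𝓘(ℝ, EG) G)) : EG →ₗ[ℝ] EG →ₗ[ℝ] ℝ := ν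

/-- `Function.invFun` is the inverse of the linear bijection `realFormEquiv`, so the formula in real
and imaginary parts is the bilinear map `formC`, for which linear algebra is available. -/
theorem complexForm_eq (hj : IsComplexification EG E j)
    (ν : LinearMap.BilinForm ℝ (GroupLieAlgebra 𝓘(ℝ, EG) G)) (Z W : E) :
    complexForm j ν Z W = formC hj (modelForm ν) Z W := by
  have h : Function.invFun (fun p : GroupLieAlgebra 𝓘(ℝ, EG) G × GroupLieAlgebra 𝓘(ℝ, EG) G ↦
      dHom EG E j p.1 + Complex.I • dHom EG E j p.2) = fun Z ↦ (realFormEquiv hj).symm Z := by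
    funext Z
    refine (realFormEquiv hj).injective ?_
    rw [LinearEquiv.apply_symm_apply]
    exact Function.rightInverse_invFun hj.realForm.2 Z
  have h3 (Z W : E) : complexForm j ν Z W =
      ((modelForm ν ((realFormEquiv hj).symm Z).1 ((realFormEquiv hj).symm W).1 -
        modelForm ν ((realFormEquiv hj).symm Z).2 ((realFormEquiv hj).symm W).2 : ℝ) : ℂ) +
      ((modelForm ν ((realFormEquiv hj).symm Z).1 ((realFormEquiv hj).symm W).2 +
        modelForm ν ((realFormEquiv hj).symm Z).2 ((realFormEquiv hj).symm W).1 : ℝ) : ℂ) *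
      Complex.I := by
    simp only [complexForm]
    rw [h]
    rfl
  obtain ⟨a, b, rfl⟩ := exists_re_im hj Z
  obtain ⟨c, d, rfl⟩ := exists_re_im hj W
  have h2 (a b : EG) : (realFormEquiv hj).symm (dH EG E j a + Complex.I • dH EG E j b) = (a, b) :=
    (realFormEquiv hj).symm_apply_apply (a, b)
  rw [h3]
  simp only [h2, map_add, map_smul, LinearMap.add_apply, LinearMap.smul_apply, formC_dH]
  push_cast
  simp only [smul_eq_mul]
  linear_combination (-(modelForm ν b d : ℂ)) * Complex.I_mul_I

variable [LieGroup 𝓘(ℂ, E) ω GC]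

theorem dH_lieB [CompleteSpace EG] [CompleteSpace E] (hj : IsComplexification EG E j) (a b : EG) :
    dH EG E j (lieB ℝ G a b) = lieB ℂ GC (dH EG E j a) (dH EG E j b) := by
  rw [← lieB_real]
  exact tder_one_bracket (fun a b ↦ map_mul j a b)
    (Eventually.of_forall fun a ↦ hj.smooth.contMDiffAt) a b

theorem adj_dH (hj : IsComplexification EG E j) (g : G) (a : EG) :
    adj ℂ E (j g) (dH EG E j a) = dH EG E j (adj ℝ EG g a) := by
  rw [← adj_real_apply]
  have h1 := tder_comp_of_eq (𝕜 := ℝ) (g := j) (f := fun x : G ↦ g * x * g⁻¹) (1 : G) (y := 1)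
    (by simp) hj.smooth.contMDiffAt.mdiff (mdiff_conj g 1)
  have h2 := tder_comp_of_eq (𝕜 := ℝ) (g := fun x : GC ↦ j g * x * (j g)⁻¹) (f := j) (1 : G)
    (y := 1) (map_one j) (mdiff_conj (j g) 1) hj.smooth.contMDiffAt.mdiff
  have h3 : (fun y : G ↦ j (g * y * g⁻¹)) = fun y ↦ j g * j y * (j g)⁻¹ := by
    funext y; simp
  rw [h3] at h1
  exact DFunLike.congr_fun (h2.symm.trans h1) a

/-- The bracket of the complex Lie algebra as a bilinear map. -/
def lieC (E GC : Type*) [NormedAddCommGroup E] [NormedSpace ℂ E] [TopologicalSpace GC]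
    [ChartedSpace E GC] [Group GC] [LieGroup 𝓘(ℂ, E) ω GC] : E →ₗ[ℂ] E →ₗ[ℂ] E :=
  LinearMap.mk₂ ℂ (lieB ℂ GC) (lieB_add_left ℂ) (lieB_smul_left ℂ) (lieB_add_right ℂ)
    (fun c a b ↦ lieB_smul_right ℂ c a b)

theorem lieC_apply (Z W : E) : lieC E GC Z W = lieB ℂ GC Z W := rfl

end Complexification

/-! ### The Cartan involution and the invariant form on the real Lie algebra -/

section Involution

variable {EG : Type*} [NormedAddCommGroup EG] [NormedSpace ℝ EG] [CompleteSpace EG]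
  {G : Type*} [TopologicalSpace G] [ChartedSpace EG G] [Group G] [LieGroup 𝓘(ℝ, EG) ∞ G]
  {ν : LinearMap.BilinForm ℝ (GroupLieAlgebra 𝓘(ℝ, EG) G)}

namespace MaximalCompact

/-- The Cartan involution as a linear map of the model space. -/
def inv (M : MaximalCompact ν) : EG →ₗ[ℝ] EG where
  toFun a := M.θ a
  map_add' a b := map_add M.θ a b
  map_smul' c a := map_smul M.θ c a

variable (M : MaximalCompact ν)

theorem inv_inv (a : EG) : M.inv (M.inv a) = a := M.involutive a

theorem inv_lieB (a b : EG) : M.inv (lieB ℝ G a b) = lieB ℝ G (M.inv a) (M.inv b) :=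
  M.θ.map_lie a b

theorem form_inv_inv (a b : EG) : modelForm ν (M.inv a) (M.inv b) = modelForm ν a b :=
  M.invariant a b

theorem form_neg_inv_pos {a : EG} (ha : a ≠ 0) : 0 < modelForm ν a (-M.inv a) :=
  M.posDef a ha

theorem mem_K_iff (g : G) : g ∈ M.K ↔ ∀ a, adj ℝ EG g (M.inv a) = M.inv (adj ℝ EG g a) :=
  M.mem_iff g

end MaximalCompact

theorem modelForm_adj (hν : ∀ (g : G) a b, ν (Ad (𝕜 := ℝ) EG g a) (Ad (𝕜 := ℝ) EG g b) = ν a b)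
    (g : G) (a b : EG) : modelForm ν (adj ℝ EG g a) (adj ℝ EG g b) = modelForm ν a b :=
  hν g a b

theorem modelForm_symm (hν : ν.IsSymm) (a b : EG) : modelForm ν a b = modelForm ν b a :=
  hν.eq a b

/-- The derivative at `0` of the constant function `t ↦ ν(Ad(γ t) a, Ad(γ t) b)`, where `γ` is the
one-parameter subgroup of `Z`. -/
theorem modelForm_lieB [FiniteDimensional ℝ EG] [T2Space G]
    (hν : ∀ (g : G) a b, ν (Ad (𝕜 := ℝ) EG g a) (Ad (𝕜 := ℝ) EG g b) = ν a b) (Z a b : EG) :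
    modelForm ν (lieB ℝ G Z a) b + modelForm ν a (lieB ℝ G Z b) = 0 := by
  obtain ⟨γ, hγ, hadd, rfl⟩ := exists_oneParameterSubgroup (G := G) Z
  let B : EG →L[ℝ] EG →L[ℝ] ℝ := (modelForm ν).toContinuousBilinearMap
  have h1 := (B.hasFDerivAt (x := adj ℝ EG (γ 0) a)).comp_hasDerivAt (0 : ℝ)
    (hasDerivAt_adj hγ hadd a 0)
  have h2 := h1.clm_apply (hasDerivAt_adj hγ hadd b 0)
  have h3 : (fun t ↦ (B ∘ fun t ↦ adj ℝ EG (γ t) a) t (adj ℝ EG (γ t) b)) =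
      fun _ ↦ modelForm ν a b := by
    funext t
    exact modelForm_adj hν (γ t) a b
  rw [h3] at h2
  have h4 := h2.unique (hasDerivAt_const _ _)
  simp only [Function.comp_apply, oneParam_zero hadd, adj_one, ContinuousLinearMap.id_apply] at h4
  exact h4

theorem eq_zero_of_lieB_eq_zero
    (hG : LieAlgebra.IsSemisimple ℝ (GroupLieAlgebra 𝓘(ℝ, EG) G)) {a : EG}
    (ha : ∀ b, lieB ℝ G a b = 0) : a = 0 := by
  have key (a : GroupLieAlgebra 𝓘(ℝ, EG) G) (ha : ∀ b : GroupLieAlgebra 𝓘(ℝ, EG) G, ⁅a, b⁆ = 0) :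
      a = 0 := by
    have h : a ∈ LieAlgebra.center ℝ (GroupLieAlgebra 𝓘(ℝ, EG) G) := by
      rw [LieModule.mem_maxTrivSubmodule]
      intro b
      rw [← lie_skew, ha, neg_zero]
    rwa [LieAlgebra.center_eq_bot, LieSubmodule.mem_bot] at h
  exact key a ha

end Involution

/-! ### The complexified Cartan decomposition -/

section Cartan

variable {EG : Type*} [NormedAddCommGroup EG] [NormedSpace ℝ EG] [CompleteSpace EG]
  {G : Type*} [TopologicalSpace G] [ChartedSpace EG G] [Group G] [LieGroup 𝓘(ℝ, EG) ∞ G]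
  {ν : LinearMap.BilinForm ℝ (GroupLieAlgebra 𝓘(ℝ, EG) G)}
  {E : Type*} [NormedAddCommGroup E] [NormedSpace ℂ E]
  {GC : Type*} [TopologicalSpace GC] [ChartedSpace E GC] [Group GC] [LieGroup 𝓘(ℂ, E) ω GC]
  {j : G →* GC} (hj : IsComplexification EG E j) (M : MaximalCompact ν)

namespace MaximalCompact

/-- The complex linear extension of the Cartan involution. -/
def thetaC : E →ₗ[ℂ] E := cext hj ((dH EG E j : EG →ₗ[ℝ] E) ∘ₗ M.inv)

theorem thetaC_dH (a : EG) : M.thetaC hj (dH EG E j a) = dH EG E j (M.inv a) := by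
  rw [thetaC, cext_dH]; rfl

theorem thetaC_thetaC (Z : E) : M.thetaC hj (M.thetaC hj Z) = Z := by
  have : M.thetaC hj ∘ₗ M.thetaC hj = LinearMap.id := linearMap_ext_dH hj fun a ↦ by
    simp [thetaC_dH, inv_inv]
  exact LinearMap.congr_fun this Z

theorem thetaC_lieB [CompleteSpace E] (Z W : E) :
    M.thetaC hj (lieB ℂ GC Z W) = lieB ℂ GC (M.thetaC hj Z) (M.thetaC hj W) := by
  have : (lieC E GC).compr₂ (M.thetaC hj) = (lieC E GC).compl₁₂ (M.thetaC hj) (M.thetaC hj) := by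
    refine bilin_ext_dH hj fun a b ↦ ?_
    simp only [LinearMap.compr₂_apply, LinearMap.compl₁₂_apply, lieC_apply, thetaC_dH]
    rw [← dH_lieB hj, thetaC_dH, inv_lieB, dH_lieB hj]
  exact LinearMap.congr_fun₂ this Z W

theorem mem_kC_iff (Z : E) : Z ∈ M.kC E j ↔ M.thetaC hj Z = Z := by
  constructor
  · intro h
    have : M.kC E j ≤ LinearMap.eqLocus (M.thetaC hj) LinearMap.id := by
      have key (a : EG) (ha : M.inv a = a) : M.thetaC hj (dH EG E j a) = dH EG E j a := by
        rw [thetaC_dH, ha]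
      refine Submodule.span_le.mpr ?_
      rintro _ ⟨a, ha, rfl⟩
      exact key a ha
    exact this h
  · intro h
    obtain ⟨a, b, rfl⟩ := exists_re_im hj Z
    rw [map_add, map_smul, thetaC_dH, thetaC_dH] at h
    obtain ⟨ha, hb⟩ := re_im_injective hj h
    exact add_mem (Submodule.subset_span ⟨a, ha, rfl⟩)
      (Submodule.smul_mem _ _ (Submodule.subset_span ⟨b, hb, rfl⟩))

theorem mem_pC_iff (Z : E) : Z ∈ M.pC E j ↔ M.thetaC hj Z = -Z := by
  constructor
  · intro h
    have : M.pC E j ≤ LinearMap.eqLocus (M.thetaC hj) (-LinearMap.id) := by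
      have key (a : EG) (ha : M.inv a = -a) : M.thetaC hj (dH EG E j a) = -dH EG E j a := by
        rw [thetaC_dH, ha, map_neg]
      refine Submodule.span_le.mpr ?_
      rintro _ ⟨a, ha, rfl⟩
      exact key a ha
    exact this h
  · intro h
    obtain ⟨a, b, rfl⟩ := exists_re_im hj Z
    rw [map_add, map_smul, thetaC_dH, thetaC_dH, neg_add, ← smul_neg, ← map_neg, ← map_neg] at h
    obtain ⟨ha, hb⟩ := re_im_injective hj h
    exact add_mem (Submodule.subset_span ⟨a, ha, rfl⟩)
      (Submodule.smul_mem _ _ (Submodule.subset_span ⟨b, hb, rfl⟩))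

include hj in
theorem isCompl_kC_pC : IsCompl (M.kC E j) (M.pC E j) := by
  refine IsCompl.of_eq ?_ ?_
  · rw [Submodule.eq_bot_iff]
    rintro Z ⟨h1, h2⟩
    have h1 := (M.mem_kC_iff hj Z).mp h1
    rw [(M.mem_pC_iff hj Z).mp h2] at h1
    have h3 : (2 : ℂ) • Z = 0 := by rw [two_smul]; nth_rewrite 1 [← h1]; simp
    simpa using h3
  · rw [Submodule.eq_top_iff']
    intro Z
    refine Submodule.mem_sup.mpr ⟨(1 / 2 : ℂ) • (Z + M.thetaC hj Z), ?_,
      (1 / 2 : ℂ) • (Z - M.thetaC hj Z), ?_, ?_⟩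
    · rw [mem_kC_iff hj, map_smul, map_add, thetaC_thetaC, add_comm]
    · rw [mem_pC_iff hj, map_smul, map_sub, thetaC_thetaC, ← smul_neg, neg_sub]
    · module

include hj in
theorem lieB_kC_kC [CompleteSpace E] {Z W : E} (hZ : Z ∈ M.kC E j) (hW : W ∈ M.kC E j) :
    lieB ℂ GC Z W ∈ M.kC E j := by
  rw [mem_kC_iff hj] at hZ hW ⊢
  rw [thetaC_lieB, hZ, hW]

include hj in
theorem lieB_kC_pC [CompleteSpace E] {Z W : E} (hZ : Z ∈ M.kC E j) (hW : W ∈ M.pC E j) :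
    lieB ℂ GC Z W ∈ M.pC E j := by
  rw [mem_kC_iff hj] at hZ
  rw [mem_pC_iff hj] at hW ⊢
  rw [thetaC_lieB, hZ, hW, ← lieC_apply, map_neg, lieC_apply]

include hj in
theorem lieB_pC_pC [CompleteSpace E] {Z W : E} (hZ : Z ∈ M.pC E j) (hW : W ∈ M.pC E j) :
    lieB ℂ GC Z W ∈ M.kC E j := by
  rw [mem_pC_iff hj] at hZ hW
  rw [mem_kC_iff hj, thetaC_lieB, hZ, hW, ← lieC_apply, map_neg, map_neg, LinearMap.neg_apply,
    neg_neg, lieC_apply]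

/-- Nondegeneracy on `𝔭^ℂ`: pairing `Z = a + ib` with its conjugate `a - ib` has real part `ν(a,
-θa) + ν(b, -θb)`, which is positive. -/
theorem exists_form_ne_zero {Z : E} (hZ : Z ∈ M.pC E j) (h0 : Z ≠ 0) :
    ∃ W ∈ M.pC E j, formC hj (modelForm ν) Z W ≠ 0 := by
  rw [mem_pC_iff hj] at hZ
  obtain ⟨a, b, rfl⟩ := exists_re_im hj Z
  rw [map_add, map_smul, thetaC_dH, thetaC_dH, neg_add, ← smul_neg, ← map_neg, ← map_neg] at hZ
  obtain ⟨ha, hb⟩ := re_im_injective hj hZ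
  refine ⟨dH EG E j a - Complex.I • dH EG E j b, ?_, ?_⟩
  · rw [mem_pC_iff hj, map_sub, map_smul, thetaC_dH, thetaC_dH, ha, hb]
    simp only [map_neg, smul_neg]; abel
  · have h1 : formC hj (modelForm ν) (dH EG E j a + Complex.I • dH EG E j b)
        (dH EG E j a - Complex.I • dH EG E j b) =
        ((modelForm ν a (-M.inv a) + modelForm ν b (-M.inv b) : ℝ) : ℂ) +
          ((modelForm ν b a - modelForm ν a b : ℝ) : ℂ) * Complex.I := by
      rw [ha, hb]
      simp only [map_add, map_sub, map_smul, LinearMap.add_apply, LinearMap.smul_apply, formC_dH,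
        neg_neg, smul_eq_mul]
      push_cast
      linear_combination (-(modelForm ν b b : ℂ)) * Complex.I_mul_I
    rw [h1]
    intro h
    have h2 := congrArg Complex.re h
    simp only [Complex.add_re, Complex.ofReal_re, Complex.mul_re, Complex.I_re, mul_zero,
      Complex.ofReal_im, zero_mul, sub_zero, add_zero, Complex.zero_re] at h2
    have hpos : ∀ c : EG, 0 ≤ modelForm ν c (-M.inv c) := fun c ↦ by
      rcases eq_or_ne c 0 with rfl | hc
      · simp
      · exact (M.form_neg_inv_pos hc).le
    have ha0 : a = 0 := by
      by_contra hne
      linarith [M.form_neg_inv_pos hne, hpos b]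
    have hb0 : b = 0 := by
      by_contra hne
      linarith [M.form_neg_inv_pos hne, hpos a]
    exact h0 (by simp [ha0, hb0])

end MaximalCompact

theorem formC_symm (hν : ν.IsSymm) (Z W : E) :
    formC hj (modelForm ν) Z W = formC hj (modelForm ν) W Z := by
  have : formC hj (modelForm ν) = (formC hj (modelForm ν)).flip := bilin_ext_dH hj fun a b ↦ by
    simp only [LinearMap.flip_apply, formC_dH, modelForm_symm hν a b]
  exact LinearMap.congr_fun₂ this Z W

/-- Infinitesimal invariance is complex linear in all three arguments, so the real case implies it.
-/
theorem formC_lieB [CompleteSpace E] [FiniteDimensional ℝ EG] [T2Space G]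
    (hν : ∀ (g : G) a b, ν (Ad (𝕜 := ℝ) EG g a) (Ad (𝕜 := ℝ) EG g b) = ν a b) (X Z W : E) :
    formC hj (modelForm ν) (lieB ℂ GC X Z) W + formC hj (modelForm ν) Z (lieB ℂ GC X W) = 0 := by
  obtain ⟨a, b, rfl⟩ := exists_re_im hj X
  have key (c : EG) : (formC hj (modelForm ν)).compl₁₂ (lieC E GC (dH EG E j c)) LinearMap.id +
      (formC hj (modelForm ν)).compl₁₂ LinearMap.id (lieC E GC (dH EG E j c)) = 0 := by
    refine bilin_ext_dH hj fun a b ↦ ?_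
    simp only [LinearMap.add_apply, LinearMap.compl₁₂_apply, lieC_apply, LinearMap.id_apply,
      ← dH_lieB hj, formC_dH, LinearMap.zero_apply]
    exact_mod_cast modelForm_lieB hν c a b
  have h1 := LinearMap.congr_fun₂ (key a) Z W
  have h2 := LinearMap.congr_fun₂ (key b) Z W
  simp only [LinearMap.add_apply, LinearMap.compl₁₂_apply, lieC_apply, LinearMap.id_apply,
    LinearMap.zero_apply] at h1 h2
  simp only [lieB_add_left, lieB_smul_left, map_add, map_smul, LinearMap.add_apply,
    LinearMap.smul_apply, smul_eq_mul]
  linear_combination h1 + Complex.I * h2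

theorem eq_zero_of_lieB_eq_zero_complex [CompleteSpace E] (hj : IsComplexification EG E j)
    (hG : LieAlgebra.IsSemisimple ℝ (GroupLieAlgebra 𝓘(ℝ, EG) G)) {Z : E}
    (hZ : ∀ W, lieB ℂ GC Z W = 0) : Z = 0 := by
  obtain ⟨a, b, rfl⟩ := exists_re_im hj Z
  have h (c : EG) : lieB ℝ G a c = 0 ∧ lieB ℝ G b c = 0 := by
    have := hZ (dH EG E j c)
    rw [lieB_add_left, lieB_smul_left, ← dH_lieB hj, ← dH_lieB hj] at this
    exact re_im_injective hj (this.trans (by simp))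
  rw [eq_zero_of_lieB_eq_zero hG fun c ↦ (h c).1, eq_zero_of_lieB_eq_zero hG fun c ↦ (h c).2]
  simp

end Cartan

/-! ### Action of `K^ℂ` on the decomposition; conjugation of maximal compact subgroups -/

section Isotropy

variable {EG : Type*} [NormedAddCommGroup EG] [NormedSpace ℝ EG] [CompleteSpace EG]
  {G : Type*} [TopologicalSpace G] [ChartedSpace EG G] [Group G] [LieGroup 𝓘(ℝ, EG) ∞ G]
  {ν : LinearMap.BilinForm ℝ (GroupLieAlgebra 𝓘(ℝ, EG) G)}
  {E : Type*} [NormedAddCommGroup E] [NormedSpace ℂ E] [FiniteDimensional ℂ E]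
  {GC : Type*} [TopologicalSpace GC] [T2Space GC] [ChartedSpace E GC] [Group GC] [LieGroup 𝓘(ℂ, E) ω GC]
  {j : G →* GC} (hj : IsComplexification EG E j)

namespace MaximalCompact

section Projections

variable (M : MaximalCompact ν)

/-- The projection to `𝔨 ⊗ ℂ`. -/
def prK : E →L[ℂ] E := LinearMap.toContinuousLinearMap ((1 / 2 : ℂ) • (LinearMap.id + M.thetaC hj))

/-- The projection to `𝔭 ⊗ ℂ`. -/
def prP : E →L[ℂ] E := LinearMap.toContinuousLinearMap ((1 / 2 : ℂ) • (LinearMap.id - M.thetaC hj))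

theorem prK_apply (Z : E) : M.prK hj Z = (1 / 2 : ℂ) • (Z + M.thetaC hj Z) := rfl

theorem prP_apply (Z : E) : M.prP hj Z = (1 / 2 : ℂ) • (Z - M.thetaC hj Z) := rfl

theorem prK_add_prP (Z : E) : M.prK hj Z + M.prP hj Z = Z := by
  rw [prK_apply, prP_apply]; module

theorem prK_mem (Z : E) : M.prK hj Z ∈ M.kC E j := by
  rw [mem_kC_iff hj, prK_apply, map_smul, map_add, thetaC_thetaC, add_comm]

theorem prP_mem (Z : E) : M.prP hj Z ∈ M.pC E j := by
  rw [mem_pC_iff hj, prP_apply, map_smul, map_sub, thetaC_thetaC, ← smul_neg, neg_sub]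

theorem prK_of_mem_kC {Z : E} (h : Z ∈ M.kC E j) : M.prK hj Z = Z := by
  rw [prK_apply, (M.mem_kC_iff hj Z).mp h]; module

theorem prP_of_mem_kC {Z : E} (h : Z ∈ M.kC E j) : M.prP hj Z = 0 := by
  rw [prP_apply, (M.mem_kC_iff hj Z).mp h]; module

theorem prP_of_mem_pC {Z : E} (h : Z ∈ M.pC E j) : M.prP hj Z = Z := by
  rw [prP_apply, (M.mem_pC_iff hj Z).mp h]; module

theorem prK_of_mem_pC {Z : E} (h : Z ∈ M.pC E j) : M.prK hj Z = 0 := by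
  rw [prK_apply, (M.mem_pC_iff hj Z).mp h]; module

end Projections

section Adjoint

variable (M : MaximalCompact ν)

/-- It is enough to look at generators. Elements of `K` commute with `θ` by definition. For `θ a =
a` the operator `ad(ia)` commutes with the complex linear extension of `θ`, hence so does the
one-parameter group of `ia`. All invariance of `𝔨^ℂ` and `𝔭^ℂ` under `K^ℂ` rests on this. -/
theorem adj_thetaC_of_mem_KC {g : GC} (hg : g ∈ M.KC E j) (Z : E) :
    adj ℂ E g (M.thetaC hj Z) = M.thetaC hj (adj ℂ E g Z) := by
  have : CompleteSpace E := FiniteDimensional.complete ℂ E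
  induction hg using Subgroup.closure_induction generalizing Z with
  | mem g hg =>
    rcases hg with ⟨k, hk, rfl⟩ | ⟨γ, hγ, hadd, ⟨(a : EG), ha, hv⟩, rfl⟩
    · have : (adj ℂ E (j k) : E →ₗ[ℂ] E) ∘ₗ M.thetaC hj = M.thetaC hj ∘ₗ (adj ℂ E (j k) : E →ₗ[ℂ] E) := by
        refine linearMap_ext_dH hj fun a ↦ ?_
        simp only [LinearMap.comp_apply, ContinuousLinearMap.coe_coe, thetaC_dH, adj_dH hj]
        rw [(M.mem_K_iff k).mp hk]
      exact LinearMap.congr_fun this Z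
    · have hv' : tder ℝ ℝ E γ 0 1 = Complex.I • dH EG E j a := hv
      have ha' : M.inv a = a := ha
      have h1 := adj_comm_of_lieB_comm hγ hadd
        (T := (LinearMap.toContinuousLinearMap (M.thetaC hj)).restrictScalars ℝ) (fun W ↦ ?_) Z 1
      · rw [← adj_real_apply, ← adj_real_apply]
        exact h1
      · simp only [ContinuousLinearMap.coe_restrictScalars', LinearMap.coe_toContinuousLinearMap']
        rw [hv', lieB_real, lieB_real, thetaC_lieB, map_smul, thetaC_dH, ha']
  | one => simp [adj_one]
  | mul g h _ _ hg hh => rw [adj_mul]; simp only [ContinuousLinearMap.comp_apply, hg, hh]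
  | inv g _ hg =>
    have h1 := hg (adj ℂ E g⁻¹ Z)
    rw [adj_adj_inv] at h1
    rw [← h1, adj_inv_adj]

/-- Again on generators: the real invariance gives the case of `K`, and along a one-parameter
subgroup the pairing has derivative zero by `formC_lieB`. -/
theorem formC_adj_of_mem_KC [FiniteDimensional ℝ EG] [T2Space G]
    (hν : ∀ (g : G) a b, ν (Ad (𝕜 := ℝ) EG g a) (Ad (𝕜 := ℝ) EG g b) = ν a b) {g : GC}
    (hg : g ∈ M.KC E j) (Z W : E) :
    formC hj (modelForm ν) (adj ℂ E g Z) (adj ℂ E g W) = formC hj (modelForm ν) Z W := by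
  have : CompleteSpace E := FiniteDimensional.complete ℂ E
  induction hg using Subgroup.closure_induction generalizing Z W with
  | mem g hg =>
    rcases hg with ⟨k, hk, rfl⟩ | ⟨γ, hγ, hadd, ⟨(a : EG), ha, hv⟩, rfl⟩
    · have : (formC hj (modelForm ν)).compl₁₂ (adj ℂ E (j k) : E →ₗ[ℂ] E)
          (adj ℂ E (j k) : E →ₗ[ℂ] E) = formC hj (modelForm ν) := by
        refine bilin_ext_dH hj fun a b ↦ ?_
        simp only [LinearMap.compl₁₂_apply, ContinuousLinearMap.coe_coe, adj_dH hj, formC_dH,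
          modelForm_adj hν]
      exact LinearMap.congr_fun₂ this Z W
    · let B : E →L[ℂ] E →L[ℂ] ℂ := (formC hj (modelForm ν)).toContinuousBilinearMap
      let B' : E →L[ℝ] E →L[ℝ] ℂ := (ContinuousLinearMap.restrictScalarsL ℂ E ℂ ℝ ℝ).comp
        (B.restrictScalars ℝ)
      have key (t : ℝ) : HasDerivAt (fun t ↦ formC hj (modelForm ν) (adj ℝ E (γ t) Z)
          (adj ℝ E (γ t) W)) 0 t := by
        have h1 := (B'.hasFDerivAt (x := adj ℝ E (γ t) Z)).comp_hasDerivAt t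
          (hasDerivAt_adj hγ hadd Z t)
        have h2 := h1.clm_apply (hasDerivAt_adj hγ hadd W t)
        have h3 := formC_lieB hj hν (tder ℝ ℝ E γ 0 1) (adj ℝ E (γ t) Z) (adj ℝ E (γ t) W)
        rw [← lieB_real, ← lieB_real] at h3
        exact h2.congr_deriv h3
      have h := is_const_of_deriv_eq_zero (fun t ↦ (key t).differentiableAt)
        (fun t ↦ (key t).deriv) 1 0
      simpa only [adj_real_apply, oneParam_zero hadd, adj_one, ContinuousLinearMap.id_apply] using h
  | one => simp [adj_one]
  | mul g h _ _ hg hh => rw [adj_mul]; simp only [ContinuousLinearMap.comp_apply, hg, hh]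
  | inv g _ hg =>
    have h1 := hg (adj ℂ E g⁻¹ Z) (adj ℂ E g⁻¹ W)
    rw [adj_adj_inv, adj_adj_inv] at h1
    exact h1.symm

include hj in
theorem adj_mem_kC {g : GC} (hg : g ∈ M.KC E j) {Z : E} (hZ : Z ∈ M.kC E j) :
    adj ℂ E g Z ∈ M.kC E j := by
  rw [mem_kC_iff hj] at hZ ⊢
  rw [← adj_thetaC_of_mem_KC hj M hg, hZ]

include hj in
theorem adj_mem_pC {g : GC} (hg : g ∈ M.KC E j) {Z : E} (hZ : Z ∈ M.pC E j) :
    adj ℂ E g Z ∈ M.pC E j := by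
  rw [mem_pC_iff hj] at hZ ⊢
  rw [← adj_thetaC_of_mem_KC hj M hg, hZ, map_neg]

theorem prK_adj {g : GC} (hg : g ∈ M.KC E j) (Z : E) :
    M.prK hj (adj ℂ E g Z) = adj ℂ E g (M.prK hj Z) := by
  rw [prK_apply, prK_apply, map_smul, map_add, adj_thetaC_of_mem_KC hj M hg]

theorem prP_adj {g : GC} (hg : g ∈ M.KC E j) (Z : E) :
    M.prP hj (adj ℂ E g Z) = adj ℂ E g (M.prP hj Z) := by
  rw [prP_apply, prP_apply, map_smul, map_sub, adj_thetaC_of_mem_KC hj M hg]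

/-- The generators of `K^ℂ` are values at time one only; the value at time `t` is the value at time
one of the reparametrised subgroup, whose direction is `t` times the original one. -/
theorem oneParam_mem_KC {γ : ℝ → GC} (hγ : ContMDiff 𝓘(ℝ, ℝ) 𝓘(ℝ, E) ∞ γ)
    (hadd : ∀ s t, γ (s + t) = γ s * γ t) {a : EG} (ha : M.inv a = a)
    (hv : tder ℝ ℝ E γ 0 1 = Complex.I • dH EG E j a) (t : ℝ) : γ t ∈ M.KC E j := by
  refine Subgroup.subset_closure (Or.inr ⟨fun s ↦ γ (t * s), ?_, fun r s ↦ ?_, ⟨t • a, ?_, ?_⟩, ?_⟩)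
  · exact hγ.comp (f := fun s ↦ t * s) (contDiff_const.mul contDiff_id).contMDiff
  · simp only [mul_add, hadd]
  · exact (map_smul M.inv t a).trans (by rw [ha])
  · have h1 : HasFDerivAt (fun s : ℝ ↦ t * s) (t • ContinuousLinearMap.id ℝ ℝ) 0 :=
      (hasFDerivAt_id 0).const_mul t
    have h2 := tder_comp_of_eq (𝕜 := ℝ) (g := γ) (f := fun s : ℝ ↦ t * s) (0 : ℝ) (mul_zero t)
      hγ.contMDiffAt.mdiff (contDiff_const.mul contDiff_id).contMDiff.contMDiffAt.mdiff
    rw [tder_eq_fderiv, h1.fderiv] at h2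
    have h3 : tder ℝ ℝ E (fun s ↦ γ (t * s)) 0 1 = Complex.I • dH EG E j (t • a) := by
      rw [h2, map_smul, smul_comm, ← hv]
      simp
    exact h3
  · simp

end Adjoint

section Conjugation

variable {M M' M'' : MaximalCompact ν} {h h' : G}

theorem ConjTo.inv_adj (hM : M.ConjTo M' h) (a : EG) :
    M'.inv (adj ℝ EG h a) = adj ℝ EG h (M.inv a) := hM.2 a

/-- The subgroup is determined by its involution, so the condition on involutions implies the one on
subgroups. -/
theorem conjTo_of_inv_adj (hM : ∀ a, M'.inv (adj ℝ EG h a) = adj ℝ EG h (M.inv a)) :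
    M.ConjTo M' h := by
  refine ⟨fun k ↦ ?_, hM⟩
  rw [mem_K_iff, mem_K_iff]
  simp only [adj_mul, ContinuousLinearMap.comp_apply]
  constructor
  · intro hk a
    obtain ⟨b, rfl⟩ : ∃ b, a = adj ℝ EG h b := ⟨_, (adj_adj_inv h a).symm⟩
    rw [hM, adj_inv_adj, adj_inv_adj, hk, hM]
  · intro hk a
    have := hk (adj ℝ EG h a)
    rw [hM, adj_inv_adj, adj_inv_adj, hM] at this
    simpa only [adj_inv_adj] using congrArg (adj ℝ EG h⁻¹) this

theorem ConjTo.refl (M : MaximalCompact ν) : M.ConjTo M 1 :=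
  conjTo_of_inv_adj fun a ↦ by simp [adj_one]

theorem ConjTo.symm (hM : M.ConjTo M' h) : M'.ConjTo M h⁻¹ :=
  conjTo_of_inv_adj fun a ↦ by
    have := hM.inv_adj (adj ℝ EG h⁻¹ a)
    rw [adj_adj_inv] at this
    rw [this, adj_inv_adj]

theorem ConjTo.trans (hM : M.ConjTo M' h) (hM' : M'.ConjTo M'' h') : M.ConjTo M'' (h' * h) :=
  conjTo_of_inv_adj fun a ↦ by
    simp only [adj_mul, ContinuousLinearMap.comp_apply, hM'.inv_adj, hM.inv_adj]

theorem ConjTo.mem_K (hM : M.ConjTo M h) : h ∈ M.K :=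
  (M.mem_K_iff h).mpr fun a ↦ (hM.inv_adj a).symm

theorem ConjTo.thetaC_adj (hM : M.ConjTo M' h) (Z : E) :
    M'.thetaC hj (adj ℂ E (j h) Z) = adj ℂ E (j h) (M.thetaC hj Z) := by
  have : M'.thetaC hj ∘ₗ (adj ℂ E (j h) : E →ₗ[ℂ] E) =
      (adj ℂ E (j h) : E →ₗ[ℂ] E) ∘ₗ M.thetaC hj := by
    refine linearMap_ext_dH hj fun a ↦ ?_
    simp only [LinearMap.comp_apply, ContinuousLinearMap.coe_coe, thetaC_dH, adj_dH hj]
    rw [hM.inv_adj]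
  exact LinearMap.congr_fun this Z

include hj in
theorem ConjTo.adj_mem_kC (hM : M.ConjTo M' h) {Z : E} (hZ : Z ∈ M.kC E j) :
    adj ℂ E (j h) Z ∈ M'.kC E j := by
  rw [mem_kC_iff hj] at hZ ⊢
  rw [hM.thetaC_adj hj, hZ]

include hj in
theorem ConjTo.adj_mem_pC (hM : M.ConjTo M' h) {Z : E} (hZ : Z ∈ M.pC E j) :
    adj ℂ E (j h) Z ∈ M'.pC E j := by
  rw [mem_pC_iff hj] at hZ ⊢
  rw [hM.thetaC_adj hj, hZ, map_neg]

theorem contMDiff_conj (g : GC) : ContMDiff 𝓘(ℝ, E) 𝓘(ℝ, E) ∞ fun x : GC ↦ g * x * g⁻¹ :=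
  (contMDiff_mul_right (I := 𝓘(ℝ, E)) (a := g⁻¹)).comp (contMDiff_mul_left (I := 𝓘(ℝ, E)) (a := g))

include hj in
theorem ConjTo.conj_mem_KC (hM : M.ConjTo M' h) {g : GC} (hg : g ∈ M.KC E j) :
    j h * g * (j h)⁻¹ ∈ M'.KC E j := by
  induction hg using Subgroup.closure_induction with
  | mem g hg =>
    rcases hg with ⟨k, hk, rfl⟩ | ⟨γ, hγ, hadd, ⟨(a : EG), ha, hv⟩, rfl⟩
    · refine Subgroup.subset_closure (Or.inl ⟨h * k * h⁻¹, (hM.1 k).mp hk, by simp⟩)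
    · refine Subgroup.subset_closure (Or.inr ⟨fun t ↦ j h * γ t * (j h)⁻¹, ?_, fun s t ↦ ?_,
        ⟨adj ℝ EG h a, ?_, ?_⟩, rfl⟩)
      · exact (contMDiff_conj (j h)).comp hγ
      · simp only [hadd]; group
      · have ha' : M.inv a = a := ha
        exact (hM.inv_adj a).trans (by rw [ha'])
      · have h1 := tder_comp_of_eq (𝕜 := ℝ) (g := fun x : GC ↦ j h * x * (j h)⁻¹) (f := γ) (0 : ℝ)
          (oneParam_zero hadd) (mdiff_conj (j h) 1) hγ.contMDiffAt.mdiff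
        have hv' : tder ℝ ℝ E γ 0 1 = Complex.I • dH EG E j a := hv
        have h2 : tder ℝ ℝ E (fun t ↦ j h * γ t * (j h)⁻¹) 0 1 =
            Complex.I • dH EG E j (adj ℝ EG h a) := by
          rw [h1, ContinuousLinearMap.comp_apply, hv', ← adj_dH hj, ← (adj ℂ E (j h)).map_smul]
          exact adj_real_apply _ _
        exact h2
  | one => simp
  | mul g g' _ _ hg hg' =>
    have := mul_mem hg hg'
    rwa [show j h * g * (j h)⁻¹ * (j h * g' * (j h)⁻¹) = j h * (g * g') * (j h)⁻¹ by group] at this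
  | inv g _ hg =>
    have := inv_mem hg
    rwa [show (j h * g * (j h)⁻¹)⁻¹ = j h * g⁻¹ * (j h)⁻¹ by group] at this

end Conjugation

end MaximalCompact

end Isotropy

/-! ### The homogeneous space: differentials of orbit maps and local lifts -/

section Quotient

variable {E : Type*} [NormedAddCommGroup E] [NormedSpace ℂ E] [FiniteDimensional ℂ E]
  {GC : Type*} [TopologicalSpace GC] [T2Space GC] [ChartedSpace E GC] [Group GC]
  [LieGroup 𝓘(ℂ, E) ω GC] {H : Subgroup GC}
  {V : Type*} [NormedAddCommGroup V] [NormedSpace ℂ V] [ChartedSpace V (GC ⧸ H)]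
  [IsManifold 𝓘(ℂ, V) ω (GC ⧸ H)]

variable (E V) in
/-- The quotient map of a homogeneous space is a holomorphic submersion. -/
structure IsHolomorphicQuotient (H : Subgroup GC) [ChartedSpace V (GC ⧸ H)] : Prop where
  smooth : ContMDiff 𝓘(ℂ, E) 𝓘(ℂ, V) ω (QuotientGroup.mk : GC → GC ⧸ H)
  submersion : ∀ g : GC, Function.Surjective
    (tder ℂ E V (QuotientGroup.mk : GC → GC ⧸ H) g)

variable (E V) in
/-- The differential at `1` of the orbit map `a ↦ g a H`. -/
def pr (H : Subgroup GC) [ChartedSpace V (GC ⧸ H)] (g : GC) : E →L[ℂ] V :=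
  tder ℂ E V (fun a : GC ↦ (QuotientGroup.mk (g * a) : GC ⧸ H)) 1

variable (hq : IsHolomorphicQuotient E V H)
include hq

theorem IsHolomorphicQuotient.finiteDimensional : FiniteDimensional ℂ V :=
  Module.Finite.of_surjective
    (tder ℂ E V (QuotientGroup.mk : GC → GC ⧸ H) 1 : E →ₗ[ℂ] V) (hq.submersion 1)

theorem IsHolomorphicQuotient.mdiff (g : GC) :
    MDifferentiableAt 𝓘(ℂ, E) 𝓘(ℂ, V) (QuotientGroup.mk : GC → GC ⧸ H) g :=
  (hq.smooth g).mdiff'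

theorem IsHolomorphicQuotient.mdiff_orbit (g a : GC) :
    MDifferentiableAt 𝓘(ℂ, E) 𝓘(ℂ, V) (fun a : GC ↦ (QuotientGroup.mk (g * a) : GC ⧸ H)) a :=
  (hq.mdiff (g * a)).comp a (contMDiff_mul_left (I := 𝓘(ℂ, E)) (n := ω) (a := g) a).mdiff'

theorem pr_eq (g : GC) : pr E V H g =
    (tder ℂ E V (QuotientGroup.mk : GC → GC ⧸ H) g).comp (tder ℂ E E (fun a ↦ g * a) 1) :=
  tder_comp_of_eq (f := fun a : GC ↦ g * a) (1 : GC) (mul_one g) (hq.mdiff g)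
    (contMDiff_mul_left (I := 𝓘(ℂ, E)) (n := ω) (a := g) 1).mdiff'

theorem pr_surjective (g : GC) : Function.Surjective (pr E V H g) := by
  rw [pr_eq hq]
  refine (hq.submersion g).comp ?_
  have h := tder_comp_of_eq (𝕜 := ℂ) (g := fun a : GC ↦ g * a) (f := fun a : GC ↦ g⁻¹ * a) g
    (y := 1) (by simp) (contMDiff_mul_left (I := 𝓘(ℂ, E)) (n := ω) (a := g) 1).mdiff'
    (contMDiff_mul_left (I := 𝓘(ℂ, E)) (n := ω) (a := g⁻¹) g).mdiff'
  simp only [mul_inv_cancel_left] at h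
  rw [tder_id] at h
  exact fun v ↦ ⟨_, (DFunLike.congr_fun h v).symm⟩

theorem exists_section_quotient (g : GC) {R : V →L[ℂ] E}
    (hR : (tder ℂ E V (QuotientGroup.mk : GC → GC ⧸ H) g).comp R = ContinuousLinearMap.id ℂ V) :
    ∃ σ : GC ⧸ H → GC, σ (QuotientGroup.mk g) = g ∧ tder ℂ V E σ (QuotientGroup.mk g) = R ∧
      ∀ᶠ x in 𝓝 (QuotientGroup.mk g : GC ⧸ H),
        QuotientGroup.mk (σ x) = x ∧ ContMDiffAt 𝓘(ℂ, V) 𝓘(ℂ, E) ω σ x := by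
  have := hq.finiteDimensional
  have : CompleteSpace E := FiniteDimensional.complete ℂ E
  have : CompleteSpace V := FiniteDimensional.complete ℂ V
  exact exists_local_section hq.smooth g hR

theorem exists_section_quotient' (g : GC) :
    ∃ σ : GC ⧸ H → GC, σ (QuotientGroup.mk g) = g ∧
      ∀ᶠ x in 𝓝 (QuotientGroup.mk g : GC ⧸ H),
        QuotientGroup.mk (σ x) = x ∧ ContMDiffAt 𝓘(ℂ, V) 𝓘(ℂ, E) ω σ x := by
  have := hq.finiteDimensional
  obtain ⟨R, hR⟩ := (tder ℂ E V (QuotientGroup.mk : GC → GC ⧸ H) g :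
    E →ₗ[ℂ] V).exists_rightInverse_of_surjective (LinearMap.range_eq_top.mpr (hq.submersion g))
  obtain ⟨σ, h1, -, h2⟩ := exists_section_quotient hq g (R := LinearMap.toContinuousLinearMap R)
    (ContinuousLinearMap.ext fun v ↦ LinearMap.congr_fun hR v)
  exact ⟨σ, h1, h2⟩

/-- Locally `g • x = [g σ(x)]` for a holomorphic section `σ`. -/
theorem contMDiff_smul_quotient (g : GC) :
    ContMDiff 𝓘(ℂ, V) 𝓘(ℂ, V) ω (fun x : GC ⧸ H ↦ g • x) := by
  intro x
  induction x using QuotientGroup.induction_on with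
  | H a =>
    obtain ⟨σ, h1, h2⟩ := exists_section_quotient' hq a
    have e : (fun x : GC ⧸ H ↦ g • x) =ᶠ[𝓝 (QuotientGroup.mk a)]
        fun x ↦ QuotientGroup.mk (g * σ x) := by
      filter_upwards [h2] with x hx
      nth_rewrite 1 [← hx.1]
      rfl
    refine ContMDiffAt.congr_of_eventuallyEq ?_ e
    refine ContMDiffAt.comp (f := fun x ↦ g * σ x) _ (hq.smooth _) ?_
    exact ContMDiffAt.comp (g := fun y ↦ g * y) (f := σ) _
      (contMDiff_mul_left (I := 𝓘(ℂ, E)) (a := g) _) h2.self_of_nhds.2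

theorem pr_mul_left (g g' : GC) : pr E V H (g' * g) =
    (tder ℂ V V (fun x : GC ⧸ H ↦ g' • x) (QuotientGroup.mk g)).comp (pr E V H g) := by
  have h := tder_comp_of_eq (𝕜 := ℂ) (g := fun x : GC ⧸ H ↦ g' • x)
    (f := fun a : GC ↦ (QuotientGroup.mk (g * a) : GC ⧸ H)) (1 : GC) (y := QuotientGroup.mk g)
    (by simp) (contMDiff_smul_quotient hq g' _).mdiff' (hq.mdiff_orbit g 1)
  refine Eq.trans ?_ h
  simp only [pr, mul_assoc]
  rfl

theorem pr_eq_zero_iff (g : GC) (Z : E) : pr E V H g Z = 0 ↔ pr E V H 1 Z = 0 := by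
  constructor <;> intro h
  · have := pr_mul_left hq g g⁻¹
    rw [inv_mul_cancel] at this
    rw [this, ContinuousLinearMap.comp_apply, h, map_zero]
  · have := pr_mul_left hq 1 g
    rw [mul_one] at this
    rw [this, ContinuousLinearMap.comp_apply, h, map_zero]

/-- `[g k a] = [g (k a k⁻¹)]` for `k` in `H`. -/
theorem pr_mul_right (g : GC) {k : GC} (hk : k ∈ H) (Z : E) :
    pr E V H (g * k) Z = pr E V H g (adj ℂ E k Z) := by
  have h := tder_comp_of_eq (𝕜 := ℂ) (g := fun a : GC ↦ (QuotientGroup.mk (g * a) : GC ⧸ H))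
    (f := fun a : GC ↦ k * a * k⁻¹) (1 : GC) (y := 1) (by simp) (hq.mdiff_orbit g 1)
    (mdiff_conj k 1)
  refine (DFunLike.congr_fun ?_ Z).trans (DFunLike.congr_fun h Z)
  unfold pr
  congr 1
  funext a
  rw [QuotientGroup.eq]
  have : (g * k * a)⁻¹ * (g * (k * a * k⁻¹)) = k⁻¹ := by group
  rw [this]
  exact inv_mem hk

section Curve

variable {N : Type*} [NormedAddCommGroup N] [NormedSpace ℝ N] {Q : Type*} [TopologicalSpace Q]
  [ChartedSpace N Q]

/-- The differential of `[s]` depends on `s` only through its value and its Maurer-Cartan form,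
since left translations descend to the quotient. -/
theorem tder_mk_comp {s : Q → GC} {x : Q} (hs : MDifferentiableAt 𝓘(ℝ, N) 𝓘(ℝ, E) s x) (v : N) :
    tder ℝ N V (fun y ↦ (QuotientGroup.mk (s y) : GC ⧸ H)) x v =
      pr E V H (s x) (mc ℝ E N s x v) := by
  have h := tder_comp_of_eq (𝕜 := ℝ)
    (g := fun a : GC ↦ (QuotientGroup.mk (s x * a) : GC ⧸ H)) (f := fun y ↦ (s x)⁻¹ * s y) x
    (y := 1) (by simp) (hq.mdiff_orbit (s x) 1).restrictReal (mdiff_div hs _)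
  simp only [mul_inv_cancel_left] at h
  rw [h, ContinuousLinearMap.comp_apply, tder_real_apply (hq.mdiff_orbit (s x) 1)]
  rfl

theorem pr_mc_eq_zero {s : Q → GC} {x : Q} (hs : MDifferentiableAt 𝓘(ℝ, N) 𝓘(ℝ, E) s x)
    (h : ∀ᶠ y in 𝓝 x, s y ∈ H) (v : N) : pr E V H 1 (mc ℝ E N s x v) = 0 := by
  rw [← pr_eq_zero_iff hq (s x), ← tder_mk_comp hq hs]
  have : (fun y ↦ (QuotientGroup.mk (s y) : GC ⧸ H)) =ᶠ[𝓝 x] fun _ ↦ QuotientGroup.mk 1 := by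
    filter_upwards [h] with y hy
    rw [QuotientGroup.eq]
    simpa using inv_mem hy
  rw [tder_congr this, tder_const]
  rfl

theorem exists_local_lift {f : Q → GC ⧸ H} (hf : ContMDiff 𝓘(ℝ, N) 𝓘(ℝ, V) ∞ f) (x : Q) {g : GC}
    (hg : QuotientGroup.mk g = f x) : ∃ s : Q → GC, s x = g ∧
      ∀ᶠ y in 𝓝 x, QuotientGroup.mk (s y) = f y ∧ ContMDiffAt 𝓘(ℝ, N) 𝓘(ℝ, E) ∞ s y := by
  obtain ⟨σ, h1, h2⟩ := exists_section_quotient' hq g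
  refine ⟨fun y ↦ σ (f y), (congrArg σ hg.symm).trans h1, ?_⟩
  rw [hg] at h2
  filter_upwards [hf.continuous.continuousAt.eventually h2] with y hy
  refine ⟨hy.1, ContMDiffAt.comp (g := σ) (f := f) y ?_ (hf y)⟩
  exact hy.2.restrictReal.of_le (by simp)

end Curve

/-- One-parameter subgroups with velocity in the kernel of `pr 1` stay in `H`. -/
theorem oneParam_mem_of_pr_eq_zero {γ : ℝ → GC} (hγ : ContMDiff 𝓘(ℝ, ℝ) 𝓘(ℝ, E) ∞ γ)
    (hadd : ∀ s t, γ (s + t) = γ s * γ t) (h0 : pr E V H 1 (tder ℝ ℝ E γ 0 1) = 0) (t : ℝ) :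
    γ t ∈ H := by
  have : CompleteSpace E := FiniteDimensional.complete ℂ E
  have hm : IsManifold 𝓘(ℝ, V) ∞ (GC ⧸ H) := isManifold_real
  have hder (t : ℝ) : tder ℝ ℝ V (fun t ↦ (QuotientGroup.mk (γ t) : GC ⧸ H)) t = 0 := by
    ext
    rw [tder_mk_comp hq hγ.contMDiffAt.mdiff, mc_oneParam hγ hadd,
      (pr_eq_zero_iff hq _ _).mpr h0]
    rfl
  have hsm (t : ℝ) : ContMDiffAt 𝓘(ℝ, ℝ) 𝓘(ℝ, V) ∞ (fun t ↦ (QuotientGroup.mk (γ t) : GC ⧸ H)) t :=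
    ContMDiffAt.comp (f := γ) t ((hq.smooth _).restrictReal.of_le (by simp)) (hγ t)
  have hloc : IsLocallyConstant fun t ↦ (QuotientGroup.mk (γ t) : GC ⧸ H) := by
    rw [IsLocallyConstant.iff_eventually_eq]
    intro t
    set c := chartAt V (QuotientGroup.mk (γ t) : GC ⧸ H)
    have hsrc : ∀ᶠ s in 𝓝 t, (QuotientGroup.mk (γ s) : GC ⧸ H) ∈ c.source :=
      (hsm t).continuousAt.eventually (c.open_source.mem_nhds (mem_chart_source V _))
    have hmd : ∀ᶠ s in 𝓝 t, MDifferentiableAt 𝓘(ℝ, ℝ) 𝓘(ℝ, V)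
        (fun s ↦ c (QuotientGroup.mk (γ s))) s := by
      filter_upwards [hsrc] with s hs
      exact (ContMDiffAt.comp (g := c) s (contMDiffAt_chart hs) (hsm s)).mdiff
    have hc := eventually_eq_of_fderiv_eq_zero (f := fun s ↦ c (QuotientGroup.mk (γ s))) (x := t)
      (hmd.mono fun s hs ↦ hs.differentiableAt) (by
        filter_upwards [hsrc] with s hs
        rw [← tder_eq_fderiv]
        have := tder_comp (𝕜 := ℝ) (g := c) (f := fun s ↦ (QuotientGroup.mk (γ s) : GC ⧸ H)) s
          (contMDiffAt_chart hs).mdiff (hsm s).mdiff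
        rw [this, hder]
        simp)
    filter_upwards [hc, hsrc] with s h1 h2
    exact c.injOn h2 (mem_chart_source V _) h1
  have h1 := hloc.apply_eq_of_isPreconnected isPreconnected_univ (Set.mem_univ t)
    (Set.mem_univ (0 : ℝ))
  rw [oneParam_zero hadd] at h1
  have := QuotientGroup.eq.mp h1.symm
  simpa using this

end Quotient

/-! ### The Lie algebra of `K^ℂ` as a kernel -/

section Symmetric

variable {EG : Type*} [NormedAddCommGroup EG] [NormedSpace ℝ EG] [CompleteSpace EG]
  {G : Type*} [TopologicalSpace G] [ChartedSpace EG G] [Group G] [LieGroup 𝓘(ℝ, EG) ∞ G]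
  {ν : LinearMap.BilinForm ℝ (GroupLieAlgebra 𝓘(ℝ, EG) G)}
  {E : Type*} [NormedAddCommGroup E] [NormedSpace ℂ E] [FiniteDimensional ℂ E]
  {GC : Type*} [TopologicalSpace GC] [T2Space GC] [ChartedSpace E GC] [Group GC]
  [LieGroup 𝓘(ℂ, E) ω GC]
  {j : G →* GC} (hj : IsComplexification EG E j) {M : MaximalCompact ν}
  {V : Type*} [NormedAddCommGroup V] [NormedSpace ℂ V] [ChartedSpace V (GC ⧸ M.KC E j)]
  [IsManifold 𝓘(ℂ, V) ω (GC ⧸ M.KC E j)]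
  (hq : IsHolomorphicQuotient E V (M.KC E j))

include hq in
-- For `a` in `𝔨` the one-parameter subgroup of `ia` lies in `K^ℂ` by definition, so the
-- differential kills `ia`. Since it is complex linear, it kills `a`.
theorem pr_one_eq_zero_of_mem_kC {Z : E} (hZ : Z ∈ M.kC E j) : pr E V (M.KC E j) 1 Z = 0 := by
  have : CompleteSpace E := FiniteDimensional.complete ℂ E
  have key (a : EG) (ha : M.inv a = a) : pr E V (M.KC E j) 1 (dH EG E j a) = 0 := by
    obtain ⟨γ, hγ, hadd, hv⟩ := exists_oneParameterSubgroup (G := GC) (Complex.I • dH EG E j a)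
    have h1 := pr_mc_eq_zero hq (hγ.contMDiffAt (x := 0)).mdiff
      (Eventually.of_forall fun t ↦ M.oneParam_mem_KC hγ hadd ha hv t) 1
    rw [mc_oneParam hγ hadd, hv, map_smul] at h1
    exact (smul_eq_zero.mp h1).resolve_left Complex.I_ne_zero
  have : M.kC E j ≤ LinearMap.ker (pr E V (M.KC E j) 1 : E →ₗ[ℂ] V) := by
    refine Submodule.span_le.mpr ?_
    rintro _ ⟨a, ha, rfl⟩
    exact key a ha
  exact this hZ

include hq hj in
-- The one-parameter subgroup of `Z` stays in `K^ℂ`, whose adjoint action commutes with `θ`.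
-- Differentiation shows that `ad Z` commutes with `θ`, so `ad(Z - θZ) = 0`. Semisimplicity then
-- forces `Z = θZ`.
theorem mem_kC_of_pr_one_eq_zero
    (hG : LieAlgebra.IsSemisimple ℝ (GroupLieAlgebra 𝓘(ℝ, EG) G)) {Z : E}
    (hZ : pr E V (M.KC E j) 1 Z = 0) : Z ∈ M.kC E j := by
  have : CompleteSpace E := FiniteDimensional.complete ℂ E
  obtain ⟨γ, hγ, hadd, rfl⟩ := exists_oneParameterSubgroup (G := GC) Z
  have hmem := oneParam_mem_of_pr_eq_zero hq hγ hadd hZ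
  set X := tder ℝ ℝ E γ 0 1
  let T : E →L[ℝ] E := (LinearMap.toContinuousLinearMap (M.thetaC hj)).restrictScalars ℝ
  have hT (W : E) : T W = M.thetaC hj W := rfl
  have hcomm (W : E) : lieB ℂ GC X (M.thetaC hj W) = M.thetaC hj (lieB ℂ GC X W) := by
    have h1 := hasDerivAt_adj hγ hadd (T W) 0
    have h2 := T.hasFDerivAt.comp_hasDerivAt (0 : ℝ) (hasDerivAt_adj hγ hadd W 0)
    have e : (fun t ↦ adj ℝ E (γ t) (T W)) = (T ∘ fun t ↦ adj ℝ E (γ t) W) := by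
      funext t
      simp only [Function.comp_apply, hT, adj_real_apply]
      exact M.adj_thetaC_of_mem_KC hj (hmem t) W
    rw [e] at h1
    have h3 := h1.unique h2
    simpa only [oneParam_zero hadd, adj_one, ContinuousLinearMap.id_apply, hT, lieB_real] using h3
  rw [M.mem_kC_iff hj]
  have hz : X - M.thetaC hj X = 0 := by
    refine eq_zero_of_lieB_eq_zero_complex hj hG fun W ↦ ?_
    have h1 := hcomm (M.thetaC hj W)
    rw [M.thetaC_lieB, M.thetaC_thetaC] at h1
    rw [← lieC_apply, map_sub, LinearMap.sub_apply, lieC_apply, lieC_apply, h1, sub_self]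
  exact (sub_eq_zero.mp hz).symm

end Symmetric

/-! ### Spectral theorem, functional calculus, inner derivations -/

section Spectral

variable {W : Type*} [AddCommGroup W] [Module ℝ W] [FiniteDimensional ℝ W]

theorem exists_eigenbasis (B : W →ₗ[ℝ] W →ₗ[ℝ] ℝ) (hsymm : ∀ a b, B a b = B b a)
    (hpos : ∀ a, a ≠ 0 → 0 < B a a) (N : W →ₗ[ℝ] W) (hN : ∀ a b, B (N a) b = B a (N b)) :
    ∃ (b : Module.Basis (Fin (Module.finrank ℝ W)) ℝ W) (μ : Fin (Module.finrank ℝ W) → ℝ),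
      ∀ i, N (b i) = μ i • b i := by
  let core : InnerProductSpace.Core ℝ W :=
    { inner := fun a b ↦ B a b
      conj_inner_symm := fun a b ↦ by simpa using hsymm b a
      re_inner_nonneg := fun a ↦ by
        rcases eq_or_ne a 0 with rfl | h
        · simp
        · simpa using (hpos a h).le
      add_left := fun a b c ↦ by simp
      smul_left := fun a b r ↦ by simp
      definite := fun a h ↦ by
        by_contra hne
        exact (hpos a hne).ne' h }
  let _ : NormedAddCommGroup W := core.toNormedAddCommGroup
  let _ : InnerProductSpace ℝ W := InnerProductSpace.ofCore core.toCore
  have hsym : N.IsSymmetric := fun a b ↦ hN a b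
  exact ⟨(hsym.eigenvectorBasis rfl).toBasis, hsym.eigenvalues rfl, fun i ↦ by
    simp⟩

/-- The conclusion covers all eigenvectors, not only basis vectors, because it will be used on
brackets of basis vectors and on images of basis vectors under an involution. -/
theorem exists_functional_calculus {ι : Type*} [Finite ι] (b : Module.Basis ι ℝ W) {μ : ι → ℝ} {N : W →ₗ[ℝ] W}
    (hN : ∀ i, N (b i) = μ i • b i) (F : ℝ → ℝ) :
    ∃ D : W →ₗ[ℝ] W, ∀ (r : ℝ) (w : W), N w = r • w → D w = F r • w := by
  have := Fintype.ofFinite ι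
  have hcoord (g : ι → ℝ) (T : W →ₗ[ℝ] W) (hT : ∀ i, T (b i) = g i • b i) (w : W) (i : ι) :
      b.repr (T w) i = g i * b.repr w i := by
    conv_lhs => rw [← b.sum_repr w]
    simp only [map_sum, map_smul, hT, Finsupp.coe_finsetSum, Finset.sum_apply]
    simp only [Finsupp.smul_apply, b.repr_self, smul_eq_mul]
    rw [Finset.sum_eq_single i]
    · simp [mul_comm]
    · intro k _ hk
      simp [hk]
    · simp
  refine ⟨b.constr ℝ fun i ↦ F (μ i) • b i, fun r w hw ↦ b.repr.injective (Finsupp.ext fun i ↦ ?_)⟩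
  rw [hcoord (fun i ↦ F (μ i)) _ (fun i ↦ b.constr_basis ℝ _ i)]
  have h1 := hcoord μ N hN w i
  rw [hw, map_smul, Finsupp.smul_apply, smul_eq_mul] at h1
  rw [map_smul, Finsupp.smul_apply, smul_eq_mul]
  by_cases h0 : b.repr w i = 0
  · rw [h0, mul_zero, mul_zero]
  · rw [mul_right_cancel₀ h0 h1]

end Spectral

/-- In characteristic zero the Killing form of a semisimple Lie algebra is nondegenerate, so
derivations are inner. -/
theorem exists_lie_eq_of_derivation {L : Type*} [LieRing L] [LieAlgebra ℝ L]
    [FiniteDimensional ℝ L] [LieAlgebra.IsSemisimple ℝ L] {D : L →ₗ[ℝ] L}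
    (hD : ∀ a b, D ⁅a, b⁆ = ⁅D a, b⁆ + ⁅a, D b⁆) : ∃ X : L, ∀ a, D a = ⁅X, a⁆ := by
  have : LieAlgebra.IsKilling ℝ L := inferInstance
  let D' : LieDerivation ℝ L L :=
    { D with
      leibniz' := fun a b ↦ by
        have := hD a b
        rw [← lie_skew (D a) b] at this
        simpa [sub_eq_add_neg, add_comm] using this }
  obtain ⟨X, hX⟩ := LieDerivation.IsKilling.exists_eq_ad D'
  exact ⟨X, fun a ↦ by
    change D' a = _
    rw [← hX, LieDerivation.ad_apply_apply]⟩

/-! ### Conjugacy of Cartan involutions -/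

section Conjugacy

variable {EG : Type*} [NormedAddCommGroup EG] [NormedSpace ℝ EG] [CompleteSpace EG]
  [FiniteDimensional ℝ EG] {G : Type*} [TopologicalSpace G] [T2Space G] [ChartedSpace EG G] [Group G]
  [LieGroup 𝓘(ℝ, EG) ∞ G] {ν : LinearMap.BilinForm ℝ (GroupLieAlgebra 𝓘(ℝ, EG) G)}

/-- Any two maximal compact subgroups that belong to Cartan involutions are conjugate. -/
theorem MaximalCompact.exists_conjTo (hν : ν.IsSymm)
    (hG : LieAlgebra.IsSemisimple ℝ (GroupLieAlgebra 𝓘(ℝ, EG) G)) (M M' : MaximalCompact ν) :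
    ∃ h : G, M.ConjTo M' h := by
  -- `N = θ'θ` is self-adjoint and positive for the inner product `B(a, b) = ν(a, -θ'b)`. The
  -- conjugating element is found by taking the square root of `N` inside the adjoint group.
  let N : EG →ₗ[ℝ] EG := M'.inv ∘ₗ M.inv
  let B : EG →ₗ[ℝ] EG →ₗ[ℝ] ℝ := -((modelForm ν).compl₂ M'.inv)
  have hB (a b : EG) : B a b = modelForm ν a (-M'.inv b) := by simp [B]
  have hswap (M : MaximalCompact ν) (a b : EG) :
      modelForm ν a (M.inv b) = modelForm ν (M.inv a) b := by
    rw [← M.form_inv_inv, M.inv_inv]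
  have hNa (a : EG) : N a = M'.inv (M.inv a) := rfl
  obtain ⟨b, μ, hb⟩ := exists_eigenbasis B
    (fun a b ↦ by rw [hB, hB, map_neg, map_neg, hswap, modelForm_symm hν])
    (fun a ha ↦ by rw [hB]; exact M'.form_neg_inv_pos ha) N
    (fun a b ↦ by simp only [hB, hNa, map_neg, hswap M', M'.inv_inv, hswap M])
  have hpos (i) : 0 < μ i := by
    have h1 : B (N (b i)) (b i) = μ i * B (b i) (b i) := by rw [hb]; simp
    have h2 : 0 < B (N (b i)) (b i) := by
      rw [hB, hNa, map_neg, hswap, M'.inv_inv, ← hswap, ← map_neg]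
      exact M.form_neg_inv_pos (b.ne_zero i)
    have h3 : 0 < B (b i) (b i) := by rw [hB]; exact M'.form_neg_inv_pos (b.ne_zero i)
    rw [h1] at h2
    exact (pos_iff_pos_of_mul_pos h2).mpr h3
  have hbra (a b : EG) : N (lieB ℝ G a b) = lieB ℝ G (N a) (N b) := by
    simp only [hNa, MaximalCompact.inv_lieB]
  -- `D = log N`. Since `N` is an automorphism, the bracket of eigenvectors belongs to the product
  -- of the eigenvalues, and the logarithm makes `D` a derivation, hence `D = ad X`.
  obtain ⟨D, hD⟩ := exists_functional_calculus b hb Real.log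
  have hder (a c : EG) : D (lieB ℝ G a c) = lieB ℝ G (D a) c + lieB ℝ G a (D c) := by
    have hbil : (LinearMap.mk₂ ℝ (lieB ℝ G) (lieB_add_left ℝ) (lieB_smul_left ℝ) (lieB_add_right ℝ)
          (fun c a b ↦ lieB_smul_right ℝ c a b)).compr₂ D =
        (LinearMap.mk₂ ℝ (lieB ℝ G) (lieB_add_left ℝ) (lieB_smul_left ℝ) (lieB_add_right ℝ)
          (fun c a b ↦ lieB_smul_right ℝ c a b)).comp D +
        (LinearMap.mk₂ ℝ (lieB ℝ G) (lieB_add_left ℝ) (lieB_smul_left ℝ) (lieB_add_right ℝ)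
          (fun c a b ↦ lieB_smul_right ℝ c a b)).compl₂ D := by
      refine b.ext fun i ↦ b.ext fun k ↦ ?_
      simp only [LinearMap.compr₂_apply, LinearMap.add_apply, LinearMap.comp_apply,
        LinearMap.compl₂_apply, LinearMap.mk₂_apply]
      rw [hD (μ i) _ (hb i), hD (μ k) _ (hb k), hD (μ i * μ k), lieB_smul_left, lieB_smul_right,
        Real.log_mul (hpos i).ne' (hpos k).ne', add_smul]
      rw [hbra, hb, hb, lieB_smul_left, lieB_smul_right, smul_smul]
    exact LinearMap.congr_fun₂ hbil a c
  obtain ⟨X, hX⟩ : ∃ X : EG, ∀ a, D a = lieB ℝ G X a := by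
    have : FiniteDimensional ℝ (GroupLieAlgebra 𝓘(ℝ, EG) G) := inferInstanceAs (FiniteDimensional ℝ EG)
    exact exists_lie_eq_of_derivation (L := GroupLieAlgebra 𝓘(ℝ, EG) G) (D := D) hder
  obtain ⟨γ, hγ, hadd, rfl⟩ := exists_oneParameterSubgroup (G := G) X
  have hexp {w : EG} {r : ℝ} (hr : N w = r • w) :
      adj ℝ EG (γ (1 / 2)) w = Real.exp (1 / 2 * Real.log r) • w :=
    adj_eigenvector hγ hadd (by rw [← hX, hD r w hr]) (1 / 2)
  -- For `h = exp(X/2)` one has `Ad h = N^(1/2)`. As `θ` exchanges the eigenspaces of `N` for `μ`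
  -- and `μ⁻¹`, and `θ'b = μ⁻¹ θb` on the first, `θ'` after `N^(1/2)` equals `N^(1/2)` after `θ`.
  refine ⟨γ (1 / 2), conjTo_of_inv_adj fun a ↦ ?_⟩
  suffices h : M'.inv ∘ₗ (adj ℝ EG (γ (1 / 2)) : EG →ₗ[ℝ] EG) =
      (adj ℝ EG (γ (1 / 2)) : EG →ₗ[ℝ] EG) ∘ₗ M.inv from LinearMap.congr_fun h a
  refine b.ext fun i ↦ ?_
  simp only [LinearMap.comp_apply, ContinuousLinearMap.coe_coe]
  have h1 : M'.inv (b i) = (μ i)⁻¹ • M.inv (b i) := by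
    have := congrArg M'.inv (hb i)
    rw [hNa, M'.inv_inv, map_smul] at this
    rw [this, smul_smul, inv_mul_cancel₀ (hpos i).ne', one_smul]
  have h2 : N (M.inv (b i)) = (μ i)⁻¹ • M.inv (b i) := by
    rw [hNa, M.inv_inv, h1]
  rw [hexp h2, hexp (hb i), map_smul, h1, smul_smul, Real.log_inv]
  congr 1
  nth_rewrite 2 [← Real.exp_log (hpos i)]
  rw [← Real.exp_neg, ← Real.exp_add]
  congr 1
  ring

end Conjugacy

/-! ### Pointwise algebra of complex metrics `λ dz dw̄` -/

section MetricAlgebra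

variable {lam : ℂ} {Z W : Fin 2 → ℂ}

/-- `Z` and `W` are the components of `dz` and `dw̄`. The vectors `(W₁, -W₀)` and `(-Z₁, Z₀)` are
the dual frame up to the factor `Δ = Z₀W₁ - Z₁W₀`, and the inverse metric is their symmetric product
divided by `λΔ²`. -/
theorem conformal_inv (hlam : lam ≠ 0) (hΔ : Z 0 * W 1 - Z 1 * W 0 ≠ 0)
    {g : Matrix (Fin 2) (Fin 2) ℂ} (hg : ∀ i j, g i j = lam * (Z i * W j + W i * Z j)) :
    g⁻¹ = Matrix.of fun i j ↦ (![W 1, -W 0] i * ![-Z 1, Z 0] j + ![-Z 1, Z 0] i * ![W 1, -W 0] j) /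
      (lam * (Z 0 * W 1 - Z 1 * W 0) ^ 2) := by
  refine Matrix.inv_eq_left_inv ?_
  obtain ⟨Δ, hd⟩ : ∃ Δ, Δ = Z 0 * W 1 - Z 1 * W 0 := ⟨_, rfl⟩
  rw [← hd] at hΔ ⊢
  have hpos : lam * Δ ^ 2 ≠ 0 := mul_ne_zero hlam (pow_ne_zero 2 hΔ)
  ext i j
  simp only [Matrix.mul_apply, Fin.sum_univ_two, Matrix.of_apply, hg, div_mul_eq_mul_div, ← add_div]
  rw [div_eq_iff hpos]
  fin_cases i <;> fin_cases j <;> simp [hd] <;> ring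

/-- An isotropic coordinate is harmonic: with respect to `z`, `w̄` the inverse metric has only mixed
entries, whereas the Christoffel symbols with mixed lower indices vanish. In an arbitrary chart this
is an identity between the first derivatives `Z`, `W`, the second derivatives `ZZ`, `WW` and the
derivative `dl` of the conformal factor. -/
theorem laplacian_coordinate_eq_zero (hlam : lam ≠ 0) (hΔ : Z 0 * W 1 - Z 1 * W 0 ≠ 0)
    {g : Matrix (Fin 2) (Fin 2) ℂ} (hg : ∀ i j, g i j = lam * (Z i * W j + W i * Z j))
    {dl : Fin 2 → ℂ} {ZZ WW : Fin 2 → Fin 2 → ℂ} (hZ : ZZ 1 0 = ZZ 0 1) (hW : WW 1 0 = WW 0 1)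
    {dg : Fin 2 → Fin 2 → Fin 2 → ℂ}
    (hdg : ∀ i j l, dg i j l = dl l * (Z i * W j + W i * Z j) +
      lam * (ZZ l i * W j + Z i * WW l j + WW l i * Z j + W i * ZZ l j)) :
    ∑ i, ∑ j, g⁻¹ i j * (ZZ i j -
      ∑ k, (1 / 2 * ∑ l, g⁻¹ k l * (dg j l i + dg i l j - dg i j l)) * Z k) = 0 := by
  rw [conformal_inv hlam hΔ hg]
  simp only [Fin.sum_univ_two, Matrix.of_apply, hdg, hZ, hW, Matrix.cons_val_zero,
    Matrix.cons_val_one]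
  set Δ := Z 0 * W 1 - Z 1 * W 0 with hΔd
  have : lam * Δ ^ 2 ≠ 0 := mul_ne_zero hlam (pow_ne_zero 2 hΔ)
  field_simp
  rw [hΔd]
  ring

/-- The trace of `∇(a dz + b dw̄)`, with `na`, `nb` the covariant derivatives of `a`, `b`. The
Hessians of the coordinates drop out, contraction with `dz` or `dw̄` leaves the mixed derivatives,
and `hflat` makes the two contributions equal, whence the factor `2`. -/
theorem trace_second_derivative {F : Type*} [AddCommGroup F] [Module ℂ F] (hlam : lam ≠ 0)
    (hΔ : Z 0 * W 1 - Z 1 * W 0 ≠ 0) {g : Matrix (Fin 2) (Fin 2) ℂ}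
    (hg : ∀ i j, g i j = lam * (Z i * W j + W i * Z j))
    {dl : Fin 2 → ℂ} {ZZ WW : Fin 2 → Fin 2 → ℂ} (hZ : ZZ 1 0 = ZZ 0 1) (hW : WW 1 0 = WW 0 1)
    {dg : Fin 2 → Fin 2 → Fin 2 → ℂ}
    (hdg : ∀ i j l, dg i j l = dl l * (Z i * W j + W i * Z j) +
      lam * (ZZ l i * W j + Z i * WW l j + WW l i * Z j + W i * ZZ l j))
    {a b : F} {na nb : Fin 2 → F}
    (hflat : (Z 1 • na 0 - Z 0 • na 1) + (W 1 • nb 0 - W 0 • nb 1) = 0) :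
    ∑ i, ∑ j, g⁻¹ i j • (Z j • na i + ZZ i j • a + (W j • nb i + WW i j • b) -
      ∑ k, (1 / 2 * ∑ l, g⁻¹ k l * (dg j l i + dg i l j - dg i j l)) • (Z k • a + W k • b)) =
    (2 / (lam * (Z 0 * W 1 - Z 1 * W 0))) • (W 1 • nb 0 - W 0 • nb 1) := by
  have hΔ' : W 0 * Z 1 - W 1 * Z 0 ≠ 0 := fun h ↦ hΔ (by linear_combination -h)
  have e1 := laplacian_coordinate_eq_zero hlam hΔ hg hZ hW hdg
  have e2 := laplacian_coordinate_eq_zero (Z := W) (W := Z) hlam hΔ'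
    (fun i j ↦ (hg i j).trans (by ring)) hW hZ (fun i j l ↦ (hdg i j l).trans (by ring))
  set Γ : Fin 2 → Fin 2 → Fin 2 → ℂ := fun k i j ↦
    1 / 2 * ∑ l, g⁻¹ k l * (dg j l i + dg i l j - dg i j l) with hΓ
  change ∑ i, ∑ j, g⁻¹ i j * (ZZ i j - ∑ k, Γ k i j * Z k) = 0 at e1
  change ∑ i, ∑ j, g⁻¹ i j * (WW i j - ∑ k, Γ k i j * W k) = 0 at e2
  change ∑ i, ∑ j, g⁻¹ i j • (Z j • na i + ZZ i j • a + (W j • nb i + WW i j • b) -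
      ∑ k, Γ k i j • (Z k • a + W k • b)) = _
  have e3 : ∑ i, ∑ j, g⁻¹ i j • (Z j • na i + ZZ i j • a + (W j • nb i + WW i j • b) -
      ∑ k, Γ k i j • (Z k • a + W k • b)) =
      (∑ i, ∑ j, g⁻¹ i j * (ZZ i j - ∑ k, Γ k i j * Z k)) • a +
      (∑ i, ∑ j, g⁻¹ i j * (WW i j - ∑ k, Γ k i j * W k)) • b +
      ∑ i, ((∑ j, g⁻¹ i j * Z j) • na i + (∑ j, g⁻¹ i j * W j) • nb i) := by
    simp only [Fin.sum_univ_two]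
    module
  have e4 (i : Fin 2) : ∑ j, g⁻¹ i j * Z j =
      ![-Z 1, Z 0] i / (lam * (Z 0 * W 1 - Z 1 * W 0)) := by
    rw [conformal_inv hlam hΔ hg, eq_div_iff (mul_ne_zero hlam hΔ)]
    obtain ⟨Δ, hd⟩ : ∃ Δ, Δ = Z 0 * W 1 - Z 1 * W 0 := ⟨_, rfl⟩
    rw [← hd] at hΔ ⊢
    simp only [Fin.sum_univ_two, Matrix.of_apply, Matrix.cons_val_zero, Matrix.cons_val_one]
    field_simp
    rw [hd]; ring
  have e5 (i : Fin 2) : ∑ j, g⁻¹ i j * W j =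
      ![W 1, -W 0] i / (lam * (Z 0 * W 1 - Z 1 * W 0)) := by
    rw [conformal_inv hlam hΔ hg, eq_div_iff (mul_ne_zero hlam hΔ)]
    obtain ⟨Δ, hd⟩ : ∃ Δ, Δ = Z 0 * W 1 - Z 1 * W 0 := ⟨_, rfl⟩
    rw [← hd] at hΔ ⊢
    simp only [Fin.sum_univ_two, Matrix.of_apply, Matrix.cons_val_zero, Matrix.cons_val_one]
    field_simp
    rw [hd]; ring
  rw [e3, e1, e2]
  simp only [e4, e5, Fin.sum_univ_two, Matrix.cons_val_zero, Matrix.cons_val_one]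
  have e6 : Z 1 • na 0 - Z 0 • na 1 = -(W 1 • nb 0 - W 0 • nb 1) := eq_neg_of_add_eq_zero_left hflat
  have e7 : ∀ c : ℂ, (-Z 1 / c) • na 0 + (W 1 / c) • nb 0 + ((Z 0 / c) • na 1 + (-W 0 / c) • nb 1) =
      -(c⁻¹ • (Z 1 • na 0 - Z 0 • na 1)) + c⁻¹ • (W 1 • nb 0 - W 0 • nb 1) := fun c ↦ by
    simp only [div_eq_mul_inv]; module
  rw [e7, e6]
  simp only [div_eq_mul_inv]
  module

end MetricAlgebra

/-! ### Christoffel symbols from a frame with symmetric derivative -/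

section Koszul

variable {E : Type*} [NormedAddCommGroup E] [NormedSpace ℂ E] [FiniteDimensional ℂ E]
  {V : Type*} [NormedAddCommGroup V] [NormedSpace ℂ V]

/-- The Christoffel symbols of a metric given by a symmetric parallel frame. -/
theorem holChristoffel_of_frame {B : V → V → V → ℂ} {P : Submodule ℂ E} {n : E →ₗ[ℂ] E →ₗ[ℂ] ℂ}
    (hn : ∀ Z W, n Z W = n W Z) (hnd : ∀ Z ∈ P, Z ≠ 0 → ∃ W ∈ P, n Z W ≠ 0) {Q : V → V →L[ℂ] E}
    {y : V} (hQ : DifferentiableAt ℂ Q y)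
    (hB : ∀ᶠ y' in 𝓝 y, ∀ u v, B y' u v = n (Q y' u) (Q y' v)) (hQP : ∀ u, Q y u ∈ P)
    (hsurj : ∀ Z ∈ P, ∃ u, Q y u = Z) (hC : ∀ u v, fderiv ℂ Q y u v ∈ P)
    (hsym : ∀ u v, fderiv ℂ Q y u v = fderiv ℂ Q y v u) (u v : V) :
    Q y (holChristoffel B y u v) = fderiv ℂ Q y u v := by
  have hder (a b w : V) : fderiv ℂ (fun y' ↦ B y' a b) y w =
      n (fderiv ℂ Q y w a) (Q y b) + n (Q y a) (fderiv ℂ Q y w b) := by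
    have h1 : (fun y' ↦ B y' a b) =ᶠ[𝓝 y] fun y' ↦
        n.toContinuousBilinearMap (Q y' a) (Q y' b) := by
      filter_upwards [hB] with y' h using h a b
    have h2 (a : V) : HasFDerivAt (fun y' ↦ Q y' a) ((fderiv ℂ Q y).flip a) y := by
      have := hQ.hasFDerivAt.clm_apply (hasFDerivAt_const a y)
      simpa using this
    have h3 := (n.toContinuousBilinearMap.hasFDerivAt.comp y (h2 a)).clm_apply (h2 b)
    rw [h1.fderiv_eq]
    rw [show (fun y' ↦ n.toContinuousBilinearMap (Q y' a) (Q y' b)) =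
      fun y' ↦ (n.toContinuousBilinearMap ∘ fun y' ↦ Q y' a) y' (Q y' b) from rfl, h3.fderiv]
    simp only [add_apply, ContinuousLinearMap.comp_apply, ContinuousLinearMap.flip_apply,
      Function.comp_apply, LinearMap.toContinuousBilinearMap_apply]
    rw [add_comm]
  -- The metric is `n(Q·, Q·)` with `n` constant. Symmetry of the derivative of `Q` cancels four of
  -- the six terms of the Koszul formula.
  have hkos (w : V) : fderiv ℂ (fun y' ↦ B y' v w) y u + fderiv ℂ (fun y' ↦ B y' u w) y v -
      fderiv ℂ (fun y' ↦ B y' u v) y w = 2 * n (fderiv ℂ Q y u v) (Q y w) := by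
    rw [hder, hder, hder, hsym w u, hsym w v, hsym v u, hn (fderiv ℂ Q y u w) (Q y v)]
    ring
  have hB0 := hB.self_of_nhds
  have hspec : ∃ c : V, ∀ w : V, 2 * B y c w = fderiv ℂ (fun y' ↦ B y' v w) y u +
      fderiv ℂ (fun y' ↦ B y' u w) y v - fderiv ℂ (fun y' ↦ B y' u v) y w := by
    obtain ⟨c, hc⟩ := hsurj _ (hC u v)
    exact ⟨c, fun w ↦ by rw [hkos, hB0, hc]⟩
  have hc := Classical.epsilon_spec hspec
  change ∀ w, 2 * B y (holChristoffel B y u v) w = _ at hc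
  set c := holChristoffel B y u v
  by_contra hne
  obtain ⟨W, hW, hW'⟩ := hnd _ (P.sub_mem (hQP c) (hC u v)) (sub_ne_zero.mpr hne)
  obtain ⟨w, rfl⟩ := hsurj W hW
  refine hW' ?_
  have := hc w
  rw [hkos, hB0] at this
  rw [map_sub, LinearMap.sub_apply, mul_left_cancel₀ two_ne_zero this, sub_self]

end Koszul

/-! ### The Levi-Civita connection of the symmetric space -/

section Frame

variable {EG : Type*} [NormedAddCommGroup EG] [NormedSpace ℝ EG] [CompleteSpace EG]
  [FiniteDimensional ℝ EG]
  {G : Type*} [TopologicalSpace G] [T2Space G] [ChartedSpace EG G] [Group G]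
  [LieGroup 𝓘(ℝ, EG) ∞ G]
  {ν : LinearMap.BilinForm ℝ (GroupLieAlgebra 𝓘(ℝ, EG) G)}
  {E : Type*} [NormedAddCommGroup E] [NormedSpace ℂ E] [FiniteDimensional ℂ E]
  {GC : Type*} [TopologicalSpace GC] [T2Space GC] [ChartedSpace E GC] [Group GC]
  [LieGroup 𝓘(ℂ, E) ω GC]
  {j : G →* GC} (hj : IsComplexification EG E j) {M : MaximalCompact ν}
  {V : Type*} [NormedAddCommGroup V] [NormedSpace ℂ V] [ChartedSpace V (GC ⧸ M.KC E j)]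
  [IsManifold 𝓘(ℂ, V) ω (GC ⧸ M.KC E j)]
  (hq : IsHolomorphicQuotient E V (M.KC E j))
  (hG : LieAlgebra.IsSemisimple ℝ (GroupLieAlgebra 𝓘(ℝ, EG) G))

include hj hq

theorem pr_eq_pr_prP (g : GC) (Z : E) : pr E V (M.KC E j) g Z = pr E V (M.KC E j) g (M.prP hj Z) := by
  conv_lhs => rw [← M.prK_add_prP hj Z]
  rw [map_add, (pr_eq_zero_iff hq g _).mpr (pr_one_eq_zero_of_mem_kC hq (M.prK_mem hj Z)), zero_add]

include hG in
theorem eq_of_pr_eq {g : GC} {Z W : E} (hZ : Z ∈ M.pC E j) (hW : W ∈ M.pC E j)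
    (h : pr E V (M.KC E j) g Z = pr E V (M.KC E j) g W) : Z = W := by
  have h1 : pr E V (M.KC E j) 1 (Z - W) = 0 := by
    rw [← pr_eq_zero_iff hq g, map_sub, h, sub_self]
  have h2 := mem_kC_of_pr_one_eq_zero hj hq hG h1
  exact sub_eq_zero.mp (Submodule.disjoint_def.mp (M.isCompl_kC_pC hj).disjoint _ h2
    (sub_mem hZ hW))

/-- A right inverse of the differential can be projected to `𝔭^ℂ`, as the differential kills `𝔨^ℂ`.
The section is horizontal at the one point only. -/
theorem exists_adapted_section (g : GC) : ∃ σ : GC ⧸ M.KC E j → GC, σ (QuotientGroup.mk g) = g ∧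
    (∀ᶠ x in 𝓝 (QuotientGroup.mk g : GC ⧸ M.KC E j),
      QuotientGroup.mk (σ x) = x ∧ ContMDiffAt 𝓘(ℂ, V) 𝓘(ℂ, E) ω σ x) ∧
    ∀ v, mc ℂ E V σ (QuotientGroup.mk g) v ∈ M.pC E j := by
  have := hq.finiteDimensional
  obtain ⟨R, hR⟩ := (pr E V (M.KC E j) g : E →ₗ[ℂ] V).exists_rightInverse_of_surjective
    (LinearMap.range_eq_top.mpr (pr_surjective hq g))
  let R₁ : V →L[ℂ] E := (M.prP hj).comp (LinearMap.toContinuousLinearMap R)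
  have hR₁ (v : V) : pr E V (M.KC E j) g (R₁ v) = v :=
    (pr_eq_pr_prP hj hq g (R v)).symm.trans (LinearMap.congr_fun hR v)
  obtain ⟨σ, h1, h2, h3⟩ := exists_section_quotient hq g
    (R := (tder ℂ E E (fun a ↦ g * a) 1).comp R₁)
    (by
      rw [← ContinuousLinearMap.comp_assoc, ← pr_eq hq]
      exact ContinuousLinearMap.ext hR₁)
  refine ⟨σ, h1, h3, fun v ↦ ?_⟩
  have h4 := tder_comp_of_eq (𝕜 := ℂ) (g := fun a : GC ↦ g⁻¹ * a) (f := σ)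
    (QuotientGroup.mk g : GC ⧸ M.KC E j) (y := g) h1
    (contMDiff_mul_left (I := 𝓘(ℂ, E)) (n := ω) (a := g⁻¹) g).mdiff' h3.self_of_nhds.2.mdiff'
  have h5 := tder_comp_of_eq (𝕜 := ℂ) (g := fun a : GC ↦ g⁻¹ * a) (f := fun a : GC ↦ g * a)
    (1 : GC) (y := g) (mul_one g)
    (contMDiff_mul_left (I := 𝓘(ℂ, E)) (n := ω) (a := g⁻¹) g).mdiff'
    (contMDiff_mul_left (I := 𝓘(ℂ, E)) (n := ω) (a := g) 1).mdiff'
  simp only [inv_mul_cancel_left] at h5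
  rw [tder_id] at h5
  have h6 : mc ℂ E V σ (QuotientGroup.mk g) = R₁ := by
    rw [mc, h1, h4, h2, ← ContinuousLinearMap.comp_assoc, ← h5, ContinuousLinearMap.id_comp]
  rw [h6]
  exact M.prP_mem hj _

theorem tder_mk_comp_complex {N Q : Type*} [NormedAddCommGroup N] [NormedSpace ℂ N]
    [TopologicalSpace Q] [ChartedSpace N Q] {s : Q → GC} {x : Q}
    (hs : MDifferentiableAt 𝓘(ℂ, N) 𝓘(ℂ, E) s x) (v : N) :
    tder ℂ N V (fun y ↦ (QuotientGroup.mk (s y) : GC ⧸ M.KC E j)) x v =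
      pr E V (M.KC E j) (s x) (mc ℂ E N s x v) := by
  have h := tder_comp_of_eq (𝕜 := ℂ)
    (g := fun a : GC ↦ (QuotientGroup.mk (s x * a) : GC ⧸ M.KC E j))
    (f := fun y ↦ (s x)⁻¹ * s y) x (y := 1) (by simp) (hq.mdiff_orbit (s x) 1) (mdiff_div hs _)
  simp only [mul_inv_cancel_left] at h
  exact DFunLike.congr_fun h v

include hG in
-- The metric is defined with a chosen representative of each coset. Another representative changes
-- the vectors of `𝔭^ℂ` by `Ad` of an element of `K^ℂ`, under which the form is invariant.
theorem symmetricMetric_eq (hν : ∀ (g : G) a b, ν (Ad (𝕜 := ℝ) EG g a) (Ad (𝕜 := ℝ) EG g b) = ν a b)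
    {g : GC} {Z W : E} (hZ : Z ∈ M.pC E j) (hW : W ∈ M.pC E j) {x : GC ⧸ M.KC E j}
    (hx : QuotientGroup.mk g = x) {u v : V} (hu : pr E V (M.KC E j) g Z = u)
    (hv : pr E V (M.KC E j) g W = v) :
    M.symmetricMetric (V := V) j x u v = formC hj (modelForm ν) Z W := by
  have hk : g⁻¹ * x.out ∈ M.KC E j := QuotientGroup.eq.mp (hx.trans x.out_eq'.symm)
  set k := g⁻¹ * x.out with hkd
  have hout : x.out = g * k := by rw [hkd, mul_inv_cancel_left]
  have key {Z : E} (hZ : Z ∈ M.pC E j) {u : V} (hu : pr E V (M.KC E j) g Z = u) :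
      M.tangentToPC (V := V) j x u = adj ℂ E k⁻¹ Z := by
    have hk' : adj ℂ E k⁻¹ Z ∈ M.pC E j := M.adj_mem_pC hj (inv_mem hk) hZ
    have hpr : pr E V (M.KC E j) x.out (adj ℂ E k⁻¹ Z) = u := by
      rw [hout, pr_mul_right hq g hk, adj_adj_inv, hu]
    have hspec := Classical.epsilon_spec
      (p := fun Z : E ↦ Z ∈ M.pC E j ∧ pr E V (M.KC E j) x.out Z = u) ⟨_, hk', hpr⟩
    exact eq_of_pr_eq hj hq hG hspec.1 hk' (hspec.2.trans hpr.symm)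
  change complexForm j ν (M.tangentToPC (V := V) j x u) (M.tangentToPC (V := V) j x v) = _
  rw [key hZ hu, key hW hv, complexForm_eq hj, M.formC_adj_of_mem_KC hj hν (inv_mem hk)]

include hG in
-- `Q` is the `𝔭^ℂ`-part of `σ⁻¹dσ`, an isometric frame. At a point where `σ` is horizontal the
-- Maurer-Cartan equation makes the derivative of `Q` symmetric, because `[𝔭,𝔭] ⊂ 𝔨`. The
-- Christoffel symbols are then this derivative.
theorem exists_parallel_frame (hν_symm : ν.IsSymm)
    (hν : ∀ (g : G) a b, ν (Ad (𝕜 := ℝ) EG g a) (Ad (𝕜 := ℝ) EG g b) = ν a b)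
    {g : GC} {x₀ : GC ⧸ M.KC E j} (hg : QuotientGroup.mk g = x₀) :
    ∃ (σ : GC ⧸ M.KC E j → GC) (Q : V → V →L[ℂ] E), σ x₀ = g ∧
      (∀ᶠ x in 𝓝 x₀, QuotientGroup.mk (σ x) = x ∧ ContMDiffAt 𝓘(ℂ, V) 𝓘(ℂ, E) ω σ x) ∧
      (∀ v, mc ℂ E V σ x₀ v ∈ M.pC E j) ∧ ContDiffAt ℂ ∞ Q (chartAt V x₀ x₀) ∧
      (∀ y, Q y = (M.prP hj).comp (mc ℂ E V (fun y ↦ σ ((chartAt V x₀).symm y)) y)) ∧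
      Function.Injective (Q (chartAt V x₀ x₀)) ∧
      ∀ u v, Q (chartAt V x₀ x₀) (holChristoffel
        (holMetricInChart (M.symmetricMetric (V := V) j) x₀) (chartAt V x₀ x₀) u v) =
          fderiv ℂ Q (chartAt V x₀ x₀) u v := by
  have : CompleteSpace E := FiniteDimensional.complete ℂ E
  have hm : IsManifold 𝓘(ℂ, V) ∞ (GC ⧸ M.KC E j) := IsManifold.of_le (n := ω) (by simp)
  obtain ⟨σ, h1, h2, h3⟩ := exists_adapted_section hj hq g
  rw [hg] at h1 h2 h3
  set d := chartAt V x₀ with hd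
  set y₁ := d x₀ with hy₁
  let R : V → GC := fun y ↦ σ (d.symm y)
  have hy₁t : y₁ ∈ d.target := mem_chart_target V x₀
  have hleft : d.symm y₁ = x₀ := d.left_inv (mem_chart_source V x₀)
  have htend : Tendsto d.symm (𝓝 y₁) (𝓝 x₀) := by
    have := d.continuousAt_symm hy₁t
    rwa [ContinuousAt, hleft] at this
  have hev : ∀ᶠ y in 𝓝 y₁, y ∈ d.target ∧ QuotientGroup.mk (σ (d.symm y)) = d.symm y ∧
      ContMDiffAt 𝓘(ℂ, V) 𝓘(ℂ, E) ω σ (d.symm y) :=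
    (Filter.eventually_of_mem (d.open_target.mem_nhds hy₁t) fun _ h ↦ h).and
      (htend.eventually h2)
  have hsymm (y) (hy : y ∈ d.target) : ContMDiffAt 𝓘(ℂ, V) 𝓘(ℂ, V) ∞ d.symm y :=
    contMDiffAt_chart_symm hy
  have hR : ∀ᶠ y in 𝓝 y₁, ContMDiffAt 𝓘(ℂ, V) 𝓘(ℂ, E) ∞ R y := by
    filter_upwards [hev] with y hy
    exact ContMDiffAt.comp (f := d.symm) y (hy.2.2.of_le (by simp)) (hsymm y hy.1)
  let Q : V → V →L[ℂ] E := fun y ↦ (M.prP hj).comp (mc ℂ E V R y)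
  have hβ : ContDiffAt ℂ ∞ (fun y ↦ mc ℂ E V R y) y₁ := contDiffAt_mc hR
  have hQ : ContDiffAt ℂ ∞ Q y₁ := contDiffAt_const.clm_comp hβ
  have hQP (y u) : Q y u ∈ M.pC E j := M.prP_mem hj _
  have hpr : ∀ᶠ y in 𝓝 y₁, ∀ u, pr E V (M.KC E j) (R y) (Q y u) = tder ℂ V V d.symm y u := by
    filter_upwards [hev.eventually_nhds, hR] with y hy hRy u
    have e1 := tder_mk_comp_complex hj hq hRy.mdiff u
    have e2 : (fun y ↦ (QuotientGroup.mk (R y) : GC ⧸ M.KC E j)) =ᶠ[𝓝 y] d.symm :=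
      hy.mono fun z hz ↦ hz.2.1
    rw [tder_congr e2] at e1
    rw [e1]
    exact (pr_eq_pr_prP hj hq (R y) _).symm
  have hsurj (Z : E) (hZ : Z ∈ M.pC E j) : ∃ u, Q y₁ u = Z := by
    refine ⟨tder ℂ V V d (d.symm y₁) (pr E V (M.KC E j) (R y₁) Z), ?_⟩
    refine eq_of_pr_eq hj hq hG (hQP _ _) hZ (g := R y₁) ?_
    rw [hpr.self_of_nhds]
    have := tder_symm_comp_tder_chart (𝕜 := ℂ) (N := V) (x := x₀) (mem_chart_source V x₀)
    rw [hleft]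
    exact DFunLike.congr_fun this _
  have hinj : Function.Injective (Q y₁) := by
    intro u v huv
    have h4 := hpr.self_of_nhds u
    rw [huv, hpr.self_of_nhds v] at h4
    have h5 := tder_chart_comp_tder_symm (𝕜 := ℂ) (N := V) (x := x₀) hy₁t
    have h6 := DFunLike.congr_fun h5 u
    have h7 := DFunLike.congr_fun h5 v
    rw [ContinuousLinearMap.comp_apply] at h6 h7
    rw [h4] at h7
    exact (h6.symm.trans h7)
  have hdQ (u v : V) : fderiv ℂ Q y₁ u v =
      M.prP hj (fderiv ℂ (fun y ↦ mc ℂ E V R y) y₁ u v) := by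
    have := (hasFDerivAt_const (M.prP hj) y₁).clm_comp
      (hβ.differentiableAt (by simp)).hasFDerivAt
    rw [this.fderiv]
    simp
  have hβ₁ (v : V) : mc ℂ E V R y₁ v ∈ M.pC E j := by
    have := mc_comp (𝕜 := ℂ) (s := σ) (κ := d.symm) (x := y₁)
      (by rw [hleft]; exact h2.self_of_nhds.2.mdiff') (hsymm y₁ hy₁t).mdiff
    rw [show mc ℂ E V R y₁ = _ from this, hleft]
    exact h3 _
  have hsym (u v : V) : fderiv ℂ Q y₁ u v = fderiv ℂ Q y₁ v u := by
    have h4 := congrArg (M.prP hj) (fderiv_mc_sub hR u v)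
    rw [map_add, map_sub, map_zero, M.prP_of_mem_kC hj (M.lieB_pC_pC hj (hβ₁ u) (hβ₁ v)),
      add_zero] at h4
    rw [hdQ, hdQ, sub_eq_zero.mp h4]
  refine ⟨σ, Q, h1, h2, h3, hQ, fun y ↦ rfl, hinj, fun u v ↦ ?_⟩
  refine holChristoffel_of_frame (P := M.pC E j) (n := formC hj (modelForm ν))
    (formC_symm hj hν_symm) (fun Z hZ h0 ↦ M.exists_form_ne_zero hj hZ h0)
    (hQ.differentiableAt (by simp)) ?_ (hQP y₁) hsurj
    (fun u v ↦ by rw [hdQ]; exact M.prP_mem hj _) hsym u v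
  filter_upwards [hev, hpr] with y hy hpy u v
  exact symmetricMetric_eq hj hq hG hν (hQP y u) (hQP y v) hy.2.1 (hpy u) (hpy v)

end Frame

/-- As the source is finite dimensional, `L` is given by finitely many of its values. -/
theorem differentiableAt_of_apply {D F₁ F₂ : Type*} [NormedAddCommGroup D] [NormedSpace ℝ D]
    [NormedAddCommGroup F₁] [NormedSpace ℝ F₁] [FiniteDimensional ℝ F₁] [NormedAddCommGroup F₂]
    [NormedSpace ℝ F₂] {L : D → F₁ →L[ℝ] F₂} {x : D}
    (h : ∀ v, DifferentiableAt ℝ (fun y ↦ L y v) x) : DifferentiableAt ℝ L x := by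
  let d := Module.finrank ℝ F₁
  have hd : d = Module.finrank ℝ (Fin d → ℝ) := (Module.finrank_fin_fun ℝ).symm
  let e₁ := ContinuousLinearEquiv.ofFinrankEq hd
  let e₂ := (e₁.arrowCongr (1 : F₂ ≃L[ℝ] F₂)).trans (ContinuousLinearEquiv.piRing (Fin d))
  rw [← Function.id_comp L, ← e₂.symm_comp_self]
  exact e₂.symm.differentiableAt.comp x (differentiableAt_pi.mpr fun i ↦ h _)

theorem contDiffAt_of_apply {D F₁ F₂ : Type*} [NormedAddCommGroup D] [NormedSpace ℝ D]
    [NormedAddCommGroup F₁] [NormedSpace ℝ F₁] [FiniteDimensional ℝ F₁] [NormedAddCommGroup F₂]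
    [NormedSpace ℝ F₂] {L : D → F₁ →L[ℝ] F₂} {x : D} {n : WithTop ℕ∞}
    (h : ∀ v, ContDiffAt ℝ n (fun y ↦ L y v) x) : ContDiffAt ℝ n L x := by
  let d := Module.finrank ℝ F₁
  have hd : d = Module.finrank ℝ (Fin d → ℝ) := (Module.finrank_fin_fun ℝ).symm
  let e₁ := ContinuousLinearEquiv.ofFinrankEq hd
  let e₂ := (e₁.arrowCongr (1 : F₂ ≃L[ℝ] F₂)).trans (ContinuousLinearEquiv.piRing (Fin d))
  rw [← Function.id_comp L, ← e₂.symm_comp_self]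
  exact e₂.symm.contDiff.contDiffAt.comp x (contDiffAt_pi.mpr fun i ↦ h _)

/-! ### Second covariant derivative of a map to the symmetric space -/

section SecondDerivative

variable {EG : Type*} [NormedAddCommGroup EG] [NormedSpace ℝ EG] [CompleteSpace EG]
  [FiniteDimensional ℝ EG]
  {G : Type*} [TopologicalSpace G] [T2Space G] [ChartedSpace EG G] [Group G]
  [LieGroup 𝓘(ℝ, EG) ∞ G]
  {ν : LinearMap.BilinForm ℝ (GroupLieAlgebra 𝓘(ℝ, EG) G)}
  {E : Type*} [NormedAddCommGroup E] [NormedSpace ℂ E] [FiniteDimensional ℂ E]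
  {GC : Type*} [TopologicalSpace GC] [T2Space GC] [ChartedSpace E GC] [Group GC]
  [LieGroup 𝓘(ℂ, E) ω GC]
  {j : G →* GC} (hj : IsComplexification EG E j) {M : MaximalCompact ν}
  {V : Type*} [NormedAddCommGroup V] [NormedSpace ℂ V] [ChartedSpace V (GC ⧸ M.KC E j)]
  [IsManifold 𝓘(ℂ, V) ω (GC ⧸ M.KC E j)]
  (hq : IsHolomorphicQuotient E V (M.KC E j))
  (hG : LieAlgebra.IsSemisimple ℝ (GroupLieAlgebra 𝓘(ℝ, EG) G))
  {St : Type*} [TopologicalSpace St] [ChartedSpace ℂ St] [IsManifold 𝓘(ℝ, ℂ) ∞ St]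

theorem mc_mem_kC (hj : IsComplexification EG E j) (hq : IsHolomorphicQuotient E V (M.KC E j))
    (hG : LieAlgebra.IsSemisimple ℝ (GroupLieAlgebra 𝓘(ℝ, EG) G)) {N Q : Type*}
    [NormedAddCommGroup N] [NormedSpace ℝ N]
    [TopologicalSpace Q] [ChartedSpace N Q] {s : Q → GC} {x : Q}
    (hs : MDifferentiableAt 𝓘(ℝ, N) 𝓘(ℝ, E) s x) (h : ∀ᶠ y in 𝓝 x, s y ∈ M.KC E j) (v : N) :
    mc ℝ E N s x v ∈ M.kC E j :=
  mem_kC_of_pr_one_eq_zero hj hq hG (pr_mc_eq_zero hq hs h v)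

include hj hq hG in
/-- The second covariant derivative of a map to the symmetric space, computed with a local lift to
the group. -/
theorem exists_frame_second_derivative (hν_symm : ν.IsSymm)
    (hν : ∀ (g : G) a b, ν (Ad (𝕜 := ℝ) EG g a) (Ad (𝕜 := ℝ) EG g b) = ν a b)
    {f : St → GC ⧸ M.KC E j} (hf : ContMDiff 𝓘(ℝ, ℂ) 𝓘(ℝ, V) ∞ f) (x : St) {s : ℂ → GC}
    (hs : ∀ᶠ y in 𝓝 (chartAt ℂ x x), ContMDiffAt 𝓘(ℝ, ℂ) 𝓘(ℝ, E) ∞ s y ∧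
      QuotientGroup.mk (s y) = f ((chartAt ℂ x).symm y)) :
    ∃ Q : V →L[ℂ] E, Function.Injective Q ∧
      ContDiffAt ℝ ∞ (mapInCharts V f x) (chartAt ℂ x x) ∧
      (∀ v, Q (fderiv ℝ (mapInCharts V f x) (chartAt ℂ x x) v) =
        M.prP hj (mc ℝ E ℂ s (chartAt ℂ x x) v)) ∧
      ∀ u v : ℂ, Q (fderiv ℝ (fun y ↦ fderiv ℝ (mapInCharts V f x) y v) (chartAt ℂ x x) u +
          holChristoffel (holMetricInChart (M.symmetricMetric (V := V) j) (f x))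
            (mapInCharts V f x (chartAt ℂ x x))
            (fderiv ℝ (mapInCharts V f x) (chartAt ℂ x x) u)
            (fderiv ℝ (mapInCharts V f x) (chartAt ℂ x x) v)) =
        fderiv ℝ (fun y ↦ M.prP hj (mc ℝ E ℂ s y v)) (chartAt ℂ x x) u +
          lieB ℂ GC (M.prK hj (mc ℝ E ℂ s (chartAt ℂ x x) u))
            (M.prP hj (mc ℝ E ℂ s (chartAt ℂ x x) v)) := by
  have : CompleteSpace E := FiniteDimensional.complete ℂ E
  have : FiniteDimensional ℝ E := FiniteDimensional.complexToReal E
  have hm : IsManifold 𝓘(ℂ, V) ∞ (GC ⧸ M.KC E j) := IsManifold.of_le (n := ω) (by simp)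
  have hmr : IsManifold 𝓘(ℝ, V) ∞ (GC ⧸ M.KC E j) := isManifold_real
  set c := chartAt ℂ x with hc
  set y₀ := c x with hy₀
  have hcy₀ : c.symm y₀ = x := c.left_inv (mem_chart_source ℂ x)
  have hy₀t : y₀ ∈ c.target := mem_chart_target ℂ x
  set d := chartAt V (f x) with hd
  obtain ⟨σ, Q, hσ0, hσ, hσp, hQ, hQeq, hQinj, hQΓ⟩ := exists_parallel_frame hj hq hG hν_symm hν
    (g := s y₀) (x₀ := f x) (by rw [hs.self_of_nhds.2, hcy₀])
  rw [← hd] at hQ hQeq hQinj hQΓ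
  let f' : ℂ → GC ⧸ M.KC E j := fun y ↦ f (c.symm y)
  have hf' (y) (hy : y ∈ c.target) : ContMDiffAt 𝓘(ℝ, ℂ) 𝓘(ℝ, V) ∞ f' y :=
    ContMDiffAt.comp (g := f) y (hf _) (contMDiffAt_chart_symm hy)
  have hf'0 : f' y₀ = f x := by simp only [f', hcy₀]
  have htar : ∀ᶠ y in 𝓝 y₀, y ∈ c.target :=
    Filter.eventually_of_mem (c.open_target.mem_nhds hy₀t) fun _ h ↦ h
  have hft : Tendsto f' (𝓝 y₀) (𝓝 (f x)) := by
    have := (hf' y₀ hy₀t).continuousAt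
    rwa [ContinuousAt, hf'0] at this
  have hsrc : ∀ᶠ y in 𝓝 y₀, f' y ∈ d.source :=
    hft (d.open_source.mem_nhds (mem_chart_source V (f x)))
  have hσ' : ∀ᶠ y in 𝓝 y₀, QuotientGroup.mk (σ (f' y)) = f' y ∧
      ContMDiffAt 𝓘(ℂ, V) 𝓘(ℂ, E) ω σ (f' y) := hft.eventually hσ
  set F := mapInCharts V f x with hF
  have hFeq (y) : F y = d (f' y) := rfl
  have hF0 : F y₀ = d (f x) := by rw [hFeq, hf'0]
  have hFs : ∀ᶠ y in 𝓝 y₀, ContDiffAt ℝ ∞ F y := by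
    filter_upwards [htar, hsrc] with y h1 h2
    exact (ContMDiffAt.comp (g := d) (f := f') y (contMDiffAt_chart h2) (hf' y h1)).contDiffAt
  -- the adapted lift
  let s₀ : ℂ → GC := fun y ↦ σ (f' y)
  have hs₀ : ∀ᶠ y in 𝓝 y₀, ContMDiffAt 𝓘(ℝ, ℂ) 𝓘(ℝ, E) ∞ s₀ y := by
    filter_upwards [htar, hσ'] with y h1 h2
    exact ContMDiffAt.comp (g := σ) (f := f') y (h2.2.restrictReal.of_le (by simp)) (hf' y h1)
  have hφ₀ : ∀ᶠ y in 𝓝 y₀, ∀ v, M.prP hj (mc ℝ E ℂ s₀ y v) = Q (F y) (fderiv ℝ F y v) := by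
    filter_upwards [hsrc.eventually_nhds, htar, hσ', hFs] with y h1 h2 h3 h4 v
    have e1 : s₀ =ᶠ[𝓝 y] fun y ↦ σ (d.symm (F y)) := by
      filter_upwards [h1] with z hz
      simp only [hFeq, s₀, d.left_inv hz]
    have hFt : F y ∈ d.target := d.map_source h1.self_of_nhds
    have hdF : d.symm (F y) = f' y := d.left_inv h1.self_of_nhds
    have e2 : MDifferentiableAt 𝓘(ℂ, V) 𝓘(ℂ, E) (fun y ↦ σ (d.symm y)) (F y) := by
      refine MDifferentiableAt.comp (g := σ) (f := d.symm) (F y) ?_ (contMDiffAt_chart_symm hFt).mdiff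
      rw [hdF]; exact h3.2.mdiff'
    rw [mc_congr e1, mc_comp (s := fun y ↦ σ (d.symm y)) (κ := F) e2.restrictReal
      (h4.differentiableAt (by simp)).mdifferentiableAt, ContinuousLinearMap.comp_apply,
      tder_eq_fderiv, mc_real_apply e2, hQeq]
    rfl
  have hα₀ (v) : mc ℝ E ℂ s₀ y₀ v ∈ M.pC E j := by
    have := mc_comp (𝕜 := ℝ) (s := σ) (κ := f') (x := y₀)
      (by rw [hf'0]; exact hσ.self_of_nhds.2.mdiff'.restrictReal) (hf' y₀ hy₀t).mdiff
    rw [show mc ℝ E ℂ s₀ y₀ = _ from this, hf'0, ContinuousLinearMap.comp_apply,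
      mc_real_apply hσ.self_of_nhds.2.mdiff']
    exact hσp _
  -- the change of lift
  let k : ℂ → GC := fun y ↦ (s₀ y)⁻¹ * s y
  have hk : ∀ᶠ y in 𝓝 y₀, ContMDiffAt 𝓘(ℝ, ℂ) 𝓘(ℝ, E) ∞ k y := by
    filter_upwards [hs₀, hs] with y h1 h2
    exact ContMDiffAt.mul h1.inv h2.1
  have hkK : ∀ᶠ y in 𝓝 y₀, k y ∈ M.KC E j := by
    filter_upwards [hs, hσ'] with y h1 h2
    exact QuotientGroup.eq.mp (h2.1.trans h1.2.symm)
  have hk0 : k y₀ = 1 := by simp only [k, s₀, hf'0, hσ0, inv_mul_cancel]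
  have hmc : ∀ᶠ y in 𝓝 y₀, ∀ v, mc ℝ E ℂ s y v =
      adj ℂ E (k y)⁻¹ (mc ℝ E ℂ s₀ y v) + mc ℝ E ℂ k y v := by
    filter_upwards [hs₀, hk] with y h1 h2 v
    have := mc_mul h1.mdiff h2.mdiff
    simp only [k, mul_inv_cancel_left] at this
    rw [this]
    simp only [add_apply, ContinuousLinearMap.comp_apply, adj_real_apply, k]
  have hkC : ∀ᶠ y in 𝓝 y₀, ∀ v, mc ℝ E ℂ k y v ∈ M.kC E j := by
    filter_upwards [hk, hkK.eventually_nhds] with y h1 h2 v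
    exact mc_mem_kC hj hq hG h1.mdiff h2 v
  -- The lift `s` and the adapted lift `s₀` differ by the `K^ℂ`-valued `k`, whose Maurer-Cartan form
  -- is in `𝔨^ℂ`; so the `𝔭^ℂ`-parts differ by `Ad(k⁻¹)`.
  have hφ (v : ℂ) : (fun y ↦ M.prP hj (mc ℝ E ℂ s y v)) =ᶠ[𝓝 y₀]
      fun y ↦ adj ℝ E (k y)⁻¹ (Q (F y) (fderiv ℝ F y v)) := by
    filter_upwards [hmc, hkC, hkK, hφ₀] with y h1 h2 h3 h4
    rw [h1, map_add, M.prP_of_mem_kC hj (h2 v), add_zero, M.prP_adj hj (inv_mem h3), h4,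
      adj_real_apply]
  have hF1 := hFs.self_of_nhds
  have hDF (v : ℂ) : DifferentiableAt ℝ (fun y ↦ fderiv ℝ F y v) y₀ :=
    ((hF1.fderiv_right (m := ∞) (by simp)).differentiableAt (by simp)).clm_apply
      (differentiableAt_const v)
  have hQd : HasFDerivAt (fun z ↦ (Q z).restrictScalars ℝ)
      ((ContinuousLinearMap.restrictScalarsL ℂ V E ℝ ℝ).comp
        ((fderiv ℂ Q (F y₀)).restrictScalars ℝ)) (F y₀) := by
    have h1 : HasFDerivAt Q ((fderiv ℂ Q (F y₀)).restrictScalars ℝ) (F y₀) := by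
      rw [hF0]
      exact (hQ.differentiableAt (by simp)).hasFDerivAt.restrictScalars ℝ
    exact (ContinuousLinearMap.restrictScalarsL ℂ V E ℝ ℝ).hasFDerivAt.comp _ h1
  have hinner (v : ℂ) := (hQd.comp y₀ (hF1.differentiableAt (by simp)).hasFDerivAt).clm_apply
    (hDF v).hasFDerivAt
  have hadj : DifferentiableAt ℝ (fun y ↦ adj ℝ E (k y)⁻¹) y₀ :=
    differentiableAt_of_apply fun W ↦ (fderiv_adj_inv hk W).1
  have hadj' (u : ℂ) (W : E) : fderiv ℝ (fun y ↦ adj ℝ E (k y)⁻¹) y₀ u W =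
      -lieB ℝ GC (mc ℝ E ℂ k y₀ u) W := by
    have h1 := hadj.hasFDerivAt.clm_apply (hasFDerivAt_const W y₀)
    have h2 := (fderiv_adj_inv hk W).2 u
    rw [h1.fderiv, hk0] at h2
    simpa [adj_one] using h2
  have hmck (u : ℂ) : M.prK hj (mc ℝ E ℂ s y₀ u) = mc ℝ E ℂ k y₀ u := by
    rw [hmc.self_of_nhds, hk0, inv_one, adj_one, ContinuousLinearMap.id_apply, map_add,
      M.prK_of_mem_pC hj (hα₀ u), M.prK_of_mem_kC hj (hkC.self_of_nhds u), zero_add]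
  have hφ0 (v : ℂ) : M.prP hj (mc ℝ E ℂ s y₀ v) = Q (F y₀) (fderiv ℝ F y₀ v) := by
    refine (hφ v).self_of_nhds.trans ?_
    change adj ℝ E (k y₀)⁻¹ (Q (F y₀) (fderiv ℝ F y₀ v)) = _
    rw [hk0, inv_one, adj_one, ContinuousLinearMap.id_apply]
  rw [← hF0] at hQinj hQΓ
  refine ⟨Q (F y₀), hQinj, hF1, fun v ↦ (hφ0 v).symm, fun u v ↦ ?_⟩
  -- At the base point `k = 1`. The product rule gives the second derivative of `F`, the derivative
  -- of `Q`, which is the Christoffel term, and the bracket with the form of `k`. The latter is the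
  -- `𝔨^ℂ`-part of `s⁻¹ds` there, as `s₀` is horizontal.
  have hprod : HasFDerivAt (fun y ↦ adj ℝ E (k y)⁻¹ (Q (F y) (fderiv ℝ F y v))) _ y₀ :=
    hadj.hasFDerivAt.clm_apply (hinner v)
  rw [map_add, hQΓ, (hφ v).fderiv_eq, hprod.fderiv, hmck, hφ0]
  simp only [add_apply, ContinuousLinearMap.comp_apply, ContinuousLinearMap.flip_apply,
    Function.comp_apply, ContinuousLinearMap.coe_restrictScalars', hadj', hk0, inv_one, adj_one,
    ContinuousLinearMap.id_apply, ContinuousLinearMap.coe_restrict_scalarsL', lieB_real]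
  abel

end SecondDerivative

/-! ### Exterior derivative and pull-back of forms -/

section PullBack

variable {W : Type*} [NormedAddCommGroup W] [NormedSpace ℂ W]

/-- The exterior derivative of a `1`-form on an open set of `ℂ`. -/
def extD (β : ℂ → ℂ →L[ℝ] W) (y u v : ℂ) : W := fderiv ℝ β y u v - fderiv ℝ β y v u

theorem extD_congr {β β' : ℂ → ℂ →L[ℝ] W} {y : ℂ} (h : β =ᶠ[𝓝 y] β') (u v : ℂ) :
    extD β y u v = extD β' y u v := by
  simp only [extD, h.fderiv_eq]

/-- The terms with second derivatives of `κ` cancel by symmetry. -/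
theorem extD_comp {β : ℂ → ℂ →L[ℝ] W} {κ : ℂ → ℂ} {y : ℂ} (hβ : ContDiffAt ℝ ∞ β (κ y))
    (hκ : ContDiffAt ℝ ∞ κ y) (u v : ℂ) :
    extD (fun y ↦ (β (κ y)).comp (fderiv ℝ κ y)) y u v =
      extD β (κ y) (fderiv ℝ κ y u) (fderiv ℝ κ y v) := by
  have h1 : HasFDerivAt (fun y ↦ β (κ y)) _ y :=
    (hβ.differentiableAt (by simp)).hasFDerivAt.comp y (hκ.differentiableAt (by simp)).hasFDerivAt
  have h2 : HasFDerivAt (fderiv ℝ κ) (fderiv ℝ (fderiv ℝ κ) y) y :=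
    ((hκ.fderiv_right (m := ∞) (by simp)).differentiableAt (by simp)).hasFDerivAt
  have h3 : fderiv ℝ (fderiv ℝ κ) y u v = fderiv ℝ (fderiv ℝ κ) y v u :=
    (hκ.isSymmSndFDerivAt (by simp; exact WithTop.coe_le_coe.mpr le_top)) u v
  simp only [extD]
  rw [(h1.clm_comp h2).fderiv]
  simp [h3]

theorem contDiffAt_comp_fderiv {β : ℂ → ℂ →L[ℝ] W} {κ : ℂ → ℂ} {y : ℂ}
    (hβ : ContDiffAt ℝ ∞ β (κ y)) (hκ : ContDiffAt ℝ ∞ κ y) :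
    ContDiffAt ℝ ∞ (fun y ↦ (β (κ y)).comp (fderiv ℝ κ y)) y :=
  ContDiffAt.clm_comp (hβ.comp y hκ) (hκ.fderiv_right (m := ∞) (by simp))

variable {S : Type*} [TopologicalSpace S] [ChartedSpace ℂ S]

/-- The pull-back of a `1`-form on a surface by a map from `ℂ`. -/
def pull (β : OneForm S W) (κ : ℂ → S) (y : ℂ) : ℂ →L[ℝ] W :=
  ContinuousLinearMap.comp (show ℂ →L[ℝ] W from β (κ y)) (tder ℝ ℂ ℂ κ y)

theorem pull_apply (β : OneForm S W) (κ : ℂ → S) (y v : ℂ) :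
    pull β κ y v = β (κ y) (tder ℝ ℂ ℂ κ y v) := rfl

theorem formInChart_eq_pull (β : OneForm S W) (x : S) :
    formInChart β x = pull β (chartAt ℂ x).symm := rfl

variable [IsManifold 𝓘(ℝ, ℂ) ∞ S]

variable {κ : ℂ → S} {y : ℂ} (hκ : ∀ᶠ z in 𝓝 y, ContMDiffAt 𝓘(ℝ, ℂ) 𝓘(ℝ, ℂ) ∞ κ z)
include hκ

theorem contDiffAt_chart_comp : ContDiffAt ℝ ∞ (fun z ↦ chartAt ℂ (κ y) (κ z)) y :=
  (ContMDiffAt.comp y (contMDiffAt_chart (mem_chart_source ℂ (κ y))) hκ.self_of_nhds).contDiffAt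

theorem tder_eq_fderiv_chart_comp :
    tder ℝ ℂ ℂ κ y = fderiv ℝ (fun z ↦ chartAt ℂ (κ y) (κ z)) y := by
  rw [← tder_eq_fderiv, tder_comp y (contMDiffAt_chart (mem_chart_source ℂ (κ y))).mdiff
    hκ.self_of_nhds.mdiff, tder_chart_self, ContinuousLinearMap.id_comp]

theorem pull_eventuallyEq (β : OneForm S W) : pull β κ =ᶠ[𝓝 y]
    fun z ↦ (formInChart β (κ y) (chartAt ℂ (κ y) (κ z))).comp
      (fderiv ℝ (fun z ↦ chartAt ℂ (κ y) (κ z)) z) := by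
  have hsrc : ∀ᶠ z in 𝓝 y, κ z ∈ (chartAt ℂ (κ y)).source :=
    hκ.self_of_nhds.continuousAt ((chartAt ℂ (κ y)).open_source.mem_nhds (mem_chart_source ℂ (κ y)))
  filter_upwards [hsrc, hκ] with z h1 h2
  rw [formInChart_eq_pull, pull, pull, (chartAt ℂ (κ y)).left_inv h1, ContinuousLinearMap.comp_assoc,
    ← tder_eq_fderiv, tder_comp z (contMDiffAt_chart h1).mdiff h2.mdiff,
    ← ContinuousLinearMap.comp_assoc (tder ℝ ℂ ℂ (chartAt ℂ (κ y)).symm _),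
    tder_symm_comp_tder_chart h1, ContinuousLinearMap.id_comp]

theorem contDiffAt_pull {β : OneForm S W}
    (hβ : ContDiffAt ℝ ∞ (formInChart β (κ y)) (chartAt ℂ (κ y) (κ y))) :
    ContDiffAt ℝ ∞ (pull β κ) y :=
  (contDiffAt_comp_fderiv hβ (contDiffAt_chart_comp hκ)).congr_of_eventuallyEq
    (pull_eventuallyEq hκ β)

theorem extD_pull {β : OneForm S W}
    (hβ : ContDiffAt ℝ ∞ (formInChart β (κ y)) (chartAt ℂ (κ y) (κ y))) (u v : ℂ) :
    extD (pull β κ) y u v = extDerivForm β (κ y) (tder ℝ ℂ ℂ κ y u) (tder ℝ ℂ ℂ κ y v) := by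
  rw [extD_congr (pull_eventuallyEq hκ β), extD_comp hβ (contDiffAt_chart_comp hκ),
    tder_eq_fderiv_chart_comp hκ]
  rfl

omit hκ in
theorem pull_congr {β β' : OneForm S W} (hκ : ContinuousAt κ y) (h : ∀ᶠ x in 𝓝 (κ y), β x = β' x) :
    pull β κ =ᶠ[𝓝 y] pull β' κ := by
  filter_upwards [hκ.eventually h] with z hz
  rw [pull, pull, hz]

end PullBack

/-! ### Covariant exterior derivative and curvature under pull-back -/

section Covariant

variable {E : Type*} [NormedAddCommGroup E] [NormedSpace ℂ E]
  (GC : Type*) [TopologicalSpace GC] [ChartedSpace E GC] [Group GC]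

/-- The exterior covariant derivative on an open set of `ℂ`. -/
def covD (A β : ℂ → ℂ →L[ℝ] E) (y u v : ℂ) : E :=
  extD β y u v + lieB ℂ GC (A y u) (β y v) - lieB ℂ GC (A y v) (β y u)

theorem covD_congr {A A' β β' : ℂ → ℂ →L[ℝ] E} {y : ℂ} (hA : A y = A' y) (h : β =ᶠ[𝓝 y] β')
    (u v : ℂ) : covD GC A β y u v = covD GC A' β' y u v := by
  simp only [covD, extD_congr h, hA, h.self_of_nhds]

variable {S : Type*} [TopologicalSpace S] [ChartedSpace ℂ S] [IsManifold 𝓘(ℝ, ℂ) ∞ S]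
  {κ : ℂ → S} {y : ℂ} (hκ : ∀ᶠ z in 𝓝 y, ContMDiffAt 𝓘(ℝ, ℂ) 𝓘(ℝ, ℂ) ∞ κ z)
include hκ

theorem covD_pull (A : OneForm S E) {β : OneForm S E}
    (hβ : ContDiffAt ℝ ∞ (formInChart β (κ y)) (chartAt ℂ (κ y) (κ y))) (u v : ℂ) :
    covD GC (pull A κ) (pull β κ) y u v =
      covExtDeriv GC A β (κ y) (tder ℝ ℂ ℂ κ y u) (tder ℝ ℂ ℂ κ y v) := by
  rw [covD, extD_pull hκ hβ]
  rfl

theorem curvature_pull {A : OneForm S E}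
    (hA : ContDiffAt ℝ ∞ (formInChart A (κ y)) (chartAt ℂ (κ y) (κ y))) (u v : ℂ) :
    extD (pull A κ) y u v + lieB ℂ GC (pull A κ y u) (pull A κ y v) =
      curvature GC A (κ y) (tder ℝ ℂ ℂ κ y u) (tder ℝ ℂ ℂ κ y v) := by
  rw [extD_pull hκ hA]
  rfl

omit hκ in
theorem covExtDeriv_congr (A : OneForm S E) {β β' : OneForm S E} {x : S}
    (h : ∀ᶠ y in 𝓝 x, β y = β' y) (a b : ℂ) :
    covExtDeriv GC A β x a b = covExtDeriv GC A β' x a b := by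
  have hc : ContinuousAt (chartAt ℂ x).symm (chartAt ℂ x x) :=
    (chartAt ℂ x).continuousAt_symm (mem_chart_target ℂ x)
  have e : (chartAt ℂ x).symm (chartAt ℂ x x) = x := (chartAt ℂ x).left_inv (mem_chart_source ℂ x)
  have h' : formInChart β x =ᶠ[𝓝 (chartAt ℂ x x)] formInChart β' x := by
    rw [formInChart_eq_pull, formInChart_eq_pull]
    refine pull_congr hc ?_
    rwa [e]
  simp only [covExtDeriv, extDerivForm, h'.fderiv_eq, h.self_of_nhds]

end Covariant

/-! ### Linear algebra of complex covectors on the plane -/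

section Covectors

variable {W : Type*} [NormedAddCommGroup W] [NormedSpace ℂ W]

/-- The exterior product of two complex valued covectors, evaluated on the standard frame. -/
def wedge (p q : ℂ →L[ℝ] ℂ) : ℂ := p 1 * q Complex.I - p Complex.I * q 1

theorem wedge_swap (p q : ℂ →L[ℝ] ℂ) : wedge q p = -wedge p q := by
  simp only [wedge]; ring

/-- The coefficient of `p` in the expression of a covector in terms of `p` and `q`. -/
def coef (p q : ℂ →L[ℝ] ℂ) (η : ℂ →L[ℝ] W) : W :=
  (wedge p q)⁻¹ • (q Complex.I • η 1 - q 1 • η Complex.I)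

theorem clm_apply_eq (η : ℂ →L[ℝ] W) (v : ℂ) : η v = v.re • η 1 + v.im • η Complex.I := by
  rw [← map_smul, ← map_smul, ← map_add]
  congr 1
  simp [Complex.re_add_im]

theorem clm_ext {η η' : ℂ →L[ℝ] W} (h1 : η 1 = η' 1) (h2 : η Complex.I = η' Complex.I) : η = η' := by
  ext v
  rw [clm_apply_eq η, clm_apply_eq η', h1, h2]

theorem coef_add_coef {p q : ℂ →L[ℝ] ℂ} (h : wedge p q ≠ 0) (η : ℂ →L[ℝ] W) :
    p.smulRight (coef p q η) + q.smulRight (coef q p η) = η := by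
  have key (a b c d e : ℂ) (x y : W) (he : e = a * d - b * c) (he0 : e ≠ 0) :
      a • e⁻¹ • (d • x - c • y) + c • -e⁻¹ • (b • x - a • y) = x ∧
      b • e⁻¹ • (d • x - c • y) + d • -e⁻¹ • (b • x - a • y) = y := by
    constructor
    · have : a • e⁻¹ • (d • x - c • y) + c • -e⁻¹ • (b • x - a • y) =
          (e⁻¹ * (a * d - b * c)) • x := by module
      rw [this, ← he, inv_mul_cancel₀ he0, one_smul]
    · have : b • e⁻¹ • (d • x - c • y) + d • -e⁻¹ • (b • x - a • y) =
          (e⁻¹ * (a * d - b * c)) • y := by module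
      rw [this, ← he, inv_mul_cancel₀ he0, one_smul]
  have := key (p 1) (p Complex.I) (q 1) (q Complex.I) (wedge p q) (η 1) (η Complex.I) rfl h
  refine clm_ext ?_ ?_
  · simpa [coef, wedge_swap p q, inv_neg] using this.1
  · simpa [coef, wedge_swap p q, inv_neg] using this.2

theorem coef_smulRight_add {p q : ℂ →L[ℝ] ℂ} (h : wedge p q ≠ 0) (a b : W) :
    coef p q (p.smulRight a + q.smulRight b) = a := by
  simp only [coef, add_apply, ContinuousLinearMap.smulRight_apply]
  have : q Complex.I • (p 1 • a + q 1 • b) - q 1 • (p Complex.I • a + q Complex.I • b) =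
      wedge p q • a := by
    simp only [wedge]; module
  rw [this, smul_smul, inv_mul_cancel₀ h, one_smul]

theorem coef_comp {W' : Type*} [NormedAddCommGroup W'] [NormedSpace ℂ W'] (p q : ℂ →L[ℝ] ℂ)
    (L : W →L[ℂ] W') {η : ℂ →L[ℝ] W} {η' : ℂ →L[ℝ] W'} (h : ∀ v, η' v = L (η v)) :
    coef p q η' = L (coef p q η) := by
  simp only [coef, map_smul, map_sub, h]

theorem coef_mem {m : Submodule ℂ W} (p q : ℂ →L[ℝ] ℂ) {η : ℂ →L[ℝ] W} (h : ∀ v, η v ∈ m) :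
    coef p q η ∈ m :=
  m.smul_mem _ (m.sub_mem (m.smul_mem _ (h _)) (m.smul_mem _ (h _)))

theorem det_eq (L : ℂ →L[ℝ] ℂ) :
    L.det = (L 1).re * (L Complex.I).im - (L Complex.I).re * (L 1).im := by
  rw [ContinuousLinearMap.det, ← LinearMap.det_toMatrix Complex.basisOneI, Matrix.det_fin_two]
  simp [LinearMap.toMatrix_apply]

/-- If `p` and `L ∘ p` are dependent, then `L(i) = i L(1)`, so `L` is complex linear and its
determinant `|L(1)|²` is not negative. This is how opposite orientation makes `dz` and `dw̄`
independent. -/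
theorem wedge_comp_ne_zero {p L : ℂ →L[ℝ] ℂ} (hp : p.det ≠ 0) (hL : L.det < 0) :
    wedge p (L.comp p) ≠ 0 := by
  intro h
  rw [det_eq] at hp hL
  have h' : p 1 * L (p Complex.I) - p Complex.I * L (p 1) = 0 := h
  rw [clm_apply_eq L (p Complex.I), clm_apply_eq L (p 1)] at h'
  generalize p 1 = a at *
  generalize p Complex.I = b at *
  generalize L 1 = c at *
  generalize L Complex.I = d at *
  have hre := congrArg Complex.re h'
  have him := congrArg Complex.im h'
  simp only [Complex.sub_re, Complex.mul_re, Complex.add_re, Complex.real_smul, Complex.ofReal_re,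
    Complex.ofReal_im, Complex.add_im, Complex.mul_im, Complex.sub_im, Complex.zero_re,
    Complex.zero_im] at hre him
  have e1 : (a.re * b.im - b.re * a.im) * (d.re + c.im) = 0 := by linear_combination hre
  have e2 : (a.re * b.im - b.re * a.im) * (d.im - c.re) = 0 := by linear_combination him
  have e3 := (mul_eq_zero.mp e1).resolve_left hp
  have e4 := (mul_eq_zero.mp e2).resolve_left hp
  have e5 : d.re = -c.im := by linarith
  have e6 : d.im = c.re := by linarith
  rw [e5, e6] at hL
  nlinarith [mul_self_nonneg c.re, mul_self_nonneg c.im]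

end Covectors

/-! ### Types of forms for the two complex structures -/

section Types

variable {S : Type*} [TopologicalSpace S] [ChartedSpace ℂ S] [IsManifold 𝓘(ℝ, ℂ) ∞ S]
  {W : Type*} [NormedAddCommGroup W] [NormedSpace ℂ W]

theorem ComplexStructure.contMDiffAt (c : ComplexStructure S) {z : OpenPartialHomeomorph S ℂ}
    (hz : z ∈ c.charts) {x : S} (hx : x ∈ z.source) : ContMDiffAt 𝓘(ℝ, ℂ) 𝓘(ℝ, ℂ) ∞ z x :=
  (contMDiffOn_of_mem_maximalAtlas (c.smooth z hz)).contMDiffAt (z.open_source.mem_nhds hx)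

theorem ComplexStructure.contMDiffAt_symm (c : ComplexStructure S) {z : OpenPartialHomeomorph S ℂ}
    (hz : z ∈ c.charts) {y : ℂ} (hy : y ∈ z.target) : ContMDiffAt 𝓘(ℝ, ℂ) 𝓘(ℝ, ℂ) ∞ z.symm y :=
  (contMDiffOn_symm_of_mem_maximalAtlas (c.smooth z hz)).contMDiffAt (z.open_target.mem_nhds hy)

theorem ComplexStructure.tder_comp_tder_symm (c : ComplexStructure S)
    {z : OpenPartialHomeomorph S ℂ} (hz : z ∈ c.charts) {x : S} (hx : x ∈ z.source) :
    (tder ℝ ℂ ℂ z x).comp (tder ℝ ℂ ℂ z.symm (z x)) = ContinuousLinearMap.id ℝ ℂ := by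
  rw [← tder_comp_of_eq (z x) (z.left_inv hx) (c.contMDiffAt hz hx).mdiff
    (c.contMDiffAt_symm hz (z.map_source hx)).mdiff, ← tder_id (M := ℂ)]
  refine tder_congr ?_
  filter_upwards [z.open_target.mem_nhds (z.map_source hx)] with a ha
  exact z.right_inv ha

theorem ComplexStructure.det_ne_zero (c : ComplexStructure S)
    {z : OpenPartialHomeomorph S ℂ} (hz : z ∈ c.charts) {x : S} (hx : x ∈ z.source) :
    (tder ℝ ℂ ℂ z x).det ≠ 0 := by
  intro h
  have h1 := congrArg ContinuousLinearMap.det (c.tder_comp_tder_symm hz hx)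
  rw [ContinuousLinearMap.det, ContinuousLinearMap.toLinearMap_comp, LinearMap.det_comp] at h1
  rw [ContinuousLinearMap.det] at h
  rw [h, zero_mul] at h1
  simp [ContinuousLinearMap.det] at h1

/-- Around a point of both domains, `w = (w ∘ z⁻¹) ∘ z`. -/
theorem tder_transition (c c' : ComplexStructure S) {z w : OpenPartialHomeomorph S ℂ}
    (hz : z ∈ c.charts) (hw : w ∈ c'.charts) {x : S} (hx : x ∈ z.source) (hx' : x ∈ w.source) :
    tder ℝ ℂ ℂ w x = (fderiv ℝ (w ∘ z.symm) (z x)).comp (tder ℝ ℂ ℂ z x) := by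
  have h1 : MDifferentiableAt 𝓘(ℝ, ℂ) 𝓘(ℝ, ℂ) (w ∘ z.symm) (z x) := by
    refine MDifferentiableAt.comp (g := w) (f := z.symm) (z x) ?_
      (c.contMDiffAt_symm hz (z.map_source hx)).mdiff
    rw [z.left_inv hx]
    exact (c'.contMDiffAt hw hx').mdiff
  rw [← tder_eq_fderiv, ← tder_comp x h1 (c.contMDiffAt hz hx).mdiff]
  refine tder_congr ?_
  filter_upwards [z.open_source.mem_nhds hx] with a ha
  simp only [Function.comp_apply, z.left_inv ha]

theorem OppositelyOriented.wedge_ne_zero {c₁ c₂ : ComplexStructure S}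
    (h : OppositelyOriented c₁ c₂) {z w : OpenPartialHomeomorph S ℂ}
    (hz : z ∈ c₁.charts) (hw : w ∈ c₂.charts) {x : S} (hx : x ∈ z.source) (hx' : x ∈ w.source) :
    wedge (tder ℝ ℂ ℂ z x) (tder ℝ ℂ ℂ w x) ≠ 0 := by
  rw [tder_transition c₁ c₂ hz hw hx hx']
  exact wedge_comp_ne_zero (c₁.det_ne_zero hz hx) (h z hz w hw x ⟨hx, hx'⟩)

theorem ComplexStructure.exists_tder_eq_smul (c : ComplexStructure S)
    {z z' : OpenPartialHomeomorph S ℂ} (hz : z ∈ c.charts) (hz' : z' ∈ c.charts) {x : S}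
    (hx : x ∈ z.source) (hx' : x ∈ z'.source) :
    ∃ μ : ℂ, μ ≠ 0 ∧ ∀ v, tder ℝ ℂ ℂ z' x v = μ * tder ℝ ℂ ℂ z x v := by
  have hopen : IsOpen (z.target ∩ z.symm ⁻¹' z'.source) :=
    z.isOpen_inter_preimage_symm z'.open_source
  have hd : DifferentiableAt ℂ (z' ∘ z.symm) (z x) :=
    (c.holomorphic z hz z' hz').differentiableAt
      (hopen.mem_nhds ⟨z.map_source hx, by simpa [z.left_inv hx] using hx'⟩)
  have h1 (v : ℂ) : tder ℝ ℂ ℂ z' x v = deriv (z' ∘ z.symm) (z x) * tder ℝ ℂ ℂ z x v := by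
    rw [tder_transition c c hz hz' hx hx', hd.hasFDerivAt.restrictScalars ℝ |>.fderiv]
    simp [mul_comm]
  refine ⟨_, fun h0 ↦ c.det_ne_zero hz' hx' ?_, h1⟩
  rw [det_eq, h1, h1, h0]
  simp

/-- The coordinates of the two complex structures have linearly independent differentials. -/
def Transverse (c c' : ComplexStructure S) : Prop :=
  ∀ z ∈ c.charts, ∀ w ∈ c'.charts, ∀ x, x ∈ z.source → x ∈ w.source →
    wedge (tder ℝ ℂ ℂ z x) (tder ℝ ℂ ℂ w x) ≠ 0

theorem OppositelyOriented.transverse {c₁ c₂ : ComplexStructure S}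
    (h : OppositelyOriented c₁ c₂) : Transverse c₁ c₂ :=
  fun _ hz _ hw _ hx hx' ↦ h.wedge_ne_zero hz hw hx hx'

theorem Transverse.symm {c c' : ComplexStructure S} (h : Transverse c c') : Transverse c' c :=
  fun z hz w hw x hx hx' h0 ↦ h w hw z hz x hx' hx (by rw [wedge_swap, h0, neg_zero])

/-- One coordinate suffices, as differentials of holomorphic coordinates are multiples of each other
by nonzero factors. -/
theorem isTypeOneZero_iff {c : ComplexStructure S} {z : OpenPartialHomeomorph S ℂ}
    (hz : z ∈ c.charts) {x : S} (hx : x ∈ z.source) (η : ℂ →L[ℝ] W) :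
    IsTypeOneZero c x η ↔ ∃ a : W, η = (tder ℝ ℂ ℂ z x).smulRight a := by
  constructor
  · intro h
    obtain ⟨a, ha⟩ := h z hz hx
    exact ⟨a, ContinuousLinearMap.ext ha⟩
  · rintro ⟨a, rfl⟩ z' hz' hx'
    obtain ⟨μ, hμ, h⟩ := c.exists_tder_eq_smul hz hz' hx hx'
    have key (v : ℂ) : tder ℝ ℂ ℂ z x v • a = tder ℝ ℂ ℂ z' x v • μ⁻¹ • a := by
      rw [h, smul_smul, mul_comm μ, mul_assoc, mul_inv_cancel₀ hμ, mul_one]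
    exact ⟨μ⁻¹ • a, key⟩

variable {c c' : ComplexStructure S} (hc : Transverse c c') {β : OneForm S W}
include hc

/-- Cramer's rule provides a splitting, so the choice in `typeProj` has a witness; independence of
`dz` and `dw̄` makes the splitting unique. -/
theorem typeProj_eq {z w : OpenPartialHomeomorph S ℂ} (hz : z ∈ c.charts) (hw : w ∈ c'.charts)
    {x : S} (hx : x ∈ z.source) (hx' : x ∈ w.source) :
    typeProj c c' β x =
      (tder ℝ ℂ ℂ z x).smulRight (coef (tder ℝ ℂ ℂ z x) (tder ℝ ℂ ℂ w x) (β x)) := by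
  have hne := hc z hz w hw x hx hx'
  have hex : ∃ η : TangentSpace 𝓘(ℝ, ℂ) x →L[ℝ] W,
      IsTypeOneZero c x η ∧ IsTypeOneZero c' x (β x - η) := by
    refine ⟨_, (isTypeOneZero_iff hz hx _).mpr ⟨coef (tder ℝ ℂ ℂ z x) (tder ℝ ℂ ℂ w x) (β x), rfl⟩,
      (isTypeOneZero_iff hw hx' _).mpr ⟨coef (tder ℝ ℂ ℂ w x) (tder ℝ ℂ ℂ z x) (β x), ?_⟩⟩
    exact sub_eq_of_eq_add' (coef_add_coef hne (β x)).symm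
  have hsp : IsTypeOneZero c x (typeProj c c' β x) ∧
      IsTypeOneZero c' x (β x - typeProj c c' β x) := Classical.epsilon_spec hex
  obtain ⟨a, ha⟩ := (isTypeOneZero_iff hz hx _).mp hsp.1
  obtain ⟨b, hb⟩ := (isTypeOneZero_iff hw hx' _).mp hsp.2
  rw [ha]
  congr 1
  have : (β x : ℂ →L[ℝ] W) = (tder ℝ ℂ ℂ z x).smulRight a + (tder ℝ ℂ ℂ w x).smulRight b := by
    rw [← ha, ← hb]
    exact (add_sub_cancel _ _).symm
  rw [this, coef_smulRight_add hne]

theorem typeProj_spec (x : S) : IsTypeOneZero c x (typeProj c c' β x) ∧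
    typeProj c c' β x + typeProj c' c β x = β x := by
  obtain ⟨z, hz, hx⟩ := c.cover x
  obtain ⟨w, hw, hx'⟩ := c'.cover x
  rw [typeProj_eq hc hz hw hx hx', typeProj_eq hc.symm hw hz hx' hx]
  exact ⟨(isTypeOneZero_iff hz hx _).mpr ⟨_, rfl⟩, coef_add_coef (hc z hz w hw x hx hx') (β x)⟩

/-- The components with respect to the splitting into types are unique. -/
theorem typeProj_of_eq_add {x : S} {η η' : ℂ →L[ℝ] W} (h : IsTypeOneZero c x η)
    (h' : IsTypeOneZero c' x η') (hβ : β x = η + η') : typeProj c c' β x = η := by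
  obtain ⟨z, hz, hx⟩ := c.cover x
  obtain ⟨w, hw, hx'⟩ := c'.cover x
  obtain ⟨a, rfl⟩ := (isTypeOneZero_iff hz hx _).mp h
  obtain ⟨b, rfl⟩ := (isTypeOneZero_iff hw hx' _).mp h'
  rw [typeProj_eq hc hz hw hx hx', hβ, coef_smulRight_add (hc z hz w hw x hx hx')]

theorem typeProj_of_isType {x : S} (h : IsTypeOneZero c x (β x)) : typeProj c c' β x = β x :=
  typeProj_of_eq_add hc h (η' := 0) (fun _ _ _ ↦ ⟨0, fun _ ↦ (smul_zero _).symm⟩)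
    (add_zero (β x)).symm

theorem typeProj_comp {W' : Type*} [NormedAddCommGroup W'] [NormedSpace ℂ W'] (L : W →L[ℂ] W')
    {β' : OneForm S W'} {x : S} (h : ∀ v, β' x v = L (β x v)) (v : ℂ) :
    typeProj c c' β' x v = L (typeProj c c' β x v) := by
  obtain ⟨z, hz, hx⟩ := c.cover x
  obtain ⟨w, hw, hx'⟩ := c'.cover x
  rw [typeProj_eq hc hz hw hx hx', typeProj_eq hc hz hw hx hx', coef_comp _ _ L h]
  change tder ℝ ℂ ℂ z x v • _ = L (tder ℝ ℂ ℂ z x v • _)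
  rw [map_smul]

theorem typeProj_mem {m : Submodule ℂ W} {x : S} (h : ∀ v, β x v ∈ m) (v : ℂ) :
    typeProj c c' β x v ∈ m := by
  obtain ⟨z, hz, hx⟩ := c.cover x
  obtain ⟨w, hw, hx'⟩ := c'.cover x
  rw [typeProj_eq hc hz hw hx hx']
  exact m.smul_mem _ (coef_mem _ _ h)

end Types

/-! ### Smoothness and pull-back of coefficients -/

section CoefCalculus

variable {W : Type*} [NormedAddCommGroup W] [NormedSpace ℂ W]

theorem contDiffAt_coef {p q : ℂ → ℂ →L[ℝ] ℂ} {η : ℂ → ℂ →L[ℝ] W} {y : ℂ}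
    (hp : ContDiffAt ℝ ∞ p y) (hq : ContDiffAt ℝ ∞ q y) (hη : ContDiffAt ℝ ∞ η y)
    (h : wedge (p y) (q y) ≠ 0) : ContDiffAt ℝ ∞ (fun z ↦ coef (p z) (q z) (η z)) y := by
  have h1 : ContDiffAt ℝ ∞ (fun z ↦ wedge (p z) (q z)) y :=
    ((hp.clm_apply contDiffAt_const).mul (hq.clm_apply contDiffAt_const)).sub
      ((hp.clm_apply contDiffAt_const).mul (hq.clm_apply contDiffAt_const))
  exact (h1.inv h).smul (((hq.clm_apply contDiffAt_const).smul (hη.clm_apply contDiffAt_const)).sub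
    ((hq.clm_apply contDiffAt_const).smul (hη.clm_apply contDiffAt_const)))

theorem contDiffAt_smulRight {p : ℂ → ℂ →L[ℝ] ℂ} {a : ℂ → W} {y : ℂ}
    (hp : ContDiffAt ℝ ∞ p y) (ha : ContDiffAt ℝ ∞ a y) :
    ContDiffAt ℝ ∞ (fun z ↦ (p z).smulRight (a z)) y :=
  contDiffAt_of_apply fun _ ↦ (hp.clm_apply contDiffAt_const).smul ha

theorem wedge_comp (p q κ : ℂ →L[ℝ] ℂ) : wedge (p.comp κ) (q.comp κ) = κ.det * wedge p q := by
  simp only [wedge, ContinuousLinearMap.comp_apply, det_eq]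
  rw [clm_apply_eq p (κ 1), clm_apply_eq p (κ Complex.I), clm_apply_eq q (κ 1),
    clm_apply_eq q (κ Complex.I)]
  simp only [Complex.real_smul]
  push_cast
  ring

end CoefCalculus

/-! ### Smoothness of the projections to types -/

section TypeSmooth

variable {S : Type*} [TopologicalSpace S] [ChartedSpace ℂ S] [IsManifold 𝓘(ℝ, ℂ) ∞ S]
  {W : Type*} [NormedAddCommGroup W] [NormedSpace ℂ W]
  {c c' : ComplexStructure S} (hc : Transverse c c') {β : OneForm S W}

include hc in
-- With coordinates fixed near `x`, the projection is `dz` times a Cramer coefficient. The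
-- coefficient does not change under pull-back by the inverse chart, so it can be computed from
-- smooth data in the chart.
theorem contDiffAt_typeProj {x : S} (hβ : ContDiffAt ℝ ∞ (formInChart β x) (chartAt ℂ x x)) :
    ContDiffAt ℝ ∞ (formInChart (typeProj c c' β) x) (chartAt ℂ x x) := by
  obtain ⟨z, hz, hx⟩ := c.cover x
  obtain ⟨w, hw, hx'⟩ := c'.cover x
  set e := chartAt ℂ x with he
  have hex : e.symm (e x) = x := e.left_inv (mem_chart_source ℂ x)
  have hmem : e x ∈ e.target := mem_chart_target ℂ x
  have htar : ∀ᶠ y in 𝓝 (e x), y ∈ e.target := e.open_target.mem_nhds hmem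
  have hcont : Tendsto e.symm (𝓝 (e x)) (𝓝 x) := by
    have := e.continuousAt_symm hmem
    rwa [ContinuousAt, hex] at this
  have hzs : ∀ᶠ y in 𝓝 (e x), e.symm y ∈ z.source := hcont (z.open_source.mem_nhds hx)
  have hws : ∀ᶠ y in 𝓝 (e x), e.symm y ∈ w.source := hcont (w.open_source.mem_nhds hx')
  have hcomp (y) (hy : y ∈ e.target) {d : ComplexStructure S} {ζ : OpenPartialHomeomorph S ℂ}
      (hζ : ζ ∈ d.charts) (hy' : e.symm y ∈ ζ.source) :
      ContDiffAt ℝ ∞ (fun y ↦ ζ (e.symm y)) y ∧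
        fderiv ℝ (fun y ↦ ζ (e.symm y)) y =
          (tder ℝ ℂ ℂ ζ (e.symm y)).comp (tder ℝ ℂ ℂ e.symm y) := by
    refine ⟨(ContMDiffAt.comp y (d.contMDiffAt hζ hy') (contMDiffAt_chart_symm hy)).contDiffAt, ?_⟩
    rw [← tder_eq_fderiv, tder_comp y (d.contMDiffAt hζ hy').mdiff (contMDiffAt_chart_symm hy).mdiff]
  have hdet (y) (hy : y ∈ e.target) : ((tder ℝ ℂ ℂ e.symm y).det : ℂ) ≠ 0 := by
    intro h
    have h1 := congrArg ContinuousLinearMap.det (tder_chart_comp_tder_symm (𝕜 := ℝ) hy)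
    rw [ContinuousLinearMap.det, ContinuousLinearMap.toLinearMap_comp, LinearMap.det_comp] at h1
    rw [ContinuousLinearMap.det, Complex.ofReal_eq_zero] at h
    rw [h, mul_zero] at h1
    simp [ContinuousLinearMap.det] at h1
  have h1 : formInChart (typeProj c c' β) x =ᶠ[𝓝 (e x)] fun y ↦
      (fderiv ℝ (fun y ↦ z (e.symm y)) y).smulRight (coef (fderiv ℝ (fun y ↦ z (e.symm y)) y)
        (fderiv ℝ (fun y ↦ w (e.symm y)) y) (formInChart β x y)) := by
    filter_upwards [htar, hzs, hws] with y h1 h2 h3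
    have hw0 := hc z hz w hw _ h2 h3
    have hw1 : wedge (fderiv ℝ (fun y ↦ z (e.symm y)) y) (fderiv ℝ (fun y ↦ w (e.symm y)) y) ≠ 0 := by
      rw [(hcomp y h1 hz h2).2, (hcomp y h1 hw h3).2, wedge_comp]
      exact mul_ne_zero (hdet y h1) hw0
    have hb : formInChart β x y = (fderiv ℝ (fun y ↦ z (e.symm y)) y).smulRight
        (coef (tder ℝ ℂ ℂ z (e.symm y)) (tder ℝ ℂ ℂ w (e.symm y)) (β (e.symm y))) +
        (fderiv ℝ (fun y ↦ w (e.symm y)) y).smulRight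
        (coef (tder ℝ ℂ ℂ w (e.symm y)) (tder ℝ ℂ ℂ z (e.symm y)) (β (e.symm y))) := by
      ext v
      rw [(hcomp y h1 hz h2).2, (hcomp y h1 hw h3).2, formInChart_eq_pull, pull_apply]
      exact (DFunLike.congr_fun (coef_add_coef hw0 (β (e.symm y))) (tder ℝ ℂ ℂ e.symm y v)).symm
    have hl : coef (fderiv ℝ (fun y ↦ z (e.symm y)) y)
        (fderiv ℝ (fun y ↦ w (e.symm y)) y) (formInChart β x y) =
        coef (tder ℝ ℂ ℂ z (e.symm y)) (tder ℝ ℂ ℂ w (e.symm y)) (β (e.symm y)) := by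
      rw [hb, coef_smulRight_add hw1]
    rw [hl, formInChart_eq_pull, pull, typeProj_eq hc hz hw h2 h3, (hcomp y h1 hz h2).2]
    rfl
  refine ContDiffAt.congr_of_eventuallyEq ?_ h1
  have hxz : e.symm (e x) ∈ z.source := by rwa [hex]
  have hxw : e.symm (e x) ∈ w.source := by rwa [hex]
  have d1 := (hcomp _ hmem hz hxz).1.fderiv_right (m := ∞) (by simp)
  have d2 := (hcomp _ hmem hw hxw).1.fderiv_right (m := ∞) (by simp)
  refine contDiffAt_smulRight d1 (contDiffAt_coef d1 d2 hβ ?_)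
  rw [(hcomp _ hmem hz hxz).2, (hcomp _ hmem hw hxw).2, wedge_comp]
  exact mul_ne_zero (hdet _ hmem) (hc z hz w hw _ hxz hxw)

end TypeSmooth

/-! ### The two parts of the Maurer-Cartan form of a lift -/

section Parts

variable {EG : Type*} [NormedAddCommGroup EG] [NormedSpace ℝ EG] [CompleteSpace EG]
  [FiniteDimensional ℝ EG]
  {G : Type*} [TopologicalSpace G] [T2Space G] [ChartedSpace EG G] [Group G]
  [LieGroup 𝓘(ℝ, EG) ∞ G]
  {ν : LinearMap.BilinForm ℝ (GroupLieAlgebra 𝓘(ℝ, EG) G)}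
  {E : Type*} [NormedAddCommGroup E] [NormedSpace ℂ E] [FiniteDimensional ℂ E]
  {GC : Type*} [TopologicalSpace GC] [T2Space GC] [ChartedSpace E GC] [Group GC]
  [LieGroup 𝓘(ℂ, E) ω GC]
  {j : G →* GC} (hj : IsComplexification EG E j) (M : MaximalCompact ν)

/-- The `𝔨 ⊗ ℂ`-part of the Maurer-Cartan form. -/
def partK {N Q : Type*} [NormedAddCommGroup N] [NormedSpace ℝ N] [TopologicalSpace Q]
    [ChartedSpace N Q] (s : Q → GC) (y : Q) : N →L[ℝ] E :=
  ((M.prK hj).restrictScalars ℝ).comp (mc ℝ E N s y)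

/-- The `𝔭 ⊗ ℂ`-part of the Maurer-Cartan form. -/
def partP {N Q : Type*} [NormedAddCommGroup N] [NormedSpace ℝ N] [TopologicalSpace Q]
    [ChartedSpace N Q] (s : Q → GC) (y : Q) : N →L[ℝ] E :=
  ((M.prP hj).restrictScalars ℝ).comp (mc ℝ E N s y)

/-- The `𝔭 ⊗ ℂ`-part of the Maurer-Cartan equation. -/
theorem covD_part {s : ℂ → GC} {y : ℂ}
    (hs : ∀ᶠ z in 𝓝 y, ContMDiffAt 𝓘(ℝ, ℂ) 𝓘(ℝ, E) ∞ s z) (u v : ℂ) :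
    covD GC (partK hj M s) (partP hj M s) y u v = 0 := by
  have : CompleteSpace E := FiniteDimensional.complete ℂ E
  have h1 := fderiv_mc_sub hs u v
  have h2 : HasFDerivAt (fun y ↦ mc ℝ E ℂ s y) _ y :=
    ((contDiffAt_mc hs).differentiableAt (by simp)).hasFDerivAt
  have h3 (u v : ℂ) : fderiv ℝ (partP hj M (N := ℂ) s) y u v =
      M.prP hj (fderiv ℝ (fun y ↦ mc ℝ E ℂ s y) y u v) := by
    have := (hasFDerivAt_const ((M.prP hj).restrictScalars ℝ) y).clm_comp h2
    rw [show fderiv ℝ (partP hj M (N := ℂ) s) y = _ from this.fderiv]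
    simp
  have h4 := congrArg (M.prP hj) h1
  rw [map_zero, map_add, map_sub, ← h3, ← h3, lieB_real] at h4
  -- Of the bracket of `𝔨`- and `𝔭`-parts only the mixed terms have a `𝔭`-component.
  have h5 : M.prP hj (lieB ℂ GC (mc ℝ E ℂ s y u) (mc ℝ E ℂ s y v)) =
      lieB ℂ GC (partK hj M s y u) (partP hj M s y v) -
        lieB ℂ GC (partK hj M s y v) (partP hj M s y u) := by
    have e (u : ℂ) : mc ℝ E ℂ s y u = partK hj M s y u + partP hj M s y u :=
      (M.prK_add_prP hj _).symm
    have hK (u : ℂ) : partK hj M s y u ∈ M.kC E j := M.prK_mem hj _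
    have hP (u : ℂ) : partP hj M s y u ∈ M.pC E j := M.prP_mem hj _
    rw [e u, e v, lieB_add_left, lieB_add_right, lieB_add_right, map_add, map_add, map_add,
      M.prP_of_mem_kC hj (M.lieB_kC_kC hj (hK u) (hK v)),
      M.prP_of_mem_pC hj (M.lieB_kC_pC hj (hK u) (hP v)),
      M.prP_of_mem_kC hj (M.lieB_pC_pC hj (hP u) (hP v)),
      lieB_skew (𝕜 := ℂ) (partP hj M s y u), map_neg,
      M.prP_of_mem_pC hj (M.lieB_kC_pC hj (hK v) (hP u))]
    abel
  rw [h5] at h4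
  rw [covD, extD, add_sub_assoc]
  exact h4

end Parts

/-! ### The tension field in terms of a lift -/

section Tension

variable {EG : Type*} [NormedAddCommGroup EG] [NormedSpace ℝ EG] [CompleteSpace EG]
  [FiniteDimensional ℝ EG]
  {G : Type*} [TopologicalSpace G] [T2Space G] [ChartedSpace EG G] [Group G]
  [LieGroup 𝓘(ℝ, EG) ∞ G]
  {ν : LinearMap.BilinForm ℝ (GroupLieAlgebra 𝓘(ℝ, EG) G)}
  {E : Type*} [NormedAddCommGroup E] [NormedSpace ℂ E] [FiniteDimensional ℂ E]
  {GC : Type*} [TopologicalSpace GC] [T2Space GC] [ChartedSpace E GC] [Group GC]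
  [LieGroup 𝓘(ℂ, E) ω GC]
  {j : G →* GC} (hj : IsComplexification EG E j) {M : MaximalCompact ν}
  {V : Type*} [NormedAddCommGroup V] [NormedSpace ℂ V] [ChartedSpace V (GC ⧸ M.KC E j)]
  [IsManifold 𝓘(ℂ, V) ω (GC ⧸ M.KC E j)]
  (hq : IsHolomorphicQuotient E V (M.KC E j))
  (hG : LieAlgebra.IsSemisimple ℝ (GroupLieAlgebra 𝓘(ℝ, EG) G))
  {St : Type*} [TopologicalSpace St] [ChartedSpace ℂ St] [IsManifold 𝓘(ℝ, ℂ) ∞ St]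

theorem fderiv_symm {F : Type*} [NormedAddCommGroup F] [NormedSpace ℝ F] {Z : ℂ → F} {y : ℂ}
    (hZ : ContDiffAt ℝ ∞ Z y) (u v : ℂ) :
    fderiv ℝ (fun z ↦ fderiv ℝ Z z v) y u = fderiv ℝ (fun z ↦ fderiv ℝ Z z u) y v := by
  have h : DifferentiableAt ℝ (fderiv ℝ Z) y :=
    (hZ.fderiv_right (m := ∞) (by simp)).differentiableAt (by simp)
  have h' (u v : ℂ) : fderiv ℝ (fun z ↦ fderiv ℝ Z z v) y u = fderiv ℝ (fderiv ℝ Z) y u v := by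
    have := h.hasFDerivAt.clm_apply (hasFDerivAt_const v y)
    rw [this.fderiv]
    simp
  rw [h', h']
  exact (hZ.isSymmSndFDerivAt (by simp; exact WithTop.coe_le_coe.mpr le_top)) u v

theorem extD_smulRight {W : Type*} [NormedAddCommGroup W] [NormedSpace ℂ W] {Z : ℂ → ℂ} {a : ℂ → W}
    {y : ℂ} (hZ : ContDiffAt ℝ ∞ Z y) (ha : ContDiffAt ℝ ∞ a y) (u v : ℂ) :
    extD (fun y ↦ (fderiv ℝ Z y).smulRight (a y)) y u v =
      fderiv ℝ Z y v • fderiv ℝ a y u - fderiv ℝ Z y u • fderiv ℝ a y v := by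
  have hd := (hZ.fderiv_right (m := ∞) (by simp))
  have h := (contDiffAt_smulRight hd ha).differentiableAt (by simp)
  have h' (u v : ℂ) : fderiv ℝ (fun y ↦ (fderiv ℝ Z y).smulRight (a y)) y u v =
      fderiv ℝ (fun z ↦ fderiv ℝ Z z v) y u • a y + fderiv ℝ Z y v • fderiv ℝ a y u := by
    have h1 := h.hasFDerivAt.clm_apply (hasFDerivAt_const v y)
    have h2 : HasFDerivAt (fun z ↦ fderiv ℝ Z z v) _ y :=
      ((hd.clm_apply contDiffAt_const).differentiableAt (by simp)).hasFDerivAt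
    have h3 : HasFDerivAt a _ y := (ha.differentiableAt (by simp)).hasFDerivAt
    have h4 := congrArg (fun L ↦ L u) (h1.unique (h2.smul h3))
    simpa [add_comm] using h4
  rw [extD, h', h', fderiv_symm hZ u v]
  abel

include hj hq hG in
/-- The tension field of a map to the symmetric space, computed with a local lift to the group. -/
theorem exists_frame_tension (hν_symm : ν.IsSymm)
    (hν : ∀ (g : G) a b, ν (Ad (𝕜 := ℝ) EG g a) (Ad (𝕜 := ℝ) EG g b) = ν a b)
    {f : St → GC ⧸ M.KC E j} (hf : ContMDiff 𝓘(ℝ, ℂ) 𝓘(ℝ, V) ∞ f) (x : St) {s : ℂ → GC}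
    (hs : ∀ᶠ y in 𝓝 (chartAt ℂ x x), ContMDiffAt 𝓘(ℝ, ℂ) 𝓘(ℝ, E) ∞ s y ∧
      QuotientGroup.mk (s y) = f ((chartAt ℂ x).symm y))
    {Z W : ℂ → ℂ} (hZ : ContDiffAt ℝ ∞ Z (chartAt ℂ x x)) (hW : ContDiffAt ℝ ∞ W (chartAt ℂ x x))
    {a b : ℂ → E} (ha : ContDiffAt ℝ ∞ a (chartAt ℂ x x)) (hb : ContDiffAt ℝ ∞ b (chartAt ℂ x x))
    (hab : ∀ᶠ y in 𝓝 (chartAt ℂ x x), partP hj M s y =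
      (fderiv ℝ Z y).smulRight (a y) + (fderiv ℝ W y).smulRight (b y))
    (hZW : wedge (fderiv ℝ Z (chartAt ℂ x x)) (fderiv ℝ W (chartAt ℂ x x)) ≠ 0)
    {g : ∀ x : St, TangentSpace 𝓘(ℝ, ℂ) x →L[ℝ] TangentSpace 𝓘(ℝ, ℂ) x →L[ℝ] ℂ}
    {lam : ℂ → ℂ} (hlam : DifferentiableAt ℝ lam (chartAt ℂ x x)) (hlam0 : lam (chartAt ℂ x x) ≠ 0)
    (hg : ∀ᶠ y in 𝓝 (chartAt ℂ x x), ∀ i k, metricMatrix g x y i k =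
      lam y * (fderiv ℝ Z y (frame i) * fderiv ℝ W y (frame k) +
        fderiv ℝ W y (frame i) * fderiv ℝ Z y (frame k))) :
    ∃ Q : V →L[ℂ] E, Function.Injective Q ∧ ∃ r : ℂ, r ≠ 0 ∧
      Q (tension (M.symmetricMetric (V := V) j) g f x) =
        r • covD GC (partK hj M s) (fun y ↦ (fderiv ℝ W y).smulRight (b y)) (chartAt ℂ x x)
          1 Complex.I := by
  have : CompleteSpace E := FiniteDimensional.complete ℂ E
  obtain ⟨Q, hQ, -, hQ1, hQ2⟩ := exists_frame_second_derivative hj hq hG hν_symm hν hf x hs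
  set y₀ := chartAt ℂ x x with hy₀
  have hZ' := hZ.fderiv_right (m := ∞) (by simp)
  have hW' := hW.fderiv_right (m := ∞) (by simp)
  have hZd (v : ℂ) : HasFDerivAt (fun z ↦ fderiv ℝ Z z v) _ y₀ :=
    ((hZ'.clm_apply contDiffAt_const).differentiableAt (by simp)).hasFDerivAt
  have hWd (v : ℂ) : HasFDerivAt (fun z ↦ fderiv ℝ W z v) _ y₀ :=
    ((hW'.clm_apply contDiffAt_const).differentiableAt (by simp)).hasFDerivAt
  have had : HasFDerivAt a _ y₀ := (ha.differentiableAt (by simp)).hasFDerivAt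
  have hbd : HasFDerivAt b _ y₀ := (hb.differentiableAt (by simp)).hasFDerivAt
  let A : Fin 2 → E := fun i ↦ partK hj M s y₀ (frame i)
  let na : Fin 2 → E := fun i ↦ fderiv ℝ a y₀ (frame i) + lieB ℂ GC (A i) (a y₀)
  let nb : Fin 2 → E := fun i ↦ fderiv ℝ b y₀ (frame i) + lieB ℂ GC (A i) (b y₀)
  let Zf : Fin 2 → ℂ := fun i ↦ fderiv ℝ Z y₀ (frame i)
  let Wf : Fin 2 → ℂ := fun i ↦ fderiv ℝ W y₀ (frame i)
  let ZZ : Fin 2 → Fin 2 → ℂ := fun i k ↦ fderiv ℝ (fun z ↦ fderiv ℝ Z z (frame k)) y₀ (frame i)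
  let WW : Fin 2 → Fin 2 → ℂ := fun i k ↦ fderiv ℝ (fun z ↦ fderiv ℝ W z (frame k)) y₀ (frame i)
  have hφ (v : ℂ) : (fun y ↦ M.prP hj (mc ℝ E ℂ s y v)) =ᶠ[𝓝 y₀]
      fun y ↦ fderiv ℝ Z y v • a y + fderiv ℝ W y v • b y := by
    filter_upwards [hab] with y hy
    exact DFunLike.congr_fun hy v
  have hφ0 (v : ℂ) : M.prP hj (mc ℝ E ℂ s y₀ v) = fderiv ℝ Z y₀ v • a y₀ + fderiv ℝ W y₀ v • b y₀ :=
    (hφ v).self_of_nhds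
  -- The covariant derivative of `a dz + b dw̄`: covariant derivatives of the coefficients plus
  -- second derivatives of the coordinates.
  have hsec (i k : Fin 2) : fderiv ℝ (fun y ↦ M.prP hj (mc ℝ E ℂ s y (frame k))) y₀ (frame i) +
      lieB ℂ GC (M.prK hj (mc ℝ E ℂ s y₀ (frame i))) (M.prP hj (mc ℝ E ℂ s y₀ (frame k))) =
      Zf k • na i + ZZ i k • a y₀ + (Wf k • nb i + WW i k • b y₀) := by
    rw [(hφ (frame k)).fderiv_eq, hφ0,
      show fderiv ℝ (fun y ↦ fderiv ℝ Z y (frame k) • a y + fderiv ℝ W y (frame k) • b y) y₀ = _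
        from (((hZd (frame k)).smul had).add ((hWd (frame k)).smul hbd)).fderiv, lieB_add_right,
      lieB_smul_right, lieB_smul_right]
    simp only [add_apply, smul_apply, ContinuousLinearMap.smulRight_apply, Zf, Wf, ZZ, WW, na, nb, A]
    change _ + (fderiv ℝ Z y₀ (frame k) • lieB ℂ GC (partK hj M s y₀ (frame i)) (a y₀) +
      fderiv ℝ W y₀ (frame k) • lieB ℂ GC (partK hj M s y₀ (frame i)) (b y₀)) = _
    simp only [smul_add]
    abel
  have hcov {Y : ℂ → ℂ} {e : ℂ → E} (hY : ContDiffAt ℝ ∞ Y y₀) (he : ContDiffAt ℝ ∞ e y₀) :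
      covD GC (partK hj M s) (fun y ↦ (fderiv ℝ Y y).smulRight (e y)) y₀ 1 Complex.I =
        fderiv ℝ Y y₀ Complex.I • (fderiv ℝ e y₀ 1 + lieB ℂ GC (A 0) (e y₀)) -
        fderiv ℝ Y y₀ 1 • (fderiv ℝ e y₀ Complex.I + lieB ℂ GC (A 1) (e y₀)) := by
    rw [covD, extD_smulRight hY he]
    simp only [ContinuousLinearMap.smulRight_apply, lieB_smul_right, smul_add]
    simp only [A, frame, Matrix.cons_val_zero, Matrix.cons_val_one]
    abel
  -- The `𝔭`-part of the Maurer-Cartan equation of the lift, split along `dz` and `dw̄`.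
  have hflat : (Zf 1 • na 0 - Zf 0 • na 1) + (Wf 1 • nb 0 - Wf 0 • nb 1) = 0 := by
    have h1 := covD_part hj M (hs.mono fun _ h ↦ h.1) 1 Complex.I
    have h2 : covD GC (partK hj M s) (partP hj M s) y₀ 1 Complex.I =
        covD GC (partK hj M s) (fun y ↦ (fderiv ℝ Z y).smulRight (a y)) y₀ 1 Complex.I +
        covD GC (partK hj M s) (fun y ↦ (fderiv ℝ W y).smulRight (b y)) y₀ 1 Complex.I := by
      rw [covD_congr GC rfl hab]
      have e1 := ((contDiffAt_smulRight hZ' ha).differentiableAt (by simp)).hasFDerivAt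
      have e2 := ((contDiffAt_smulRight hW' hb).differentiableAt (by simp)).hasFDerivAt
      simp only [covD, extD, add_apply, lieB_add_right]
      rw [show fderiv ℝ (fun y ↦ (fderiv ℝ Z y).smulRight (a y) + (fderiv ℝ W y).smulRight (b y)) y₀
        = _ from (e1.add e2).fderiv]
      simp only [add_apply]
      abel
    rw [h1, hcov hZ ha, hcov hW hb] at h2
    exact h2.symm
  have hdg (i k l : Fin 2) : fderiv ℝ (fun y ↦ metricMatrix g x y i k) y₀ (frame l) =
      fderiv ℝ lam y₀ (frame l) * (Zf i * Wf k + Wf i * Zf k) +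
      lam y₀ * (ZZ l i * Wf k + Zf i * WW l k + WW l i * Zf k + Wf i * ZZ l k) := by
    have e : (fun y ↦ metricMatrix g x y i k) =ᶠ[𝓝 y₀] fun y ↦
        lam y * (fderiv ℝ Z y (frame i) * fderiv ℝ W y (frame k) +
        fderiv ℝ W y (frame i) * fderiv ℝ Z y (frame k)) := hg.mono fun y h ↦ h i k
    have h1 := (hlam.hasFDerivAt.mul (((hZd (frame i)).mul (hWd (frame k))).add
      ((hWd (frame i)).mul (hZd (frame k))))).fderiv
    rw [e.fderiv_eq]
    refine (DFunLike.congr_fun h1 (frame l)).trans ?_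
    simp only [add_apply, smul_apply, smul_eq_mul, Pi.add_apply, Pi.mul_apply, Zf, Wf, ZZ, WW]
    ring
  have hΔ : Zf 0 * Wf 1 - Zf 1 * Wf 0 ≠ 0 := hZW
  refine ⟨Q, hQ, 2 / (lam y₀ * (Zf 0 * Wf 1 - Zf 1 * Wf 0)),
    div_ne_zero two_ne_zero (mul_ne_zero hlam0 hΔ), ?_⟩
  have key := trace_second_derivative hlam0 hΔ (a := a y₀) (b := b y₀) (g := metricMatrix g x y₀)
    (fun i k ↦ hg.self_of_nhds i k) (ZZ := ZZ) (WW := WW) (fderiv_symm hZ _ _) (fderiv_symm hW _ _)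
    (dg := fun i k l ↦ fderiv ℝ (fun y ↦ metricMatrix g x y i k) y₀ (frame l)) hdg hflat
  rw [hcov hW hb]
  refine Eq.trans ?_ key
  simp only [tension, map_sum, map_smul]
  refine Finset.sum_congr rfl fun i _ ↦ Finset.sum_congr rfl fun k _ ↦ ?_
  congr 1
  rw [sub_add_eq_add_sub, map_sub, hQ2, hsec, map_sum]
  congr 1
  refine Finset.sum_congr rfl fun l _ ↦ ?_
  rw [map_smul, hQ1, hφ0]
  rfl

end Tension

/-! ### Two-forms on the plane are determined by one value -/

section Alternating

variable {E : Type*} [NormedAddCommGroup E] [NormedSpace ℂ E] [CompleteSpace E]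
  {GC : Type*} [TopologicalSpace GC] [ChartedSpace E GC] [Group GC] [LieGroup 𝓘(ℂ, E) ω GC]

theorem covD_eq_smul (A β : ℂ → ℂ →L[ℝ] E) (y u v : ℂ) :
    covD GC A β y u v = (u.re * v.im - u.im * v.re) • covD GC A β y 1 Complex.I := by
  simp only [covD, extD, ← lieB_real]
  rw [clm_apply_eq (fderiv ℝ β y) u, clm_apply_eq (fderiv ℝ β y) v, clm_apply_eq (A y) u,
    clm_apply_eq (A y) v]
  simp only [add_apply, smul_apply]
  rw [clm_apply_eq (fderiv ℝ β y 1) u, clm_apply_eq (fderiv ℝ β y Complex.I) u,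
    clm_apply_eq (fderiv ℝ β y 1) v, clm_apply_eq (fderiv ℝ β y Complex.I) v,
    clm_apply_eq (β y) u, clm_apply_eq (β y) v]
  simp only [lieB_add_left, lieB_add_right, lieB_smul_left, lieB_smul_right]
  module

theorem covD_eq_zero_of {A β : ℂ → ℂ →L[ℝ] E} {y : ℂ} (h : covD GC A β y 1 Complex.I = 0) (u v : ℂ) :
    covD GC A β y u v = 0 := by
  rw [covD_eq_smul, h, smul_zero]

end Alternating

/-! ### Coordinates and complex metrics on the covering -/

section Coordinates

variable {S St : Type*} [TopologicalSpace S] [ChartedSpace ℂ S] [IsManifold 𝓘(ℝ, ℂ) ∞ S]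
  [TopologicalSpace St] [ChartedSpace ℂ St] [IsManifold 𝓘(ℝ, ℂ) ∞ St]
  {π : St → S} (hπ : IsLocalDiffeomorph 𝓘(ℝ, ℂ) 𝓘(ℝ, ℂ) ∞ π)

include hπ in
theorem tder_surjective (x : St) : Function.Surjective (tder ℝ ℂ ℂ π x) :=
  ((hπ x).mfderivToContinuousLinearEquiv (by simp)).surjective

include hπ in
theorem tder_injective (x : St) : Function.Injective (tder ℝ ℂ ℂ π x) :=
  ((hπ x).mfderivToContinuousLinearEquiv (by simp)).injective

theorem det_ne_zero_of_injective {L : ℂ →L[ℝ] ℂ} (h : Function.Injective L) : L.det ≠ 0 := by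
  intro h0
  have := LinearMap.bot_lt_ker_of_det_eq_zero (f := (L : ℂ →ₗ[ℝ] ℂ)) h0
  rw [LinearMap.ker_eq_bot.mpr h] at this
  exact lt_irrefl _ this

include hπ in
theorem eventually_contMDiffAt_comp_symm (x : St) : ∀ᶠ y in 𝓝 (chartAt ℂ x x),
    ContMDiffAt 𝓘(ℝ, ℂ) 𝓘(ℝ, ℂ) ∞ (fun y ↦ π ((chartAt ℂ x).symm y)) y := by
  filter_upwards [(chartAt ℂ x).open_target.mem_nhds (mem_chart_target ℂ x)] with y hy
  exact ContMDiffAt.comp y (hπ.contMDiff _) (contMDiffAt_chart_symm hy)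

include hπ in
theorem tder_comp_symm_self (x : St) :
    tder ℝ ℂ ℂ (fun y ↦ π ((chartAt ℂ x).symm y)) (chartAt ℂ x x) = tder ℝ ℂ ℂ π x := by
  rw [tder_comp_of_eq (g := π) _ ((chartAt ℂ x).left_inv (mem_chart_source ℂ x))
    (hπ.contMDiff _).mdiff (contMDiffAt_chart_symm (mem_chart_target ℂ x)).mdiff,
    tder_chart_symm_self, ContinuousLinearMap.comp_id]

/-- A coordinate of a complex structure of `S`, read in a chart of the covering. -/
def coord (π : St → S) (x : St) (z : OpenPartialHomeomorph S ℂ) (y : ℂ) : ℂ :=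
  z (π ((chartAt ℂ x).symm y))

variable {c c₁ c₂ : ComplexStructure S}

include hπ in
theorem coord_spec {z : OpenPartialHomeomorph S ℂ} (hz : z ∈ c.charts) {x : St} {y : ℂ}
    (hy : y ∈ (chartAt ℂ x).target) (hyz : π ((chartAt ℂ x).symm y) ∈ z.source) :
    ContDiffAt ℝ ∞ (coord π x z) y ∧
    fderiv ℝ (coord π x z) y = (tder ℝ ℂ ℂ z (π ((chartAt ℂ x).symm y))).comp
      (tder ℝ ℂ ℂ (fun y ↦ π ((chartAt ℂ x).symm y)) y) ∧
    ∀ v, tder ℝ ℂ ℂ (z ∘ π) ((chartAt ℂ x).symm y) (tder ℝ ℂ ℂ (chartAt ℂ x).symm y v) =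
      fderiv ℝ (coord π x z) y v := by
  have hs := contMDiffAt_chart_symm (𝕜 := ℝ) hy
  have h1 : ContMDiffAt 𝓘(ℝ, ℂ) 𝓘(ℝ, ℂ) ∞ (fun y ↦ π ((chartAt ℂ x).symm y)) y :=
    ContMDiffAt.comp y (hπ.contMDiff _) hs
  have h2 := c.contMDiffAt hz hyz
  have h3 : ContMDiffAt 𝓘(ℝ, ℂ) 𝓘(ℝ, ℂ) ∞ (z ∘ π) ((chartAt ℂ x).symm y) :=
    ContMDiffAt.comp _ h2 (hπ.contMDiff _)
  refine ⟨(ContMDiffAt.comp y h2 h1).contDiffAt, ?_, fun v ↦ ?_⟩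
  · rw [← tder_eq_fderiv]
    exact tder_comp (g := z) y h2.mdiff h1.mdiff
  · rw [← tder_eq_fderiv]
    exact (DFunLike.congr_fun (tder_comp (g := z ∘ π) y h3.mdiff hs.mdiff) v).symm

include hπ in
theorem wedge_coord_ne_zero (hc : Transverse c₁ c₂) {z w : OpenPartialHomeomorph S ℂ}
    (hz : z ∈ c₁.charts) (hw : w ∈ c₂.charts) {x : St} {y : ℂ}
    (hy : y ∈ (chartAt ℂ x).target) (hyz : π ((chartAt ℂ x).symm y) ∈ z.source)
    (hyw : π ((chartAt ℂ x).symm y) ∈ w.source) :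
    wedge (fderiv ℝ (coord π x z) y) (fderiv ℝ (coord π x w) y) ≠ 0 := by
  rw [(coord_spec hπ hz hy hyz).2.1, (coord_spec hπ hw hy hyw).2.1, wedge_comp]
  refine mul_ne_zero (Complex.ofReal_ne_zero.mpr (det_ne_zero_of_injective ?_))
    (hc z hz w hw _ hyz hyw)
  have hs := contMDiffAt_chart_symm (𝕜 := ℝ) hy
  rw [tder_comp y (hπ.contMDiff _).mdiff hs.mdiff]
  refine (tder_injective hπ _).comp (Function.LeftInverse.injective
    (g := tder ℝ ℂ ℂ (chartAt ℂ x) ((chartAt ℂ x).symm y)) fun v ↦ ?_)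
  exact DFunLike.congr_fun (tder_chart_comp_tder_symm (𝕜 := ℝ) hy) v

include hπ in
theorem eventually_mem_source {z : OpenPartialHomeomorph S ℂ} {x : St} (hx : π x ∈ z.source) :
    ∀ᶠ y in 𝓝 (chartAt ℂ x x), y ∈ (chartAt ℂ x).target ∧ π ((chartAt ℂ x).symm y) ∈ z.source := by
  have htar : ∀ᶠ y in 𝓝 (chartAt ℂ x x), y ∈ (chartAt ℂ x).target :=
    (chartAt ℂ x).open_target.mem_nhds (mem_chart_target ℂ x)
  refine htar.and ?_
  have h := (eventually_contMDiffAt_comp_symm hπ x).self_of_nhds.continuousAt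
  refine h (z.open_source.mem_nhds ?_)
  simpa [(chartAt ℂ x).left_inv (mem_chart_source ℂ x)] using hx

include hπ in
/-- The conformal factor of a complex metric. -/
theorem exists_conformal_factor (hc : Transverse c₁ c₂) {U : Set St} (hU : IsOpen U)
    {g : ∀ x : St, TangentSpace 𝓘(ℝ, ℂ) x →L[ℝ] TangentSpace 𝓘(ℝ, ℂ) x →L[ℝ] ℂ}
    (hg : IsComplexMetricOn π c₁ c₂ U g) {x : St} (hx : x ∈ U) {z w : OpenPartialHomeomorph S ℂ}
    (hz : z ∈ c₁.charts) (hw : w ∈ c₂.charts) (hxz : π x ∈ z.source) (hxw : π x ∈ w.source) :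
    ∃ lam : ℂ → ℂ, DifferentiableAt ℝ lam (chartAt ℂ x x) ∧ lam (chartAt ℂ x x) ≠ 0 ∧
      ∀ᶠ y in 𝓝 (chartAt ℂ x x), ∀ i k, metricMatrix g x y i k =
        lam y * (fderiv ℝ (coord π x z) y (frame i) * fderiv ℝ (coord π x w) y (frame k) +
          fderiv ℝ (coord π x w) y (frame i) * fderiv ℝ (coord π x z) y (frame k)) := by
  let Z : Fin 2 → ℂ → ℂ := fun i y ↦ fderiv ℝ (coord π x z) y (frame i)
  let W : Fin 2 → ℂ → ℂ := fun i y ↦ fderiv ℝ (coord π x w) y (frame i)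
  let g' : Fin 2 → Fin 2 → ℂ → ℂ := fun i k y ↦ metricMatrix g x y i k
  let Δ : ℂ → ℂ := fun y ↦ Z 0 y * W 1 y - Z 1 y * W 0 y
  have h0 : ∀ᶠ y in 𝓝 (chartAt ℂ x x), (chartAt ℂ x).symm y ∈ U := by
    have h := (chartAt ℂ x).continuousAt_symm (mem_chart_target ℂ x)
    refine h (hU.mem_nhds ?_)
    rwa [(chartAt ℂ x).left_inv (mem_chart_source ℂ x)]
  have hloc : ∀ᶠ y in 𝓝 (chartAt ℂ x x), Δ y ≠ 0 ∧ ∃ l : ℂ, l ≠ 0 ∧ ∀ i k,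
      g' i k y = l * (Z i y * W k y + W i y * Z k y) := by
    filter_upwards [h0, eventually_mem_source hπ hxz, eventually_mem_source hπ hxw] with y h1 h2 h3
    obtain ⟨l, hl, h⟩ := hg.2 _ h1 z hz w hw h2.2 h3.2
    refine ⟨wedge_coord_ne_zero hπ hc hz hw h2.1 h2.2 h3.2, l, hl, fun i k ↦ ?_⟩
    have e1 := (coord_spec hπ hz h2.1 h2.2).2.2
    have e2 := (coord_spec hπ hw h3.1 h3.2).2.2
    refine (h (tder ℝ ℂ ℂ (chartAt ℂ x).symm y (frame i))
      (tder ℝ ℂ ℂ (chartAt ℂ x).symm y (frame k))).trans ?_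
    simp only [Z, W, ← e1, ← e2]
    rfl
  -- Contracting the metric with the vectors `(W₁, -W₀)` and `(-Z₁, Z₀)` gives the conformal factor
  -- times `Δ²`. This expresses the factor by smooth functions; its pointwise existence alone would
  -- not make it differentiable.
  let lam : ℂ → ℂ := fun y ↦ (-(W 1 y * Z 1 y * g' 0 0 y) + W 1 y * Z 0 y * g' 0 1 y +
    W 0 y * Z 1 y * g' 1 0 y - W 0 y * Z 0 y * g' 1 1 y) / Δ y ^ 2
  have hlam : ∀ᶠ y in 𝓝 (chartAt ℂ x x), lam y ≠ 0 ∧ ∀ i k,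
      g' i k y = lam y * (Z i y * W k y + W i y * Z k y) := by
    filter_upwards [hloc] with y hy
    obtain ⟨hΔ, l, hl, h⟩ := hy
    have : lam y = l := by
      simp only [lam, div_eq_iff (pow_ne_zero 2 hΔ), h, Δ]
      ring
    rw [this]
    exact ⟨hl, h⟩
  refine ⟨lam, ?_, hlam.self_of_nhds.1, hlam.mono fun y h ↦ h.2⟩
  have hm := (eventually_mem_source hπ hxz).self_of_nhds
  have hm' := (eventually_mem_source hπ hxw).self_of_nhds
  have dZ (i) : DifferentiableAt ℝ (Z i) (chartAt ℂ x x) :=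
    ((((coord_spec hπ hz hm.1 hm.2).1.fderiv_right (m := ∞) (by simp)).clm_apply
      contDiffAt_const).differentiableAt (by simp))
  have dW (i) : DifferentiableAt ℝ (W i) (chartAt ℂ x x) :=
    ((((coord_spec hπ hw hm'.1 hm'.2).1.fderiv_right (m := ∞) (by simp)).clm_apply
      contDiffAt_const).differentiableAt (by simp))
  have dg (i k) : DifferentiableAt ℝ (g' i k) (chartAt ℂ x x) :=
    (hg.1 x hx i k).differentiableAt (by simp)
  have dΔ : DifferentiableAt ℝ Δ (chartAt ℂ x x) := ((dZ 0).mul (dW 1)).sub ((dZ 1).mul (dW 0))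
  have hΔ2 : Δ (chartAt ℂ x x) ^ 2 ≠ 0 := pow_ne_zero 2 hloc.self_of_nhds.1
  simp only [lam, div_eq_mul_inv]
  refine DifferentiableAt.fun_mul ?_ ((dΔ.fun_pow 2).fun_inv hΔ2)
  exact ((((((dW 1).mul (dZ 1)).mul (dg 0 0)).neg).add (((dW 1).mul (dZ 0)).mul (dg 0 1))).add
    (((dW 0).mul (dZ 1)).mul (dg 1 0))).sub (((dW 0).mul (dZ 0)).mul (dg 1 1))

/-- The symmetric product of two covectors. -/
def symProd (p q : ℂ →L[ℝ] ℂ) : ℂ →L[ℝ] ℂ →L[ℝ] ℂ := p.smulRight q + q.smulRight p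

/-- The complex metric `dz dw̄` of a pair of coordinates. -/
def coordMetric (π : St → S) (z w : S → ℂ) (x : St) :
    TangentSpace 𝓘(ℝ, ℂ) x →L[ℝ] TangentSpace 𝓘(ℝ, ℂ) x →L[ℝ] ℂ :=
  symProd (tder ℝ ℂ ℂ (z ∘ π) x) (tder ℝ ℂ ℂ (w ∘ π) x)

theorem coordMetric_apply (z w : S → ℂ) (x : St) (u v : ℂ) :
    coordMetric π z w x u v = tder ℝ ℂ ℂ (z ∘ π) x u * tder ℝ ℂ ℂ (w ∘ π) x v +
      tder ℝ ℂ ℂ (w ∘ π) x u * tder ℝ ℂ ℂ (z ∘ π) x v := rfl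

include hπ in
theorem tder_coord_comp {z : OpenPartialHomeomorph S ℂ} (hz : z ∈ c.charts) {x : St}
    (hx : π x ∈ z.source) (v : ℂ) :
    tder ℝ ℂ ℂ (z ∘ π) x v = tder ℝ ℂ ℂ z (π x) (tder ℝ ℂ ℂ π x v) :=
  DFunLike.congr_fun (tder_comp (g := z) x (c.contMDiffAt hz hx).mdiff (hπ.contMDiff x).mdiff) v

include hπ in
-- Other coordinates of the two structures have proportional differentials, so the conformal factor
-- changes by the product of the two nonzero factors.
theorem isComplexMetricOn_coordMetric {z w : OpenPartialHomeomorph S ℂ}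
    (hz : z ∈ c₁.charts) (hw : w ∈ c₂.charts) :
    IsComplexMetricOn π c₁ c₂ (π ⁻¹' (z.source ∩ w.source)) (coordMetric π z w) := by
  constructor
  · rintro x ⟨hxz, hxw⟩ i k
    have hm := (eventually_mem_source hπ hxz).self_of_nhds
    have hm' := (eventually_mem_source hπ hxw).self_of_nhds
    have dZ (i) : ContDiffAt ℝ ∞ (fun y ↦ fderiv ℝ (coord π x z) y (frame i)) (chartAt ℂ x x) :=
      (((coord_spec hπ hz hm.1 hm.2).1.fderiv_right (m := ∞) (by simp)).clm_apply
        contDiffAt_const)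
    have dW (i) : ContDiffAt ℝ ∞ (fun y ↦ fderiv ℝ (coord π x w) y (frame i)) (chartAt ℂ x x) :=
      (((coord_spec hπ hw hm'.1 hm'.2).1.fderiv_right (m := ∞) (by simp)).clm_apply
        contDiffAt_const)
    refine (((dZ i).mul (dW k)).add ((dW i).mul (dZ k))).congr_of_eventuallyEq ?_
    filter_upwards [eventually_mem_source hπ hxz, eventually_mem_source hπ hxw] with y h2 h3
    have e1 := (coord_spec hπ hz h2.1 h2.2).2.2
    have e2 := (coord_spec hπ hw h3.1 h3.2).2.2
    rw [← e1, ← e1, ← e2, ← e2]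
    rfl
  · rintro x ⟨hxz, hxw⟩ z' hz' w' hw' hxz' hxw'
    obtain ⟨μ, hμ, h⟩ := c₁.exists_tder_eq_smul hz' hz hxz' hxz
    obtain ⟨μ', hμ', h'⟩ := c₂.exists_tder_eq_smul hw' hw hxw' hxw
    have key (u v : ℂ) : coordMetric π z w x u v = μ * μ' *
 (tder ℝ ℂ ℂ (z' ∘ π) x u *
        tder ℝ ℂ ℂ (w' ∘ π) x v + tder ℝ ℂ ℂ (w' ∘ π) x u * tder ℝ ℂ ℂ (z' ∘ π) x v) := by
      refine (coordMetric_apply z w x u v).trans ?_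
      rw [tder_coord_comp hπ hz hxz, tder_coord_comp hπ hz hxz, tder_coord_comp hπ hw hxw,
        tder_coord_comp hπ hw hxw, tder_coord_comp hπ hz' hxz', tder_coord_comp hπ hz' hxz', tder_coord_comp hπ hw' hxw',
        tder_coord_comp hπ hw' hxw', h, h, h', h']
      ring
    exact ⟨μ * μ', mul_ne_zero hμ hμ', key⟩

end Coordinates

/-! ### Harmonicity as an equation for the Higgs field -/

section Criterion

variable {EG : Type*} [NormedAddCommGroup EG] [NormedSpace ℝ EG] [CompleteSpace EG]
  [FiniteDimensional ℝ EG]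
  {G : Type*} [TopologicalSpace G] [T2Space G] [ChartedSpace EG G] [Group G]
  [LieGroup 𝓘(ℝ, EG) ∞ G]
  {ν : LinearMap.BilinForm ℝ (GroupLieAlgebra 𝓘(ℝ, EG) G)}
  {E : Type*} [NormedAddCommGroup E] [NormedSpace ℂ E] [FiniteDimensional ℂ E]
  {GC : Type*} [TopologicalSpace GC] [T2Space GC] [ChartedSpace E GC] [Group GC]
  [LieGroup 𝓘(ℂ, E) ω GC]
  {j : G →* GC} (hj : IsComplexification EG E j) {M : MaximalCompact ν}
  {V : Type*} [NormedAddCommGroup V] [NormedSpace ℂ V] [ChartedSpace V (GC ⧸ M.KC E j)]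
  [IsManifold 𝓘(ℂ, V) ω (GC ⧸ M.KC E j)]
  (hq : IsHolomorphicQuotient E V (M.KC E j))
  (hG : LieAlgebra.IsSemisimple ℝ (GroupLieAlgebra 𝓘(ℝ, EG) G))
  {S St : Type*} [TopologicalSpace S] [ChartedSpace ℂ S] [IsManifold 𝓘(ℝ, ℂ) ∞ S]
  [TopologicalSpace St] [ChartedSpace ℂ St] [IsManifold 𝓘(ℝ, ℂ) ∞ St]
  {π : St → S} (hπ : IsLocalDiffeomorph 𝓘(ℝ, ℂ) 𝓘(ℝ, ℂ) ∞ π)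
  {c₁ c₂ : ComplexStructure S}

/-- Smoothness of a form at a point. -/
def SmoothFormAt {W : Type*} [NormedAddCommGroup W] [NormedSpace ℂ W] (β : OneForm S W) (q : S) :
    Prop :=
  ContDiffAt ℝ ∞ (formInChart β q) (chartAt ℂ q q)

/-- The values of forms `A`, `φ₁`, `φ₂` are in `𝔨 ⊗ ℂ` and `𝔭 ⊗ ℂ`, and `φ₁` and `φ₂` are of the
types of `c₁` and `c₂`. -/
structure IsSplitAt (j : G →* GC) (M : MaximalCompact ν) (c₁ c₂ : ComplexStructure S)
    (A φ₁ φ₂ : OneForm S E) (q : S) : Prop where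
  smooth_A : SmoothFormAt A q
  smooth₁ : SmoothFormAt φ₁ q
  smooth₂ : SmoothFormAt φ₂ q
  mem_A : ∀ v : ℂ, A q v ∈ M.kC E j
  mem₁ : ∀ v : ℂ, φ₁ q v ∈ M.pC E j
  mem₂ : ∀ v : ℂ, φ₂ q v ∈ M.pC E j
  type₁ : IsTypeOneZero c₁ q (φ₁ q)
  type₂ : IsTypeOneZero c₂ q (φ₂ q)

theorem coef_smulRight {W : Type*} [NormedAddCommGroup W] [NormedSpace ℂ W] {p q : ℂ →L[ℝ] ℂ}
    (h : wedge p q ≠ 0) (a : W) : coef p q (p.smulRight a) = a := by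
  have := coef_smulRight_add h a 0
  rwa [show q.smulRight (0 : W) = 0 by ext; simp, add_zero] at this

include hπ in
/-- A form of type `(1,0)` on `S`, read in a chart of the covering. -/
theorem pull_eq_smulRight {W : Type*} [NormedAddCommGroup W] [NormedSpace ℂ W] {β : OneForm S W}
    {z : OpenPartialHomeomorph S ℂ} (hz : z ∈ c₁.charts) {x : St} {y : ℂ}
    (hy : y ∈ (chartAt ℂ x).target) (hyz : π ((chartAt ℂ x).symm y) ∈ z.source)
    (hβ : IsTypeOneZero c₁ (π ((chartAt ℂ x).symm y)) (β (π ((chartAt ℂ x).symm y)))) :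
    ∃ a, pull β (fun y ↦ π ((chartAt ℂ x).symm y)) y = (fderiv ℝ (coord π x z) y).smulRight a := by
  obtain ⟨a, ha⟩ := (isTypeOneZero_iff hz hyz _).mp hβ
  refine ⟨a, ?_⟩
  rw [pull, ha, (coord_spec hπ hz hy hyz).2.1]
  rfl

theorem SmoothFormAt.add {W : Type*} [NormedAddCommGroup W] [NormedSpace ℂ W] {α β : OneForm S W}
    {q : S} (hα : SmoothFormAt α q) (hβ : SmoothFormAt β q) :
    SmoothFormAt (fun y ↦ α y + β y) q := by
  have h : ContDiffAt ℝ ∞ (fun y ↦ formInChart α q y + formInChart β q y) (chartAt ℂ q q) :=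
    ContDiffAt.add hα hβ
  exact h

variable {A φ₁ φ₂ : OneForm S E} {x : St} {s : St → GC}
  (hs : ∀ᶠ y in 𝓝 x, ContMDiffAt 𝓘(ℝ, ℂ) 𝓘(ℝ, E) ∞ s y)
  (hmc : ∀ᶠ y in 𝓝 x, ∀ v : ℂ, mc ℝ E ℂ s y v =
    A (π y) (tder ℝ ℂ ℂ π y v) + φ₁ (π y) (tder ℝ ℂ ℂ π y v) + φ₂ (π y) (tder ℝ ℂ ℂ π y v))

theorem tendsto_chart_symm (x : St) :
    Tendsto (chartAt ℂ x).symm (𝓝 (chartAt ℂ x x)) (𝓝 x) := by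
  have := (chartAt ℂ x).continuousAt_symm (mem_chart_target ℂ x)
  rwa [ContinuousAt, (chartAt ℂ x).left_inv (mem_chart_source ℂ x)] at this

theorem eventually_mem_target_chart (x : St) :
    ∀ᶠ y in 𝓝 (chartAt ℂ x x), y ∈ (chartAt ℂ x).target :=
  (chartAt ℂ x).open_target.mem_nhds (mem_chart_target ℂ x)

include hs in
theorem contMDiffAt_comp_chart_symm : ∀ᶠ y in 𝓝 (chartAt ℂ x x),
    ContMDiffAt 𝓘(ℝ, ℂ) 𝓘(ℝ, E) ∞ (fun y ↦ s ((chartAt ℂ x).symm y)) y := by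
  filter_upwards [eventually_mem_target_chart x, (tendsto_chart_symm x).eventually hs] with y h1 h2
  exact ContMDiffAt.comp y h2 (contMDiffAt_chart_symm h1)

include hs hmc hπ in
theorem mc_comp_chart_symm : ∀ᶠ y in 𝓝 (chartAt ℂ x x), ∀ v,
    mc ℝ E ℂ (fun y ↦ s ((chartAt ℂ x).symm y)) y v =
      pull A (fun y ↦ π ((chartAt ℂ x).symm y)) y v + pull φ₁ (fun y ↦ π ((chartAt ℂ x).symm y)) y v +
        pull φ₂ (fun y ↦ π ((chartAt ℂ x).symm y)) y v := by
  filter_upwards [eventually_mem_target_chart x, (tendsto_chart_symm x).eventually hs,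
    (tendsto_chart_symm x).eventually hmc] with y h1 h2 h3 v
  rw [mc_comp h2.mdiff (contMDiffAt_chart_symm h1).mdiff, ContinuousLinearMap.comp_apply, h3,
    pull_apply, pull_apply, pull_apply, tder_comp y (hπ.contMDiff _).mdiff
    (contMDiffAt_chart_symm h1).mdiff]
  rfl

include hπ in
-- The derivative of `π` is onto, and a two-form in the chart is determined by its value on the
-- standard frame.
theorem covExtDeriv_eq_zero_iff {β : OneForm S E} (hβ : SmoothFormAt β (π x)) :
    (∀ a b, covExtDeriv GC A β (π x) a b = 0) ↔
      covD GC (pull A (fun y ↦ π ((chartAt ℂ x).symm y)))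
        (pull β (fun y ↦ π ((chartAt ℂ x).symm y))) (chartAt ℂ x x) 1 Complex.I = 0 := by
  have : CompleteSpace E := FiniteDimensional.complete ℂ E
  have hk := eventually_contMDiffAt_comp_symm hπ x
  have e : π ((chartAt ℂ x).symm (chartAt ℂ x x)) = π x := by
    rw [(chartAt ℂ x).left_inv (mem_chart_source ℂ x)]
  have gen (q : S) (hq : q = π x) (a b : ℂ) :
      covExtDeriv GC A β q a b = covExtDeriv GC A β (π x) a b := by
    subst hq; rfl
  have key (u v : ℂ) := (covD_pull (GC := GC) hk A (β := β) (by simp only [e]; exact hβ) u v).trans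
    (gen _ e _ _)
  simp only [tder_comp_symm_self hπ] at key
  constructor
  · intro h
    rw [key]
    exact h _ _
  · intro h a b
    obtain ⟨u, hu⟩ := tder_surjective hπ x a
    obtain ⟨v, hv⟩ := tder_surjective hπ x b
    have := key u v
    rw [covD_eq_zero_of h, hu, hv] at this
    exact this.symm

variable (hsplit : ∀ᶠ q in 𝓝 (π x), IsSplitAt j M c₁ c₂ A φ₁ φ₂ q)

include hsplit hπ in
theorem eventually_isSplitAt : ∀ᶠ y in 𝓝 (chartAt ℂ x x),
    IsSplitAt j M c₁ c₂ A φ₁ φ₂ (π ((chartAt ℂ x).symm y)) :=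
  ((hπ.contMDiff x).continuousAt.tendsto.comp (tendsto_chart_symm x)).eventually hsplit

include hs hmc hπ hsplit in
theorem part_comp_chart_symm : ∀ᶠ y in 𝓝 (chartAt ℂ x x),
    partK hj M (fun y ↦ s ((chartAt ℂ x).symm y)) y =
      pull A (fun y ↦ π ((chartAt ℂ x).symm y)) y ∧
    partP hj M (fun y ↦ s ((chartAt ℂ x).symm y)) y =
      pull φ₁ (fun y ↦ π ((chartAt ℂ x).symm y)) y + pull φ₂ (fun y ↦ π ((chartAt ℂ x).symm y)) y := by
  filter_upwards [mc_comp_chart_symm hπ hs hmc, eventually_isSplitAt hπ hsplit] with y h1 h2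
  have hA (v) : pull A (fun y ↦ π ((chartAt ℂ x).symm y)) y v ∈ M.kC E j := h2.mem_A _
  have h1' (v) : pull φ₁ (fun y ↦ π ((chartAt ℂ x).symm y)) y v ∈ M.pC E j := h2.mem₁ _
  have h2' (v) : pull φ₂ (fun y ↦ π ((chartAt ℂ x).symm y)) y v ∈ M.pC E j := h2.mem₂ _
  constructor
  · ext v
    refine (congrArg (M.prK hj) (h1 v)).trans ?_
    rw [map_add, map_add, M.prK_of_mem_kC hj (hA v), M.prK_of_mem_pC hj (h1' v),
      M.prK_of_mem_pC hj (h2' v), add_zero, add_zero]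
  · ext v
    refine (congrArg (M.prP hj) (h1 v)).trans ?_
    rw [map_add, map_add, M.prP_of_mem_kC hj (hA v), M.prP_of_mem_pC hj (h1' v),
      M.prP_of_mem_pC hj (h2' v), zero_add, add_apply]

include hj hs hmc hπ hsplit in
/-- The `𝔭 ⊗ ℂ`-part of flatness. -/
theorem covExtDeriv_iff_covExtDeriv :
    (∀ a b, covExtDeriv GC A φ₁ (π x) a b = 0) ↔ ∀ a b, covExtDeriv GC A φ₂ (π x) a b = 0 := by
  have hx := hsplit.self_of_nhds
  have hk := eventually_contMDiffAt_comp_symm hπ x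
  have e : π ((chartAt ℂ x).symm (chartAt ℂ x x)) = π x := by
    rw [(chartAt ℂ x).left_inv (mem_chart_source ℂ x)]
  rw [covExtDeriv_eq_zero_iff hπ hx.smooth₁, covExtDeriv_eq_zero_iff hπ hx.smooth₂]
  have h1 := covD_part hj M (contMDiffAt_comp_chart_symm hs) 1 Complex.I
  have h2 := part_comp_chart_symm hj hπ hs hmc hsplit
  rw [covD_congr GC h2.self_of_nhds.1 (h2.mono fun y h ↦ h.2)] at h1
  have d1 := (contDiffAt_pull hk (β := φ₁) (by simp only [e]; exact hx.smooth₁)).differentiableAt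
    (by simp)
  have d2 := (contDiffAt_pull hk (β := φ₂) (by simp only [e]; exact hx.smooth₂)).differentiableAt
    (by simp)
  -- The `𝔭`-part of the Maurer-Cartan equation says that the covariant derivatives of `φ₁` and `φ₂`
  -- add up to zero.
  have h3 : covD GC (pull A (fun y ↦ π ((chartAt ℂ x).symm y)))
        (pull φ₁ (fun y ↦ π ((chartAt ℂ x).symm y))) (chartAt ℂ x x) 1 Complex.I +
      covD GC (pull A (fun y ↦ π ((chartAt ℂ x).symm y)))
        (pull φ₂ (fun y ↦ π ((chartAt ℂ x).symm y))) (chartAt ℂ x x) 1 Complex.I = 0 := by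
    have : CompleteSpace E := FiniteDimensional.complete ℂ E
    rw [← h1]
    simp only [covD, extD, add_apply, lieB_add_right]
    rw [show fderiv ℝ (fun y ↦ pull φ₁ (fun y ↦ π ((chartAt ℂ x).symm y)) y +
      pull φ₂ (fun y ↦ π ((chartAt ℂ x).symm y)) y) (chartAt ℂ x x) = _ from fderiv_add d1 d2]
    simp only [add_apply]
    abel
  constructor
  · intro h
    rwa [h, zero_add] at h3
  · intro h
    rwa [h, add_zero] at h3

include hs hmc hπ hsplit in
theorem curvature_eq_zero (a b : ℂ) :
    curvature GC (fun y ↦ A y + φ₁ y + φ₂ y) (π x) a b = 0 := by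
  have : CompleteSpace E := FiniteDimensional.complete ℂ E
  have hx := hsplit.self_of_nhds
  have hk := eventually_contMDiffAt_comp_symm hπ x
  have e : π ((chartAt ℂ x).symm (chartAt ℂ x x)) = π x := by
    rw [(chartAt ℂ x).left_inv (mem_chart_source ℂ x)]
  have hsm : SmoothFormAt (fun y ↦ A y + φ₁ y + φ₂ y) (π x) :=
    (hx.smooth_A.add hx.smooth₁).add hx.smooth₂
  have gen (q : S) (hq : q = π x) (a b : ℂ) : curvature GC (fun y ↦ A y + φ₁ y + φ₂ y) q a b =
      curvature GC (fun y ↦ A y + φ₁ y + φ₂ y) (π x) a b := by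
    subst hq; rfl
  have key (u v : ℂ) := (curvature_pull (GC := GC) hk (A := fun y ↦ A y + φ₁ y + φ₂ y)
    (by simp only [e]; exact hsm) u v).trans (gen _ e _ _)
  simp only [tder_comp_symm_self hπ] at key
  have h1 : pull (fun y ↦ A y + φ₁ y + φ₂ y) (fun y ↦ π ((chartAt ℂ x).symm y)) =ᶠ[𝓝 (chartAt ℂ x x)]
      fun y ↦ mc ℝ E ℂ (fun y ↦ s ((chartAt ℂ x).symm y)) y := by
    filter_upwards [mc_comp_chart_symm hπ hs hmc] with y hy
    ext v
    rw [hy]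
    rfl
  obtain ⟨u, hu⟩ := tder_surjective hπ x a
  obtain ⟨v, hv⟩ := tder_surjective hπ x b
  have h2 := key u v
  rw [hu, hv, extD_congr h1, h1.self_of_nhds, ← lieB_real] at h2
  exact h2.symm.trans (fderiv_mc_sub (contMDiffAt_comp_chart_symm hs) u v)

include hj hq hG hs hmc hπ hsplit in
/-- A map is complex harmonic if and only if its Higgs field satisfies `∂₁ φ₂ = 0`. -/
theorem tension_eq_zero_iff (hc : Transverse c₁ c₂) (hν_symm : ν.IsSymm)
    (hν : ∀ (g : G) a b, ν (Ad (𝕜 := ℝ) EG g a) (Ad (𝕜 := ℝ) EG g b) = ν a b)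
    {f : St → GC ⧸ M.KC E j} (hf : ContMDiff 𝓘(ℝ, ℂ) 𝓘(ℝ, V) ∞ f)
    (hsf : ∀ᶠ y in 𝓝 x, QuotientGroup.mk (s y) = f y) :
    (∀ U : Set St, IsOpen U →
      ∀ g : (∀ x : St, TangentSpace 𝓘(ℝ, ℂ) x →L[ℝ] TangentSpace 𝓘(ℝ, ℂ) x →L[ℝ] ℂ),
        IsComplexMetricOn π c₁ c₂ U g → x ∈ U →
          tension (M.symmetricMetric (V := V) j) g f x = 0) ↔
      ∀ a b, covExtDeriv GC A φ₂ (π x) a b = 0 := by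
  have : CompleteSpace E := FiniteDimensional.complete ℂ E
  have hx := hsplit.self_of_nhds
  obtain ⟨z, hz, hxz⟩ := c₁.cover (π x)
  obtain ⟨w, hw, hxw⟩ := c₂.cover (π x)
  have hm := eventually_mem_source hπ hxz
  have hm' := eventually_mem_source hπ hxw
  have hwedge := wedge_coord_ne_zero hπ hc hz hw hm.self_of_nhds.1 hm.self_of_nhds.2
    hm'.self_of_nhds.2
  have hZ := (coord_spec hπ hz hm.self_of_nhds.1 hm.self_of_nhds.2).1
  have hW := (coord_spec hπ hw hm'.self_of_nhds.1 hm'.self_of_nhds.2).1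
  have hZ' := hZ.fderiv_right (m := ∞) (by simp)
  have hW' := hW.fderiv_right (m := ∞) (by simp)
  have hk := eventually_contMDiffAt_comp_symm hπ x
  have e : π ((chartAt ℂ x).symm (chartAt ℂ x x)) = π x := by
    rw [(chartAt ℂ x).left_inv (mem_chart_source ℂ x)]
  let p₁ := pull φ₁ (fun y ↦ π ((chartAt ℂ x).symm y))
  let p₂ := pull φ₂ (fun y ↦ π ((chartAt ℂ x).symm y))
  have hp₁ : ContDiffAt ℝ ∞ p₁ (chartAt ℂ x x) :=
    contDiffAt_pull hk (by simp only [e]; exact hx.smooth₁)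
  have hp₂ : ContDiffAt ℝ ∞ p₂ (chartAt ℂ x x) :=
    contDiffAt_pull hk (by simp only [e]; exact hx.smooth₂)
  let a : ℂ → E := fun y ↦ coef (fderiv ℝ (coord π x z) y) (fderiv ℝ (coord π x w) y) (p₁ y)
  let b : ℂ → E := fun y ↦ coef (fderiv ℝ (coord π x w) y) (fderiv ℝ (coord π x z) y) (p₂ y)
  have ha : ContDiffAt ℝ ∞ a (chartAt ℂ x x) := contDiffAt_coef hZ' hW' hp₁ hwedge
  have hb : ContDiffAt ℝ ∞ b (chartAt ℂ x x) :=
    contDiffAt_coef hW' hZ' hp₂ (by rw [wedge_swap]; exact neg_ne_zero.mpr hwedge)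
  have hab : ∀ᶠ y in 𝓝 (chartAt ℂ x x), p₁ y = (fderiv ℝ (coord π x z) y).smulRight (a y) ∧
      p₂ y = (fderiv ℝ (coord π x w) y).smulRight (b y) := by
    filter_upwards [hm, hm', eventually_isSplitAt hπ hsplit] with y h1 h2 h3
    have hwy := wedge_coord_ne_zero hπ hc hz hw h1.1 h1.2 h2.2
    obtain ⟨a', ha'⟩ := pull_eq_smulRight hπ hz h1.1 h1.2 h3.type₁
    obtain ⟨b', hb'⟩ := pull_eq_smulRight hπ hw h2.1 h2.2 h3.type₂
    have ea : a y = a' := by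
      simp only [a, p₁, ha', coef_smulRight hwy]
    have eb : b y = b' := by
      simp only [b, p₂, hb']
      exact coef_smulRight (by rw [wedge_swap]; exact neg_ne_zero.mpr hwy) _
    rw [ea, eb]
    exact ⟨ha', hb'⟩
  have hpart := part_comp_chart_symm hj hπ hs hmc hsplit
  have hP : ∀ᶠ y in 𝓝 (chartAt ℂ x x), partP hj M (fun y ↦ s ((chartAt ℂ x).symm y)) y =
      (fderiv ℝ (coord π x z) y).smulRight (a y) + (fderiv ℝ (coord π x w) y).smulRight (b y) := by
    filter_upwards [hab, hpart] with y h1 h2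
    rw [h2.2, ← h1.1, ← h1.2]
  have hs' := (contMDiffAt_comp_chart_symm hs).and ((tendsto_chart_symm x).eventually hsf)
  have hcov : covD GC (partK hj M (fun y ↦ s ((chartAt ℂ x).symm y)))
      (fun y ↦ (fderiv ℝ (coord π x w) y).smulRight (b y)) (chartAt ℂ x x) 1 Complex.I =
      covD GC (pull A (fun y ↦ π ((chartAt ℂ x).symm y))) p₂ (chartAt ℂ x x) 1 Complex.I :=
    covD_congr GC hpart.self_of_nhds.1 (hab.mono fun y h ↦ h.2.symm) _ _
  rw [covExtDeriv_eq_zero_iff hπ hx.smooth₂]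
  constructor
  · intro h
    -- The single metric `dz dw̄` near the point already yields the equation. Conversely the
    -- equation implies that the tension vanishes for every metric, as the conformal factor enters
    -- only in a nonzero multiple.
    have hg := isComplexMetricOn_coordMetric hπ (c₁ := c₁) (c₂ := c₂) hz hw
    have hU : IsOpen (π ⁻¹' (z.source ∩ w.source)) :=
      (z.open_source.inter w.open_source).preimage hπ.contMDiff.continuous
    obtain ⟨lam, h1, h2, h3⟩ := exists_conformal_factor hπ hc hU hg ⟨hxz, hxw⟩ hz hw hxz hxw
    obtain ⟨Q, hQ, r, hr, hQt⟩ := exists_frame_tension hj hq hG hν_symm hν hf x hs' hZ hW ha hb hP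
      hwedge h1 h2 h3
    rw [h _ hU _ hg ⟨hxz, hxw⟩, map_zero, hcov] at hQt
    exact (smul_eq_zero.mp hQt.symm).resolve_left hr
  · intro h U hU g hg hxU
    obtain ⟨lam, h1, h2, h3⟩ := exists_conformal_factor hπ hc hU hg hxU hz hw hxz hxw
    obtain ⟨Q, hQ, r, hr, hQt⟩ := exists_frame_tension hj hq hG hν_symm hν hf x hs' hZ hW ha hb hP
      hwedge h1 h2 h3
    rw [hcov] at hQt
    refine hQ ?_
    rw [hQt, map_zero, show covD GC _ p₂ (chartAt ℂ x x) 1 Complex.I = 0 from h, smul_zero]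

end Criterion

/-! ### Locally constant cocycles on simply connected spaces -/

section Trivialization

/-- A type with the discrete topology. -/
def Disc (H : Type*) := H

instance (H : Type*) : TopologicalSpace (Disc H) := ⊥

instance (H : Type*) : DiscreteTopology (Disc H) := ⟨rfl⟩

variable {X H : Type*} [TopologicalSpace X] [Group H]

/-- Right multiplication by elements of the group. -/
def Disc.mulRight (v : Disc H) (h : H) : Disc H := (show H from v) * h

/-- The fibre bundle with discrete fibre defined by a locally constant cocycle. -/
def cocycleBundle {W : X → Set X} (hW : ∀ q, IsOpen (W q)) (hmem : ∀ q, q ∈ W q) (c : X → X → X → H)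
    (hself : ∀ q, ∀ y ∈ W q, c q q y = 1)
    (hcomp : ∀ q q' q'', ∀ y ∈ W q ∩ W q' ∩ W q'', c q q' y * c q' q'' y = c q q'' y)
    (hloc : ∀ q q', ∀ y ∈ W q ∩ W q', ∀ᶠ y' in 𝓝 y, c q q' y' = c q q' y) :
    FiberBundleCore X X (Disc H) where
  baseSet := W
  isOpen_baseSet := hW
  indexAt := id
  mem_baseSet_at := hmem
  coordChange := fun q q' y (v : H) ↦ v * c q q' y
  coordChange_self := fun q y hy (v : H) ↦ by
    change v * c q q y = v
    rw [hself q y hy, mul_one]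
  continuousOn_coordChange := fun q q' ↦ by
    rintro ⟨y, v⟩ ⟨hy, -⟩
    refine ContinuousAt.continuousWithinAt ?_
    have key : (fun _ ↦ Disc.mulRight v (c q q' y) : X × Disc H → Disc H) =ᶠ[𝓝 (y, v)]
        fun p ↦ Disc.mulRight p.2 (c q q' p.1) := by
      rw [nhds_prod_eq, nhds_discrete (Disc H)]
      have h1 := (hloc q q' y hy).prod_inl (pure v)
      have h2 : ∀ᶠ p : X × Disc H in 𝓝 y ×ˢ pure v, p.2 = v :=
        Eventually.prod_inr (by simp : ∀ᶠ w in pure v, w = v) (𝓝 y)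
      filter_upwards [h1, h2] with p e1 e2
      rw [e1, e2]
    exact tendsto_const_nhds.congr' key
  coordChange_comp := fun q q' q'' y hy (v : H) ↦ by
    change v * c q q' y * c q' q'' y = v * c q q'' y
    rw [mul_assoc, hcomp q q' q'' y hy]

/-- Locally constant cocycles on a simply connected space are coboundaries. -/
theorem exists_coboundary [SimplyConnectedSpace X] [LocallyPathConnectedSpace X]
    {W : X → Set X} (hW : ∀ q, IsOpen (W q)) (hmem : ∀ q, q ∈ W q) (c : X → X → X → H)
    (hself : ∀ q, ∀ y ∈ W q, c q q y = 1)
    (hcomp : ∀ q q' q'', ∀ y ∈ W q ∩ W q' ∩ W q'', c q q' y * c q' q'' y = c q q'' y)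
    (hloc : ∀ q q', ∀ y ∈ W q ∩ W q', ∀ᶠ y' in 𝓝 y, c q q' y' = c q q' y) :
    ∃ v : X → X → H, (∀ q, ∀ y ∈ W q, ∀ᶠ y' in 𝓝 y, v q y' = v q y) ∧
      ∀ q q', ∀ y ∈ W q ∩ W q', v q' y = v q y * c q q' y := by
  let Z := cocycleBundle hW hmem c hself hcomp hloc
  have hcov : IsCoveringMap Z.proj :=
    IsCoveringMap.mk Z.proj (fun _ ↦ Disc H) (fun x ↦ Z.localTrivAt x) fun x ↦ hmem x
  let x₀ : X := Classical.arbitrary X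
  -- The bundle with discrete fibre is a covering, so the identity of the simply connected base
  -- lifts to a global section. Its expressions in the trivialisations form the coboundary.
  obtain ⟨Λ, ⟨-, hΛ⟩, -⟩ := hcov.existsUnique_continuousMap_lifts (ContinuousMap.id X) x₀
    (⟨x₀, (1 : H)⟩ : Z.TotalSpace) rfl
  have hΛ' (y : X) : (Λ y).1 = y := congrFun hΛ y
  let v : X → X → H := fun q y ↦ (Z.localTriv q (Λ y)).2
  have hv (q y) : v q y = (show H from (Λ y).2) * c y q y := by
    have h1 : Z.localTriv q (Λ y) = _ := Z.localTriv_apply q (Λ y)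
    have h2 : v q y = (show H from (Λ y).2) * c (Λ y).1 q (Λ y).1 := congrArg Prod.snd h1
    rwa [hΛ'] at h2
  refine ⟨v, fun q y hy ↦ ?_, fun q q' y hy ↦ ?_⟩
  · have hsrc : Λ y ∈ (Z.localTriv q).source := by
      rw [Z.mem_localTriv_source]
      change (Λ y).1 ∈ W q
      rwa [hΛ']
    have h1 : ContinuousAt (fun y ↦ Z.localTriv q (Λ y)) y :=
      ContinuousAt.comp (g := Z.localTriv q) (((Z.localTriv q).continuousOn_toFun).continuousAt
        ((Z.localTriv q).open_source.mem_nhds hsrc)) Λ.continuous.continuousAt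
    have h2 : ContinuousAt (fun y ↦ (Z.localTriv q (Λ y)).2) y := h1.snd
    rw [ContinuousAt, nhds_discrete (Disc H), tendsto_pure] at h2
    exact h2
  · rw [hv, hv, mul_assoc, hcomp y q q' y ⟨⟨hmem y, hy.1⟩, hy.2⟩]

end Trivialization

/-! ### Surjectivity and deck transformations of the universal covering -/

section Covering

variable {S St : Type*} [TopologicalSpace S] [TopologicalSpace St] {π : St → S}
  (hπ : IsCoveringMap π)
include hπ

/-- The image is open. Its complement is open too, since in an evenly covered neighbourhood all
fibres are in bijection with the same set. -/
theorem _root_.IsCoveringMap.surjective_of_connected [ConnectedSpace S] [Nonempty St] :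
    Function.Surjective π := by
  have h1 : IsOpen (Set.range π) := hπ.isOpenMap.isOpen_range
  have h2 : IsOpen (Set.range π)ᶜ := by
    rw [isOpen_iff_mem_nhds]
    intro q hq
    obtain ⟨-, U, hqU, hU, -, e, he⟩ := hπ q
    refine Filter.mem_of_superset (hU.mem_nhds hqU) ?_
    rintro _ hx' ⟨x, rfl⟩
    have := (e ⟨x, hx'⟩).2.2
    exact hq ⟨_, this⟩
  have h3 : IsClopen (Set.range π) := ⟨⟨h2⟩, h1⟩
  exact Set.range_eq_univ.mp (h3.eq_univ (Set.range_nonempty π))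

variable [SimplyConnectedSpace St] [LocallyPathConnectedSpace St]

/-- Lift `π` through itself with `x ↦ x'` and with `x' ↦ x`; by uniqueness of lifts the two lifts
are inverse to each other. -/
theorem exists_deck {x x' : St} (h : π x = π x') : ∃ γ : Deck π, (γ : St ≃ₜ St) x = x' := by
  obtain ⟨f, ⟨hf0, hf⟩, -⟩ := hπ.existsUnique_continuousMap_lifts ⟨π, hπ.continuous⟩ x x' h.symm
  obtain ⟨g, ⟨hg0, hg⟩, -⟩ := hπ.existsUnique_continuousMap_lifts ⟨π, hπ.continuous⟩ x' x h
  have hf' (y) : π (f y) = π y := congrFun hf y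
  have hg' (y) : π (g y) = π y := congrFun hg y
  have e1 : (fun y ↦ g (f y)) = id := hπ.eq_of_comp_eq (g.continuous.comp f.continuous) continuous_id
    (funext fun y ↦ (hg' _).trans (hf' y)) x ((congrArg g hf0).trans hg0)
  have e2 : (fun y ↦ f (g y)) = id := hπ.eq_of_comp_eq (f.continuous.comp g.continuous) continuous_id
    (funext fun y ↦ (hf' _).trans (hg' y)) x' ((congrArg f hg0).trans hf0)
  exact ⟨⟨⟨⟨f, g, congrFun e1, congrFun e2⟩, f.continuous, g.continuous⟩, hf'⟩, hf0⟩

omit [LocallyPathConnectedSpace St] in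
theorem deck_eq {γ γ' : Deck π} {x : St} (h : (γ : St ≃ₜ St) x = (γ' : St ≃ₜ St) x) : γ = γ' := by
  refine Subtype.ext (Homeomorph.ext fun y ↦ ?_)
  exact congrFun (hπ.eq_of_comp_eq (γ : St ≃ₜ St).continuous (γ' : St ≃ₜ St).continuous
    (funext fun y ↦ (γ.2 y).trans (γ'.2 y).symm) x h) y

end Covering

/-! ### Calculus of differences in principal sets -/

section PrincipalSets

variable {GC : Type v} [Group GC] {H : Subgroup GC} {S : Type u} (B : PrincipalSet S H)

namespace PrincipalSet

theorem proj_smul (p : B.P) (k : H) : B.proj (MulOpposite.op k • p) = B.proj p :=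
  ((B.transitive p _).mpr ⟨k, rfl⟩).symm

variable {B}

theorem smul_eq_iff {p : B.P} {k k' : H} :
    MulOpposite.op k • p = MulOpposite.op k' • p ↔ k = k' := by
  refine ⟨fun h ↦ ?_, fun h ↦ by rw [h]⟩
  have h1 : MulOpposite.op (k * k'⁻¹) • p = p := by
    rw [MulOpposite.op_mul, mul_smul, h, ← mul_smul, ← MulOpposite.op_mul, mul_inv_cancel,
      MulOpposite.op_one, one_smul]
  exact mul_inv_eq_one.mp (B.free p _ h1)

theorem div_spec {p q : B.P} (h : B.proj p = B.proj q) : MulOpposite.op (B.div p q) • p = q :=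
  Classical.epsilon_spec ((B.transitive p q).mp h)

theorem div_eq {p q : B.P} {k : H} (h : MulOpposite.op k • p = q) : B.div p q = k := by
  have h1 : B.proj p = B.proj q := by rw [← h, proj_smul]
  exact smul_eq_iff.mp ((div_spec h1).trans h.symm)

theorem div_self (p : B.P) : B.div p p = 1 := div_eq (by simp)

theorem div_smul {p q : B.P} (h : B.proj p = B.proj q) (k : H) :
    B.div p (MulOpposite.op k • q) = B.div p q * k :=
  div_eq (by rw [MulOpposite.op_mul, mul_smul, div_spec h])

theorem div_mul_div {p q r : B.P} (h : B.proj p = B.proj q) (h' : B.proj q = B.proj r) :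
    B.div p q * B.div q r = B.div p r :=
  (div_eq (by rw [MulOpposite.op_mul, mul_smul, div_spec h, div_spec h'])).symm

theorem inv_div {p q : B.P} (h : B.proj p = B.proj q) : (B.div p q)⁻¹ = B.div q p :=
  inv_eq_of_mul_eq_one_right (by rw [div_mul_div h h.symm, div_self])

end PrincipalSet

end PrincipalSets

/-! ### Local sections of the covering and smoothness of deck transformations -/

section LocalSections

variable {S St : Type*} [TopologicalSpace S] [ChartedSpace ℂ S] [IsManifold 𝓘(ℝ, ℂ) ∞ S]
  [TopologicalSpace St] [ChartedSpace ℂ St] [IsManifold 𝓘(ℝ, ℂ) ∞ St]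
  {π : St → S} (hπ : IsLocalDiffeomorph 𝓘(ℝ, ℂ) 𝓘(ℝ, ℂ) ∞ π)
include hπ

theorem exists_section_local (x : St) : ∃ σ : S → St, σ (π x) = x ∧
    (∀ᶠ y in 𝓝 (π x), π (σ y) = y ∧ ContMDiffAt 𝓘(ℝ, ℂ) 𝓘(ℝ, ℂ) ∞ σ y) ∧
    ∀ᶠ y in 𝓝 x, σ (π y) = y := by
  have h := hπ x
  refine ⟨h.localInverse, h.localInverse_left_inv h.localInverse_mem_target, ?_,
    h.localInverse_eventuallyEq_left⟩
  filter_upwards [h.localInverse_open_source.mem_nhds h.localInverse_mem_source] with y hy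
  exact ⟨h.localInverse_right_inv hy,
    h.localInverse_contMDiffOn.contMDiffAt (h.localInverse_open_source.mem_nhds hy)⟩

theorem contMDiff_deck (γ : Deck π) : ContMDiff 𝓘(ℝ, ℂ) 𝓘(ℝ, ℂ) ∞ (γ : St ≃ₜ St) := by
  intro x
  obtain ⟨σ, h1, h2, h3⟩ := exists_section_local hπ ((γ : St ≃ₜ St) x)
  have h4 : (fun y ↦ σ (π y)) =ᶠ[𝓝 x] (γ : St ≃ₜ St) := by
    filter_upwards [(γ : St ≃ₜ St).continuous.continuousAt.eventually h3] with y hy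
    rw [← hy, γ.2]
  refine ContMDiffAt.congr_of_eventuallyEq ?_ h4.symm
  refine ContMDiffAt.comp x ?_ (hπ.contMDiff x)
  have := h2.self_of_nhds.2
  rwa [γ.2] at this

theorem tder_deck (γ : Deck π) (x : St) :
    (tder ℝ ℂ ℂ π ((γ : St ≃ₜ St) x)).comp (tder ℝ ℂ ℂ (γ : St ≃ₜ St) x) = tder ℝ ℂ ℂ π x := by
  rw [← tder_comp x (hπ.contMDiff _).mdiff (contMDiff_deck hπ γ x).mdiff]
  exact tder_congr (Eventually.of_forall fun y ↦ γ.2 y)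

variable {E : Type*} [NormedAddCommGroup E] [NormedSpace ℂ E] {GC : Type*} [TopologicalSpace GC]
  [ChartedSpace E GC]

/-- Functions on the base with smooth pull-back to the covering are smooth. -/
theorem contMDiffAt_of_comp {t : S → GC} {x : St}
    (h : ContMDiffAt 𝓘(ℝ, ℂ) 𝓘(ℝ, E) ∞ (fun y ↦ t (π y)) x) :
    ContMDiffAt 𝓘(ℝ, ℂ) 𝓘(ℝ, E) ∞ t (π x) := by
  obtain ⟨σ, h1, h2, h3⟩ := exists_section_local hπ x
  have h4 : (fun y ↦ t (π (σ y))) =ᶠ[𝓝 (π x)] t := h2.mono fun y hy ↦ by simp only [hy.1]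
  refine ContMDiffAt.congr_of_eventuallyEq ?_ h4.symm
  refine ContMDiffAt.comp (g := fun y ↦ t (π y)) (π x) ?_ h2.self_of_nhds.2
  rwa [h1]

end LocalSections

/-! ### Developments of flat bundles and their holonomy -/

section Development

variable {E : Type*} [NormedAddCommGroup E] [NormedSpace ℂ E] [FiniteDimensional ℂ E]
  {GC : Type v} [TopologicalSpace GC] [T2Space GC] [ChartedSpace E GC] [Group GC]
  [LieGroup 𝓘(ℂ, E) ω GC] {H : Subgroup GC}
  {S St : Type u} [TopologicalSpace S] [ChartedSpace ℂ S] [IsManifold 𝓘(ℝ, ℂ) ∞ S]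
  [TopologicalSpace St] [ChartedSpace ℂ St] [IsManifold 𝓘(ℝ, ℂ) ∞ St]
  (π : St → S) (B : PrincipalBundle E S H) (α : B.ι → OneForm S E)

/-- `F` develops the bundle with the flat connection given by the local connection forms `α`: it is
a parallel trivialisation of the pull-back to the covering of the associated `GC`-bundle. -/
structure IsDevelopment (F : St → B.P → GC) : Prop where
  equivariant : ∀ x q, π x = B.proj q → ∀ k : H, F x (MulOpposite.op k • q) = F x q * k
  smooth : ∀ i, ∀ x, π x ∈ B.U i →
    ContMDiffAt 𝓘(ℝ, ℂ) 𝓘(ℝ, E) ∞ (fun x ↦ F x (B.sec i (π x))) x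
  mc_eq : ∀ i, ∀ x, π x ∈ B.U i → ∀ v : ℂ,
    mc ℝ E ℂ (fun x ↦ F x (B.sec i (π x))) x v = α i (π x) (tder ℝ ℂ ℂ π x v)

variable {π B α} {F F' : St → B.P → GC}

theorem IsDevelopment.apply_div (hF : IsDevelopment π B α F) {x : St} {p q : B.P}
    (hp : π x = B.proj p) (hq : π x = B.proj q) : F x q = F x p * (B.div p q : GC) := by
  rw [← hF.equivariant x p hp, PrincipalSet.div_spec (hp.symm.trans hq)]

theorem IsDevelopment.const_mul (hF : IsDevelopment π B α F) (g : GC) :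
    IsDevelopment π B α fun x q ↦ g * F x q where
  equivariant := fun x q h k ↦ by rw [hF.equivariant x q h, mul_assoc]
  smooth := fun i x hx ↦ contMDiffAt_const.mul (hF.smooth i x hx)
  mc_eq := fun i x hx v ↦ by rw [mc_const_mul, hF.mc_eq i x hx]

theorem isLocallyConstant_iff_eq {X Y : Type*} [TopologicalSpace X] [PreconnectedSpace X] {f : X → Y}
    (h : ∀ x, ∀ᶠ y in 𝓝 x, f y = f x) (x y : X) : f x = f y :=
  ((IsLocallyConstant.iff_eventually_eq f).mpr h).apply_eq_of_preconnectedSpace x y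

theorem eventually_mem_U (hπ : Continuous π) {i : B.ι} {x : St} (hx : π x ∈ B.U i) :
    ∀ᶠ y in 𝓝 x, π y ∈ B.U i :=
  hπ.continuousAt ((B.isOpen_U i).mem_nhds hx)

/-- Developments are unique up to left multiplication. -/
theorem IsDevelopment.unique [PreconnectedSpace St] [Nonempty St] (hπ : Continuous π)
    (hF : IsDevelopment π B α F) (hF' : IsDevelopment π B α F') :
    ∃ g : GC, ∀ x q, π x = B.proj q → F' x q = g * F x q := by
  choose idx hidx using B.cover
  let q₀ : St → B.P := fun x ↦ B.sec (idx (π x)) (π x)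
  have hq₀ (x) : π x = B.proj (q₀ x) := (B.proj_sec _ _ (hidx _)).symm
  let g : St → GC := fun x ↦ F' x (q₀ x) * (F x (q₀ x))⁻¹
  have hg (x q) (h : π x = B.proj q) : F' x q * (F x q)⁻¹ = g x := by
    rw [hF.apply_div (hq₀ x) h, hF'.apply_div (hq₀ x) h, mul_inv_rev]
    simp only [g]
    group
  have hloc (x) : ∀ᶠ y in 𝓝 x, g y = g x := by
    have hU := eventually_mem_U hπ (hidx (π x))
    have h1 := eventually_eq_of_mc_eq (N := ℂ) (E := E)
      (s := fun x' ↦ F' x' (B.sec (idx (π x)) (π x'))) (t := fun x' ↦ F x' (B.sec (idx (π x)) (π x')))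
      (x := x) (hU.mono fun y hy ↦ hF'.smooth _ y hy) (hU.mono fun y hy ↦ hF.smooth _ y hy) (by
        filter_upwards [hU] with y hy
        ext v
        rw [hF'.mc_eq _ y hy, hF.mc_eq _ y hy])
    filter_upwards [h1, hU] with y h2 h3
    rwa [hg _ _ (B.proj_sec _ _ h3).symm, hg _ _ (B.proj_sec _ _ (hidx _)).symm] at h2
  refine ⟨g (Classical.arbitrary St), fun x q h ↦ ?_⟩
  rw [isLocallyConstant_iff_eq hloc _ x, ← hg x q h, inv_mul_cancel_right]

/-- The holonomy representation of a development. -/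
theorem IsDevelopment.exists_holonomy [PreconnectedSpace St] [Nonempty St]
    (hπ : IsLocalDiffeomorph 𝓘(ℝ, ℂ) 𝓘(ℝ, ℂ) ∞ π) (hF : IsDevelopment π B α F) :
    ∃ ρ : Deck π →* GC, ∀ (γ : Deck π) x q, π x = B.proj q →
      F ((γ : St ≃ₜ St) x) q = ρ γ * F x q := by
  -- Deck transformations cover the identity of `S`, and the connection forms live on `S`, so `F ∘
  -- γ` is again a development. Uniqueness then provides the factor `ρ γ`.
  have hdeck (γ : Deck π) : IsDevelopment π B α fun x q ↦ F ((γ : St ≃ₜ St) x) q := by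
    have e (i) : (fun x ↦ F ((γ : St ≃ₜ St) x) (B.sec i (π x))) =
        fun x ↦ (fun x' ↦ F x' (B.sec i (π x'))) ((γ : St ≃ₜ St) x) := by
      funext x
      simp only [γ.2 x]
    constructor
    · intro x q h k
      exact hF.equivariant _ q ((γ.2 x).trans h) k
    · intro i x hx
      rw [e]
      exact ContMDiffAt.comp (g := fun x' ↦ F x' (B.sec i (π x'))) x
        (hF.smooth i _ (by rwa [γ.2])) (contMDiff_deck hπ γ x)
    · intro i x hx v
      have hx' : π ((γ : St ≃ₜ St) x) ∈ B.U i := by rwa [γ.2]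
      rw [e, mc_comp (s := fun x' ↦ F x' (B.sec i (π x'))) (hF.smooth i _ hx').mdiff
        (contMDiff_deck hπ γ x).mdiff, ContinuousLinearMap.comp_apply, hF.mc_eq i _ hx',
        ← tder_deck hπ γ x]
      have gen (q q' : S) (hq : q = q') (w : ℂ) : (α i q : ℂ →L[ℝ] E) w = (α i q' : ℂ →L[ℝ] E) w := by
        rw [hq]
      exact gen _ _ (γ.2 x) _
  choose ρ hρ using fun γ ↦ hF.unique hπ.contMDiff.continuous (hdeck γ)
  obtain ⟨x₀⟩ := ‹Nonempty St›
  obtain ⟨i, hi⟩ := B.cover (π x₀)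
  have h0 : π x₀ = B.proj (B.sec i (π x₀)) := (B.proj_sec i _ hi).symm
  refine ⟨⟨⟨ρ, ?_⟩, fun γ γ' ↦ ?_⟩, fun γ x q h ↦ hρ γ x q h⟩
  · have := hρ 1 x₀ _ h0
    exact mul_eq_right.mp this.symm
  · have h1 := hρ (γ * γ') x₀ _ h0
    have h2 : F (((γ * γ' : Deck π) : St ≃ₜ St) x₀) (B.sec i (π x₀)) =
        F ((γ : St ≃ₜ St) ((γ' : St ≃ₜ St) x₀)) (B.sec i (π x₀)) := rfl
    rw [h2, hρ γ _ _ ((γ'.2 x₀).trans h0), hρ γ' _ _ h0, ← mul_assoc] at h1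
    exact (mul_right_cancel h1).symm

variable (hπ : IsLocalDiffeomorph 𝓘(ℝ, ℂ) 𝓘(ℝ, ℂ) ∞ π)
include hπ

/-- A flat connection form on the base is the pulled back Maurer-Cartan form of a local map on the
covering. -/
theorem exists_local_parallel {β : OneForm S E} {x : St}
    (hβ : ∀ᶠ q in 𝓝 (π x), SmoothFormAt β q)
    (hflat : ∀ᶠ q in 𝓝 (π x), ∀ a b : ℂ, curvature GC β q a b = 0) :
    ∃ s : St → GC, ∀ᶠ y in 𝓝 x, ContMDiffAt 𝓘(ℝ, ℂ) 𝓘(ℝ, E) ∞ s y ∧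
      ∀ v : ℂ, mc ℝ E ℂ s y v = β (π y) (tder ℝ ℂ ℂ π y v) := by
  have : CompleteSpace E := FiniteDimensional.complete ℂ E
  have : FiniteDimensional ℝ E := FiniteDimensional.complexToReal E
  let κ : ℂ → S := fun y ↦ π ((chartAt ℂ x).symm y)
  have hk := eventually_contMDiffAt_comp_symm hπ x
  have hcont : Tendsto κ (𝓝 (chartAt ℂ x x)) (𝓝 (π x)) :=
    (hπ.contMDiff x).continuousAt.tendsto.comp (tendsto_chart_symm x)
  obtain ⟨s, -, hs⟩ := exists_mc_eq (G := GC) (α := pull β κ) (y₀ := chartAt ℂ x x) (by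
      filter_upwards [hk.eventually_nhds, hcont.eventually hβ] with y h1 h2
      exact contDiffAt_pull h1 h2) (by
      filter_upwards [hk.eventually_nhds, hcont.eventually hβ, hcont.eventually hflat] with y h1 h2 h3
        u v
      have := curvature_pull (GC := GC) h1 h2 u v
      rw [lieB_real]
      exact this.trans (h3 _ _))
  have hsrc : ∀ᶠ y in 𝓝 x, y ∈ (chartAt ℂ x).source :=
    (chartAt ℂ x).open_source.mem_nhds (mem_chart_source ℂ x)
  have hc : ContinuousAt (chartAt ℂ x) x := (chartAt ℂ x).continuousAt (mem_chart_source ℂ x)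
  refine ⟨fun y ↦ s (chartAt ℂ x y), ?_⟩
  filter_upwards [hsrc, hc.eventually hs] with y h1 h2
  have hch := contMDiffAt_chart (𝕜 := ℝ) h1
  have hsy := contMDiffAt_chart_symm (𝕜 := ℝ) ((chartAt ℂ x).map_source h1)
  refine ⟨ContMDiffAt.comp y h2.1 hch, fun v ↦ ?_⟩
  rw [mc_comp (s := s) h2.1.mdiff hch.mdiff, ContinuousLinearMap.comp_apply, h2.2, pull_apply,
    tder_comp (g := π) (f := (chartAt ℂ x).symm) _ (hπ.contMDiff _).mdiff hsy.mdiff,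
    ContinuousLinearMap.comp_apply, ← ContinuousLinearMap.comp_apply (tder ℝ ℂ ℂ (chartAt ℂ x).symm _),
    tder_symm_comp_tder_chart h1]
  have gen (y' : St) (h : y' = y) (w : ℂ) : (β (π y') : ℂ →L[ℝ] E) (tder ℝ ℂ ℂ π y' w) =
      (β (π y) : ℂ →L[ℝ] E) (tder ℝ ℂ ℂ π y w) := by rw [h]
  exact gen _ ((chartAt ℂ x).left_inv h1) v

variable (hgauge : ∀ i i', ∀ q ∈ B.U i ∩ B.U i', ∀ v : ℂ,
  α i' q v = adj ℂ E (B.trans i i' q)⁻¹ (α i q v) + mc ℝ E ℂ (B.trans i i') q v)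

theorem contMDiffAt_trans_comp {i i' : B.ι} {y : St} (hy : π y ∈ B.U i ∩ B.U i') :
    ContMDiffAt 𝓘(ℝ, ℂ) 𝓘(ℝ, E) ∞ (fun y ↦ B.trans i i' (π y)) y :=
  ContMDiffAt.comp (g := B.trans i i') y ((B.smooth_trans i i').contMDiffAt
    (((B.isOpen_U i).inter (B.isOpen_U i')).mem_nhds hy)) (hπ.contMDiff y)

include hgauge in
theorem mc_mul_trans {s : St → GC} {i i' : B.ι} {y : St} (hy : π y ∈ B.U i ∩ B.U i')
    (hs : ContMDiffAt 𝓘(ℝ, ℂ) 𝓘(ℝ, E) ∞ s y)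
    (h : ∀ v : ℂ, mc ℝ E ℂ s y v = α i (π y) (tder ℝ ℂ ℂ π y v)) (v : ℂ) :
    mc ℝ E ℂ (fun y ↦ s y * B.trans i i' (π y)) y v = α i' (π y) (tder ℝ ℂ ℂ π y v) := by
  have h1 := (B.smooth_trans i i').contMDiffAt
    (((B.isOpen_U i).inter (B.isOpen_U i')).mem_nhds hy)
  rw [mc_mul hs.mdiff (contMDiffAt_trans_comp hπ hy).mdiff,
    mc_comp (s := B.trans i i') h1.mdiff (hπ.contMDiff y).mdiff]
  simp only [add_apply, ContinuousLinearMap.comp_apply]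
  rw [h, adj_real_apply, hgauge i i' (π y) hy]

include hgauge in
/-- Flat bundles over `S` have developments on simply connected coverings. -/
theorem exists_development [SimplyConnectedSpace St] [LocallyPathConnectedSpace St]
    (hsmooth : ∀ i, ∀ q ∈ B.U i, SmoothFormAt (α i) q)
    (hflat : ∀ i, ∀ q ∈ B.U i, ∀ a b : ℂ, curvature GC (α i) q a b = 0) :
    ∃ F : St → B.P → GC, IsDevelopment π B α F := by
  have hcont := hπ.contMDiff.continuous
  choose idx hidx using fun x : St ↦ B.cover (π x)
  have hloc (x : St) := exists_local_parallel (GC := GC) hπ (β := α (idx x)) (x := x)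
    (Filter.mem_of_superset ((B.isOpen_U _).mem_nhds (hidx x)) fun q hq ↦ hsmooth _ q hq)
    (Filter.mem_of_superset ((B.isOpen_U _).mem_nhds (hidx x)) fun q hq ↦ hflat _ q hq)
  choose s hs using hloc
  have hW (x : St) : ∃ W : Set St, IsOpen W ∧ x ∈ W ∧ ∀ y ∈ W, π y ∈ B.U (idx x) ∧
      ContMDiffAt 𝓘(ℝ, ℂ) 𝓘(ℝ, E) ∞ (s x) y ∧
      ∀ v : ℂ, mc ℝ E ℂ (s x) y v = α (idx x) (π y) (tder ℝ ℂ ℂ π y v) := by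
    obtain ⟨W, h1, h2, h3⟩ := eventually_nhds_iff.mp ((eventually_mem_U hcont (hidx x)).and (hs x))
    exact ⟨W, h2, h3, h1⟩
  choose W hWo hWx hW using hW
  let d : St → St → St → GC := fun x x' y ↦ B.trans (idx x) (idx x') (π y)
  have hd (x x' x'' y) (h : y ∈ W x) (h' : y ∈ W x') (h'' : y ∈ W x'') :
      d x x' y * d x' x'' y = d x x'' y := by
    have e1 := B.proj_sec _ _ (hW x y h).1
    have e2 := B.proj_sec _ _ (hW x' y h').1
    have e3 := B.proj_sec _ _ (hW x'' y h'').1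
    exact congrArg Subtype.val (PrincipalSet.div_mul_div (e1.trans e2.symm) (e2.trans e3.symm))
  have hd1 (x y) : d x x y = 1 := congrArg Subtype.val (PrincipalSet.div_self (B := B.toPrincipalSet) _)
  obtain ⟨v, hv, hvc⟩ := exists_coboundary hWo hWx
    -- Multiplied by the transition function, `s x'` solves the same equation as `s x` on the
    -- overlap. The quotient of the two is locally constant, which makes it a cocycle to which
    -- `exists_coboundary` applies.
    (fun x x' y ↦ s x y * (s x' y * d x' x y)⁻¹)
    (fun x y _ ↦ by simp only [hd1, mul_one, mul_inv_cancel])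
    (fun x x' x'' y hy ↦ by
      simp only [← hd x'' x' x y hy.2 hy.1.2 hy.1.1]
      group)
    (fun x x' y hy ↦ by
      have h1 : ∀ᶠ y' in 𝓝 y, y' ∈ W x ∩ W x' := ((hWo x).inter (hWo x')).mem_nhds hy
      refine eventually_eq_of_mc_eq (N := ℂ) (E := E) (s := s x) (t := fun y ↦ s x' y * d x' x y)
        (h1.mono fun y' h ↦ (hW x y' h.1).2.1)
        (h1.mono fun y' h ↦ ContMDiffAt.mul (hW x' y' h.2).2.1
          (contMDiffAt_trans_comp hπ ⟨(hW x' y' h.2).1, (hW x y' h.1).1⟩)) ?_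
      filter_upwards [h1] with y' h
      ext u
      rw [(hW x y' h.1).2.2]
      exact (mc_mul_trans hπ hgauge ⟨(hW x' y' h.2).1, (hW x y' h.1).1⟩ (hW x' y' h.2).2.1
        (hW x' y' h.2).2.2 u).symm)
  -- The local solutions, corrected by the coboundary on the left and extended equivariantly along
  -- the fibres, agree on overlaps. So the index of the point itself can be used.
  let F : St → B.P → GC := fun y p ↦ v y y * s y y * (B.div (B.sec (idx y) (π y)) p : GC)
  have hF (x y) (hy : y ∈ W x) (p) (hp : π y = B.proj p) :
      F y p = v x y * (s x y * (B.div (B.sec (idx x) (π y)) p : GC)) := by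
    have e1 := (B.proj_sec _ _ (hW x y hy).1).trans hp
    have e2 := (B.proj_sec _ _ (hidx y)).trans hp
    have e3 : d y x y * (B.div (B.sec (idx x) (π y)) p : GC) = B.div (B.sec (idx y) (π y)) p :=
      congrArg Subtype.val (PrincipalSet.div_mul_div (e2.trans e1.symm) e1)
    simp only [F, hvc x y y ⟨hy, hWx y⟩, ← e3]
    group
  refine ⟨F, fun y p hp k ↦ ?_, fun i x hx ↦ ?_, fun i x hx u ↦ ?_⟩
  · have e2 := (B.proj_sec _ _ (hidx y)).trans hp
    simp only [F, PrincipalSet.div_smul e2, Subgroup.coe_mul, mul_assoc]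
  all_goals
    have h0 : (fun y ↦ F y (B.sec i (π y))) =ᶠ[𝓝 x]
        fun y ↦ v x x * (s x y * B.trans (idx x) i (π y)) := by
      filter_upwards [hv x x (hWx x), (hWo x).mem_nhds (hWx x), eventually_mem_U hcont hx] with y h1 h2 h3
      rw [hF x y h2 _ (B.proj_sec _ _ h3).symm, h1]
      rfl
  · refine ContMDiffAt.congr_of_eventuallyEq ?_ h0
    exact contMDiffAt_const.mul (ContMDiffAt.mul (hW x x (hWx x)).2.1
      (contMDiffAt_trans_comp hπ ⟨hidx x, hx⟩))
  · rw [mc_congr h0, mc_const_mul]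
    exact mc_mul_trans hπ hgauge ⟨hidx x, hx⟩ (hW x x (hWx x)).2.1 (hW x x (hWx x)).2.2 u

end Development

/-! ### Linear images of forms -/

section MapForm

variable {S : Type*} [TopologicalSpace S] [ChartedSpace ℂ S] [IsManifold 𝓘(ℝ, ℂ) ∞ S]
  {W : Type*} [NormedAddCommGroup W] [NormedSpace ℂ W]

/-- The composition of a vector valued form with a linear map. -/
def mapForm (L : W →L[ℂ] W) (β : OneForm S W) : OneForm S W := fun q ↦
  show ℂ →L[ℝ] W from (L.restrictScalars ℝ).comp (show ℂ →L[ℝ] W from β q)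

theorem mapForm_apply (L : W →L[ℂ] W) (β : OneForm S W) (q : S) (v : ℂ) :
    mapForm L β q v = L (β q v) := rfl

theorem formInChart_mapForm (L : W →L[ℂ] W) (β : OneForm S W) (q : S) :
    formInChart (mapForm L β) q = fun y ↦ (L.restrictScalars ℝ).comp (formInChart β q y) := rfl

theorem SmoothFormAt.mapForm (L : W →L[ℂ] W) {β : OneForm S W} {q : S} (h : SmoothFormAt β q) :
    SmoothFormAt (mapForm L β) q := by
  rw [SmoothFormAt, formInChart_mapForm]
  exact contDiffAt_const.clm_comp h

theorem isTypeOneZero_mapForm {c : ComplexStructure S} (L : W →L[ℂ] W) {β : OneForm S W} {q : S}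
    (h : IsTypeOneZero c q (β q)) : IsTypeOneZero c q (mapForm L β q) := by
  intro z hz hq
  obtain ⟨a, ha⟩ := h z hz hq
  have key (v : ℂ) : mapForm L β q v = (tder ℝ ℂ ℂ z q v) • L a := by
    rw [mapForm_apply, ← map_smul]
    exact congrArg L (ha v)
  exact ⟨L a, key⟩

theorem extDerivForm_mapForm (L : W →L[ℂ] W) {β : OneForm S W} {q : S} (h : SmoothFormAt β q)
    (a b : ℂ) : extDerivForm (mapForm L β) q a b = L (extDerivForm β q a b) := by
  have h1 : HasFDerivAt (formInChart β q) _ (chartAt ℂ q q) :=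
    (ContDiffAt.differentiableAt (n := ∞) h (by simp)).hasFDerivAt
  have h2 := (hasFDerivAt_const (L.restrictScalars ℝ) (chartAt ℂ q q)).clm_comp h1
  have h3 (u v : ℂ) : fderiv ℝ (formInChart (mapForm L β) q) (chartAt ℂ q q) u v =
      L (fderiv ℝ (formInChart β q) (chartAt ℂ q q) u v) := by
    rw [show fderiv ℝ (formInChart (mapForm L β) q) (chartAt ℂ q q) = _ from h2.fderiv]
    simp
  refine (congrArg₂ (· - ·) (h3 a b) (h3 b a)).trans ?_
  exact (map_sub L _ _).symm

variable {GC : Type*} [TopologicalSpace GC] [ChartedSpace W GC] [Group GC]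

theorem covExtDeriv_mapForm (L : W →L[ℂ] W) (hL : ∀ a b, L (lieB ℂ GC a b) = lieB ℂ GC (L a) (L b))
    (A : OneForm S W) {β : OneForm S W} {q : S} (h : SmoothFormAt β q) (a b : ℂ) :
    covExtDeriv GC (mapForm L A) (mapForm L β) q a b = L (covExtDeriv GC A β q a b) := by
  have e : covExtDeriv GC (mapForm L A) (mapForm L β) q a b = extDerivForm (mapForm L β) q a b +
      lieB ℂ GC (L (A q a)) (L (β q b)) - lieB ℂ GC (L (A q b)) (L (β q a)) := rfl
  have e' : covExtDeriv GC A β q a b = extDerivForm β q a b +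
      lieB ℂ GC (A q a) (β q b) - lieB ℂ GC (A q b) (β q a) := rfl
  rw [e, e', extDerivForm_mapForm L h, map_sub, map_add, hL, hL]

end MapForm

/-! ### From bundles to pairs -/

section Bundles

variable {EG : Type*} [NormedAddCommGroup EG] [NormedSpace ℝ EG] [CompleteSpace EG]
  [FiniteDimensional ℝ EG]
  {G : Type*} [TopologicalSpace G] [T2Space G] [ChartedSpace EG G] [Group G]
  [LieGroup 𝓘(ℝ, EG) ∞ G]
  {ν : LinearMap.BilinForm ℝ (GroupLieAlgebra 𝓘(ℝ, EG) G)}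
  {E : Type*} [NormedAddCommGroup E] [NormedSpace ℂ E] [FiniteDimensional ℂ E]
  {GC : Type v} [TopologicalSpace GC] [T2Space GC] [ChartedSpace E GC] [Group GC]
  [LieGroup 𝓘(ℂ, E) ω GC]
  {j : G →* GC} (hj : IsComplexification EG E j) {M : MaximalCompact ν}
  {V : Type*} [NormedAddCommGroup V] [NormedSpace ℂ V] [ChartedSpace V (GC ⧸ M.KC E j)]
  [IsManifold 𝓘(ℂ, V) ω (GC ⧸ M.KC E j)]
  (hq : IsHolomorphicQuotient E V (M.KC E j))
  (hG : LieAlgebra.IsSemisimple ℝ (GroupLieAlgebra 𝓘(ℝ, EG) G))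
  {S St : Type u} [TopologicalSpace S] [ChartedSpace ℂ S] [IsManifold 𝓘(ℝ, ℂ) ∞ S]
  [TopologicalSpace St] [ChartedSpace ℂ St] [IsManifold 𝓘(ℝ, ℂ) ∞ St]
  {π : St → S} (hπ : IsLocalDiffeomorph 𝓘(ℝ, ℂ) 𝓘(ℝ, ℂ) ∞ π)
  {c₁ c₂ : ComplexStructure S}

namespace HarmonicBundle

variable (b : HarmonicBundle (E := E) c₁ c₂ j ν)

/-- The connection forms of the flat connection of a complex harmonic bundle. -/
def conn (i : b.B.ι) : OneForm S E := fun y ↦ b.A.form i y + b.φ₁.form i y + b.φ₂.form i y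

theorem conn_apply (i : b.B.ι) (x : S) (v : ℂ) :
    b.conn i x v = b.A.form i x v + b.φ₁.form i x v + b.φ₂.form i x v := rfl

theorem conn_smooth (i : b.B.ι) (x : S) (hx : x ∈ b.B.U i) : SmoothFormAt (b.conn i) x :=
  ((show SmoothFormAt (b.A.form i) x from b.A.smooth i x hx).add (b.φ₁.smooth i x hx)).add
    (b.φ₂.smooth i x hx)

theorem conn_gauge (i i' : b.B.ι) (q : S) (hq : q ∈ b.B.U i ∩ b.B.U i') (v : ℂ) :
    b.conn i' q v = adj ℂ E (b.B.trans i i' q)⁻¹ (b.conn i q v) + mc ℝ E ℂ (b.B.trans i i') q v := by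
  have h1 : (b.A.form i' q v : E) = adj ℂ E (b.B.trans i i' q)⁻¹ (b.A.form i q v) +
    mc ℝ E ℂ (b.B.trans i i') q v := b.A.gauge i i' q hq v
  have h2 : (b.φ₁.form i' q v : E) = adj ℂ E (b.B.trans i i' q)⁻¹ (b.φ₁.form i q v) :=
    b.φ₁.gauge i i' q hq v
  have h3 : (b.φ₂.form i' q v : E) = adj ℂ E (b.B.trans i i' q)⁻¹ (b.φ₂.form i q v) :=
    b.φ₂.gauge i i' q hq v
  rw [conn_apply, conn_apply, h1, h2, h3, map_add, map_add]
  abel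

theorem isSplitAt (i : b.B.ι) (q : S) (hq : q ∈ b.B.U i) :
    IsSplitAt j b.M c₁ c₂ (b.A.form i) (b.φ₁.form i) (b.φ₂.form i) q where
  smooth_A := b.A.smooth i q hq
  smooth₁ := b.φ₁.smooth i q hq
  smooth₂ := b.φ₂.smooth i q hq
  mem_A := b.A.mem i q hq
  mem₁ := b.φ₁.mem i q hq
  mem₂ := b.φ₂.mem i q hq
  type₁ := b.type₁ i q hq
  type₂ := b.type₂ i q hq

theorem covExtDeriv_φ₂ (hc : Transverse c₁ c₂) (i : b.B.ι) (q : S) (hq : q ∈ b.B.U i) (a a' : ℂ) :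
    covExtDeriv GC (b.A.form i) (b.φ₂.form i) q a a' = 0 := by
  refine Eq.trans ?_ (b.del_φ₂ i q hq a a')
  refine covExtDeriv_congr GC _ ?_ a a'
  filter_upwards [(b.B.isOpen_U i).mem_nhds hq] with y hy
  exact (typeProj_of_isType hc.symm (b.type₂ i y hy)).symm

end HarmonicBundle

/-- The correspondence in terms of developments. -/
theorem corresponds_iff (hπ : Continuous π) (p : HarmonicPair (E := E) (V := V) π c₁ c₂ j M)
    (b : HarmonicBundle (E := E) c₁ c₂ j ν) :
    Corresponds p b ↔ ∃ (h : G) (F : St → b.B.P → GC), M.ConjTo b.M h ∧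
      IsDevelopment π b.B b.conn F ∧
      (∀ (γ : Deck π) x q, π x = b.B.proj q → F ((γ : St ≃ₜ St) x) q = p.ρ γ * F x q) ∧
      ∀ x q, π x = b.B.proj q → p.f x = QuotientGroup.mk (F x q * j h) := by
  constructor
  · rintro ⟨h, F, h1, h2, h3, h4, h5⟩
    refine ⟨h, F, h1, ⟨h2, fun i x hx ↦ ?_, fun i x hx v ↦ (h5 i).2 x hx v⟩, h3, h4⟩
    exact (h5 i).1.contMDiffAt (((b.B.isOpen_U i).preimage hπ).mem_nhds hx)
  · rintro ⟨h, F, h1, h2, h3, h4⟩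
    exact ⟨h, F, h1, h2.equivariant, h3, h4, fun i ↦
      ⟨fun x hx ↦ (h2.smooth i x hx).contMDiffWithinAt, fun x hx v ↦ h2.mc_eq i x hx v⟩⟩

theorem contMDiff_mk_real (hq : IsHolomorphicQuotient E V (M.KC E j)) :
    ContMDiff 𝓘(ℝ, E) 𝓘(ℝ, V) ∞ (QuotientGroup.mk : GC → GC ⧸ M.KC E j) := fun g ↦
  ((hq.smooth g).restrictReal).of_le (by simp)

include hj hG hq hπ in
/-- Every complex harmonic bundle comes from a pair. -/
theorem exists_pair_corresponds [SimplyConnectedSpace St] [LocallyPathConnectedSpace St]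
    (hc : Transverse c₁ c₂) (hν_symm : ν.IsSymm)
    (hν : ∀ (g : G) a b, ν (Ad (𝕜 := ℝ) EG g a) (Ad (𝕜 := ℝ) EG g b) = ν a b)
    (b : HarmonicBundle (E := E) c₁ c₂ j ν) :
    ∃ p : HarmonicPair (E := E) (V := V) π c₁ c₂ j M, Corresponds p b := by
  have : CompleteSpace E := FiniteDimensional.complete ℂ E
  have hcont := hπ.contMDiff.continuous
  -- The bundle has its own maximal compact subgroup, whereas `f` takes values in the quotient by
  -- the fixed one.
  obtain ⟨h, hh⟩ := MaximalCompact.exists_conjTo hν_symm hG M b.M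
  obtain ⟨F, hF⟩ := exists_development (π := π) (B := b.B) (α := b.conn) hπ b.conn_gauge b.conn_smooth
    fun i q hq a a' ↦ b.flat i q hq a a'
  obtain ⟨ρ, hρ⟩ := hF.exists_holonomy hπ
  choose idx hidx using b.B.cover
  let q₀ : St → b.B.P := fun x ↦ b.B.sec (idx (π x)) (π x)
  have hq₀ (x) : π x = b.B.proj (q₀ x) := (b.B.proj_sec _ _ (hidx _)).symm
  let f : St → GC ⧸ M.KC E j := fun x ↦ QuotientGroup.mk (F x (q₀ x) * j h)
  have hf (x q) (hx : π x = b.B.proj q) : f x = QuotientGroup.mk (F x q * j h) := by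
    refine QuotientGroup.eq.mpr ?_
    rw [hF.apply_div (hq₀ x) hx]
    have := hh.symm.conj_mem_KC hj (b.B.div (q₀ x) q).2
    rw [map_inv, inv_inv] at this
    convert this using 1
    group
  have hfs (i x) (hx : π x ∈ b.B.U i) :
      f =ᶠ[𝓝 x] fun y ↦ QuotientGroup.mk (F y (b.B.sec i (π y)) * j h) := by
    filter_upwards [eventually_mem_U hcont hx] with y hy
    exact hf y _ (b.B.proj_sec _ _ hy).symm
  have hs (i x) (hx : π x ∈ b.B.U i) :
      ContMDiffAt 𝓘(ℝ, ℂ) 𝓘(ℝ, E) ∞ (fun y ↦ F y (b.B.sec i (π y)) * j h) x :=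
    (hF.smooth i x hx).mul contMDiffAt_const
  have hfsmooth : ContMDiff 𝓘(ℝ, ℂ) 𝓘(ℝ, V) ∞ f := fun x ↦
    (ContMDiffAt.comp x (contMDiff_mk_real hq _) (hs _ x (hidx _))).congr_of_eventuallyEq
      (hfs _ x (hidx _))
  have hharm : IsComplexHarmonic π c₁ c₂ (M.symmetricMetric (V := V) j) f := by
    intro U hU g hg x hxU
    let i := idx (π x)
    -- The local lift of `f` is `F · j(h)`. Right multiplication by `j(h)` acts on the forms by
    -- `Ad(h⁻¹)`, which carries the Cartan decomposition of the bundle to the fixed one.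
    let L : E →L[ℂ] E := adj ℂ E (j h⁻¹)
    have hnear : ∀ᶠ y in 𝓝 (π x), y ∈ b.B.U i := (b.B.isOpen_U i).mem_nhds (hidx _)
    refine (tension_eq_zero_iff hj hq hG hπ (A := mapForm L (b.A.form i))
      (φ₁ := mapForm L (b.φ₁.form i)) (φ₂ := mapForm L (b.φ₂.form i)) (x := x)
      (s := fun y ↦ F y (b.B.sec i (π y)) * j h) ?_ ?_ ?_ hc hν_symm hν hfsmooth ?_).mpr ?_ U hU g hg
      hxU
    · filter_upwards [eventually_mem_U hcont (hidx (π x))] with y hy using hs i y hy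
    · filter_upwards [eventually_mem_U hcont (hidx (π x))] with y hy v
      rw [mc_mul_const (hF.smooth i y hy).mdiff, ContinuousLinearMap.comp_apply, hF.mc_eq i y hy,
        ← map_inv, adj_real_apply, HarmonicBundle.conn_apply, map_add, map_add]
      rfl
    · filter_upwards [hnear] with y hy
      have hsp := b.isSplitAt i y hy
      exact ⟨hsp.smooth_A.mapForm L, hsp.smooth₁.mapForm L, hsp.smooth₂.mapForm L,
        fun v ↦ hh.symm.adj_mem_kC hj (hsp.mem_A v), fun v ↦ hh.symm.adj_mem_pC hj (hsp.mem₁ v),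
        fun v ↦ hh.symm.adj_mem_pC hj (hsp.mem₂ v), isTypeOneZero_mapForm L hsp.type₁,
        isTypeOneZero_mapForm L hsp.type₂⟩
    · filter_upwards [hfs i x (hidx _)] with y hy using hy.symm
    · intro a a'
      refine (covExtDeriv_mapForm L (adj_bracket _) _ (b.isSplitAt i _ (hidx _)).smooth₂ a a').trans ?_
      exact (congrArg L (b.covExtDeriv_φ₂ hc i _ (hidx _) a a')).trans (map_zero L)
  let p : HarmonicPair (E := E) (V := V) π c₁ c₂ j M :=
    ⟨ρ, f, hfsmooth, fun γ x ↦ by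
      rw [hf _ (q₀ x) ((γ.2 x).trans (hq₀ x)), hρ γ x _ (hq₀ x), mul_assoc]
      rfl, hharm⟩
  exact ⟨p, (corresponds_iff hcont p b).mpr ⟨h, F, hh, hF, hρ, hf⟩⟩

include hj in
/-- Pairs with isomorphic bundles are equivalent. -/
theorem rel_of_corresponds [PreconnectedSpace St] [Nonempty St] (hπ : Continuous π)
    {p p' : HarmonicPair (E := E) (V := V) π c₁ c₂ j M} {b : HarmonicBundle (E := E) c₁ c₂ j ν}
    (hp : Corresponds p b) (hp' : Corresponds p' b) : p.Rel p' := by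
  obtain ⟨h, F, hh, hF, hρ, hf⟩ := (corresponds_iff hπ p b).mp hp
  obtain ⟨h', F', hh', hF', hρ', hf'⟩ := (corresponds_iff hπ p' b).mp hp'
  obtain ⟨g, hg⟩ := hF.unique hπ hF'
  have hsec (x : St) : ∃ q, π x = b.B.proj q := by
    obtain ⟨i, hi⟩ := b.B.cover (π x)
    exact ⟨_, (b.B.proj_sec i _ hi).symm⟩
  refine ⟨g, fun γ ↦ ?_, fun x ↦ ?_⟩
  · obtain ⟨x⟩ := ‹Nonempty St›
    obtain ⟨q, hq⟩ := hsec x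
    have h1 := hρ' γ x q hq
    rw [hg _ _ ((γ.2 x).trans hq), hg _ _ hq, hρ γ x q hq, ← mul_assoc, ← mul_assoc] at h1
    rw [mul_right_cancel h1, mul_inv_cancel_right]
  · obtain ⟨q, hq⟩ := hsec x
    rw [hf x q hq, hf' x q hq, hg x q hq]
    refine QuotientGroup.eq.mpr ?_
    -- The two conjugating elements differ by an element that commutes with `θ`, hence lies in `K`;
    -- this is absorbed in the coset.
    have h1 : h'⁻¹ * h ∈ M.K := (hh.trans hh'.symm).mem_K
    have h2 : j (h'⁻¹ * h) ∈ M.KC E j := Subgroup.subset_closure (Or.inl ⟨_, h1, rfl⟩)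
    convert h2 using 1
    change (g * F x q * j h')⁻¹ * (g * (F x q * j h)) = _
    rw [map_mul, map_inv]
    group

theorem corresponds_of_rel (hπ : Continuous π)
    {p p' : HarmonicPair (E := E) (V := V) π c₁ c₂ j M} {b : HarmonicBundle (E := E) c₁ c₂ j ν}
    (hp : Corresponds p b) (hpp : p.Rel p') : Corresponds p' b := by
  obtain ⟨h, F, hh, hF, hρ, hf⟩ := (corresponds_iff hπ p b).mp hp
  obtain ⟨g, hg, hgf⟩ := hpp
  refine (corresponds_iff hπ p' b).mpr ⟨h, fun x q ↦ g * F x q, hh, hF.const_mul g,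
    fun γ x q hq ↦ ?_, fun x q hq ↦ ?_⟩
  · change g * F _ q = _ * (g * F x q)
    rw [hρ γ x q hq, hg]
    group
  · rw [hgf, hf x q hq, mul_assoc]
    rfl

end Bundles

/-! ### Isomorphic bundles and bundles of the same pair -/

section Bundles

variable {EG : Type*} [NormedAddCommGroup EG] [NormedSpace ℝ EG] [CompleteSpace EG]
  [FiniteDimensional ℝ EG]
  {G : Type*} [TopologicalSpace G] [T2Space G] [ChartedSpace EG G] [Group G]
  [LieGroup 𝓘(ℝ, EG) ∞ G]
  {ν : LinearMap.BilinForm ℝ (GroupLieAlgebra 𝓘(ℝ, EG) G)}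
  {E : Type*} [NormedAddCommGroup E] [NormedSpace ℂ E] [FiniteDimensional ℂ E]
  {GC : Type v} [TopologicalSpace GC] [T2Space GC] [ChartedSpace E GC] [Group GC]
  [LieGroup 𝓘(ℂ, E) ω GC]
  {j : G →* GC} (hj : IsComplexification EG E j) {M : MaximalCompact ν}
  {V : Type*} [NormedAddCommGroup V] [NormedSpace ℂ V] [ChartedSpace V (GC ⧸ M.KC E j)]
  [IsManifold 𝓘(ℂ, V) ω (GC ⧸ M.KC E j)]
  (hq : IsHolomorphicQuotient E V (M.KC E j))
  (hG : LieAlgebra.IsSemisimple ℝ (GroupLieAlgebra 𝓘(ℝ, EG) G))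
  {S St : Type u} [TopologicalSpace S] [ChartedSpace ℂ S] [IsManifold 𝓘(ℝ, ℂ) ∞ S]
  [TopologicalSpace St] [ChartedSpace ℂ St] [IsManifold 𝓘(ℝ, ℂ) ∞ St]
  {π : St → S} (hπ : IsLocalDiffeomorph 𝓘(ℝ, ℂ) 𝓘(ℝ, ℂ) ∞ π)
  {c₁ c₂ : ComplexStructure S}

include hj hπ in
/-- Bundles isomorphic to the bundle of a pair correspond to the pair. -/
theorem corresponds_of_iso {p : HarmonicPair (E := E) (V := V) π c₁ c₂ j M}
    {b b' : HarmonicBundle (E := E) c₁ c₂ j ν} (hp : Corresponds p b) (hb : b.Iso b') :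
    Corresponds p b' := by
  have hcont := hπ.contMDiff.continuous
  obtain ⟨h, F, hh, hF, hρ, hf⟩ := (corresponds_iff hcont p b).mp hp
  obtain ⟨k, Θ, hk, hproj, hequiv, ht⟩ := hb
  choose idx hidx using b.B.cover
  let q₀ : St → b.B.P := fun x ↦ b.B.sec (idx (π x)) (π x)
  have hq₀ (x) : π x = b.B.proj (q₀ x) := (b.B.proj_sec _ _ (hidx _)).symm
  -- The development transported by `Θ`, normalised by `F'(x, Θ q) = F(x, q) j(k)⁻¹`. The factor
  -- `j(k)⁻¹` compensates for the conjugation in the equivariance of `Θ`.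
  let F' : St → b'.B.P → GC := fun x q' ↦ F x (q₀ x) * (j k)⁻¹ * (b'.B.div (Θ (q₀ x)) q' : GC)
  have hF' (x q q') (hq : π x = b.B.proj q) (hq' : π x = b'.B.proj q') :
      F' x q' = F x q * (j k)⁻¹ * (b'.B.div (Θ q) q' : GC) := by
    let κ' : b'.M.KC E j := ⟨_, hk.conj_mem_KC hj (b.B.div (q₀ x) q).2⟩
    have h1 : Θ q = MulOpposite.op κ' • Θ (q₀ x) := by
      rw [← hequiv _ _ κ' rfl, PrincipalSet.div_spec ((hq₀ x).symm.trans hq)]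
    have h2 : b'.B.div (Θ (q₀ x)) q' = κ' * b'.B.div (Θ q) q' := by
      rw [← PrincipalSet.div_mul_div (q := Θ q), PrincipalSet.div_eq h1.symm]
      · rw [hproj, hproj, ← hq₀, hq]
      · rw [hproj, ← hq, hq']
    simp only [F', h2, Subgroup.coe_mul, κ', hF.apply_div (hq₀ x) hq]
    group
  have hΘ (x q') (hq' : π x = b'.B.proj q') : b'.B.proj (Θ (q₀ x)) = b'.B.proj q' := by
    rw [hproj, ← hq₀, hq']
  have hloc (i' x) (hx : π x ∈ b'.B.U i') : ∃ t : S → GC,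
      ContMDiffAt 𝓘(ℝ, ℂ) 𝓘(ℝ, E) ∞ t (π x) ∧
      (∀ v : ℂ, adj ℂ E (j k) (b.conn (idx (π x)) (π x) v) =
        adj ℂ E (t (π x))⁻¹ (b'.conn i' (π x) v) + mc ℝ E ℂ t (π x) v) ∧
      (fun y ↦ F' y (b'.B.sec i' (π y))) =ᶠ[𝓝 x]
        fun y ↦ F y (b.B.sec (idx (π x)) (π y)) * (j k)⁻¹ * (t (π y))⁻¹ := by
    obtain ⟨t, ht1, ht2, ht3⟩ := ht (idx (π x)) i'
    have hmem : π x ∈ b.B.U (idx (π x)) ∩ b'.B.U i' := ⟨hidx _, hx⟩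
    refine ⟨t, ht2.contMDiffAt (((b.B.isOpen_U _).inter (b'.B.isOpen_U _)).mem_nhds hmem),
      fun v ↦ ?_, ?_⟩
    · obtain ⟨e1, e2, e3⟩ := ht3 _ hmem v
      rw [HarmonicBundle.conn_apply, HarmonicBundle.conn_apply, map_add, map_add, map_add, map_add]
      refine (congrArg₂ (· + ·) (congrArg₂ (· + ·) e1 e2) e3).trans ?_
      change (adj ℂ E (t (π x))⁻¹ _ + mc ℝ E ℂ t (π x) v + adj ℂ E (t (π x))⁻¹ _) +
        adj ℂ E (t (π x))⁻¹ _ = _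
      abel
    · filter_upwards [eventually_mem_U hcont hx, eventually_mem_U hcont (hidx (π x))] with y h1 h2
      rw [hF' y _ _ (b.B.proj_sec _ _ h2).symm (b'.B.proj_sec _ _ h1).symm, ht1,
        ← PrincipalSet.inv_div, Subgroup.coe_inv]
      rw [hproj, b.B.proj_sec _ _ h2, b'.B.proj_sec _ _ h1]
  refine (corresponds_iff hcont p b').mpr ⟨k * h, F', hh.trans hk, ⟨?_, ?_, ?_⟩, ?_, ?_⟩
  · intro x q' hx κ
    simp only [F', PrincipalSet.div_smul (hΘ x q' hx), Subgroup.coe_mul, mul_assoc]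
  · intro i' x hx
    obtain ⟨t, h1, h2, h3⟩ := hloc i' x hx
    refine ContMDiffAt.congr_of_eventuallyEq ?_ h3
    exact ((hF.smooth _ x (hidx _)).mul contMDiffAt_const).mul
      (ContMDiffAt.comp (g := t) x h1 (hπ.contMDiff x)).inv
  · intro i' x hx v
    obtain ⟨t, h1, h2, h3⟩ := hloc i' x hx
    have hs := hF.smooth _ x (hidx _)
    have htπ : ContMDiffAt 𝓘(ℝ, ℂ) 𝓘(ℝ, E) ∞ (fun y ↦ t (π y)) x :=
      ContMDiffAt.comp (g := t) x h1 (hπ.contMDiff x)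
    have hs' : ContMDiffAt 𝓘(ℝ, ℂ) 𝓘(ℝ, E) ∞
        (fun y ↦ F y (b.B.sec (idx (π x)) (π y)) * (j k)⁻¹) x := hs.mul contMDiffAt_const
    have ht' : ContMDiffAt 𝓘(ℝ, ℂ) 𝓘(ℝ, E) ∞ (fun y ↦ (t (π y))⁻¹) x := htπ.inv
    rw [mc_congr h3, mc_mul hs'.mdiff ht'.mdiff, mc_inv htπ.mdiff,
      mc_mul_const hs.mdiff, mc_comp (s := t) h1.mdiff (hπ.contMDiff x).mdiff]
    simp only [add_apply, neg_apply, ContinuousLinearMap.comp_apply, inv_inv]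
    rw [hF.mc_eq _ x (hidx _), adj_real_apply, adj_real_apply, adj_real_apply, h2, map_add,
      adj_adj_inv, add_neg_cancel_right]
  · intro γ x q' hx
    have hx' := (γ.2 x).trans hx
    rw [hF' _ (q₀ x) q' ((γ.2 x).trans (hq₀ x)) hx', hρ γ x _ (hq₀ x)]
    simp only [F', mul_assoc]
  · intro x q' hx
    rw [hf x _ (hq₀ x)]
    refine QuotientGroup.eq.mpr ?_
    have h1 := (hh.trans hk).symm.conj_mem_KC hj (b'.B.div (Θ (q₀ x)) q').2
    rw [map_inv, inv_inv] at h1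
    convert h1 using 1
    simp only [F', map_mul]
    group

theorem eq_and_eq_of_disjoint {W : Type*} [AddCommGroup W] [Module ℂ W] {p q : Submodule ℂ W}
    (h : Disjoint p q) {a a' b b' : W} (ha : a ∈ p) (ha' : a' ∈ p) (hb : b ∈ q) (hb' : b' ∈ q)
    (hab : a + b = a' + b') : a = a' ∧ b = b' := by
  have h1 : a - a' = b' - b := by rw [sub_eq_sub_iff_add_eq_add, hab, add_comm]
  have h2 : a - a' = 0 := Submodule.disjoint_def.mp h _ (p.sub_mem ha ha')
    (h1 ▸ q.sub_mem hb' hb)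
  exact ⟨sub_eq_zero.mp h2, (sub_eq_zero.mp (h1.symm.trans h2)).symm⟩

include hj hq hG hπ in
/-- Bundles that correspond to the same pair are isomorphic. -/
theorem iso_of_corresponds [PreconnectedSpace St] [SimplyConnectedSpace St]
    [LocallyPathConnectedSpace St]
    (hcov : IsCoveringMap π) (hsurj : Function.Surjective π) (hc : Transverse c₁ c₂)
    {p : HarmonicPair (E := E) (V := V) π c₁ c₂ j M}
    {b b' : HarmonicBundle (E := E) c₁ c₂ j ν} (hp : Corresponds p b) (hp' : Corresponds p b') :
    b.Iso b' := by
  have hcont := hπ.contMDiff.continuous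
  obtain ⟨h, F, hh, hF, hρ, hf⟩ := (corresponds_iff hcont p b).mp hp
  obtain ⟨h', F', hh', hF', hρ', hf'⟩ := (corresponds_iff hcont p b').mp hp'
  have hk : b.M.ConjTo b'.M (h' * h⁻¹) := hh.symm.trans hh'
  choose x₀ hx₀ using fun q : b.B.P ↦ hsurj (b.B.proj q)
  -- The equation determines the image of `q` under the isomorphism. It is solvable because `F(x, q)
  -- j(h)` and `F'(x, ·) j(h')` represent the same coset `f(x)`.
  have hex (q : b.B.P) : ∃ q' : b'.B.P, b'.B.proj q' = b.B.proj q ∧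
      F' (x₀ q) q' = F (x₀ q) q * (j (h' * h⁻¹))⁻¹ := by
    obtain ⟨i', hi'⟩ := b'.B.cover (b.B.proj q)
    have hq' := b'.B.proj_sec i' _ hi'
    have h1 : (F' (x₀ q) (b'.B.sec i' (b.B.proj q)) * j h')⁻¹ * (F (x₀ q) q * j h) ∈ M.KC E j :=
      QuotientGroup.eq.mp ((hf' _ _ ((hx₀ q).trans hq'.symm)).symm.trans (hf _ _ (hx₀ q)))
    let κ : b'.M.KC E j := ⟨_, hh'.conj_mem_KC hj h1⟩
    refine ⟨MulOpposite.op κ • b'.B.sec i' (b.B.proj q), (b'.B.proj_smul _ _).trans hq', ?_⟩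
    rw [hF'.equivariant _ _ ((hx₀ q).trans hq'.symm)]
    simp only [κ, map_mul, map_inv]
    group
  choose Θ hΘ hΘ₀ using hex
  -- Both developments have holonomy `ρ`, and deck transformations act transitively on fibres, so
  -- the relation holds at all points over `proj q`.
  have hΘF (x q) (hx : π x = b.B.proj q) : F' x (Θ q) = F x q * (j (h' * h⁻¹))⁻¹ := by
    obtain ⟨γ, rfl⟩ := exists_deck hcov ((hx₀ q).trans hx.symm)
    rw [hρ' γ _ _ ((hx₀ q).trans (hΘ q).symm), hρ γ _ _ (hx₀ q), hΘ₀, mul_assoc]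
  have hinj (x q q') (hx : π x = b'.B.proj q) (hx' : π x = b'.B.proj q') (e : F' x q = F' x q') :
      q = q' := by
    rw [hF'.apply_div hx hx', left_eq_mul, OneMemClass.coe_eq_one] at e
    rw [← PrincipalSet.div_spec (hx.symm.trans hx'), e, MulOpposite.op_one, one_smul]
  refine ⟨h' * h⁻¹, Θ, hk, hΘ, fun q κ κ' hκ ↦ ?_, fun i i' ↦
    ⟨fun y ↦ (b'.B.div (b'.B.sec i' y) (Θ (b.B.sec i y)) : GC), fun _ ↦ rfl, ?_⟩⟩
  · have hx' := (hx₀ q).trans (hΘ q).symm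
    refine hinj (x₀ q) _ _ ?_ (hx'.trans (b'.B.proj_smul _ _).symm) ?_
    · rw [hΘ, b.B.proj_smul, hx₀]
    · rw [hΘF _ _ ((hx₀ q).trans (b.B.proj_smul _ _).symm), hF'.equivariant _ _ hx', hΘF _ _ (hx₀ q),
        hF.equivariant _ _ (hx₀ q), hκ]
      group
  set t : S → GC := fun y ↦ (b'.B.div (b'.B.sec i' y) (Θ (b.B.sec i y)) : GC) with ht_def
  have ht (x) (hx : π x ∈ b.B.U i ∩ b'.B.U i') : F x (b.B.sec i (π x)) * (j (h' * h⁻¹))⁻¹ =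
      F' x (b'.B.sec i' (π x)) * t (π x) := by
    have e1 := b.B.proj_sec _ _ hx.1
    rw [← hΘF _ _ e1.symm]
    exact hF'.apply_div (b'.B.proj_sec _ _ hx.2).symm (by rw [hΘ, e1])
  have hev (x) (hx : π x ∈ b.B.U i ∩ b'.B.U i') : ∀ᶠ y in 𝓝 x, π y ∈ b.B.U i ∩ b'.B.U i' :=
    hcont.continuousAt (((b.B.isOpen_U _).inter (b'.B.isOpen_U _)).mem_nhds hx)
  have htπ (x) (hx : π x ∈ b.B.U i ∩ b'.B.U i') :
      ContMDiffAt 𝓘(ℝ, ℂ) 𝓘(ℝ, E) ∞ t (π x) := by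
    refine contMDiffAt_of_comp hπ (ContMDiffAt.congr_of_eventuallyEq
      (((hF'.smooth i' x hx.2).inv).mul ((hF.smooth i x hx.1).mul contMDiffAt_const))
        (f := fun x ↦ (F' x (b'.B.sec i' (π x)))⁻¹ * (F x (b.B.sec i (π x)) * (j (h' * h⁻¹))⁻¹)) ?_)
    filter_upwards [hev x hx] with y hy
    rw [ht y hy, inv_mul_cancel_left]
  constructor
  · intro y hy
    obtain ⟨x, rfl⟩ := hsurj y
    exact (htπ x hy).contMDiffWithinAt
  intro y hy
  obtain ⟨x, rfl⟩ := hsurj y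
  have hrel (w : ℂ) : adj ℂ E (j (h' * h⁻¹)) (b.conn i (π x) w) =
      adj ℂ E (t (π x))⁻¹ (b'.conn i' (π x) w) + mc ℝ E ℂ t (π x) w := by
    obtain ⟨v, rfl⟩ := tder_surjective hπ x w
    have e : (fun x ↦ F x (b.B.sec i (π x)) * (j (h' * h⁻¹))⁻¹) =ᶠ[𝓝 x]
        fun x ↦ F' x (b'.B.sec i' (π x)) * t (π x) := by
      filter_upwards [hev x hy] with y' hy' using ht y' hy'
    have h1 := congrArg (fun L ↦ L v) (mc_congr (𝕜 := ℝ) (E := E) (N := ℂ) e)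
    have htx : ContMDiffAt 𝓘(ℝ, ℂ) 𝓘(ℝ, E) ∞ (fun y ↦ t (π y)) x :=
      ContMDiffAt.comp (g := t) x (htπ x hy) (hπ.contMDiff x)
    rw [mc_mul_const (hF.smooth i x hy.1).mdiff,
      mc_mul (hF'.smooth i' x hy.2).mdiff htx.mdiff,
      mc_comp (s := t) (htπ x hy).mdiff (hπ.contMDiff x).mdiff] at h1
    simp only [add_apply, ContinuousLinearMap.comp_apply, inv_inv] at h1
    rwa [hF.mc_eq i x hy.1, hF'.mc_eq i' x hy.2, adj_real_apply, adj_real_apply] at h1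
  have htmem : (t (π x))⁻¹ ∈ b'.M.KC E j := inv_mem (Subtype.property _)
  -- A quotient manifold is given only for the fixed subgroup, so `t` is conjugated into it before
  -- `mc_mem_kC` is applied, and the result is conjugated back.
  have hmct (w : ℂ) : mc ℝ E ℂ t (π x) w ∈ b'.M.kC E j := by
    have h1 := mc_mem_kC (M := M) hj hq hG (N := ℂ) (s := fun y ↦ j h'⁻¹ * t y * (j h'⁻¹)⁻¹)
      (x := π x) ((contMDiffAt_const.mul (htπ x hy)).mul contMDiffAt_const).mdiff
      (Eventually.of_forall fun y ↦ hh'.symm.conj_mem_KC hj (Subtype.property _)) w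
    rw [mc_conj (htπ x hy).mdiff, ContinuousLinearMap.comp_apply, adj_real_apply] at h1
    have h2 := hh'.adj_mem_kC hj h1
    rwa [map_inv, adj_adj_inv] at h2
  have hs := b.isSplitAt i _ hy.1
  have hs' := b'.isSplitAt i' _ hy.2
  have hsplit (w : ℂ) : adj ℂ E (j (h' * h⁻¹)) (b.A.form i (π x) w) =
      adj ℂ E (t (π x))⁻¹ (b'.A.form i' (π x) w) + mc ℝ E ℂ t (π x) w ∧
      adj ℂ E (j (h' * h⁻¹)) (b.φ₁.form i (π x) w + b.φ₂.form i (π x) w) =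
      adj ℂ E (t (π x))⁻¹ (b'.φ₁.form i' (π x) w + b'.φ₂.form i' (π x) w) := by
    refine eq_and_eq_of_disjoint (b'.M.isCompl_kC_pC hj).disjoint (hk.adj_mem_kC hj (hs.mem_A w))
      (Submodule.add_mem _ (b'.M.adj_mem_kC hj htmem (hs'.mem_A w)) (hmct w))
      (hk.adj_mem_pC hj (Submodule.add_mem _ (hs.mem₁ w) (hs.mem₂ w)))
      (b'.M.adj_mem_pC hj htmem (Submodule.add_mem _ (hs'.mem₁ w) (hs'.mem₂ w))) ?_
    have := hrel w
    rw [HarmonicBundle.conn_apply, HarmonicBundle.conn_apply] at this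
    rw [← map_add, ← add_assoc, this, add_assoc, map_add, map_add]
    abel
  let L := adj ℂ E (j (h' * h⁻¹))
  let L' := adj ℂ E (t (π x))⁻¹
  -- The sums of the Higgs fields have been matched as `𝔭^ℂ`-parts; uniqueness of the splitting into
  -- types separates the two summands.
  let β : OneForm S E := fun y ↦ mapForm L (b.φ₁.form i) y + mapForm L (b.φ₂.form i) y
  have hβ : β (π x) = mapForm L' (b'.φ₁.form i') (π x) + mapForm L' (b'.φ₂.form i') (π x) := by
    have key (w : ℂ) : L (b.φ₁.form i (π x) w) + L (b.φ₂.form i (π x) w) =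
        L' (b'.φ₁.form i' (π x) w) + L' (b'.φ₂.form i' (π x) w) := by
      rw [← map_add, ← map_add]
      exact (hsplit w).2
    exact ContinuousLinearMap.ext key
  have e1 : mapForm L (b.φ₁.form i) (π x) = mapForm L' (b'.φ₁.form i') (π x) :=
    (typeProj_of_eq_add hc (β := β) (isTypeOneZero_mapForm L hs.type₁)
      (isTypeOneZero_mapForm L hs.type₂) rfl).symm.trans
    (typeProj_of_eq_add hc (isTypeOneZero_mapForm L' hs'.type₁)
      (isTypeOneZero_mapForm L' hs'.type₂) hβ)
  have e2 : mapForm L (b.φ₂.form i) (π x) = mapForm L' (b'.φ₂.form i') (π x) :=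
    (typeProj_of_eq_add hc.symm (β := β) (isTypeOneZero_mapForm L hs.type₂)
      (isTypeOneZero_mapForm L hs.type₁) (add_comm _ _)).symm.trans
    (typeProj_of_eq_add hc.symm (isTypeOneZero_mapForm L' hs'.type₂)
      (isTypeOneZero_mapForm L' hs'.type₁) (hβ.trans (add_comm _ _)))
  exact fun v ↦ ⟨(hsplit v).1, DFunLike.congr_fun e1 v, DFunLike.congr_fun e2 v⟩

end Bundles

/-! ### Connection forms of a development -/

section Gauge

variable {E : Type*} [NormedAddCommGroup E] [NormedSpace ℂ E] [FiniteDimensional ℂ E]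
  {GC : Type v} [TopologicalSpace GC] [T2Space GC] [ChartedSpace E GC] [Group GC]
  [LieGroup 𝓘(ℂ, E) ω GC] {H : Subgroup GC}
  {S St : Type u} [TopologicalSpace S] [ChartedSpace ℂ S] [IsManifold 𝓘(ℝ, ℂ) ∞ S]
  [TopologicalSpace St] [ChartedSpace ℂ St] [IsManifold 𝓘(ℝ, ℂ) ∞ St]
  {π : St → S} {B : PrincipalBundle E S H} {α : B.ι → OneForm S E} {F : St → B.P → GC}

/-- The forms of a development are the local forms of a connection. -/
theorem IsDevelopment.gauge (hπ : IsLocalDiffeomorph 𝓘(ℝ, ℂ) 𝓘(ℝ, ℂ) ∞ π)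
    (hsurj : Function.Surjective π) (hF : IsDevelopment π B α F) (i i' : B.ι) (q : S)
    (hq : q ∈ B.U i ∩ B.U i') (v : ℂ) :
    α i' q v = adj ℂ E (B.trans i i' q)⁻¹ (α i q v) + mc ℝ E ℂ (B.trans i i') q v := by
  have hcont := hπ.contMDiff.continuous
  obtain ⟨x, rfl⟩ := hsurj q
  obtain ⟨v, rfl⟩ := tder_surjective hπ x v
  have e : (fun y ↦ F y (B.sec i' (π y))) =ᶠ[𝓝 x]
      fun y ↦ F y (B.sec i (π y)) * B.trans i i' (π y) := by
    filter_upwards [eventually_mem_U hcont hq.1, eventually_mem_U hcont hq.2] with y h1 h2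
    exact hF.apply_div (B.proj_sec _ _ h1).symm (B.proj_sec _ _ h2).symm
  have h1 := (B.smooth_trans i i').contMDiffAt
    (((B.isOpen_U i).inter (B.isOpen_U i')).mem_nhds hq)
  have h2 := congrArg (fun L ↦ L v) (mc_congr (𝕜 := ℝ) (E := E) (N := ℂ) e)
  rw [mc_mul (hF.smooth i x hq.1).mdiff (contMDiffAt_trans_comp hπ hq).mdiff,
    mc_comp (s := B.trans i i') h1.mdiff (hπ.contMDiff x).mdiff] at h2
  simp only [add_apply, ContinuousLinearMap.comp_apply] at h2
  rwa [hF.mc_eq i x hq.1, hF.mc_eq i' x hq.2, adj_real_apply] at h2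

end Gauge

/-! ### The complex harmonic bundle of a developed reduction -/

section Bundles

variable {EG : Type*} [NormedAddCommGroup EG] [NormedSpace ℝ EG] [CompleteSpace EG]
  [FiniteDimensional ℝ EG]
  {G : Type*} [TopologicalSpace G] [T2Space G] [ChartedSpace EG G] [Group G]
  [LieGroup 𝓘(ℝ, EG) ∞ G]
  {ν : LinearMap.BilinForm ℝ (GroupLieAlgebra 𝓘(ℝ, EG) G)}
  {E : Type*} [NormedAddCommGroup E] [NormedSpace ℂ E] [FiniteDimensional ℂ E]
  {GC : Type v} [TopologicalSpace GC] [T2Space GC] [ChartedSpace E GC] [Group GC]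
  [LieGroup 𝓘(ℂ, E) ω GC]
  {j : G →* GC} (hj : IsComplexification EG E j) {M : MaximalCompact ν}
  {V : Type*} [NormedAddCommGroup V] [NormedSpace ℂ V] [ChartedSpace V (GC ⧸ M.KC E j)]
  [IsManifold 𝓘(ℂ, V) ω (GC ⧸ M.KC E j)]
  (hq : IsHolomorphicQuotient E V (M.KC E j))
  (hG : LieAlgebra.IsSemisimple ℝ (GroupLieAlgebra 𝓘(ℝ, EG) G))
  {S St : Type u} [TopologicalSpace S] [ChartedSpace ℂ S] [IsManifold 𝓘(ℝ, ℂ) ∞ S]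
  [TopologicalSpace St] [ChartedSpace ℂ St] [IsManifold 𝓘(ℝ, ℂ) ∞ St]
  {π : St → S} (hπ : IsLocalDiffeomorph 𝓘(ℝ, ℂ) 𝓘(ℝ, ℂ) ∞ π)
  {c₁ c₂ : ComplexStructure S}

include hj hq hG hπ in
/-- A reduction of a flat bundle that is defined by a complex harmonic map underlies a complex
harmonic bundle. -/
theorem exists_corresponds_of_development (hsurj : Function.Surjective π) (hc : Transverse c₁ c₂)
    (hν_symm : ν.IsSymm)
    (hν : ∀ (g : G) a b, ν (Ad (𝕜 := ℝ) EG g a) (Ad (𝕜 := ℝ) EG g b) = ν a b)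
    (p : HarmonicPair (E := E) (V := V) π c₁ c₂ j M) {B : PrincipalBundle E S (M.KC E j)}
    {α : B.ι → OneForm S E} {F : St → B.P → GC}
    (hα : ∀ i, ∀ q ∈ B.U i, SmoothFormAt (α i) q) (hF : IsDevelopment π B α F)
    (hρ : ∀ (γ : Deck π) x q, π x = B.proj q → F ((γ : St ≃ₜ St) x) q = p.ρ γ * F x q)
    (hf : ∀ x q, π x = B.proj q → p.f x = QuotientGroup.mk (F x q)) :
    ∃ b : HarmonicBundle (E := E) c₁ c₂ j ν, Corresponds p b := by
  have : CompleteSpace E := FiniteDimensional.complete ℂ E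
  have hcont := hπ.contMDiff.continuous
  have hgauge := hF.gauge hπ hsurj
  have htrans (i i' q) : (B.trans i i' q)⁻¹ ∈ M.KC E j := inv_mem (Subtype.property _)
  have hmct (i i' q) (hq' : q ∈ B.U i ∩ B.U i') (v : ℂ) :
      mc ℝ E ℂ (B.trans i i') q v ∈ M.kC E j :=
    mc_mem_kC hj hq hG ((B.smooth_trans i i').contMDiffAt
      (((B.isOpen_U i).inter (B.isOpen_U i')).mem_nhds hq')).mdiff
      (Eventually.of_forall fun y ↦ Subtype.property _) v
  -- `K^ℂ` preserves both summands, and the form of a transition function lies in `𝔨^ℂ`. So the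
  -- inhomogeneous term of the gauge rule goes into the connection `A`, and `φ` transforms by the
  -- adjoint action alone.
  let A (i : B.ι) : OneForm S E := mapForm (M.prK hj) (α i)
  let φ (i : B.ι) : OneForm S E := mapForm (M.prP hj) (α i)
  have hA (i i' q) (hq' : q ∈ B.U i ∩ B.U i') (v : ℂ) : A i' q v =
      adj ℂ E (B.trans i i' q)⁻¹ (A i q v) + mc ℝ E ℂ (B.trans i i') q v := by
    rw [mapForm_apply, mapForm_apply, hgauge i i' q hq', map_add, M.prK_adj hj (htrans i i' q),
      M.prK_of_mem_kC hj (hmct i i' q hq' v)]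
  have hφ (i i' q) (hq' : q ∈ B.U i ∩ B.U i') (v : ℂ) : φ i' q v =
      adj ℂ E (B.trans i i' q)⁻¹ (φ i q v) := by
    rw [mapForm_apply, mapForm_apply, hgauge i i' q hq', map_add, M.prP_adj hj (htrans i i' q),
      M.prP_of_mem_kC hj (hmct i i' q hq' v), add_zero]
  have hφs (i q) (hq' : q ∈ B.U i) : SmoothFormAt (φ i) q := (hα i q hq').mapForm _
  have hφmem (i q) (v : ℂ) : φ i q v ∈ M.pC E j := M.prP_mem hj _
  let φ₁ (i : B.ι) : OneForm S E := typeProj c₁ c₂ (φ i)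
  let φ₂ (i : B.ι) : OneForm S E := typeProj c₂ c₁ (φ i)
  have hsum (i) : (fun y ↦ A i y + φ₁ i y + φ₂ i y) = α i := by
    funext q
    refine (add_assoc _ _ _).trans ((congrArg _ (typeProj_spec hc q).2).trans ?_)
    have key (v : ℂ) : M.prK hj (α i q v) + M.prP hj (α i q v) = α i q v := M.prK_add_prP hj _
    exact ContinuousLinearMap.ext key
  have hsplit (i q) (hq' : q ∈ B.U i) : IsSplitAt j M c₁ c₂ (A i) (φ₁ i) (φ₂ i) q :=
    ⟨(hα i q hq').mapForm _, contDiffAt_typeProj hc (hφs i q hq'),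
      contDiffAt_typeProj hc.symm (hφs i q hq'), fun v ↦ M.prK_mem hj _,
      fun v ↦ typeProj_mem hc (hφmem i q) v, fun v ↦ typeProj_mem hc.symm (hφmem i q) v,
      (typeProj_spec hc q).1, (typeProj_spec hc.symm q).1⟩
  have hs (i x) (hx : π x ∈ B.U i) : ∀ᶠ y in 𝓝 x,
      ContMDiffAt 𝓘(ℝ, ℂ) 𝓘(ℝ, E) ∞ (fun y ↦ F y (B.sec i (π y))) y :=
    (eventually_mem_U hcont hx).mono (hF.smooth i)
  have hmc (i x) (hx : π x ∈ B.U i) : ∀ᶠ y in 𝓝 x, ∀ v : ℂ,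
      mc ℝ E ℂ (fun y ↦ F y (B.sec i (π y))) y v = A i (π y) (tder ℝ ℂ ℂ π y v) +
        φ₁ i (π y) (tder ℝ ℂ ℂ π y v) + φ₂ i (π y) (tder ℝ ℂ ℂ π y v) := by
    filter_upwards [eventually_mem_U hcont hx] with y hy v
    rw [hF.mc_eq i y hy, ← hsum i]
    rfl
  have hsp (i x) (hx : π x ∈ B.U i) :
      ∀ᶠ q in 𝓝 (π x), IsSplitAt j M c₁ c₂ (A i) (φ₁ i) (φ₂ i) q :=
    Filter.mem_of_superset ((B.isOpen_U i).mem_nhds hx) fun q hq' ↦ hsplit i q hq'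
  have hdel (i x) (hx : π x ∈ B.U i) (a a' : ℂ) : covExtDeriv GC (A i) (φ₂ i) (π x) a a' = 0 := by
    refine (tension_eq_zero_iff hj hq hG hπ (hs i x hx) (hmc i x hx) (hsp i x hx) hc hν_symm hν
      p.smooth ?_).mp (fun U hU g hg hxU ↦ p.harmonic U hU g hg x hxU) a a'
    filter_upwards [eventually_mem_U hcont hx] with y hy
    exact (hf y _ (B.proj_sec _ _ hy).symm).symm
  have e₁ (i) : typeProj c₁ c₂ (φ₁ i) = φ₁ i :=
    funext fun q ↦ typeProj_of_isType hc (typeProj_spec hc q).1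
  have e₂ (i) : typeProj c₂ c₁ (φ₂ i) = φ₂ i :=
    funext fun q ↦ typeProj_of_isType hc.symm (typeProj_spec hc.symm q).1
  let b : HarmonicBundle (E := E) c₁ c₂ j ν :=
    { M := M
      B := B
      A := ⟨A, fun i q hq' ↦ (hsplit i q hq').mem_A, fun i q hq' ↦ (hsplit i q hq').smooth_A, hA⟩
      φ₁ := ⟨φ₁, fun i q hq' ↦ (hsplit i q hq').mem₁, fun i q hq' ↦ (hsplit i q hq').smooth₁,
        fun i i' q hq' v ↦ typeProj_comp hc _ (hφ i i' q hq') v⟩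
      φ₂ := ⟨φ₂, fun i q hq' ↦ (hsplit i q hq').mem₂, fun i q hq' ↦ (hsplit i q hq').smooth₂,
        fun i i' q hq' v ↦ typeProj_comp hc.symm _ (hφ i i' q hq') v⟩
      type₁ := fun i q hq' ↦ (hsplit i q hq').type₁
      type₂ := fun i q hq' ↦ (hsplit i q hq').type₂
      del_φ₂ := fun i q hq' a a' ↦ by
        obtain ⟨x, rfl⟩ := hsurj q
        change covExtDeriv GC (A i) (typeProj c₂ c₁ (φ₂ i)) (π x) a a' = 0
        rw [e₂]
        exact hdel i x hq' a a'
      delBar_φ₁ := fun i q hq' a a' ↦ by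
        obtain ⟨x, rfl⟩ := hsurj q
        change covExtDeriv GC (A i) (typeProj c₁ c₂ (φ₁ i)) (π x) a a' = 0
        rw [e₁]
        exact (covExtDeriv_iff_covExtDeriv hj hπ (hs i x hq') (hmc i x hq') (hsp i x hq')).mpr
          (hdel i x hq') a a'
      flat := fun i q hq' a a' ↦ by
        obtain ⟨x, rfl⟩ := hsurj q
        exact curvature_eq_zero hπ (hs i x hq') (hmc i x hq') (hsp i x hq') a a' }
  refine ⟨b, (corresponds_iff hcont p b).mpr ⟨1, F, MaximalCompact.ConjTo.refl M, ?_, hρ, ?_⟩⟩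
  · have : b.conn = α := funext hsum
    rw [this]
    exact hF
  · intro x q hx
    rw [map_one, mul_one]
    exact hf x q hx

end Bundles

/-! ### The reduction as a principal set -/

section FlatReduction

variable {GC : Type v} [Group GC] {H : Subgroup GC} {S : Type u}

instance (f : S → GC ⧸ H) : MulAction Hᵐᵒᵖ {a : S × GC // QuotientGroup.mk a.2 = f a.1} where
  smul k a := ⟨(a.1.1, a.1.2 * (k.unop : GC)), by
    rw [← a.2]; exact QuotientGroup.eq.mpr (by simp)⟩
  one_smul a := Subtype.ext (Prod.ext rfl (mul_one _))
  mul_smul k k' a := Subtype.ext (Prod.ext rfl (mul_assoc _ _ _).symm)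

/-- The reduction to `H` of the trivial `GC`-bundle that is defined by a map to `GC ⧸ H`. -/
def reduction (f : S → GC ⧸ H) : PrincipalSet S H where
  P := {a : S × GC // QuotientGroup.mk a.2 = f a.1}
  proj a := a.1.1
  transitive a a' := by
    constructor
    · intro h
      have h1 : a.1.2⁻¹ * a'.1.2 ∈ H := QuotientGroup.eq.mp (by rw [a.2, a'.2, h])
      exact ⟨⟨_, h1⟩, Subtype.ext (Prod.ext h (mul_inv_cancel_left _ _))⟩
    · rintro ⟨k, rfl⟩
      rfl
  free a k h := Subtype.ext (mul_eq_left.mp (congrArg (fun a ↦ a.1.2) h))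

end FlatReduction

/-! ### Smoothness of the Maurer-Cartan form on a surface -/

section Smooth

variable {E : Type*} [NormedAddCommGroup E] [NormedSpace ℂ E] [FiniteDimensional ℂ E]
  {GC : Type v} [TopologicalSpace GC] [T2Space GC] [ChartedSpace E GC] [Group GC]
  [LieGroup 𝓘(ℂ, E) ω GC]
  {S : Type u} [TopologicalSpace S] [ChartedSpace ℂ S] [IsManifold 𝓘(ℝ, ℂ) ∞ S]

theorem smoothFormAt_mc {s : S → GC} {q : S}
    (hs : ∀ᶠ y in 𝓝 q, ContMDiffAt 𝓘(ℝ, ℂ) 𝓘(ℝ, E) ∞ s y) :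
    SmoothFormAt (fun y ↦ mc ℝ E ℂ s y) q := by
  have : CompleteSpace E := FiniteDimensional.complete ℂ E
  have h := contDiffAt_mc (contMDiffAt_comp_chart_symm hs)
  refine h.congr_of_eventuallyEq ?_
  filter_upwards [eventually_mem_target_chart q, (tendsto_chart_symm q).eventually hs] with y h1 h2
  exact (mc_comp h2.mdiff (contMDiffAt_chart_symm h1).mdiff).symm

end Smooth

/-! ### From pairs to bundles -/

section Bundles

variable {EG : Type*} [NormedAddCommGroup EG] [NormedSpace ℝ EG] [CompleteSpace EG]
  [FiniteDimensional ℝ EG]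
  {G : Type*} [TopologicalSpace G] [T2Space G] [ChartedSpace EG G] [Group G]
  [LieGroup 𝓘(ℝ, EG) ∞ G]
  {ν : LinearMap.BilinForm ℝ (GroupLieAlgebra 𝓘(ℝ, EG) G)}
  {E : Type*} [NormedAddCommGroup E] [NormedSpace ℂ E] [FiniteDimensional ℂ E]
  {GC : Type v} [TopologicalSpace GC] [T2Space GC] [ChartedSpace E GC] [Group GC]
  [LieGroup 𝓘(ℂ, E) ω GC]
  {j : G →* GC} (hj : IsComplexification EG E j) {M : MaximalCompact ν}
  {V : Type*} [NormedAddCommGroup V] [NormedSpace ℂ V] [ChartedSpace V (GC ⧸ M.KC E j)]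
  [IsManifold 𝓘(ℂ, V) ω (GC ⧸ M.KC E j)]
  (hq : IsHolomorphicQuotient E V (M.KC E j))
  (hG : LieAlgebra.IsSemisimple ℝ (GroupLieAlgebra 𝓘(ℝ, EG) G))
  {S St : Type u} [TopologicalSpace S] [ChartedSpace ℂ S] [IsManifold 𝓘(ℝ, ℂ) ∞ S]
  [TopologicalSpace St] [ChartedSpace ℂ St] [IsManifold 𝓘(ℝ, ℂ) ∞ St]
  {π : St → S} (hπ : IsLocalDiffeomorph 𝓘(ℝ, ℂ) 𝓘(ℝ, ℂ) ∞ π)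
  {c₁ c₂ : ComplexStructure S}

include hq hπ in
/-- Local frames of the reduction defined by an equivariant map. -/
theorem HarmonicPair.exists_local_frame (p : HarmonicPair (E := E) (V := V) π c₁ c₂ j M) (x : St) :
    ∃ (U : Set S) (σ : S → St) (s : S → GC), IsOpen U ∧ π x ∈ U ∧ ∀ y ∈ U, π (σ y) = y ∧
      ContMDiffAt 𝓘(ℝ, ℂ) 𝓘(ℝ, ℂ) ∞ σ y ∧ ContMDiffAt 𝓘(ℝ, ℂ) 𝓘(ℝ, E) ∞ s y ∧
      QuotientGroup.mk (s y) = p.f (σ y) := by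
  obtain ⟨σ, h1, h2, -⟩ := exists_section_local hπ x
  obtain ⟨g, hg⟩ := QuotientGroup.mk_surjective (p.f x)
  obtain ⟨s, -, hs⟩ := exists_local_lift hq p.smooth x hg
  have h3 : Tendsto σ (𝓝 (π x)) (𝓝 x) := by
    have := h2.self_of_nhds.2.continuousAt.tendsto
    rwa [h1] at this
  obtain ⟨U, hU, hUo, hxU⟩ := eventually_nhds_iff.mp (h2.and (h3.eventually hs))
  exact ⟨U, σ, fun y ↦ s (σ y), hUo, hxU, fun y hy ↦ ⟨(hU y hy).1.1, (hU y hy).1.2,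
    ContMDiffAt.comp (g := s) y (hU y hy).2.2 (hU y hy).1.2, (hU y hy).2.1⟩⟩

include hj hq hG hπ in
/-- Every pair has a complex harmonic bundle. -/
theorem exists_bundle_corresponds [SimplyConnectedSpace St] [LocallyPathConnectedSpace St]
    (hcov : IsCoveringMap π) (hsurj : Function.Surjective π) (hc : Transverse c₁ c₂)
    (hν_symm : ν.IsSymm)
    (hν : ∀ (g : G) a b, ν (Ad (𝕜 := ℝ) EG g a) (Ad (𝕜 := ℝ) EG g b) = ν a b)
    (p : HarmonicPair (E := E) (V := V) π c₁ c₂ j M) :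
    ∃ b : HarmonicBundle (E := E) c₁ c₂ j ν, Corresponds p b := by
  have hcont := hπ.contMDiff.continuous
  -- `τ` is a set-theoretic section of `π`, and `δ x` is the deck transformation taking `τ (π x)` to
  -- `x`. They trivialise the flat bundle as a set: `(y, g)` stands for the class of `(τ y, g)`, and
  -- `ρ(δ x) g` is its coordinate over `x`. The smooth structure comes from local frames only.
  choose τ hτ using hsurj
  choose δ hδ using fun x ↦ exists_deck hcov (hτ (π x))
  choose U σ s hUo hmem hU using p.exists_local_frame hq hπ
  let f₀ : S → GC ⧸ M.KC E j := fun y ↦ p.f (τ y)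
  let B₀ : PrincipalSet S (M.KC E j) := reduction f₀
  let F : St → B₀.P → GC := fun x a ↦ p.ρ (δ x) * a.1.2
  have hδγ (γ : Deck π) (x : St) : δ ((γ : St ≃ₜ St) x) = γ * δ x := by
    refine deck_eq hcov (x := τ (π x)) ?_
    have h1 := hδ ((γ : St ≃ₜ St) x)
    rw [γ.2] at h1
    rw [h1]
    exact congrArg (γ : St ≃ₜ St) (hδ x).symm
  have hρ (γ : Deck π) (x : St) (a : B₀.P) : F ((γ : St ≃ₜ St) x) a = p.ρ γ * F x a := by
    simp only [F, hδγ, map_mul, mul_assoc]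
  have hf (x : St) (a : B₀.P) (h : π x = B₀.proj a) : p.f x = QuotientGroup.mk (F x a) := by
    have h1 : (QuotientGroup.mk a.1.2 : GC ⧸ M.KC E j) = p.f (τ (π x)) := by rw [h]; exact a.2
    have h2 := p.equivariant (δ x) (τ (π x))
    rw [hδ, ← h1] at h2
    exact h2
  have hequiv (x : St) (a : B₀.P) (k : M.KC E j) : F x (MulOpposite.op k • a) = F x a * k :=
    (mul_assoc _ _ _).symm
  have hsec (x : St) (y : S) : ∃ a : B₀.P, B₀.proj a = y ∧ (y ∈ U x → F (σ x y) a = s x y) := by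
    by_cases hy : y ∈ U x
    · have h1 : QuotientGroup.mk ((p.ρ (δ (σ x y)))⁻¹ * s x y) = f₀ y := by
        have h2 := p.equivariant (δ (σ x y)) (τ (π (σ x y)))
        rw [hδ, (hU x y hy).1, ← (hU x y hy).2.2.2] at h2
        refine Eq.trans ?_ (eq_inv_smul_iff.mpr h2.symm).symm
        rfl
      exact ⟨⟨(y, _), h1⟩, rfl, fun _ ↦ mul_inv_cancel_left _ _⟩
    · obtain ⟨g, hg⟩ := QuotientGroup.mk_surjective (f₀ y)
      exact ⟨⟨(y, g), hg⟩, rfl, fun h ↦ absurd h hy⟩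
  choose sec hsec₁ hsec₂ using hsec
  -- On the sheet `σ z` the coordinate of the frame is `s z`. The point `x` lies on the image of
  -- that sheet under some deck transformation `γ`, where the coordinate gets the constant factor
  -- `ρ(γ)`.
  have hloc (z x : St) (hx : π x ∈ U z) :
      ∃ g : GC, (fun y ↦ F y (sec z (π y))) =ᶠ[𝓝 x] fun y ↦ g * s z (π y) := by
    obtain ⟨γ, hγ⟩ := exists_deck hcov (hU z _ hx).1
    obtain ⟨ς, -, -, hς⟩ := exists_section_local hπ x
    have hUx : ∀ᶠ y in 𝓝 x, π y ∈ U z := hcont.continuousAt ((hUo z).mem_nhds hx)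
    have ht : Tendsto (fun y ↦ (γ : St ≃ₜ St) (σ z (π y))) (𝓝 x) (𝓝 x) := by
      have h1 : ContinuousAt (fun y ↦ (γ : St ≃ₜ St) (σ z (π y))) x :=
        (γ : St ≃ₜ St).continuous.continuousAt.comp
          (ContinuousAt.comp (g := σ z) (hU z _ hx).2.1.continuousAt hcont.continuousAt)
      have := h1.tendsto
      rwa [hγ] at this
    refine ⟨p.ρ γ, ?_⟩
    filter_upwards [hUx, hς, ht.eventually hς] with y h1 h2 h3
    rw [γ.2, (hU z _ h1).1, h2] at h3
    rw [← hsec₂ z _ h1, ← hρ, ← h3]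
  have hsmooth (z x : St) (hx : π x ∈ U z) :
      ContMDiffAt 𝓘(ℝ, ℂ) 𝓘(ℝ, E) ∞ (fun y ↦ F y (sec z (π y))) x := by
    obtain ⟨g, hg⟩ := hloc z x hx
    exact (contMDiffAt_const.mul
      (ContMDiffAt.comp (g := s z) x (hU z _ hx).2.2.1 (hπ.contMDiff x))).congr_of_eventuallyEq hg
  let B : PrincipalBundle E S (M.KC E j) :=
    { B₀ with
      ι := ULift St
      U := fun z ↦ U z.down
      isOpen_U := fun z ↦ hUo z.down
      cover := fun y ↦ ⟨⟨τ y⟩, by have := hmem (τ y); rwa [hτ] at this⟩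
      sec := fun z ↦ sec z.down
      proj_sec := fun z y _ ↦ hsec₁ z.down y
      smooth_trans := fun z z' y hy ↦ by
        obtain ⟨x, rfl⟩ : ∃ x, π x = y := ⟨τ y, hτ y⟩
        refine (contMDiffAt_of_comp hπ (ContMDiffAt.congr_of_eventuallyEq
          ((hsmooth z.down x hy.1).inv.mul (hsmooth z'.down x hy.2))
          (Eventually.of_forall fun y ↦ ?_))).contMDiffWithinAt
        have h1 := PrincipalSet.div_spec ((hsec₁ z.down (π y)).trans (hsec₁ z'.down (π y)).symm)
        have h2 := hequiv y (sec z.down (π y)) (B₀.div (sec z.down (π y)) (sec z'.down (π y)))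
        rw [h1] at h2
        exact (inv_mul_eq_iff_eq_mul.mpr h2).symm }
  have hUs (z : St) (q : S) (hq' : q ∈ U z) : ∀ᶠ y in 𝓝 q, ContMDiffAt 𝓘(ℝ, ℂ) 𝓘(ℝ, E) ∞ (s z) y :=
    Filter.mem_of_superset ((hUo z).mem_nhds hq') fun y hy ↦ (hU z y hy).2.2.1
  refine exists_corresponds_of_development hj hq hG hπ (fun y ↦ ⟨τ y, hτ y⟩) hc hν_symm hν p (B := B)
    (α := fun z y ↦ mc ℝ E ℂ (s z.down) y) (F := F) (fun z q hq' ↦ smoothFormAt_mc (hUs z.down q hq'))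
    ⟨fun x a _ k ↦ hequiv x a k, fun z x hx ↦ hsmooth z.down x hx, fun z x hx v ↦ ?_⟩
    (fun γ x a _ ↦ hρ γ x a) hf
  obtain ⟨g, hg⟩ := hloc z.down x hx
  refine (congrArg (fun L ↦ L v) (mc_congr (𝕜 := ℝ) (E := E) (N := ℂ) hg)).trans ?_
  rw [mc_const_mul g (fun y ↦ s z.down (π y)), mc_comp (s := s z.down) (hU z.down _ hx).2.2.1.mdiff
    (hπ.contMDiff x).mdiff]
  rfl

end Bundles

/-! ### From a correspondence to the bijection of classes -/

/-- A relation between two types that respects equivalences induces a bijection of the quotients. -/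
theorem exists_quot_equiv {X Y : Type*} {r : X → X → Prop} {r' : Y → Y → Prop} {C : X → Y → Prop}
    (h₁ : ∀ x, ∃ y, C x y) (h₂ : ∀ y, ∃ x, C x y) (h₃ : ∀ x y y', C x y → C x y' → r' y y')
    (h₄ : ∀ x x' y, C x y → C x' y → r x x') (h₅ : ∀ x x' y, C x y → r x x' → C x' y)
    (h₆ : ∀ x y y', C x y → r' y y' → C x y') :
    ∃ Φ : Quot r ≃ Quot r', ∀ x y, Φ (Quot.mk _ x) = Quot.mk _ y ↔ C x y := by
  choose φ hφ using h₁
  choose ψ hψ using h₂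
  -- Equality in `Quot r'` only means equivalence in the relation generated by `r'`. But `C x` takes
  -- the same value on related elements, also against the direction of `r'`, so it descends to the
  -- quotient and can be transported along the equality.
  have hC (x y) (h : (Quot.mk r' (φ x) : Quot r') = Quot.mk r' y) : C x y := by
    let P : Quot r' → Prop := Quot.lift (C x) fun y y' hy ↦ propext ⟨fun h ↦ h₆ _ _ _ h hy,
      fun h ↦ h₅ _ _ _ (hψ y) (h₄ _ _ _ (h₆ _ _ _ (hψ y) hy) h)⟩
    exact (congrArg P h).mp (hφ x)
  let Φ : Quot r → Quot r' := Quot.lift (fun x ↦ Quot.mk r' (φ x)) fun x x' hx ↦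
    Quot.sound (h₃ _ _ _ (h₅ _ _ _ (hφ x) hx) (hφ x'))
  let Ψ : Quot r' → Quot r := Quot.lift (fun y ↦ Quot.mk r (ψ y)) fun y y' hy ↦
    Quot.sound (h₄ _ _ _ (h₆ _ _ _ (hψ y) hy) (hψ y'))
  refine ⟨⟨Φ, Ψ, ?_, ?_⟩, fun x y ↦ ⟨hC x y, fun h ↦ Quot.sound (h₃ _ _ _ (hφ x) h)⟩⟩
  · rintro ⟨x⟩
    exact Quot.sound (h₄ _ _ _ (hψ _) (hφ x))
  · rintro ⟨y⟩
    exact Quot.sound (h₃ _ _ _ (hφ _) (hψ y))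

end ComplexHarmonic

end

open ComplexHarmonic in
theorem mainTheorem11
    -- the surface `S`, its universal covering, and the two complex structures
    {S St : Type u} [TopologicalSpace S] [T2Space S] [SecondCountableTopology S]
    [ConnectedSpace S] [ChartedSpace ℂ S] [IsManifold 𝓘(ℝ, ℂ) ∞ S]
    [TopologicalSpace St] [SimplyConnectedSpace St] [ChartedSpace ℂ St]
    [IsManifold 𝓘(ℝ, ℂ) ∞ St]
    (π : St → S) (hπ : IsCoveringMap π) (hπ_diffeo : IsLocalDiffeomorph 𝓘(ℝ, ℂ) 𝓘(ℝ, ℂ) ∞ π)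
    (c₁ c₂ : ComplexStructure S) (hc : OppositelyOriented c₁ c₂)
    -- the semisimple Lie group `G` and its complexification `GC`
    {EG : Type*} [NormedAddCommGroup EG] [NormedSpace ℝ EG] [FiniteDimensional ℝ EG]
    [CompleteSpace EG]
    {G : Type*} [TopologicalSpace G] [T2Space G] [ChartedSpace EG G] [Group G]
    [LieGroup 𝓘(ℝ, EG) ∞ G] (hG : LieAlgebra.IsSemisimple ℝ (GroupLieAlgebra 𝓘(ℝ, EG) G))
    {E : Type*} [NormedAddCommGroup E] [NormedSpace ℂ E] [FiniteDimensional ℂ E]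
    {GC : Type v} [TopologicalSpace GC] [T2Space GC] [ChartedSpace E GC] [Group GC]
    [LieGroup 𝓘(ℂ, E) ω GC] (j : G →* GC) (hj : IsComplexification EG E j)
    -- the invariant form and a maximal compact subgroup
    (ν : LinearMap.BilinForm ℝ (GroupLieAlgebra 𝓘(ℝ, EG) G)) (hν_symm : ν.IsSymm)
    (hν_inv : ∀ (g : G) a b, ν (Ad (𝕜 := ℝ) EG g a) (Ad (𝕜 := ℝ) EG g b) = ν a b)
    (M : MaximalCompact ν)
    -- the quotient complex manifold `GC ⧸ KC`
    {V : Type*} [NormedAddCommGroup V] [NormedSpace ℂ V]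
    [ChartedSpace V (GC ⧸ M.KC E j)] [IsManifold 𝓘(ℂ, V) ω (GC ⧸ M.KC E j)]
    (hq : ContMDiff 𝓘(ℂ, E) 𝓘(ℂ, V) ω (QuotientGroup.mk : GC → GC ⧸ M.KC E j))
    (hq_submersion : ∀ g : GC, Function.Surjective
      (mfderiv 𝓘(ℂ, E) 𝓘(ℂ, V) (QuotientGroup.mk : GC → GC ⧸ M.KC E j) g)) :
    ∃ Φ : Quot (HarmonicPair.Rel (E := E) (V := V) (π := π) (c₁ := c₁) (c₂ := c₂) (j := j) (M := M)) ≃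
        Quot (HarmonicBundle.Iso (E := E) (c₁ := c₁) (c₂ := c₂) (j := j) (ν := ν)),
      ∀ (p : HarmonicPair (E := E) (V := V) π c₁ c₂ j M) (b : HarmonicBundle (E := E) c₁ c₂ j ν),
        Φ (Quot.mk _ p) = Quot.mk _ b ↔ Corresponds p b := by
  have : LocallyPathConnectedSpace St := ChartedSpace.locallyPathConnectedSpace ℂ St
  have hquot : IsHolomorphicQuotient E V (M.KC E j) := ⟨hq, hq_submersion⟩
  have hsurj := hπ.surjective_of_connected
  have hcont := hπ.continuous
  exact exists_quot_equiv
    (exists_bundle_corresponds hj hquot hG hπ_diffeo hπ hsurj hc.transverse hν_symm hν_inv)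
    (exists_pair_corresponds hj hquot hG hπ_diffeo hc.transverse hν_symm hν_inv)
    (fun _ _ _ h h' ↦ iso_of_corresponds hj hquot hG hπ_diffeo hπ hsurj hc.transverse h h')
    (fun _ _ _ h h' ↦ rel_of_corresponds hj hcont h h')
    (fun _ _ _ h h' ↦ corresponds_of_rel hcont h h')
    (fun _ _ _ h h' ↦ corresponds_of_iso hj hπ_diffeo h h')
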